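/- Let $K$ be a field, $R=K[X]$, $n\ge 2$, and let $P^*$ be the regular $n$-gon with vertices $P_1,\dots,P_n$ (numbered counter-clockwise, indices modulo $n$) and one puncture at its centre. Let $(P_r,P_s)$, $r\ne s$, be the curve from $P_r$ to $P_s$ going counter-clockwise around the puncture (the sides of the polygon are the $(P_r,P_{r+1})$), and let $(P_r,*)$ and $(P_r,\bowtie)$ be the plain and the notched arc from $P_r$ to the puncture. Write $a=(P_{a_1},P_{a_2})$ for a curve of the first kind and put $a_2=a_1$ for an arc from $P_{a_1}$ to the puncture. Let $d(r,s)\in\{0,\dots,n-1\}$ be the residue of $s-r$ modulo $n$, $[r,s]=\{r,r+1,\dots,s\}$ (cyclically) and $]r,s[\,=\{1,\dots,n\}\setminus[s,r]$; let $\delta(A)$ be $1$ if $A$ holds and $0$ otherwise. Let $\sigma$ be a tagged triangulation of $P^*$ (the sides together with a maximal set of pairwise compatible tagged arcs, in the sense of Fomin–Shapiro–Thurston). Its edges are the vertices of the ice quiver with potential $(Q_\sigma,W_\sigma,F)$, where $F$ is the set of sides. The arrows of $Q_\sigma$ are: for each corner of each triangle of $\sigma$ without the puncture in its interior, an internal arrow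 from one side of the triangle to the next one in anticlockwise order around the corner; for each vertex $P_k$ with an incident tagged arc of $\sigma$, an external arrow $(P_{k-1},P_k)\to(P_k,P_{k+1})$; except that, if $\sigma$ contains both $i=(P_k,*)$ and $j=(P_k,\bowtie)$, lying in the once-punctured digon with sides $a=(P_l,P_k)$ and $b=(P_k,P_l)$, then the internal arrows inside the digon are $\eta:a\to b$, $\alpha:b\to j$, $\beta:j\to a$, $\gamma:b\to i$, $\delta:i\to a$. The potential $W_\sigma$ is the sum of the clockwise triangles (in the digon: $\eta\alpha\beta+\eta\gamma\delta$), minus the anticlockwise cycles around the vertices of $P$ containing exactly one external arrow (around $P_k$ in the digon case: the one through $\gamma\delta$), minus, if there is no such digon, the anticlockwise cycle of arrows around the puncture. Let $\Gamma_\sigma=KQ_\sigma/\langle\partial_\alpha W_\sigma : \alpha \text{ not both of whose ends are in } F\rangle$ be the frozen Jacobian algebra (paths are composed from left to right), $e_a$ the idempotent at the edge $a$, $e_F=\sum_{a\in F}e_a$, and $M_a=e_F\Gamma_\sigma e_a$. Let $R'=K[X,Y]/(Y(X-Y))$ and let $\mathcal R'=K[u^{\pm1},v]/(vu-v^2)$,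 regarded as an $R'$-algebra through $X\mapsto u^{2n}$, $Y\mapsto v^{2n}$. Let $$\Lambda=\begin{bmatrix} R'&R'&R'&\cdots&R'&X^{-1}(X,Y)\\ (X,Y)&R'&R'&\cdots&R'&R'\\ (X)&(X,Y)&R'&\cdots&R'&R'\\ \vdots&\vdots&\vdots&\ddots&\vdots&\vdots\\ (X)&(X)&(X)&\cdots&R'&R'\\ (X)&(X)&(X)&\cdots&(X,Y)&R' \end{bmatrix}_{n\times n}\subset \mathrm M_n(R'[X^{-1}]).$$ Then $\Lambda$ is a Gorenstein $R$-order, that is, it is a finitely generated $R$-module with zero socle and $\mathrm{Hom}_R(\Lambda_\Lambda,R)$ is a projective left $\Lambda$-module. Moreover there is an isomorphism of $K$-algebras $\varphi$ from $R'$ to the centre of $\Gamma_\sigma$ such that: * for each side $a$, $e_a\varphi(X)$ is the big cycle at $a$, which runs once around the polygon through the external arrows (if no tagged arc of $\sigma$ is incident to $P_k$, the missing external arrow at $P_k$ is replaced by the sum of the paths of length two from $(P_{k-1},P_k)$ to $(P_k,P_{k+1})$ inside the triangle, or the punctured digon, containing these two sides); * for each edge $a$ and each planar cycle $w$ at $a$,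 i.e. each rotation, starting at $a$, of a cycle occurring in $W_\sigma$, which does not pass through the notched arc of a punctured digon: $e_a\varphi(Y)=w$ if $\sigma$ contains a plain arc incident to the puncture, and $e_a\varphi(Y)=e_a\varphi(X)-w$ otherwise; if $j$ is the notched arc in a punctured digon, $e_j\varphi(Y)=0$; and, for the $R'$-algebra structure defined by $\varphi$ on $e_F\Gamma_\sigma e_F$, there are isomorphisms of $R'$-algebras (hence of $R$-orders) $$e_F\Gamma_\sigma e_F\;\cong\;\Bigl[u^{2d(i,j)}R'+v^{2d(i,j)}R'^{\,\delta(j=i-1)}\Bigr]_{1\le i,j\le n}\subset\mathrm M_n(\mathcal R'),\qquad e_F\Gamma_\sigma e_F\;\cong\;\Lambda,$$ where the term $v^{2d(i,j)}R'$ is present only if $j=i-1$ modulo $n$. Both send the idempotent at the side $(P_i,P_{i+1})$ to the matrix unit $E_{ii}$. For each edge $a$ of $\sigma$, through the first isomorphism, $M_a\cong{}^t[A_{1,a},\dots,A_{n,a}]$ as left modules, where, for $i$ denoting the side $(P_i,P_{i+1})$, $$A_{i,a}=\begin{cases}u^{\ell_{i,a}-1}vR' & a=(P_{a_1},*),\\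 u^{\ell_{i,a}-1}(u-v)R' & a=(P_{a_1},\bowtie),\\ u^{\ell_{i,a}}R'+v^{\ell_{i,a}}R' & a=(P_{a_1},P_{a_2}),\ i+1\in\,]a_2,i[\ \text{or}\ a_1\in\,]a_2,i[,\\ u^{\ell_{i,a}}R' & a=(P_{a_1},P_{a_2})\ \text{otherwise,}\end{cases}$$ with $\ell_{i,a}=d(i,a_1)+d(i+1,a_2)+n\,\bigl|\delta(i\in\,]a_1,i+1[)-\delta(a_2\in\,]a_1,i+1[)\bigr|$. Through the second isomorphism, $M_a$ is isomorphic, as a left $\Lambda$-module, to the following column, which depends only on $a$ and not on $\sigma$: * $a=(P_{a_1},*)$: $\;(Y)$ in the first $a_1$ positions, $(Y^2)$ in the last $n-a_1$ positions; * $a=(P_{a_1},\bowtie)$: $\;(X-Y)$ in the first $a_1$ positions, $(X^2-Y^2)$ in the last $n-a_1$ positions; * $a=(P_{a_1},P_{a_2})$ with $a_1<a_2$: $\;R'$ in the first $a_1$ positions, $(X,Y)$ in the next $a_2-a_1$, $(X)$ in the last $n-a_2$; * $a=(P_{a_1},P_{a_2})$ with $a_1>a_2$: $\;(X,Y)$ in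 the first $a_2$ positions, $(X)$ in the next $a_1-a_2$, $(X^2,Y^2)$ in the last $n-a_1$. -/

import Mathlib

open Polynomial

noncomputable section

namespace PuncturedPolygon

/-! ### Frozen Jacobian algebras -/

/-- An ice quiver with vertex set `V` and arrow set `A`: each arrow has a source and a target, and
`frozen` is the set of frozen vertices. -/
structure IceQuiver (V A : Type*) where
  src : A → V
  tgt : A → V
  frozen : Set V

namespace IceQuiver

variable {V A : Type*} [Fintype V] (K : Type*) [Field K] (Q : IceQuiver V A)

/-- Defining relations of the path algebra: generators are the trivial paths `Sum.inl v` and the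
arrows `Sum.inr a`; products of arrows are read from left to right. -/
inductive PathRel : FreeAlgebra K (V ⊕ A) → FreeAlgebra K (V ⊕ A) → Prop
  | idem (v : V) : PathRel
      (FreeAlgebra.ι K (Sum.inl v) * FreeAlgebra.ι K (Sum.inl v)) (FreeAlgebra.ι K (Sum.inl v))
  | orth (v w : V) (h : v ≠ w) : PathRel
      (FreeAlgebra.ι K (Sum.inl v) * FreeAlgebra.ι K (Sum.inl w)) 0
  | one : PathRel (∑ v : V, FreeAlgebra.ι K (Sum.inl v)) 1
  | src_mul (a : A) : PathRel
      (FreeAlgebra.ι K (Sum.inl (Q.src a)) * FreeAlgebra.ι K (Sum.inr a))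
      (FreeAlgebra.ι K (Sum.inr a))
  | mul_tgt (a : A) : PathRel
      (FreeAlgebra.ι K (Sum.inr a) * FreeAlgebra.ι K (Sum.inl (Q.tgt a)))
      (FreeAlgebra.ι K (Sum.inr a))

/-- The path algebra `K Q` of the (finite) quiver `Q`. -/
def PathAlgebra : Type _ := RingQuot (PathRel K Q)

instance : Ring (PathAlgebra K Q) := inferInstanceAs (Ring (RingQuot (PathRel K Q)))

instance : Algebra K (PathAlgebra K Q) := inferInstanceAs (Algebra K (RingQuot (PathRel K Q)))

/-- The presentation of the path algebra by vertices and arrows. -/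
def toPathAlgebra : FreeAlgebra K (V ⊕ A) →ₐ[K] PathAlgebra K Q :=
  RingQuot.mkAlgHom K (PathRel K Q)

/-- The trivial path at `v`. -/
def pathVertex (v : V) : PathAlgebra K Q :=
  toPathAlgebra K Q (FreeAlgebra.ι K (Sum.inl v))

/-- The path of length one given by an arrow. -/
def pathArrow (a : A) : PathAlgebra K Q :=
  toPathAlgebra K Q (FreeAlgebra.ι K (Sum.inr a))

/-- The path `α₁ ⋯ α_d` given by a list of arrows. -/
def pathWord (w : List A) : PathAlgebra K Q := (w.map (pathArrow K Q)).prod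

open Classical in
/-- Cyclic derivative of a cycle `α₁ ⋯ α_d` with respect to the arrow `α`: the sum, over the `i`
with `α_i = α`, of the paths `α_{i+1} ⋯ α_d α_1 ⋯ α_{i-1}` from `tgt α` to `src α`. -/
def cyclicDerivWord (α : A) (w : List A) : PathAlgebra K Q :=
  ∑ i : Fin w.length, if w.get i = α then
    pathVertex K Q (Q.tgt α) * pathWord K Q (w.drop (i + 1) ++ w.take i) else 0

variable {K}

/-- Cyclic derivative of a potential; a potential is a `K`-linear combination of cycles, each
written as a list of arrows. -/
def cyclicDeriv (α : A) (W : List A →₀ K) : PathAlgebra K Q :=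
  W.sum fun w c => c • cyclicDerivWord K Q α w

/-- The generators of the Jacobian ideal are the `∂_α W` for all arrows `α` that do not have both
ends frozen. -/
def JacobianRel (W : List A →₀ K) (x y : PathAlgebra K Q) : Prop :=
  ∃ α : A, (Q.src α ∉ Q.frozen ∨ Q.tgt α ∉ Q.frozen) ∧ x = cyclicDeriv Q α W ∧ y = 0

/-- The frozen Jacobian algebra `P(Q, W, F) = K Q / ⟨∂_α W⟩`. -/
def FrozenJacobian (W : List A →₀ K) : Type _ := RingQuot (JacobianRel Q W)

variable (W : List A →₀ K)

instance : Ring (FrozenJacobian Q W) := inferInstanceAs (Ring (RingQuot (JacobianRel Q W)))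

instance : Algebra K (FrozenJacobian Q W) :=
  inferInstanceAs (Algebra K (RingQuot (JacobianRel Q W)))

/-- The projection `K Q → P(Q, W, F)`. -/
def toJacobian : PathAlgebra K Q →ₐ[K] FrozenJacobian Q W :=
  RingQuot.mkAlgHom K (JacobianRel Q W)

/-- The idempotent `e_v`. -/
def idem (v : V) : FrozenJacobian Q W := toJacobian Q W (pathVertex K Q v)

/-- The class of a path given by a list of arrows. -/
def word (w : List A) : FrozenJacobian Q W := toJacobian Q W (pathWord K Q w)

open Classical in
/-- The sum `e_F` of the idempotents at the frozen vertices. -/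
def frozenIdem : FrozenJacobian Q W := ∑ v : V, if v ∈ Q.frozen then idem Q W v else 0

theorem idem_mul_self (v : V) : idem Q W v * idem Q W v = idem Q W v := by
  have h : toPathAlgebra K Q _ = toPathAlgebra K Q _ :=
    RingQuot.mkAlgHom_rel K (PathRel.idem (K := K) (Q := Q) v)
  rw [map_mul] at h
  unfold idem pathVertex
  rw [← map_mul, h]

theorem idem_mul_of_ne {v w : V} (hvw : v ≠ w) : idem Q W v * idem Q W w = 0 := by
  have h : toPathAlgebra K Q _ = toPathAlgebra K Q _ :=
    RingQuot.mkAlgHom_rel K (PathRel.orth (K := K) (Q := Q) v w hvw)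
  rw [map_mul, map_zero] at h
  unfold idem pathVertex
  rw [← map_mul, h, map_zero]

theorem frozenIdem_mul_idem {v : V} (hv : v ∈ Q.frozen) :
    frozenIdem Q W * idem Q W v = idem Q W v := by
  classical
  unfold frozenIdem
  rw [Finset.sum_mul, Finset.sum_eq_single v]
  · rw [if_pos hv, idem_mul_self]
  · intro b _ hb
    split_ifs
    · exact idem_mul_of_ne Q W hb
    · exact zero_mul _
  · intro h
    exact absurd (Finset.mem_univ v) h

theorem idem_mul_frozenIdem {v : V} (hv : v ∈ Q.frozen) :
    idem Q W v * frozenIdem Q W = idem Q W v := by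
  classical
  unfold frozenIdem
  rw [Finset.mul_sum, Finset.sum_eq_single v]
  · rw [if_pos hv, idem_mul_self]
  · intro b _ hb
    split_ifs
    · exact idem_mul_of_ne Q W hb.symm
    · exact mul_zero _
  · intro h
    exact absurd (Finset.mem_univ v) h

theorem isIdempotentElem_frozenIdem : IsIdempotentElem (frozenIdem Q W) := by
  classical
  unfold IsIdempotentElem
  conv_lhs => rw [show frozenIdem Q W * frozenIdem Q W = frozenIdem Q W *
    ∑ v : V, if v ∈ Q.frozen then idem Q W v else 0 from rfl]
  rw [Finset.mul_sum]
  conv_rhs => unfold frozenIdem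
  refine Finset.sum_congr rfl fun v _ => ?_
  split_ifs with h
  · exact frozenIdem_mul_idem Q W h
  · exact mul_zero _

/-- The frozen part `e_F P(Q, W, F) e_F`, a ring with unit `e_F`. -/
abbrev FrozenPart : Type _ := (isIdempotentElem_frozenIdem Q W).Corner

/-- The element `e_F x e_F` of the frozen part. -/
def toFrozenPart (x : FrozenJacobian Q W) : FrozenPart Q W :=
  ⟨frozenIdem Q W * x * frozenIdem Q W, ⟨x, rfl⟩⟩

theorem frozenPart_left (x : FrozenPart Q W) : frozenIdem Q W * x.1 = x.1 :=
  ((Subsemigroup.mem_corner_iff (isIdempotentElem_frozenIdem Q W)).mp x.2).1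

theorem frozenPart_right (x : FrozenPart Q W) : x.1 * frozenIdem Q W = x.1 :=
  ((Subsemigroup.mem_corner_iff (isIdempotentElem_frozenIdem Q W)).mp x.2).2

/-- The subspace `e_F P(Q, W, F) e_v` of the frozen Jacobian algebra. -/
def frozenColumn (v : V) : AddSubgroup (FrozenJacobian Q W) where
  carrier := {x | frozenIdem Q W * x = x ∧ x * idem Q W v = x}
  add_mem' := by
    rintro x y ⟨h1, h2⟩ ⟨h3, h4⟩
    exact ⟨by rw [mul_add, h1, h3], by rw [add_mul, h2, h4]⟩
  zero_mem' := ⟨mul_zero _, zero_mul _⟩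
  neg_mem' := by
    rintro x ⟨h1, h2⟩
    exact ⟨by rw [mul_neg, h1], by rw [neg_mul, h2]⟩

/-- `e_F P(Q, W, F) e_v` is a left module over the frozen part, by multiplication. -/
instance (v : V) : Module (FrozenPart Q W) (frozenColumn Q W v) where
  smul x m := ⟨x.1 * m.1, by
    refine ⟨?_, ?_⟩
    · rw [← mul_assoc, frozenPart_left]
    · rw [mul_assoc, m.2.2]⟩
  one_smul m := Subtype.ext m.2.1
  mul_smul x y m := Subtype.ext (mul_assoc x.1 y.1 m.1)
  smul_zero x := Subtype.ext (mul_zero x.1)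
  smul_add x m m' := Subtype.ext (mul_add x.1 m.1 m'.1)
  add_smul x y m := Subtype.ext (add_mul x.1 y.1 m.1)
  zero_smul m := Subtype.ext (zero_mul m.1)

/-- A ring homomorphism from a commutative ring `S` to the centre of `P(Q, W, F)` makes the frozen
part an `S`-algebra, through `s ↦ φ(s) e_F`. -/
@[reducible] def frozenPartAlgebra {S : Type*} [CommRing S]
    (φ : S →+* Subalgebra.center K (FrozenJacobian Q W)) : Algebra S (FrozenPart Q W) :=
  have hc : ∀ (s : S) (x : FrozenJacobian Q W), x * (φ s).1 = (φ s).1 * x := fun s x =>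
    Subalgebra.mem_center_iff.mp (φ s).2 x
  have he : ∀ s : S, (toFrozenPart Q W (φ s).1).1 = (φ s).1 * frozenIdem Q W := fun s => by
    change frozenIdem Q W * (φ s).1 * frozenIdem Q W = _
    rw [hc, mul_assoc, (isIdempotentElem_frozenIdem Q W).eq]
  RingHom.toAlgebra'
    { toFun := fun s => toFrozenPart Q W (φ s).1
      map_one' := Subtype.ext <| by
        rw [he, map_one]
        exact one_mul _
      map_mul' := fun s t => Subtype.ext <| by
        change _ = (toFrozenPart Q W (φ s).1).1 * (toFrozenPart Q W (φ t).1).1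
        rw [he, he, he, map_mul]
        change (φ s).1 * (φ t).1 * _ = _
        rw [mul_assoc, mul_assoc, ← mul_assoc (frozenIdem Q W), hc, mul_assoc (φ t).1,
          (isIdempotentElem_frozenIdem Q W).eq]
      map_zero' := Subtype.ext <| by
        rw [he, map_zero]
        exact zero_mul _
      map_add' := fun s t => Subtype.ext <| by
        change _ = (toFrozenPart Q W (φ s).1).1 + (toFrozenPart Q W (φ t).1).1
        rw [he, he, he, map_add]
        exact add_mul _ _ _ }
    fun s x => Subtype.ext <| by
      change (toFrozenPart Q W (φ s).1).1 * x.1 = x.1 * (toFrozenPart Q W (φ s).1).1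
      rw [he, mul_assoc, frozenPart_left, ← mul_assoc, hc, mul_assoc, frozenPart_right]

end IceQuiver

/-! ### Tagged triangulations of the once-punctured polygon

The vertex `P_{k+1}` of the polygon is the element `k` of `Fin n`; the vertices are numbered
counter-clockwise and indices are taken modulo `n`. -/

/-- The two tags of an arc at the puncture. -/
inductive Tag
  | plain
  | notched
  deriving DecidableEq

/-- (Isotopy classes of) sides and tagged arcs: `chord r s` runs from the vertex `r` to the vertex
`s ≠ r` counter-clockwise around the puncture, `spoke r t` joins the vertex `r` to the puncture and
has tag `t`. The terms `chord r r` do not denote an edge and are excluded below. -/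
inductive Edge (n : ℕ)
  | chord (r s : Fin n)
  | spoke (r : Fin n) (t : Tag)
  deriving DecidableEq

/-- The number `d(r, s) ∈ {0, …, n - 1}` of counter-clockwise steps from `r` to `s`. -/
def ccw {n : ℕ} (r s : Fin n) : ℕ := (s - r : Fin n).val

/-- The side of the polygon from the vertex `k` to the vertex `k + 1`. -/
def side {n : ℕ} [NeZero n] (k : Fin n) : Edge n := .chord k (k + 1)

namespace Edge

variable {n : ℕ}

/-- Being a tagged arc: the endpoints are distinct and the curve is not isotopic to a side. -/
def IsTaggedArc [NeZero n] : Edge n → Prop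
  | chord r s => s ≠ r ∧ s ≠ r + 1
  | spoke _ _ => True

/-- The endpoints on the polygon. -/
def IncidentTo : Edge n → Fin n → Prop
  | chord r s, k => r = k ∨ s = k
  | spoke r _, k => r = k

/-- The starting vertex `a₁`. -/
def fst : Edge n → Fin n
  | chord r _ => r
  | spoke r _ => r

/-- The final vertex `a₂`, with `a₂ = a₁` for an arc incident to the puncture. -/
def snd : Edge n → Fin n
  | chord _ s => s
  | spoke r _ => r

/-- In the universal cover of the punctured polygon, whose boundary vertices are the integers, the
arc from `r` to `s` lifts to arcs `(x, x + d(r, s))`, `x ≡ r`. This says that some lift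
`(y, y + d(r', s'))` of the second arc satisfies `x < y < x + d(r, s) < y + d(r', s')`. -/
def Interleaves (r s r' s' : Fin n) : Prop :=
  0 < ccw r r' ∧ ccw r r' < ccw r s ∧ ccw r s < ccw r r' + ccw r' s'

/-- Compatibility of tagged arcs: the isotopy classes have representatives with disjoint relative
interiors, and two non-isotopic arcs incident to the puncture carry the same tag. A chord from `r`
to `s` meets the arc from `k` to the puncture iff `k` lies strictly between `r` and `s`. -/
def Compatible : Edge n → Edge n → Prop
  | chord r s, chord r' s' => ¬ Interleaves r s r' s' ∧ ¬ Interleaves r' s' r s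
  | chord r s, spoke k _ => ¬ (0 < ccw r k ∧ ccw r k < ccw r s)
  | spoke k _, chord r s => ¬ (0 < ccw r k ∧ ccw r k < ccw r s)
  | spoke r t, spoke r' t' => r ≠ r' → t = t'

end Edge

open Edge

/-- A tagged triangulation, given by a maximal collection of pairwise compatible tagged arcs. -/
structure TaggedTriangulation (n : ℕ) [NeZero n] where
  arcs : Finset (Edge n)
  isTaggedArc : ∀ a ∈ arcs, a.IsTaggedArc
  compatible : ∀ a ∈ arcs, ∀ b ∈ arcs, Compatible a b
  maximal : ∀ a : Edge n, a.IsTaggedArc → (∀ b ∈ arcs, Compatible a b) → a ∈ arcs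

namespace TaggedTriangulation

variable {n : ℕ} [NeZero n] (σ : TaggedTriangulation n)

/-- The edges of the triangulation: the sides of the polygon and the arcs of `σ`. -/
def edges : Finset (Edge n) := Finset.univ.image side ∪ σ.arcs

/-- The edges of the triangulation, as the vertices of the quiver. -/
abbrev Vertex : Type := {e : Edge n // e ∈ σ.edges}

/-- The vertex of the quiver given by a side of the polygon. -/
def sideVertex (k : Fin n) : σ.Vertex :=
  ⟨side k, Finset.mem_union_left _ (Finset.mem_image_of_mem _ (Finset.mem_univ k))⟩

/-- Some tagged arc of `σ` is incident to the vertex `k` of the polygon. -/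
def HasArcAt (k : Fin n) : Prop := ∃ a ∈ σ.arcs, a.IncidentTo k

/-- Some plain arc of `σ` is incident to the puncture. -/
def HasPlain : Prop := ∃ r : Fin n, spoke r .plain ∈ σ.arcs

/-- True triangles whose vertices `r`, `s`, `t` (in counter-clockwise order) are on the polygon and
which do not contain the puncture. -/
structure Triangle where
  r : Fin n
  s : Fin n
  t : Fin n
  pos : 0 < ccw r s
  lt : ccw r s < ccw r t
  mem_rs : chord r s ∈ σ.edges
  mem_st : chord s t ∈ σ.edges
  mem_rt : chord r t ∈ σ.edges

/-- True triangles with vertices `r`, `s` and the puncture (in counter-clockwise order). -/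
structure PunctureTriangle where
  tag : Tag
  r : Fin n
  s : Fin n
  ne : r ≠ s
  mem_rs : chord r s ∈ σ.edges
  mem_r : spoke r tag ∈ σ.edges
  mem_s : spoke s tag ∈ σ.edges

/-- Once-punctured digons with vertices `r` and `s` whose interior contains the plain arc and the
notched arc from `r` to the puncture. -/
structure Digon where
  r : Fin n
  s : Fin n
  ne : r ≠ s
  mem_rs : chord r s ∈ σ.edges
  mem_sr : chord s r ∈ σ.edges
  mem_plain : spoke r .plain ∈ σ.edges
  mem_notched : spoke r .notched ∈ σ.edges

instance : Finite σ.Triangle :=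
  Finite.of_injective (β := Fin n × Fin n × Fin n) (fun T => (T.r, T.s, T.t)) <| by
    rintro ⟨⟩ ⟨⟩ h
    simp only [Prod.mk.injEq] at h
    obtain ⟨rfl, rfl, rfl⟩ := h
    rfl

instance : Finite σ.PunctureTriangle :=
  have : Finite Tag := Finite.of_injective (β := Bool) (fun t => t = .plain) <| by
    rintro ⟨⟩ ⟨⟩ h <;> simp_all
  Finite.of_injective (β := Tag × Fin n × Fin n) (fun T => (T.tag, T.r, T.s)) <| by
    rintro ⟨⟩ ⟨⟩ h
    simp only [Prod.mk.injEq] at h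
    obtain ⟨rfl, rfl, rfl⟩ := h
    rfl

instance : Finite σ.Digon :=
  Finite.of_injective (β := Fin n × Fin n) (fun T => (T.r, T.s)) <| by
    rintro ⟨⟩ ⟨⟩ h
    simp only [Prod.mk.injEq] at h
    obtain ⟨rfl, rfl⟩ := h
    rfl

noncomputable instance : Fintype σ.Triangle := Fintype.ofFinite _

noncomputable instance : Fintype σ.PunctureTriangle := Fintype.ofFinite _

noncomputable instance : Fintype σ.Digon := Fintype.ofFinite _

/-! #### The quiver -/

/-- The arrows of the quiver of `σ`. There is an external arrow at each vertex of the polygon with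
an incident tagged arc, an internal arrow for each corner of each true triangle, and five arrows
for a once-punctured digon. -/
inductive Arrow
  | ext (k : Fin n) (h : σ.HasArcAt k)
  | triR (T : σ.Triangle)
  | triS (T : σ.Triangle)
  | triT (T : σ.Triangle)
  | puncR (T : σ.PunctureTriangle)
  | puncS (T : σ.PunctureTriangle)
  | puncO (T : σ.PunctureTriangle)
  | eta (D : σ.Digon)
  | alpha (D : σ.Digon)
  | beta (D : σ.Digon)
  | gamma (D : σ.Digon)
  | delta (D : σ.Digon)

/-- Starting edge of an arrow. An internal arrow at a corner of a triangle goes from a side of the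
triangle to the next one in anticlockwise order around that corner; an external arrow at `k` goes
from the side ending at `k` to the side starting at `k`. -/
def src : σ.Arrow → σ.Vertex
  | .ext k _ => σ.sideVertex (k - 1)
  | .triR T => ⟨chord T.r T.s, T.mem_rs⟩
  | .triS T => ⟨chord T.s T.t, T.mem_st⟩
  | .triT T => ⟨chord T.r T.t, T.mem_rt⟩
  | .puncR T => ⟨chord T.r T.s, T.mem_rs⟩
  | .puncS T => ⟨spoke T.s T.tag, T.mem_s⟩
  | .puncO T => ⟨spoke T.r T.tag, T.mem_r⟩
  | .eta D => ⟨chord D.s D.r, D.mem_sr⟩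
  | .alpha D => ⟨chord D.r D.s, D.mem_rs⟩
  | .beta D => ⟨spoke D.r .notched, D.mem_notched⟩
  | .gamma D => ⟨chord D.r D.s, D.mem_rs⟩
  | .delta D => ⟨spoke D.r .plain, D.mem_plain⟩

/-- Final edge of an arrow. -/
def tgt : σ.Arrow → σ.Vertex
  | .ext k _ => σ.sideVertex k
  | .triR T => ⟨chord T.r T.t, T.mem_rt⟩
  | .triS T => ⟨chord T.r T.s, T.mem_rs⟩
  | .triT T => ⟨chord T.s T.t, T.mem_st⟩
  | .puncR T => ⟨spoke T.r T.tag, T.mem_r⟩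
  | .puncS T => ⟨chord T.r T.s, T.mem_rs⟩
  | .puncO T => ⟨spoke T.s T.tag, T.mem_s⟩
  | .eta D => ⟨chord D.r D.s, D.mem_rs⟩
  | .alpha D => ⟨spoke D.r .notched, D.mem_notched⟩
  | .beta D => ⟨chord D.s D.r, D.mem_sr⟩
  | .gamma D => ⟨spoke D.r .plain, D.mem_plain⟩
  | .delta D => ⟨chord D.s D.r, D.mem_sr⟩

/-- The ice quiver of `σ`; the frozen vertices are the sides of the polygon. -/
def quiver : IceQuiver σ.Vertex σ.Arrow where
  src := σ.src
  tgt := σ.tgt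
  frozen := Set.range σ.sideVertex

/-! #### The potential -/

/-- The internal arrows winding around a vertex `k` of the polygon, with that vertex and the
position of their starting edge in the anticlockwise order of the edges incident to `k`: the chord
from `k` to `s` has position `d(k, s)`, an arc to the puncture has position `n` and the chord from
`s` to `k` has position `n + d(k, s)`. Around the vertex of a punctured digon which is joined to the
puncture, only the two arrows through the plain arc are recorded. -/
def corner : σ.Arrow → Option (Fin n × ℕ)
  | .ext _ _ => none
  | .triR T => some (T.r, ccw T.r T.s)
  | .triS T => some (T.s, ccw T.s T.t)
  | .triT T => some (T.t, n + ccw T.t T.r)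
  | .puncR T => some (T.r, ccw T.r T.s)
  | .puncS T => some (T.s, n)
  | .puncO _ => none
  | .eta D => some (D.s, ccw D.s D.r)
  | .alpha _ => none
  | .beta _ => none
  | .gamma D => some (D.r, ccw D.r D.s)
  | .delta D => some (D.r, n)

open Classical in
/-- The anticlockwise external cycle around the vertex `k` of the polygon: the external arrow, then
the (unique) internal arrows at the successive positions around `k`. -/
def externalCycle (k : Fin n) (h : σ.HasArcAt k) : List σ.Arrow :=
  .ext k h :: (List.range (2 * n)).filterMap fun p =>
    if h' : ∃ α : σ.Arrow, σ.corner α = some (k, p) then some h'.choose else none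

open Classical in
/-- The anticlockwise cycle around the puncture (when there is no punctured digon): the arrows
between the successive arcs incident to the puncture. -/
def puncturedCycle : List σ.Arrow :=
  (List.finRange n).filterMap fun r =>
    if h : ∃ T : σ.PunctureTriangle, T.r = r then some (.puncO h.choose) else none

open Classical in
/-- The potential: the clockwise triangles (two of them for a punctured digon), minus the
anticlockwise external cycles, minus the anticlockwise punctured cycle. -/
def potential (K : Type*) [Field K] : List σ.Arrow →₀ K :=
  (∑ T : σ.Triangle, Finsupp.single [.triR T, .triT T, .triS T] 1)
    + (∑ T : σ.PunctureTriangle, Finsupp.single [.puncR T, .puncO T, .puncS T] 1)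
    + (∑ D : σ.Digon, (Finsupp.single [.eta D, .alpha D, .beta D] 1
        + Finsupp.single [.eta D, .gamma D, .delta D] 1))
    - (∑ k : {k : Fin n // σ.HasArcAt k}, Finsupp.single (σ.externalCycle k.1 k.2) 1)
    - (if Nonempty σ.Digon then 0 else Finsupp.single σ.puncturedCycle 1)

variable (K : Type*) [Field K]

/-- The frozen Jacobian algebra `Γ_σ`. -/
abbrev Gam : Type _ := σ.quiver.FrozenJacobian (σ.potential K)

/-- The idempotent `e_a` of `Γ_σ` at the edge `a`. -/
abbrev e (a : σ.Vertex) : σ.Gam K := σ.quiver.idem (σ.potential K) a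

/-- The class in `Γ_σ` of a path. -/
abbrev path (w : List σ.Arrow) : σ.Gam K := σ.quiver.word (σ.potential K) w

/-- The frozen part `e_F Γ_σ e_F`. -/
abbrev FrozenPart : Type _ := σ.quiver.FrozenPart (σ.potential K)

/-- The idempotent at a side of the polygon, as an element of the frozen part. -/
def frozenE (k : Fin n) : σ.FrozenPart K :=
  σ.quiver.toFrozenPart (σ.potential K) (σ.e K (σ.sideVertex k))

/-- The left `e_F Γ_σ e_F`-module `M_a = e_F Γ_σ e_a`. -/
abbrev M (a : σ.Vertex) : AddSubgroup (σ.Gam K) := σ.quiver.frozenColumn (σ.potential K) a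

/-! #### The central elements -/

/-- The planar cycles, up to rotation, that do not pass through the notched arc of a punctured
digon. -/
inductive IsBasicCycle : List σ.Arrow → Prop
  | tri (T : σ.Triangle) : IsBasicCycle [.triR T, .triT T, .triS T]
  | punc (T : σ.PunctureTriangle) : IsBasicCycle [.puncR T, .puncO T, .puncS T]
  | digon (D : σ.Digon) : IsBasicCycle [.eta D, .gamma D, .delta D]
  | ext (k : Fin n) (h : σ.HasArcAt k) : IsBasicCycle (σ.externalCycle k h)
  | puncture (h : IsEmpty σ.Digon) : IsBasicCycle σ.puncturedCycle

/-- `w` is a planar cycle starting at the edge `a` (and not passing through the notched arc of a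
punctured digon). -/
def IsPlanarCycleAt (a : σ.Vertex) (w : List σ.Arrow) : Prop :=
  (∃ w' : List σ.Arrow, σ.IsBasicCycle w' ∧ w ~r w') ∧ ∃ α ∈ w.head?, σ.src α = a

open Classical in
/-- The path from the side ending at `k` to the side starting at `k` around the vertex `k`, outside
the polygon: the external arrow at `k` if there is a tagged arc of `σ` incident to `k`. Otherwise
the two sides belong to a triangle (or to a punctured digon), and the path is replaced by the sum of
the paths of length two between them inside it. -/
def outer (k : Fin n) : σ.Gam K :=
  if h : σ.HasArcAt k then σ.path K [.ext k h] else
    (∑ T : σ.Triangle, if T.s = k then σ.path K [.triR T, .triT T] else 0)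
      + ∑ D : σ.Digon, if D.s = k then
          σ.path K [.alpha D, .beta D] + σ.path K [.gamma D, .delta D] else 0

/-- The big cycle around the polygon at the side which starts at the vertex `k`: the product of the
outer paths at `k + 1, k + 2, …, k + n = k`. -/
def bigCycle (k : Fin n) : σ.Gam K :=
  ((List.finRange n).map fun i => σ.outer K (k + 1 + i)).prod

end TaggedTriangulation

/-! ### The orders -/

section Orders

variable (K : Type*) [Field K]

/-- `R' = K[X, Y] / (Y (X - Y))`, presented over `R = K[X]` as `R[Y] / (Y (Y - X))`. -/
abbrev RPrime : Type _ :=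
  AdjoinRoot ((X : Polynomial K[X]) * (X - C (X : K[X])))

/-- The element `X` of `R'`. -/
def RPrime.x : RPrime K := AdjoinRoot.of _ (X : K[X])

/-- The element `Y` of `R'`. -/
def RPrime.y : RPrime K := AdjoinRoot.root _

/-- `R'[X⁻¹]`. -/
abbrev RPrimeLoc : Type _ := Localization.Away (RPrime.x K)

/-- `X⁻¹` in `R'[X⁻¹]`. -/
def RPrimeLoc.xInv : RPrimeLoc K := IsLocalization.Away.invSelf (RPrime.x K)

/-- The ring `K[u^{±1}, v] / (v u - v²)`. It contains `K[X, Y] / (Y (X - Y))` through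
`X ↦ u^{2n}`, `Y ↦ v^{2n}`, hence the (otherwise unused) parameter `n`. -/
def BigR (_n : ℕ) : Type _ :=
  AdjoinRoot ((X : Polynomial (LaurentPolynomial K)) * (X - C (LaurentPolynomial.T 1)))

variable (n : ℕ)

instance : CommRing (BigR K n) := inferInstanceAs (CommRing (AdjoinRoot _))

instance : Algebra K (BigR K n) := inferInstanceAs (Algebra K (AdjoinRoot _))

/-- The powers `u^m`, `m ∈ ℤ`. -/
def BigR.u (m : ℤ) : BigR K n := AdjoinRoot.of _ (LaurentPolynomial.T m)

/-- The element `v`. -/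
def BigR.v : BigR K n := AdjoinRoot.root _

theorem BigR.u_add (a b : ℤ) : BigR.u K n (a + b) = BigR.u K n a * BigR.u K n b := by
  unfold BigR.u
  rw [LaurentPolynomial.T_add]
  exact map_mul (AdjoinRoot.of _) _ _

theorem BigR.u_zero : BigR.u K n 0 = 1 := by
  unfold BigR.u
  rw [LaurentPolynomial.T_zero]
  exact map_one (AdjoinRoot.of _)

theorem BigR.v_mul_v : BigR.v K n * BigR.v K n = BigR.u K n 1 * BigR.v K n := by
  have h := AdjoinRoot.eval₂_root
    ((X : Polynomial (LaurentPolynomial K)) * (X - C (LaurentPolynomial.T 1)))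
  rw [eval₂_mul, eval₂_sub, eval₂_X, eval₂_C] at h
  have h' : BigR.v K n * (BigR.v K n - BigR.u K n 1) = 0 := h
  rw [mul_sub, sub_eq_zero] at h'
  rw [h', mul_comm]

theorem BigR.v_pow (m : ℕ) :
    BigR.v K n ^ (m + 1) = BigR.u K n m * BigR.v K n := by
  induction m with
  | zero => rw [Nat.cast_zero, BigR.u_zero, one_mul, zero_add, pow_one]
  | succ m ih =>
    rw [pow_succ, ih, mul_assoc, BigR.v_mul_v, Nat.cast_succ, BigR.u_add, mul_assoc]

theorem BigR.v_pow_mul_v_pow (m : ℕ) :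
    BigR.v K n ^ m * BigR.v K n ^ m = BigR.v K n ^ m * BigR.u K n m := by
  cases m with
  | zero => rw [pow_zero, Nat.cast_zero, BigR.u_zero]
  | succ m =>
    rw [BigR.v_pow, mul_mul_mul_comm, BigR.v_mul_v, Nat.cast_succ, BigR.u_add]
    ring

/-- The `K`-algebra homomorphism `K[X] → K[u^{±1}, v] / (v u - v²)`, `X ↦ u^{2n}`. -/
def BigR.ofPoly : K[X] →ₐ[K] BigR K n := aeval (BigR.u K n (2 * n : ℕ))

/-- The homomorphism `R' → K[u^{±1}, v] / (v u - v²)`, `X ↦ u^{2n}`, `Y ↦ v^{2n}`. -/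
def BigR.incl : RPrime K →+* BigR K n :=
  AdjoinRoot.lift (BigR.ofPoly K n : K[X] →+* BigR K n) (BigR.v K n ^ (2 * n)) <| by
    rw [eval₂_mul, eval₂_sub, eval₂_X, eval₂_C]
    have : (BigR.ofPoly K n : K[X] →+* BigR K n) X = BigR.u K n (2 * n : ℕ) := aeval_X _
    rw [this, mul_sub, BigR.v_pow_mul_v_pow, sub_self]

instance : Algebra (RPrime K) (BigR K n) := (BigR.incl K n).toAlgebra

/-- The entry `(i, j)` of the order `Λ`, an `R'`-submodule of `R'[X⁻¹]`; rows and columns are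
numbered from `0` to `n - 1`. -/
def lamEntry {n : ℕ} (i j : Fin n) : Submodule (RPrime K) (RPrimeLoc K) :=
  if i.val = 0 ∧ j.val + 1 = n then
    Submodule.span (RPrime K)
      {1, RPrimeLoc.xInv K * algebraMap (RPrime K) (RPrimeLoc K) (RPrime.y K)}
  else if i.val ≤ j.val then Submodule.span (RPrime K) {1}
  else if i.val = j.val + 1 then
    Submodule.span (RPrime K) {algebraMap (RPrime K) (RPrimeLoc K) (RPrime.x K),
      algebraMap (RPrime K) (RPrimeLoc K) (RPrime.y K)}
  else Submodule.span (RPrime K) {algebraMap (RPrime K) (RPrimeLoc K) (RPrime.x K)}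

theorem RPrime.y_mul_y : RPrime.y K * RPrime.y K = RPrime.x K * RPrime.y K := by
  have h := AdjoinRoot.eval₂_root ((X : Polynomial K[X]) * (X - C (X : K[X])))
  rw [eval₂_mul, eval₂_sub, eval₂_X, eval₂_C] at h
  have h' : RPrime.y K * (RPrime.y K - RPrime.x K) = 0 := h
  rw [mul_sub, sub_eq_zero] at h'
  rw [h', mul_comm]

theorem RPrimeLoc.x_mul_xInv :
    algebraMap (RPrime K) (RPrimeLoc K) (RPrime.x K) * RPrimeLoc.xInv K = 1 :=
  IsLocalization.Away.mul_invSelf (RPrime.x K)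

theorem one_mem_lamEntry {n : ℕ} (i : Fin n) : (1 : RPrimeLoc K) ∈ lamEntry K i i := by
  unfold lamEntry
  split_ifs with h1 h2
  · exact Submodule.subset_span (by simp)
  · exact Submodule.subset_span (by simp)
  all_goals exact absurd le_rfl h2

/-- The products of the entries of `Λ`, computed with `w = X⁻¹ Y`, which satisfies `w² = w`. -/
theorem entry_mul_aux {R A : Type*} [CommRing R] [CommRing A] [Algebra R A] (c d : R) (x w : A)
    (hc : algebraMap R A c = x) (hd : algebraMap R A d = x * w) (hw : w * w = w)
    {n : ℕ} (i j k : Fin n) (f : Fin n → Fin n → Set A)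
    (hf : ∀ i j, f i j = if i.val = 0 ∧ j.val + 1 = n then {1, w} else if i.val ≤ j.val then {1}
      else if i.val = j.val + 1 then {x, x * w} else {x}) :
    Submodule.span R (f i j) * Submodule.span R (f j k) ≤ Submodule.span R (f i k) := by
  have key : ∀ (a b : R) (z s t : A),
      algebraMap R A a * s + algebraMap R A b * t = z → z ∈ Submodule.span R {s, t} := by
    intro a b z s t h
    rw [Submodule.mem_span_pair]
    exact ⟨a, b, by rw [Algebra.smul_def, Algebra.smul_def, h]⟩
  have key1 : ∀ (a : R) (z s : A), algebraMap R A a * s = z → z ∈ Submodule.span R {s} := by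
    intro a z s h
    rw [Submodule.mem_span_singleton]
    exact ⟨a, by rw [Algebra.smul_def, h]⟩
  have t1 : (1 : A) ∈ Submodule.span R {1, w} := key 1 0 _ _ _ (by simp)
  have t2 : w ∈ Submodule.span R {1, w} := key 0 1 _ _ _ (by simp)
  have r1 : (1 : A) ∈ Submodule.span R {(1 : A)} := key1 1 _ _ (by simp)
  have r2 : x ∈ Submodule.span R {(1 : A)} := key1 c _ _ (by simp [hc])
  have r3 : x * w ∈ Submodule.span R {(1 : A)} := key1 d _ _ (by simp [hd])
  have m1 : x ∈ Submodule.span R {x, x * w} := key 1 0 _ _ _ (by simp)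
  have m2 : x * w ∈ Submodule.span R {x, x * w} := key 0 1 _ _ _ (by simp)
  have x1 : x ∈ Submodule.span R {x} := key1 1 _ _ (by simp)
  have x2 : x * x ∈ Submodule.span R {x} := key1 c _ _ (by simp [hc])
  have x3 : x * x * w ∈ Submodule.span R {x} := key1 d _ _ (by rw [hd]; ring)
  have m3 : x * x ∈ Submodule.span R {x, x * w} := Submodule.span_mono (by simp) x2
  have m4 : x * x * w ∈ Submodule.span R {x, x * w} := Submodule.span_mono (by simp) x3
  have e1 : x * (x * w) = x * x * w := by ring
  have e2 : x * w * x = x * x * w := by ring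
  have e3 : x * w * (x * w) = x * x * w := by linear_combination x ^ 2 * hw
  have e4 : w * (x * w) = x * w := by linear_combination x * hw
  have e5 : x * w * w = x * w := by linear_combination x * hw
  have e6 : w * x = x * w := by ring
  have hi := i.isLt
  have hj := j.isLt
  have hk := k.isLt
  rw [Submodule.span_mul_span, Submodule.span_le]
  rintro _ ⟨p, hp, q, hq, rfl⟩
  have hp' : (p = 1 ∧ (i.val = 0 ∧ j.val + 1 = n ∨ i.val ≤ j.val)) ∨
      (p = w ∧ i.val = 0 ∧ j.val + 1 = n) ∨ (p = x ∧ j.val < i.val) ∨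
      (p = x * w ∧ i.val = j.val + 1) := by
    rw [hf] at hp
    split_ifs at hp <;> simp only [Set.mem_insert_iff, Set.mem_singleton_iff] at hp <;> grind
  have hq' : (q = 1 ∧ (j.val = 0 ∧ k.val + 1 = n ∨ j.val ≤ k.val)) ∨
      (q = w ∧ j.val = 0 ∧ k.val + 1 = n) ∨ (q = x ∧ k.val < j.val) ∨
      (q = x * w ∧ j.val = k.val + 1) := by
    rw [hf] at hq
    split_ifs at hq <;> simp only [Set.mem_insert_iff, Set.mem_singleton_iff] at hq <;> grind
  clear hp hq
  rw [hf]
  rcases hp' with ⟨rfl, hp⟩ | ⟨rfl, hp⟩ | ⟨rfl, hp⟩ | ⟨rfl, hp⟩ <;>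
    rcases hq' with ⟨rfl, hq⟩ | ⟨rfl, hq⟩ | ⟨rfl, hq⟩ | ⟨rfl, hq⟩ <;>
    simp only [mul_one, one_mul, SetLike.mem_coe, hw, e1, e2, e3, e4, e5, e6] <;>
    split_ifs <;> first
      | assumption
      | omega

theorem mul_mem_lamEntry {n : ℕ} {i j k : Fin n} {a b : RPrimeLoc K}
    (ha : a ∈ lamEntry K i j) (hb : b ∈ lamEntry K j k) : a * b ∈ lamEntry K i k := by
  set x := algebraMap (RPrime K) (RPrimeLoc K) (RPrime.x K) with hxdef
  set y := algebraMap (RPrime K) (RPrimeLoc K) (RPrime.y K) with hydef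
  set w := RPrimeLoc.xInv K * y with hwdef
  have hx : x * RPrimeLoc.xInv K = 1 := RPrimeLoc.x_mul_xInv K
  have hy : y * y = x * y := by rw [hxdef, hydef, ← map_mul, RPrime.y_mul_y, map_mul]
  have hY : y = x * w := by linear_combination (-y) * hx
  have hw : w * w = w := by
    linear_combination RPrimeLoc.xInv K ^ 2 * hy + (RPrimeLoc.xInv K * y) * hx
  have hE : ∀ i j : Fin n, lamEntry K i j = Submodule.span (RPrime K)
      (if i.val = 0 ∧ j.val + 1 = n then {1, w} else if i.val ≤ j.val then {1}
        else if i.val = j.val + 1 then {x, x * w} else {x}) := by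
    intro i j
    rw [← hY]
    unfold lamEntry
    split_ifs <;> rfl
  rw [hE] at ha hb ⊢
  exact entry_mul_aux (RPrime.x K) (RPrime.y K) x w rfl hY hw i j k _ (fun _ _ => rfl)
    (Submodule.mul_mem_mul ha hb)

/-- The algebra `Λ` of `n × n` matrices with entries in `lamEntry K i j`. -/
def Lam : Subalgebra (RPrime K) (Matrix (Fin n) (Fin n) (RPrimeLoc K)) where
  carrier := {m | ∀ i j, m i j ∈ lamEntry K i j}
  mul_mem' := by
    intro a b ha hb i k
    rw [Matrix.mul_apply]
    exact Submodule.sum_mem _ fun j _ => mul_mem_lamEntry K (ha i j) (hb j k)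
  add_mem' := fun ha hb i j => Submodule.add_mem _ (ha i j) (hb i j)
  algebraMap_mem' := by
    intro r i j
    rw [Matrix.algebraMap_matrix_apply]
    split_ifs with h
    · subst h
      rw [Algebra.algebraMap_eq_smul_one]
      exact Submodule.smul_mem _ _ (one_mem_lamEntry K i)
    · exact Submodule.zero_mem _

/-- `i` belongs to the open cyclic interval `]r, s[`, the complement of
`[s, r] = {s, s + 1, …, r}`. -/
def inOpen {n : ℕ} (i r s : Fin n) : Prop := ccw s r < ccw s i

open Classical in
/-- `ℓ^θ_{a,b} = d(a₁, b₁) + d(a₂, b₂) + n |δ(a₁ ∈ ]b₁, a₂[) - δ(b₂ ∈ ]b₁, a₂[)|`. -/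
def thetaLength {n : ℕ} (a b : Edge n) : ℕ :=
  ccw a.fst b.fst + ccw a.snd b.snd +
    if inOpen a.fst b.fst a.snd ↔ inOpen b.snd b.fst a.snd then 0 else n

/-- The relation `a ⊢ b` between edges not incident to the puncture. -/
def Turns {n : ℕ} (a b : Edge n) : Prop :=
  inOpen a.snd b.snd a.fst ∨ inOpen b.fst b.snd a.fst

open Classical in
/-- For a side `a` of the polygon and an edge `b`, the `R'`-submodule `A_{a,b}` of
`K[u^{±1}, v] / (v u - v²)`. -/
def sideEntry {n : ℕ} (a b : Edge n) : Submodule (RPrime K) (BigR K n) :=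
  match b with
  | .spoke _ .plain => Submodule.span (RPrime K)
      {BigR.u K n ((thetaLength a b : ℤ) - 1) * BigR.v K n}
  | .spoke _ .notched => Submodule.span (RPrime K)
      {BigR.u K n ((thetaLength a b : ℤ) - 1) * (BigR.u K n 1 - BigR.v K n)}
  | .chord _ _ => Submodule.span (RPrime K) {BigR.u K n (thetaLength a b)}
      ⊔ if Turns a b then Submodule.span (RPrime K) {BigR.v K n ^ thetaLength a b} else ⊥

/-- The entry `u^{2 d(i,j)} R' + v^{2 d(i,j)} R'^{δ(j = i - 1)}` of the frozen part. -/
def frozenEntry {n : ℕ} [NeZero n] (i j : Fin n) : Submodule (RPrime K) (BigR K n) :=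
  Submodule.span (RPrime K) {BigR.u K n (2 * ccw i j : ℕ)}
    ⊔ if j = i - 1 then Submodule.span (RPrime K) {BigR.v K n ^ (2 * ccw i j)} else ⊥

/-- The `i`-th entry, an ideal of `R'`, of the column describing `M_a` as a `Λ`-module. -/
def columnIdeal {n : ℕ} (a : Edge n) (i : Fin n) : Ideal (RPrime K) :=
  match a with
  | .spoke r .plain => if i ≤ r then Ideal.span {RPrime.y K} else Ideal.span {RPrime.y K ^ 2}
  | .spoke r .notched =>
      if i ≤ r then Ideal.span {RPrime.x K - RPrime.y K}
      else Ideal.span {RPrime.x K ^ 2 - RPrime.y K ^ 2}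
  | .chord r s =>
      if r < s then
        if i ≤ r then ⊤
        else if i ≤ s then Ideal.span {RPrime.x K, RPrime.y K}
        else Ideal.span {RPrime.x K}
      else
        if i ≤ s then Ideal.span {RPrime.x K, RPrime.y K}
        else if i ≤ r then Ideal.span {RPrime.x K}
        else Ideal.span {RPrime.x K ^ 2, RPrime.y K ^ 2}

end Orders

section GorensteinOrders

variable (R A : Type*) [CommRing R] [Ring A] [Algebra R A]

/-- `A` is an `R`-order: it is a finitely generated `R`-module with zero socle. -/
def IsOrder : Prop :=
  Module.Finite R A ∧ sSup {N : Submodule R A | IsSimpleModule R N} = ⊥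

/-- The `R`-dual `Hom_R(A_A, R)`. -/
def RegularDual : Type _ := A →ₗ[R] R

instance : AddCommGroup (RegularDual R A) := inferInstanceAs (AddCommGroup (A →ₗ[R] R))

/-- The left `A`-module structure of `Hom_R(A_A, R)`: `(a f)(x) = f(x a)`. -/
instance : Module A (RegularDual R A) where
  smul a f := LinearMap.comp (f : A →ₗ[R] R) (LinearMap.mulRight R a)
  one_smul f :=
    have h : ∀ g : A →ₗ[R] R, g.comp (LinearMap.mulRight R (1 : A)) = g := fun g => by ext; simp
    h f
  mul_smul a b f :=
    have h : ∀ g : A →ₗ[R] R, g.comp (LinearMap.mulRight R (a * b)) =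
        (g.comp (LinearMap.mulRight R b)).comp (LinearMap.mulRight R a) := fun g => by
      ext; simp [mul_assoc]
    h f
  smul_zero a := LinearMap.zero_comp (LinearMap.mulRight R a)
  smul_add a f g := LinearMap.ext fun _ => rfl
  add_smul a b f :=
    have h : ∀ g : A →ₗ[R] R, g.comp (LinearMap.mulRight R (a + b)) =
        g.comp (LinearMap.mulRight R a) + g.comp (LinearMap.mulRight R b) := fun g => by
      ext; simp [mul_add]
    h f
  zero_smul f :=
    have h : ∀ g : A →ₗ[R] R, g.comp (LinearMap.mulRight R (0 : A)) = 0 := fun g => by ext; simp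
    h f

/-- A Gorenstein `R`-order: `Hom_R(A_A, R)` is a projective left `A`-module. -/
def IsGorensteinOrder : Prop := IsOrder R A ∧ Module.Projective A (RegularDual R A)

end GorensteinOrders

end PuncturedPolygon

end

open PuncturedPolygon

/-! The edges of the triangulation at a vertex `P_k` are ordered by an angular position: the chord
from `k` to `s` stands at `d(k, s)`, the arcs to the puncture at `n`, the chord from `s` to `k` at
`n + d(k, s)`. The internal arrows are the corners between successive positions (`corner_spec`,
`At.exists_corner`), and the Jacobian relation at such an arrow says that the rest of its triangle
equals the rest of the external cycle at `P_k` (`cmp_eq`). A path inside a triangle can therefore be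
swept across it (`In_mul_Out_below`, `Cat_eq`, `In_mul_Out_beyond`).

Sweeping shows that the planar cycles `cycleAt` and the big cycles `bigAt` are the components of two
central elements `C = planarSum` and `D = bigSum`, with `C² = D C`. It also shows that `e_F Γ` is
spanned by paths along the boundary followed by a rotation around one vertex (`e_mul_mem_rowSpan`),
so that each `e_i Γ e_a`, with `i` a side, is generated over `K[D]` by at most two elements
(`row_chord`, `row_mid`, `row_notched`).

To see that there are no further relations, `rep` represents `Γ` by matrices over
`K[u^{±1}, v] / (v u - v²)`. An arrow is sent to a power of `u`, multiplied by the idempotent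
`u⁻¹ v` or `1 - u⁻¹ v` where it winds around the puncture; the relations hold by `rho_cyclicDeriv`.
The generators above have values which are independent over `K[X]`
(`IsWinding.eq_zero_and_eq_zero`). Hence the representation is faithful on `e_F Γ`
(`eq_zero_of_entry_eq_zero`), and its image there is the first description (`exists_entry_iff`,
`range_frozenHom`, `range_columnMap`).

For the centre, modulo `Γ e_F Γ` each `e_a Γ e_a` is spanned by `e_a` (`e_mul_mul_e_mem`), and
inside `Γ e_F Γ` it consists of combinations of the big and the planar cycle
(`e_mul_mul_e_of_mem_frozenIdeal`). A central element is then recovered from its components at the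
sides (`exists_eq_of_mem_center`), and the centre is the image of `R'` under `X ↦ D` and `Y ↦ C` or
`D - C` (`centreEquiv`).

The second description is the first one, conjugated by a diagonal matrix of powers of `u`, which
moves all entries into the subring `R'[X⁻¹]` (`map_lamEntry`, `map_columnIdeal`). Finally every
entry of `Λ` has the form `X^c K[X] ⊕ X^d (X⁻¹ Y) K[X]`. The exponents are complementary at the
positions `(j, i)` and `(i, j - 2)` (`exponents`), so the linear form `lamForm`, which adds the
coefficients of the second generators at the positions `(j, j - 2)`, generates the dual of `Λ`
freely (`bijective_smul_lamForm`). -/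

noncomputable section

namespace PuncturedPolygon

open Edge

/-! ### Cyclic distances -/

section Ccw

variable {n : ℕ}

theorem ccw_lt (r s : Fin n) : ccw r s < n := (s - r).isLt

theorem ccw_self (r : Fin n) : ccw r r = 0 := by
  have : NeZero n := ⟨by have := r.isLt; omega⟩
  simp [ccw]

/-- Distances expressed in the coordinate which starts at an arbitrary base point `b`. -/
theorem ccw_rel (b k l : Fin n) :
    (ccw b k ≤ ccw b l ∧ ccw k l + ccw b k = ccw b l) ∨
      (ccw b l < ccw b k ∧ ccw k l + ccw b k = n + ccw b l) := by
  have hb := b.isLt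
  have hk := k.isLt
  have hl := l.isLt
  have key : ∀ x y : Fin n, (x.val ≤ y.val ∧ ccw x y + x.val = y.val) ∨
      (y.val < x.val ∧ ccw x y + x.val = n + y.val) := by
    intro x y
    have hx := x.isLt
    have hy := y.isLt
    unfold ccw
    rw [Fin.sub_def]
    dsimp only
    rcases le_or_gt x.val y.val with h | h
    · left
      refine ⟨h, ?_⟩
      rw [show n - x.val + y.val = (y.val - x.val) + n by omega, Nat.add_mod_right,
        Nat.mod_eq_of_lt (by omega)]
      omega
    · right
      refine ⟨h, ?_⟩
      rw [Nat.mod_eq_of_lt (by omega)]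
      omega
  have h1 := key b k
  have h2 := key b l
  have h3 := key k l
  omega

theorem ccw_inj {b k l : Fin n} : ccw b k = ccw b l ↔ k = l := by
  refine ⟨fun h => ?_, fun h => h ▸ rfl⟩
  have : NeZero n := ⟨by have := b.isLt; omega⟩
  have h' : k - b = l - b := Fin.ext h
  exact sub_left_injective h'

theorem ccw_pos {r s : Fin n} (h : r ≠ s) : 0 < ccw r s := by
  rcases Nat.eq_zero_or_pos (ccw r s) with h0 | h0
  · exact absurd (ccw_inj.mp ((ccw_self r).trans h0.symm)) h
  · exact h0

theorem ne_of_ccw_pos {r s : Fin n} (h : 0 < ccw r s) : r ≠ s := by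
  rintro rfl
  rw [ccw_self] at h
  exact lt_irrefl _ h

theorem ccw_add_ccw {r s : Fin n} (h : r ≠ s) : ccw r s + ccw s r = n := by
  have := ccw_rel r s r
  have := ccw_self r
  have := ccw_pos h
  omega

variable [NeZero n]

/-- The vertex which is `m` counter-clockwise steps after `r`. -/
def shift (r : Fin n) (m : ℕ) : Fin n := r + Fin.ofNat n m

@[simp]
theorem shift_zero (r : Fin n) : shift r 0 = r := by
  unfold shift
  have : Fin.ofNat n 0 = 0 := Fin.ext (by simp)
  rw [this, add_zero]

theorem shift_shift (r : Fin n) (a b : ℕ) : shift (shift r a) b = shift r (a + b) := by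
  unfold shift
  rw [add_assoc]
  congr 1
  exact Fin.ext (by simp [Fin.val_add])

theorem shift_one (r : Fin n) : shift r 1 = r + 1 := by
  unfold shift
  congr 1

theorem shift_succ (r : Fin n) (m : ℕ) : shift r (m + 1) = shift r m + 1 := by
  rw [← shift_shift, shift_one]

theorem shift_succ' (r : Fin n) (m : ℕ) : shift r (m + 1) = shift (r + 1) m := by
  rw [← shift_one, shift_shift, add_comm]

theorem shift_n (r : Fin n) : shift r n = r := by
  unfold shift
  have : Fin.ofNat n n = 0 := Fin.ext (by simp)
  rw [this, add_zero]

theorem shift_ccw (r s : Fin n) : shift r (ccw r s) = s := by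
  have : Fin.ofNat n (ccw r s) = s - r := Fin.ext (Nat.mod_eq_of_lt (s - r).isLt)
  unfold shift
  rw [this]
  exact add_sub_cancel r s

theorem ccw_shift (r : Fin n) {m : ℕ} (h : m < n) : ccw r (shift r m) = m := by
  unfold ccw shift
  rw [add_sub_cancel_left]
  exact Nat.mod_eq_of_lt h

theorem ccw_add_one [n.AtLeastTwo] (r : Fin n) : ccw r (r + 1) = 1 := by
  have := ccw_shift r (m := 1) (Nat.AtLeastTwo.prop)
  rwa [shift_one] at this

theorem ccw_eq_one [n.AtLeastTwo] {r s : Fin n} : ccw r s = 1 ↔ s = r + 1 := by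
  rw [← ccw_add_one r, ccw_inj]

theorem ccw_sub_one [n.AtLeastTwo] (r : Fin n) : ccw (r - 1) r = 1 := by
  have := ccw_add_one (r - 1)
  rwa [sub_add_cancel] at this

end Ccw

namespace TaggedTriangulation

set_option linter.unusedSectionVars false

variable {n : ℕ} [NeZero n] [n.AtLeastTwo] (σ : TaggedTriangulation n)

/-! ### Edges of a tagged triangulation -/

variable {σ}

theorem mem_edges {a : Edge n} : a ∈ σ.edges ↔ (∃ k, side k = a) ∨ a ∈ σ.arcs := by
  simp [edges]

theorem side_mem (k : Fin n) : chord k (k + 1) ∈ σ.edges := mem_edges.mpr (.inl ⟨k, rfl⟩)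

theorem chord_mem_of_ccw_eq_one {r s : Fin n} (h : ccw r s = 1) : chord r s ∈ σ.edges := by
  rw [ccw_eq_one.mp h]
  exact side_mem r

theorem spoke_mem_arcs {k : Fin n} {t : Tag} (h : spoke k t ∈ σ.edges) : spoke k t ∈ σ.arcs := by
  rcases mem_edges.mp h with ⟨_, h⟩ | h
  · simp [side] at h
  · exact h

theorem chord_mem_arcs {r s : Fin n} (h : chord r s ∈ σ.edges) (h1 : ccw r s ≠ 1) :
    chord r s ∈ σ.arcs := by
  rcases mem_edges.mp h with ⟨k, h⟩ | h
  · simp only [side, chord.injEq] at h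
    obtain ⟨rfl, rfl⟩ := h
    exact absurd (ccw_add_one k) h1
  · exact h

theorem ne_of_chord_mem {r s : Fin n} (h : chord r s ∈ σ.edges) : r ≠ s := by
  rcases mem_edges.mp h with ⟨k, h⟩ | h
  · simp only [side, chord.injEq] at h
    obtain ⟨rfl, rfl⟩ := h
    apply ne_of_ccw_pos
    rw [ccw_add_one]
    exact one_pos
  · exact (σ.isTaggedArc _ h).1.symm

theorem not_crossing {r s x y : Fin n} (h : chord r s ∈ σ.edges) (h' : chord x y ∈ σ.edges) :
    ¬(0 < ccw r x ∧ ccw r x < ccw r s ∧ ccw r s < ccw r x + ccw x y) := by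
  intro hc
  by_cases h1 : ccw r s = 1
  · omega
  by_cases h2 : ccw x y = 1
  · omega
  exact (σ.compatible _ (chord_mem_arcs h h1) _ (chord_mem_arcs h' h2)).1 hc

theorem not_spoke_crossing {r s k : Fin n} {t : Tag} (h : chord r s ∈ σ.edges)
    (h' : spoke k t ∈ σ.edges) : ¬(0 < ccw r k ∧ ccw r k < ccw r s) := by
  intro hc
  by_cases h1 : ccw r s = 1
  · omega
  exact (σ.compatible _ (chord_mem_arcs h h1) _ (spoke_mem_arcs h')) hc

theorem tag_eq {r s : Fin n} {t t' : Tag} (h : spoke r t ∈ σ.edges) (h' : spoke s t' ∈ σ.edges)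
    (hrs : r ≠ s) : t = t' :=
  (σ.compatible _ (spoke_mem_arcs h) _ (spoke_mem_arcs h')) hrs

theorem chord_mem_of_forall {r s : Fin n} (hrs : r ≠ s)
    (h1 : ∀ x y, chord x y ∈ σ.edges →
      ¬(0 < ccw r x ∧ ccw r x < ccw r s ∧ ccw r s < ccw r x + ccw x y) ∧
      ¬(0 < ccw x r ∧ ccw x r < ccw x y ∧ ccw x y < ccw x r + ccw r s))
    (h2 : ∀ k t, spoke k t ∈ σ.edges → ¬(0 < ccw r k ∧ ccw r k < ccw r s)) :
    chord r s ∈ σ.edges := by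
  by_cases h : ccw r s = 1
  · exact chord_mem_of_ccw_eq_one h
  refine mem_edges.mpr (.inr (σ.maximal _ ⟨hrs.symm, fun h' => h (ccw_eq_one.mpr h')⟩ ?_))
  rintro (⟨x, y⟩ | ⟨k, t⟩) hb
  · exact h1 x y (mem_edges.mpr (.inr hb))
  · exact h2 k t (mem_edges.mpr (.inr hb))

theorem spoke_mem_of_forall {k : Fin n} {t : Tag}
    (h1 : ∀ x y, chord x y ∈ σ.edges → ¬(0 < ccw x k ∧ ccw x k < ccw x y))
    (h2 : ∀ r t', spoke r t' ∈ σ.edges → k ≠ r → t = t') : spoke k t ∈ σ.edges := by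
  refine mem_edges.mpr (.inr (σ.maximal _ trivial ?_))
  rintro (⟨x, y⟩ | ⟨r, t'⟩) hb
  · exact h1 x y (mem_edges.mpr (.inr hb))
  · exact h2 r t' (mem_edges.mpr (.inr hb))

/-! ### The triangles on both sides of a chord -/

/-- The triangle below a chord which is not a side: its third vertex is the last one joined to the
starting point of the chord. -/
theorem exists_below {r t : Fin n} (h : chord r t ∈ σ.edges) (h1 : 1 < ccw r t) :
    ∃ s, 0 < ccw r s ∧ ccw r s < ccw r t ∧ chord r s ∈ σ.edges ∧ chord s t ∈ σ.edges ∧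
      ∀ x, ccw r s < ccw r x → ccw r x < ccw r t → chord r x ∉ σ.edges := by
  classical
  -- Take `s` with `(r, s)` an edge as far as possible from `r`, and show that `(s, t)` is
  -- compatible with everything.
  let S : Finset (Fin n) :=
    Finset.univ.filter fun s => 0 < ccw r s ∧ ccw r s < ccw r t ∧ chord r s ∈ σ.edges
  have hS : S.Nonempty := ⟨r + 1, by simp [S, ccw_add_one, h1, side_mem]⟩
  obtain ⟨s, hs, hmax⟩ := S.exists_max_image (ccw r) hS
  simp only [S, Finset.mem_filter, Finset.mem_univ, true_and] at hs hmax
  obtain ⟨hs0, hst, hrs⟩ := hs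
  have hlast : ∀ x, ccw r s < ccw r x → ccw r x < ccw r t → chord r x ∉ σ.edges := by
    intro x hx hxt hm
    have := hmax x ⟨by omega, hxt, hm⟩
    omega
  refine ⟨s, hs0, hst, hrs, ?_, hlast⟩
  have hrr := ccw_self r
  have rst := ccw_rel r s t
  have lt := ccw_lt r t
  refine chord_mem_of_forall (fun h => by subst h; omega) ?_ ?_
  · intro x y hxy
    have c1 := not_crossing h hxy
    have c2 := not_crossing hxy h
    have c3 := not_crossing hrs hxy
    have c4 := not_crossing hxy hrs
    have rxy := ccw_rel r x y
    have rsx := ccw_rel r s x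
    have rxs := ccw_rel r x s
    have rxr := ccw_rel r x r
    have l1 := ccw_lt r x
    have l2 := ccw_lt r y
    have hxr : ccw r x = 0 → x = r := fun h => (ccw_inj.mp (hrr.trans h.symm)).symm
    have hne := ccw_pos (ne_of_chord_mem hxy)
    -- An edge starting at `r` cannot end strictly between `s` and `t`.
    have hr : ∀ z, ccw r s < ccw r z → ccw r z < ccw r t → ¬(x = r ∧ y = z) := by
      rintro z h1 h2 ⟨rfl, rfl⟩
      exact hlast y h1 h2 hxy
    have hr' := hr y
    simp only [and_true] at hr'
    constructor
    · omega
    · by_cases hx0 : x = r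
      · have := hr'
        subst hx0
        omega
      · omega
  · intro k τ hk
    have c1 := not_spoke_crossing h hk
    have rsk := ccw_rel r s k
    have := ccw_lt r k
    omega

end TaggedTriangulation

namespace TaggedTriangulation

variable {n : ℕ} [NeZero n] [n.AtLeastTwo] {σ : TaggedTriangulation n}

/-- If a chord starting where `(r, t)` starts lies beyond it, then the region beyond `(r, t)` is a
triangle with third side starting at `r`. -/
theorem exists_beyond_right {r t q : Fin n} (h : chord r t ∈ σ.edges) (hq : ccw r t < ccw r q)
    (hrq : chord r q ∈ σ.edges) :
    ∃ q, ccw r t < ccw r q ∧ chord r q ∈ σ.edges ∧ chord t q ∈ σ.edges := by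
  classical
  let S : Finset (Fin n) :=
    Finset.univ.filter fun q => ccw r t < ccw r q ∧ chord r q ∈ σ.edges
  obtain ⟨q, hq, hmin⟩ := S.exists_min_image (ccw r) ⟨q, by simp [S, hq, hrq]⟩
  simp only [S, Finset.mem_filter, Finset.mem_univ, true_and] at hq hmin
  have h0 := ccw_pos (ne_of_chord_mem h)
  -- For the shortest such chord `(r, q)`, the third vertex of the triangle below it has to be `t`.
  obtain ⟨s, hs0, hsq, hrs, hs, hlast⟩ := exists_below hq.2 (by omega)
  have hst : s = t := by
    rw [← ccw_inj (b := r)]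
    by_contra hne
    rcases lt_or_gt_of_ne hne with hlt | hlt
    · exact hlast t hlt hq.1 h
    · have := hmin s ⟨hlt, hrs⟩
      omega
  exact ⟨q, hq.1, hq.2, hst ▸ hs⟩

/-- If a chord ending where `(r, t)` ends lies beyond it, then the region beyond `(r, t)` is a
triangle with third side ending at `t`. -/
theorem exists_beyond_left {r t q : Fin n} (h : chord r t ∈ σ.edges) (hq0 : 0 < ccw q r)
    (hq : ccw q r < ccw q t) (hqt : chord q t ∈ σ.edges) :
    ∃ q, 0 < ccw q r ∧ ccw q r < ccw q t ∧ chord q r ∈ σ.edges ∧ chord q t ∈ σ.edges := by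
  classical
  let S : Finset (Fin n) :=
    Finset.univ.filter fun q => 0 < ccw q r ∧ ccw q r < ccw q t ∧ chord q t ∈ σ.edges
  obtain ⟨q, hq, hmin⟩ := S.exists_min_image (fun q => ccw q r) ⟨q, by simp [S, hq, hq0, hqt]⟩
  simp only [S, Finset.mem_filter, Finset.mem_univ, true_and] at hq hmin
  -- For the shortest such chord `(q, t)`, the third vertex of the triangle below it has to be `r`.
  obtain ⟨s, hs0, hsq, hqs, hs, -⟩ := exists_below hq.2.2 (by omega)
  have hst : s = r := by
    rw [← ccw_inj (b := q)]
    by_contra hne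
    have qsr := ccw_rel q s r
    have qst := ccw_rel q s t
    have qrs := ccw_rel q r s
    have qrt := ccw_rel q r t
    rcases lt_or_gt_of_ne hne with hlt | hlt
    · have := hmin s ⟨by omega, by omega, hs⟩
      omega
    · have := not_crossing hqs h
      omega
  exact ⟨q, hq.1, hq.2.1, hst ▸ hqs, hq.2.2⟩

/-- If there is no triangle beyond `(r, t)` with vertices on the polygon, then no chord separates
`(r, t)` from the puncture. -/
theorem not_cover {r t : Fin n} (h : chord r t ∈ σ.edges)
    (hA : ∀ q, ccw r t < ccw r q → chord r q ∉ σ.edges)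
    (hB : ∀ q, 0 < ccw q r → ccw q r < ccw q t → chord q t ∉ σ.edges) {x y : Fin n}
    (hxy : chord x y ∈ σ.edges) : ¬(0 < ccw x r ∧ ccw x r + ccw r t < ccw x y) := by
  induction hm : ccw x y using Nat.strong_induction_on generalizing x y with
  | _ m ih =>
    subst hm
    rintro ⟨h1, h2⟩
    have h0 := ccw_pos (ne_of_chord_mem h)
    have ly := ccw_lt x y
    -- One of the two other sides of the triangle below the covering chord `(x, y)` is a shorter
    -- covering chord, unless it is excluded by `hA` or `hB`.
    obtain ⟨s, hs0, hsy, hxs, hs, -⟩ := exists_below hxy (by omega)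
    have xrt := ccw_rel x r t
    have lt := ccw_lt r t
    have lxt := ccw_lt x t
    have c1 := not_crossing hxs h
    have xsr := ccw_rel x s r
    have xst := ccw_rel x s t
    have xsy := ccw_rel x s y
    have xrs := ccw_rel x r s
    have xry := ccw_rel x r y
    by_cases hst : ccw x s = ccw x t
    · rw [ccw_inj] at hst
      subst hst
      exact hB x (by omega) (by omega) hxs
    by_cases hsr : ccw x s = ccw x r
    · rw [ccw_inj] at hsr
      subst hsr
      exact hA y (by omega) hs
    rcases Nat.lt_or_ge (ccw x t) (ccw x s) with hlt | hge
    · exact ih _ hsy hxs rfl ⟨by omega, by omega⟩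
    · exact ih _ (by omega) hs rfl ⟨by omega, by omega⟩

/-- The region on the puncture side of a chord is a triangle with vertices on the polygon, a
triangle with a vertex at the puncture, or a punctured digon. -/
theorem exists_beyond {r t : Fin n} (h : chord r t ∈ σ.edges) :
    (∃ q, ccw r t < ccw r q ∧ chord r q ∈ σ.edges ∧ chord t q ∈ σ.edges) ∨
    (∃ q, 0 < ccw q r ∧ ccw q r < ccw q t ∧ chord q r ∈ σ.edges ∧ chord q t ∈ σ.edges) ∨
    (∃ τ, spoke r τ ∈ σ.edges ∧ spoke t τ ∈ σ.edges) ∨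
    (chord t r ∈ σ.edges ∧ ((∀ τ, spoke r τ ∈ σ.edges) ∨ (∀ τ, spoke t τ ∈ σ.edges))) := by
  by_cases hA : ∀ q, ccw r t < ccw r q → chord r q ∉ σ.edges
  swap
  · push Not at hA
    obtain ⟨q, hq, hrq⟩ := hA
    exact .inl (exists_beyond_right h hq hrq)
  by_cases hB : ∀ q, 0 < ccw q r → ccw q r < ccw q t → chord q t ∉ σ.edges
  swap
  · push Not at hB
    obtain ⟨q, hq0, hq, hqt⟩ := hB
    exact .inr (.inl (exists_beyond_left h hq0 hq hqt))
  right
  right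
  have hne := ne_of_chord_mem h
  have h0 := ccw_pos hne
  have hrr := ccw_self r
  have lt := ccw_lt r t
  -- No chord passes over `r`, and none passes over `t`.
  have hnr : ∀ x y, chord x y ∈ σ.edges → ¬(0 < ccw x r ∧ ccw x r < ccw x y) := by
    rintro x y hxy ⟨h1, h2⟩
    have c1 := not_crossing hxy h
    have c2 := not_cover h hA hB hxy
    have xrt := ccw_rel x r t
    have lxy := ccw_lt x y
    have hty : ccw x t = ccw x y := by omega
    rw [ccw_inj] at hty
    subst hty
    exact hB x h1 (by omega) hxy
  have hnt : ∀ x y, chord x y ∈ σ.edges → ¬(0 < ccw x t ∧ ccw x t < ccw x y) := by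
    rintro x y hxy ⟨h1, h2⟩
    have c1 := not_crossing h hxy
    have c2 := hnr x y hxy
    have rxt := ccw_rel r x t
    have rxr := ccw_rel r x r
    have lrx := ccw_lt r x
    by_cases hx : ccw r x = 0
    · have hxr : x = r := ccw_inj.mp (hx.trans hrr.symm)
      subst hxr
      exact hA y h2 hxy
    · omega
  -- With two vertices joined to the puncture, all tags agree, and then `r` and `t` are joined to
  -- it.
  by_cases hP : ∃ k l τ τ', k ≠ l ∧ spoke k τ ∈ σ.edges ∧ spoke l τ' ∈ σ.edges
  · obtain ⟨k, l, τ, τ', hkl, hk, hl⟩ := hP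
    obtain rfl := tag_eq hk hl hkl
    have htag : ∀ s τ', spoke s τ' ∈ σ.edges → τ = τ' := by
      intro s τ' hs
      by_cases hks : k = s
      · subst hks
        exact tag_eq hl hs hkl.symm
      · exact tag_eq hk hs hks
    exact .inl ⟨τ, spoke_mem_of_forall hnr fun s τ' hs _ => htag s τ' hs,
      spoke_mem_of_forall hnt fun s τ' hs _ => htag s τ' hs⟩
  right
  push Not at hP
  -- Otherwise a single vertex `k` is joined to the puncture, by both arcs.
  obtain ⟨k, τ, hk⟩ : ∃ k τ, spoke k τ ∈ σ.edges := by
    by_contra hno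
    push Not at hno
    exact hno r .plain (spoke_mem_of_forall hnr fun s τ' hs _ => absurd hs (hno s τ'))
  have hkall : ∀ τ', spoke k τ' ∈ σ.edges := fun τ' =>
    spoke_mem_of_forall (fun x y hxy => not_spoke_crossing hxy hk)
      fun s τ'' hs hks => absurd hs (hP k s τ τ'' hks hk)
  have honly : ∀ s τ', spoke s τ' ∈ σ.edges → s = k := by
    intro s τ' hs
    by_contra hsk
    exact hP k s τ τ' (Ne.symm hsk) hk hs
  -- If `k` were different from `r` and `t`, the chord `(k, t)` would be compatible with all arcs.
  have hkrt : k = r ∨ k = t := by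
    by_contra hkrt
    push Not at hkrt
    obtain ⟨hkr, hkt⟩ := hkrt
    have c0 := not_spoke_crossing h hk
    have rkt := ccw_rel r k t
    have rkr := ccw_rel r k r
    have lrk := ccw_lt r k
    have pk := ccw_pos (Ne.symm hkr)
    have nkt : ccw r k ≠ ccw r t := fun h => hkt (ccw_inj.mp h)
    refine hB k (ccw_pos hkr) (by omega) (chord_mem_of_forall hkt ?_ ?_)
    · intro x y hxy
      have c1 := not_crossing h hxy
      have c2 := not_crossing hxy h
      have c3 := hnr x y hxy
      have c4 := hnt x y hxy
      have c5 := not_spoke_crossing hxy hk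
      have rkx := ccw_rel r k x
      have rxt := ccw_rel r x t
      have rxr := ccw_rel r x r
      have rxk := ccw_rel r x k
      have rxy := ccw_rel r x y
      have lrx := ccw_lt r x
      have lry := ccw_lt r y
      have pxy := ccw_pos (ne_of_chord_mem hxy)
      by_cases hx : ccw r x = 0
      · have hxr : x = r := ccw_inj.mp (hx.trans hrr.symm)
        have := hA y
        rw [hxr] at hxy
        simp only [hxy, not_true_eq_false, imp_false] at this
        omega
      · omega
    · intro s τ' hs
      rw [honly s τ' hs, ccw_self]
      omega
  -- The chord `(t, r)`, which goes around on the other side of the puncture, crosses nothing.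
  refine ⟨chord_mem_of_forall hne.symm ?_ ?_, ?_⟩
  · intro x y hxy
    have c1 := not_crossing h hxy
    have c2 := not_crossing hxy h
    have c3 := hnr x y hxy
    have c4 := hnt x y hxy
    have rtx := ccw_rel r t x
    have rtr := ccw_rel r t r
    have rxt := ccw_rel r x t
    have rxr := ccw_rel r x r
    have rxy := ccw_rel r x y
    have lrx := ccw_lt r x
    have lry := ccw_lt r y
    have pxy := ccw_pos (ne_of_chord_mem hxy)
    by_cases hx : ccw r x = 0
    · have hxr : x = r := ccw_inj.mp (hx.trans hrr.symm)
      have := hA y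
      rw [hxr] at hxy
      simp only [hxy, not_true_eq_false, imp_false] at this
      omega
    · omega
  · intro s τ' hs
    rw [honly s τ' hs]
    rcases hkrt with rfl | rfl
    · omega
    · rw [ccw_self]
      omega
  · rcases hkrt with rfl | rfl
    · exact .inl hkall
    · exact .inr hkall

/-! ### The arcs incident to the puncture -/

/-- If only one arc joins `k` to the puncture, then another vertex is joined to the puncture. -/
theorem exists_other_spoke {k : Fin n} {τ τ' : Tag} (h : spoke k τ ∈ σ.edges)
    (h' : spoke k τ' ∉ σ.edges) : ∃ s, s ≠ k ∧ spoke s τ ∈ σ.edges := by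
  by_contra hno
  push Not at hno
  refine h' (spoke_mem_of_forall (fun x y hxy => not_spoke_crossing hxy h) fun s τ'' hs hks => ?_)
  exact absurd (tag_eq h hs hks ▸ hs) (hno s hks.symm)

/-- Unless both arcs at `k` are present, the next vertex joined to the puncture after `k` spans,
with `k` and the puncture, a triangle. -/
theorem exists_next_spoke {k : Fin n} {τ τ' : Tag} (h : spoke k τ ∈ σ.edges)
    (h' : spoke k τ' ∉ σ.edges) : ∃ s, k ≠ s ∧ spoke s τ ∈ σ.edges ∧ chord k s ∈ σ.edges := by
  classical
  obtain ⟨s, hsk, hs⟩ := exists_other_spoke h h'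
  let S : Finset (Fin n) := Finset.univ.filter fun s => s ≠ k ∧ spoke s τ ∈ σ.edges
  obtain ⟨s, hs, hmin⟩ := S.exists_min_image (ccw k) ⟨s, by simp [S, hsk, hs]⟩
  simp only [S, Finset.mem_filter, Finset.mem_univ, true_and] at hs hmin
  refine ⟨s, hs.1.symm, hs.2, chord_mem_of_forall hs.1.symm ?_ ?_⟩
  · intro x y hxy
    have c1 := not_spoke_crossing hxy h
    have c2 := not_spoke_crossing hxy hs.2
    have kxy := ccw_rel k x y
    have kxs := ccw_rel k x s
    have kxk := ccw_rel k x k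
    have l := ccw_lt k x
    have l' := ccw_lt k y
    have := ccw_self k
    omega
  · rintro l τ'' hl ⟨h1, h2⟩
    have hlk := (ne_of_ccw_pos h1)
    have := hmin l ⟨hlk.symm, tag_eq h hl hlk ▸ hl⟩
    omega

/-- Unless both arcs at `k` are present, the last vertex joined to the puncture before `k` spans,
with `k` and the puncture, a triangle. -/
theorem exists_prev_spoke {k : Fin n} {τ τ' : Tag} (h : spoke k τ ∈ σ.edges)
    (h' : spoke k τ' ∉ σ.edges) : ∃ s, s ≠ k ∧ spoke s τ ∈ σ.edges ∧ chord s k ∈ σ.edges := by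
  classical
  obtain ⟨s, hsk, hs⟩ := exists_other_spoke h h'
  let S : Finset (Fin n) := Finset.univ.filter fun s => s ≠ k ∧ spoke s τ ∈ σ.edges
  obtain ⟨s, hs, hmin⟩ := S.exists_min_image (fun s => ccw s k) ⟨s, by simp [S, hsk, hs]⟩
  simp only [S, Finset.mem_filter, Finset.mem_univ, true_and] at hs hmin
  refine ⟨s, hs.1, hs.2, chord_mem_of_forall hs.1 ?_ ?_⟩
  · intro x y hxy
    have c1 := not_spoke_crossing hxy h
    have c2 := not_spoke_crossing hxy hs.2
    have kxy := ccw_rel s x y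
    have kxs := ccw_rel s x s
    have kxk := ccw_rel s x k
    have l := ccw_lt s x
    have l' := ccw_lt s y
    have := ccw_self s
    omega
  · rintro l τ'' hl ⟨h1, h2⟩
    have hlk : k ≠ l := by
      rintro rfl
      omega
    have := hmin l ⟨hlk.symm, tag_eq h hl hlk ▸ hl⟩
    have := ccw_rel s l k
    omega

end TaggedTriangulation

namespace TaggedTriangulation

set_option linter.unusedSectionVars false

variable {n : ℕ} [NeZero n] [n.AtLeastTwo] (σ : TaggedTriangulation n)

/-! ### Winding around a vertex of the polygon -/

/-- The edge `c` is incident to the vertex `k` of the polygon, and `p` is its position in the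
anticlockwise order around `k`, with the conventions of `corner`. The notched arc of a punctured
digon has no position. -/
inductive At : Fin n → ℕ → σ.Vertex → Prop
  | out {k s : Fin n} (h : chord k s ∈ σ.edges) : At k (ccw k s) ⟨chord k s, h⟩
  | mid {k : Fin n} {τ : Tag} (h : spoke k τ ∈ σ.edges)
      (hτ : τ = .plain ∨ spoke k .plain ∉ σ.edges) : At k n ⟨spoke k τ, h⟩
  | inc {k s : Fin n} (h : chord s k ∈ σ.edges) : At k (n + ccw k s) ⟨chord s k, h⟩

/-- The position of the target of an internal arrow around the vertex of its corner. -/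
def cornerEnd : σ.Arrow → ℕ
  | .triR T => ccw T.r T.t
  | .triS T => n + ccw T.s T.r
  | .triT T => n + ccw T.t T.s
  | .puncR _ => n
  | .puncS T => n + ccw T.s T.r
  | .eta D => n + ccw D.s D.r
  | .gamma _ => n
  | .delta D => n + ccw D.r D.s
  | _ => 0

variable {σ}

theorem At.pos {k : Fin n} {p : ℕ} {c : σ.Vertex} (h : σ.At k p c) : 0 < p := by
  have : 0 < n := NeZero.pos n
  cases h with
  | out h => exact ccw_pos (ne_of_chord_mem h)
  | mid => exact this
  | inc h => omega

theorem At.lt {k : Fin n} {p : ℕ} {c : σ.Vertex} (h : σ.At k p c) : p < 2 * n := by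
  have : 0 < n := NeZero.pos n
  cases h with
  | @out s h => have := ccw_lt k s; omega
  | mid => omega
  | @inc s h => have := ccw_lt k s; omega

/-- There is at most one edge in each position around a vertex. -/
theorem At.eq {k : Fin n} {p : ℕ} {c c' : σ.Vertex} (h : σ.At k p c) (h' : σ.At k p c') :
    c = c' := by
  generalize hp : p = p' at h'
  cases h with
  | @out s h =>
    have := ccw_lt k s
    cases h' with
    | @out s' h' =>
      obtain rfl := ccw_inj.mp hp
      rfl
    | mid => omega
    | inc => omega
  | @mid τ h hτ =>
    cases h' with
    | @out s' h' => have := ccw_lt k s'; omega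
    | @mid τ' h' hτ' =>
      have : τ = τ' := by
        cases τ <;> cases τ' <;> simp_all
      subst this
      rfl
    | @inc s h' => have := ccw_pos (ne_of_chord_mem h').symm; omega
  | @inc s h =>
    have := ccw_pos (ne_of_chord_mem h).symm
    cases h' with
    | @out s' h' => have := ccw_lt k s'; omega
    | mid => omega
    | @inc s' h' =>
      obtain rfl := ccw_inj.mp (Nat.add_left_cancel hp)
      rfl

/-- An edge has only one position around a vertex. -/
theorem At.pos_eq {k : Fin n} {p p' : ℕ} {c : σ.Vertex} (h : σ.At k p c) (h' : σ.At k p' c) :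
    p = p' := by
  generalize hc : c = c' at h'
  cases h with
  | out h =>
    cases h' with
    | out h' => simp_all
    | mid => simp at hc
    | inc h' =>
      simp only [Subtype.mk.injEq, chord.injEq] at hc
      exact absurd hc.2.symm (ne_of_chord_mem h)
  | mid =>
    cases h' with
    | out h' => simp at hc
    | mid => rfl
    | inc h' => simp at hc
  | inc h =>
    cases h' with
    | out h' =>
      simp only [Subtype.mk.injEq, chord.injEq] at hc
      exact absurd hc.1 (ne_of_chord_mem h)
    | mid => simp at hc
    | inc h' => simp_all

/-- Two vertices joined to the puncture force all tags to agree, which excludes a punctured digon.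
-/
theorem PunctureTriangle.not_digon (T : σ.PunctureTriangle) (D : σ.Digon) : False := by
  by_cases h : T.r = D.r
  · have h' : T.s ≠ D.r := h ▸ T.ne.symm
    have h1 := tag_eq T.mem_s D.mem_plain h'
    have h2 := tag_eq T.mem_s D.mem_notched h'
    rw [h1] at h2
    cases h2
  · have h1 := tag_eq T.mem_r D.mem_plain h
    have h2 := tag_eq T.mem_r D.mem_notched h
    rw [h1] at h2
    cases h2

theorem PunctureTriangle.at_r (T : σ.PunctureTriangle) : σ.At T.r n ⟨spoke T.r T.tag, T.mem_r⟩ := by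
  refine .mid _ ?_
  by_contra! h
  exact h.1 (tag_eq T.mem_s h.2 T.ne.symm)

theorem PunctureTriangle.at_s (T : σ.PunctureTriangle) : σ.At T.s n ⟨spoke T.s T.tag, T.mem_s⟩ := by
  refine .mid _ ?_
  by_contra! h
  exact h.1 (tag_eq T.mem_r h.2 T.ne)

/-- The source and the target of an internal arrow are edges at the vertex of its corner, in
successive positions: no edge lies inside the corner of a triangle. -/
theorem corner_spec {α : σ.Arrow} {k : Fin n} {p : ℕ} (h : σ.corner α = some (k, p)) :
    σ.At k p (σ.src α) ∧ σ.At k (σ.cornerEnd α) (σ.tgt α) ∧ p < σ.cornerEnd α ∧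
      ∀ q c, p < q → q < σ.cornerEnd α → ¬σ.At k q c := by
  have hn : 2 ≤ n := Nat.AtLeastTwo.prop
  cases α with
  | ext k h => cases h
  | alpha D => cases h
  | beta D => cases h
  | puncO T => cases h
  | triR T =>
    simp only [corner, Option.some.injEq, Prod.mk.injEq] at h
    obtain ⟨rfl, rfl⟩ := h
    refine ⟨.out _, .out _, T.lt, ?_⟩
    intro q c h1 h2 h
    have h3 : q < ccw T.r T.t := h2
    have l := ccw_lt T.r T.t
    generalize hk : T.r = k at h
    cases h with
    | @out x hx =>
      subst hk
      have c1 := not_crossing T.mem_st hx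
      have c2 := not_crossing hx T.mem_st
      have a1 := ccw_rel T.r T.s T.t
      have := T.pos
      omega
    | mid => omega
    | inc => omega
  | triS T =>
    simp only [corner, Option.some.injEq, Prod.mk.injEq] at h
    obtain ⟨rfl, rfl⟩ := h
    have l := ccw_lt T.s T.t
    have c0 := ccw_pos (ne_of_chord_mem T.mem_rs)
    have c0' := T.lt
    refine ⟨.out _, .inc _, (by simp only [cornerEnd]; omega), ?_⟩
    intro q c h1 h2 h
    have h3 : q < n + ccw T.s T.r := h2
    have a1 := ccw_rel T.r T.s T.t
    have a2 := ccw_rel T.r T.s T.r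
    have a0 := ccw_self T.r
    have l' := ccw_lt T.r T.t
    generalize hk : T.s = k at h
    cases h with
    | @out x hx =>
      subst hk
      have c1 := not_crossing T.mem_rt hx
      have a2 := ccw_rel T.r T.s x
      have l2 := ccw_lt T.r x
      omega
    | mid hm =>
      subst hk
      have := not_spoke_crossing T.mem_rt hm
      omega
    | @inc x hx =>
      subst hk
      have c1 := not_crossing T.mem_rt hx
      have c2 := not_crossing hx T.mem_rt
      have p0 := ccw_pos (ne_of_chord_mem hx)
      have a2 := ccw_rel T.r T.s x
      have a3 := ccw_rel T.r x T.s
      have a4 := ccw_rel T.r x T.r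
      have l2 := ccw_lt T.r x
      omega
  | triT T =>
    simp only [corner, Option.some.injEq, Prod.mk.injEq] at h
    obtain ⟨rfl, rfl⟩ := h
    have c0 := ccw_pos (ne_of_chord_mem T.mem_rs)
    have c0' := T.lt
    have a1 := ccw_rel T.r T.t T.s
    have a2 := ccw_rel T.r T.t T.r
    have a0 := ccw_self T.r
    have l' := ccw_lt T.r T.t
    refine ⟨.inc _, .inc _, (by simp only [cornerEnd]; omega), ?_⟩
    intro q c h1 h2 h
    have h3 : q < n + ccw T.t T.s := h2
    generalize hk : T.t = k at h
    cases h with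
    | @out x hx =>
      subst hk
      have l2 := ccw_lt T.t x
      omega
    | mid hm => omega
    | @inc x hx =>
      subst hk
      have c1 := not_crossing T.mem_rs hx
      have c2 := not_crossing hx T.mem_rs
      have p0 := ccw_pos (ne_of_chord_mem hx)
      have a2 := ccw_rel T.r T.t x
      have a3 := ccw_rel T.r x T.t
      have l2 := ccw_lt T.r x
      omega
  | puncR T =>
    simp only [corner, Option.some.injEq, Prod.mk.injEq] at h
    obtain ⟨rfl, rfl⟩ := h
    have l := ccw_lt T.r T.s
    refine ⟨.out _, T.at_r, l, ?_⟩
    intro q c h1 h2 h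
    have h3 : q < n := h2
    generalize hk : T.r = k at h
    cases h with
    | @out x hx =>
      subst hk
      have c1 := not_spoke_crossing hx T.mem_s
      have := ccw_pos T.ne
      omega
    | mid hm => omega
    | @inc x hx => omega
  | puncS T =>
    simp only [corner, Option.some.injEq, Prod.mk.injEq] at h
    obtain ⟨rfl, rfl⟩ := h
    have l := ccw_pos T.ne.symm
    refine ⟨T.at_s, .inc _, (by simp only [cornerEnd]; omega), ?_⟩
    intro q c h1 h2 h
    have h3 : q < n + ccw T.s T.r := h2
    generalize hk : T.s = k at h
    cases h with
    | @out x hx =>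
      have := ccw_lt k x
      omega
    | mid hm => omega
    | @inc x hx =>
      subst hk
      have c1 := not_spoke_crossing hx T.mem_r
      have a1 := ccw_rel T.s x T.s
      have a2 := ccw_rel T.s x T.r
      have a3 := ccw_self T.s
      have := ccw_lt T.s T.r
      omega
  | eta D =>
    simp only [corner, Option.some.injEq, Prod.mk.injEq] at h
    obtain ⟨rfl, rfl⟩ := h
    have l := ccw_pos D.ne.symm
    refine ⟨.out _, .inc _, (by simp only [cornerEnd]; omega), ?_⟩
    intro q c h1 h2 h
    have h3 : q < n + ccw D.s D.r := h2
    generalize hk : D.s = k at h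
    cases h with
    | @out x hx =>
      subst hk
      have c1 := not_spoke_crossing hx D.mem_plain
      omega
    | mid hm =>
      subst hk
      have h1 := tag_eq hm D.mem_plain D.ne.symm
      have h2 := tag_eq hm D.mem_notched D.ne.symm
      rw [h1] at h2
      cases h2
    | @inc x hx =>
      subst hk
      have c1 := not_spoke_crossing hx D.mem_plain
      have a1 := ccw_rel D.s x D.s
      have a2 := ccw_rel D.s x D.r
      have a3 := ccw_self D.s
      have := ccw_lt D.s D.r
      have := ccw_pos (ne_of_chord_mem hx).symm
      omega
  | gamma D =>
    simp only [corner, Option.some.injEq, Prod.mk.injEq] at h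
    obtain ⟨rfl, rfl⟩ := h
    have l := ccw_lt D.r D.s
    refine ⟨.out _, .mid _ (.inl rfl), l, ?_⟩
    intro q c h1 h2 h
    have h3 : q < n := h2
    generalize hk : D.r = k at h
    cases h with
    | @out x hx =>
      subst hk
      have c1 := not_crossing D.mem_sr hx
      have c2 := not_crossing hx D.mem_sr
      have a1 := ccw_rel D.r D.s D.r
      have a2 := ccw_rel D.r D.s x
      have a3 := ccw_self D.r
      have := ccw_pos D.ne
      omega
    | mid hm => omega
    | @inc x hx => omega
  | delta D =>
    simp only [corner, Option.some.injEq, Prod.mk.injEq] at h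
    obtain ⟨rfl, rfl⟩ := h
    have l := ccw_pos D.ne
    refine ⟨.mid _ (.inl rfl), .inc _, (by simp only [cornerEnd]; omega), ?_⟩
    intro q c h1 h2 h
    have h3 : q < n + ccw D.r D.s := h2
    generalize hk : D.r = k at h
    cases h with
    | @out x hx => have := ccw_lt k x; omega
    | mid hm => omega
    | @inc x hx =>
      subst hk
      have c1 := not_crossing D.mem_rs hx
      have c2 := not_crossing hx D.mem_rs
      have a1 := ccw_rel D.r x D.r
      have a2 := ccw_rel D.r x D.s
      have a3 := ccw_self D.r
      have := ccw_lt D.r D.s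
      omega

/-- An internal arrow is determined by its corner. -/
theorem corner_inj {α β : σ.Arrow} {k : Fin n} {p : ℕ} (hα : σ.corner α = some (k, p))
    (hβ : σ.corner β = some (k, p)) : α = β := by
  obtain ⟨a1, a2, a3, a4⟩ := corner_spec hα
  obtain ⟨b1, b2, b3, b4⟩ := corner_spec hβ
  -- Both corners begin at the position `p`, so the one with the earlier end would have that end
  -- inside the other corner.
  have hend : σ.cornerEnd α = σ.cornerEnd β := by
    by_contra hne
    rcases lt_or_gt_of_ne hne with h | h
    · exact b4 _ _ a3 h a2
    · exact a4 _ _ b3 h b2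
  have hs := a1.eq b1
  have ht := a2.eq (hend ▸ b2)
  clear a1 a2 a3 a4 b1 b2 b3 b4 hend
  cases α <;> cases β <;> simp only [corner, reduceCtorEq] at hα hβ <;>
    simp only [src, tgt, Subtype.mk.injEq, chord.injEq, spoke.injEq, reduceCtorEq] at hs ht
  case triR.triR T T' =>
    obtain ⟨r, s, t, _⟩ := T
    obtain ⟨r', s', t', _⟩ := T'
    simp only at hs ht
    obtain ⟨⟨rfl, rfl⟩, -, rfl⟩ := And.intro hs ht
    rfl
  case triS.triS T T' =>
    obtain ⟨r, s, t, _⟩ := T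
    obtain ⟨r', s', t', _⟩ := T'
    simp only at hs ht
    obtain ⟨⟨rfl, rfl⟩, rfl, -⟩ := And.intro hs ht
    rfl
  case triT.triT T T' =>
    obtain ⟨r, s, t, _⟩ := T
    obtain ⟨r', s', t', _⟩ := T'
    simp only at hs ht
    obtain ⟨⟨rfl, rfl⟩, rfl, -⟩ := And.intro hs ht
    rfl
  case puncR.puncR T T' =>
    obtain ⟨τ, r, s, _⟩ := T
    obtain ⟨τ', r', s', _⟩ := T'
    simp only at hs ht
    obtain ⟨⟨rfl, rfl⟩, -, rfl⟩ := And.intro hs ht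
    rfl
  case puncS.puncS T T' =>
    obtain ⟨τ, r, s, _⟩ := T
    obtain ⟨τ', r', s', _⟩ := T'
    simp only at hs ht
    obtain ⟨⟨rfl, rfl⟩, rfl, -⟩ := And.intro hs ht
    rfl
  case eta.eta T T' =>
    obtain ⟨r, s, _⟩ := T
    obtain ⟨r', s', _⟩ := T'
    simp only at hs ht
    obtain ⟨rfl, rfl⟩ := hs
    rfl
  case gamma.gamma T T' =>
    obtain ⟨r, s, _⟩ := T
    obtain ⟨r', s', _⟩ := T'
    simp only at hs ht
    obtain ⟨rfl, rfl⟩ := hs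
    rfl
  case delta.delta T T' =>
    obtain ⟨r, s, _⟩ := T
    obtain ⟨r', s', _⟩ := T'
    simp only at hs ht
    obtain ⟨rfl, rfl⟩ := ht
    rfl
  case puncR.gamma T D => exact (T.not_digon D).elim
  case gamma.puncR D T => exact (T.not_digon D).elim
  case puncS.delta T D => exact (T.not_digon D).elim
  case delta.puncS D T => exact (T.not_digon D).elim
  -- The remaining pairs have the same source and target, which would force two ends of a chord to
  -- coincide.
  all_goals
    exfalso
    simp only [Option.some.injEq, Prod.mk.injEq] at hα hβ
    first
    | (rename_i T T'; have h1 := ne_of_chord_mem T.mem_rs; have h2 := ne_of_chord_mem T.mem_st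
       have h3 := ne_of_chord_mem T.mem_rt
       have h4 := ne_of_chord_mem T'.mem_rs; have h5 := ne_of_chord_mem T'.mem_st
       have h6 := ne_of_chord_mem T'.mem_rt; grind)
    | (rename_i T T'; have h1 := ne_of_chord_mem T.mem_rs; have h2 := ne_of_chord_mem T.mem_st
       have h3 := ne_of_chord_mem T.mem_rt
       have h4 := ne_of_chord_mem T'.mem_rs; grind)
    | (rename_i T T'; have h1 := ne_of_chord_mem T'.mem_rs; have h2 := ne_of_chord_mem T'.mem_st
       have h3 := ne_of_chord_mem T'.mem_rt
       have h4 := ne_of_chord_mem T.mem_rs; grind)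

/-- A punctured digon exists as soon as some vertex is joined to the puncture by two arcs. -/
theorem exists_digon {k : Fin n} (h : ∀ τ, spoke k τ ∈ σ.edges) : ∃ D : σ.Digon, D.r = k := by
  classical
  let S : Finset (Fin n) := Finset.univ.filter fun s => chord k s ∈ σ.edges
  obtain ⟨s, hs, hmax⟩ := S.exists_max_image (ccw k) ⟨k + 1, by simp [S, side_mem]⟩
  simp only [S, Finset.mem_filter, Finset.mem_univ, true_and] at hs hmax
  rcases exists_beyond hs with ⟨q, hq, hkq, -⟩ | ⟨q, h1, h2, -, h3⟩ | ⟨τ, -, hτ⟩ | ⟨h1, -⟩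
  · have := hmax q hkq
    omega
  · exact absurd ⟨h1, h2⟩ (not_spoke_crossing h3 (h .plain))
  · have hne := ne_of_chord_mem hs
    have h1 := tag_eq (h .plain) hτ hne
    have h2 := tag_eq (h .notched) hτ hne
    rw [← h1] at h2
    cases h2
  · exact ⟨⟨k, s, ne_of_chord_mem hs, hs, h1, h _, h _⟩, rfl⟩

/-- Every edge at `k`, except the side ending at `k`, is followed by a corner of a triangle. -/
theorem At.exists_corner {k : Fin n} {p : ℕ} {c : σ.Vertex} (h : σ.At k p c)
    (hp : p < 2 * n - 1) : ∃ α, σ.corner α = some (k, p) ∧ σ.src α = c := by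
  have key : ∃ α, σ.corner α = some (k, p) := by
    cases h with
    | @out s h =>
      rcases exists_beyond h with ⟨q, hq, hkq, hsq⟩ | ⟨q, h1, h2, hqk, hqs⟩ | ⟨τ, hk, hs⟩ |
        ⟨h1, hk | hs⟩
      · exact ⟨.triR ⟨k, s, q, ccw_pos (ne_of_chord_mem h), hq, h, hsq, hkq⟩, rfl⟩
      · exact ⟨.triS ⟨q, k, s, h1, h2, hqk, h, hqs⟩, rfl⟩
      · exact ⟨.puncR ⟨τ, k, s, ne_of_chord_mem h, h, hk, hs⟩, rfl⟩
      -- In a punctured digon, the corner depends on which of its vertices is joined to the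
      -- puncture.
      · exact ⟨.gamma ⟨k, s, ne_of_chord_mem h, h, h1, hk _, hk _⟩, rfl⟩
      · exact ⟨.eta ⟨s, k, ne_of_chord_mem h1, h1, h, hs _, hs _⟩, rfl⟩
    | @mid τ h hτ =>
      by_cases hk : ∀ τ, spoke k τ ∈ σ.edges
      · obtain ⟨D, rfl⟩ := exists_digon hk
        exact ⟨.delta D, rfl⟩
      · push Not at hk
        obtain ⟨τ', hτ'⟩ := hk
        obtain ⟨s, hsk, hs, hc⟩ := exists_prev_spoke h hτ'
        exact ⟨.puncS ⟨τ, s, k, hsk, hc, hs, h⟩, rfl⟩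
    | @inc s h =>
      have := ccw_add_ccw (ne_of_chord_mem h)
      obtain ⟨x, h0, h1, h2, h3, -⟩ := exists_below h (by omega)
      exact ⟨.triT ⟨s, x, k, h0, h1, h2, h3, h⟩, rfl⟩
  obtain ⟨α, hα⟩ := key
  exact ⟨α, hα, (corner_spec hα).1.eq h⟩

/-- A triangle at the puncture is determined by its first vertex. -/
theorem PunctureTriangle.eq_of_r_eq {T T' : σ.PunctureTriangle} (h : T.r = T'.r) : T = T' := by
  obtain ⟨τ, r, s, h1, h2, h3, h4⟩ := T
  obtain ⟨τ', r', s', h1', h2', h3', h4'⟩ := T'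
  dsimp only at h
  subst h
  obtain rfl := tag_eq h4 h3' (Ne.symm h1)
  have a1 := not_spoke_crossing h2 h4'
  have a2 := not_spoke_crossing h2' h4
  have a3 := ccw_pos h1
  have a4 := ccw_pos h1'
  have : ccw r s = ccw r s' := by omega
  rw [ccw_inj] at this
  subst this
  rfl

instance : Subsingleton σ.Digon := ⟨fun D D' => by
  have h : D.r = D'.r := by
    by_contra h
    have h1 := tag_eq D.mem_plain D'.mem_notched h
    cases h1
  have h2 : σ.corner (.delta D) = some (D'.r, n) := by rw [← h]; rfl
  have := corner_inj h2 (show σ.corner (.delta D') = some (D'.r, n) from rfl)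
  exact Arrow.delta.inj this⟩

end TaggedTriangulation

/-! ### Path algebras and cyclic derivatives -/

namespace IceQuiver

variable {V A : Type*} [Fintype V] (K : Type*) [Field K] (Q : IceQuiver V A)

theorem sum_pathVertex : ∑ v, pathVertex K Q v = 1 := by
  have h : toPathAlgebra K Q _ = toPathAlgebra K Q _ :=
    RingQuot.mkAlgHom_rel K (PathRel.one (K := K) (Q := Q))
  rwa [map_sum, map_one] at h

theorem pathVertex_src_mul (a : A) :
    pathVertex K Q (Q.src a) * pathArrow K Q a = pathArrow K Q a := by
  have h : toPathAlgebra K Q _ = toPathAlgebra K Q _ :=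
    RingQuot.mkAlgHom_rel K (PathRel.src_mul (K := K) (Q := Q) a)
  rwa [map_mul] at h

theorem pathArrow_mul_tgt (a : A) :
    pathArrow K Q a * pathVertex K Q (Q.tgt a) = pathArrow K Q a := by
  have h : toPathAlgebra K Q _ = toPathAlgebra K Q _ :=
    RingQuot.mkAlgHom_rel K (PathRel.mul_tgt (K := K) (Q := Q) a)
  rwa [map_mul] at h

@[simp]
theorem pathWord_nil : pathWord K Q [] = 1 := rfl

@[simp]
theorem pathWord_cons (a : A) (w : List A) :
    pathWord K Q (a :: w) = pathArrow K Q a * pathWord K Q w := by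
  simp [pathWord]

theorem pathWord_append (w w' : List A) :
    pathWord K Q (w ++ w') = pathWord K Q w * pathWord K Q w' := by
  simp [pathWord]

theorem cyclicDerivWord_of_notMem {α : A} {w : List A} (h : α ∉ w) :
    cyclicDerivWord K Q α w = 0 := by
  classical
  unfold cyclicDerivWord
  refine Finset.sum_eq_zero fun i _ => if_neg fun (hi : w.get i = α) => h (hi ▸ List.get_mem w i)

/-- Cyclic derivative of a cycle in which the arrow occurs once. -/
theorem cyclicDerivWord_append_cons {α : A} {l₁ l₂ : List A} (h₁ : α ∉ l₁) (h₂ : α ∉ l₂) :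
    cyclicDerivWord K Q α (l₁ ++ α :: l₂) =
      pathVertex K Q (Q.tgt α) * pathWord K Q (l₂ ++ l₁) := by
  classical
  unfold cyclicDerivWord
  have hlen : l₁.length < (l₁ ++ α :: l₂).length := by simp
  rw [Finset.sum_eq_single ⟨l₁.length, hlen⟩]
  · rw [if_pos (by simp)]
    congr 3 <;> simp
  · rintro ⟨i, hi⟩ _ hne
    refine if_neg fun h => ?_
    simp only [List.get_eq_getElem] at h
    rcases lt_trichotomy i l₁.length with hlt | rfl | hgt
    · rw [List.getElem_append_left hlt] at h
      exact h₁ (h ▸ List.getElem_mem hlt)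
    · exact hne rfl
    · rw [List.getElem_append_right hgt.le, List.getElem_cons,
        dif_neg (by omega : ¬i - l₁.length = 0)] at h
      exact h₂ (h ▸ List.getElem_mem _)
  · intro h
    exact absurd (Finset.mem_univ _) h

theorem cyclicDeriv_eq (α : A) (W : List A →₀ K) :
    cyclicDeriv Q α W = Finsupp.linearCombination K (cyclicDerivWord K Q α) W := rfl

theorem sum_cyclicDerivWord_eq_single {ι : Type*} [Fintype ι] {α : A} {f : ι → List A} (i : ι)
    (h : ∀ j, α ∈ f j → j = i) :
    ∑ j, cyclicDerivWord K Q α (f j) = cyclicDerivWord K Q α (f i) := by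
  classical
  refine Finset.sum_eq_single i (fun j _ hj => ?_) fun h => absurd (Finset.mem_univ _) h
  exact cyclicDerivWord_of_notMem K Q fun hm => hj (h j hm)

theorem sum_cyclicDerivWord_eq_zero {ι : Type*} [Fintype ι] {α : A} {f : ι → List A}
    (h : ∀ j, α ∉ f j) : ∑ j, cyclicDerivWord K Q α (f j) = 0 :=
  Finset.sum_eq_zero fun j _ => cyclicDerivWord_of_notMem K Q (h j)

end IceQuiver

namespace TaggedTriangulation

open IceQuiver

set_option linter.unusedSectionVars false

variable {n : ℕ} [NeZero n] [n.AtLeastTwo] {σ : TaggedTriangulation n}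

instance : DecidablePred σ.HasArcAt := fun _ => Classical.propDecidable _

open Classical in
/-- The internal arrow which starts at the position `p` around `k`, if there is one. -/
def cornerAt (σ : TaggedTriangulation n) (k : Fin n) (p : ℕ) : Option σ.Arrow :=
  if h' : ∃ α : σ.Arrow, σ.corner α = some (k, p) then some h'.choose else none

theorem cornerAt_eq_some {k : Fin n} {p : ℕ} {α : σ.Arrow} :
    σ.cornerAt k p = some α ↔ σ.corner α = some (k, p) := by
  classical
  unfold cornerAt
  constructor
  · intro h
    split_ifs at h with h'
    rw [← Option.some.inj h]
    exact h'.choose_spec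
  · intro h
    have h' : ∃ α : σ.Arrow, σ.corner α = some (k, p) := ⟨α, h⟩
    rw [dif_pos h']
    exact congrArg some (corner_inj h'.choose_spec h)

/-- The internal arrows around `k` which start at the positions `p, …, q - 1`. -/
def segList (σ : TaggedTriangulation n) (k : Fin n) (p q : ℕ) : List σ.Arrow :=
  (List.range' p (q - p)).filterMap (σ.cornerAt k)

theorem externalCycle_eq (k : Fin n) (h : σ.HasArcAt k) :
    σ.externalCycle k h = .ext k h :: σ.segList k 0 (2 * n) := by
  unfold externalCycle segList
  rw [List.range_eq_range']
  rfl

theorem mem_segList {k : Fin n} {p q : ℕ} {α : σ.Arrow} :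
    α ∈ σ.segList k p q ↔ ∃ x, p ≤ x ∧ x < q ∧ σ.corner α = some (k, x) := by
  simp only [segList, List.mem_filterMap, List.mem_range'_1, cornerAt_eq_some]
  constructor
  · rintro ⟨x, hx, h⟩
    exact ⟨x, by omega, by omega, h⟩
  · rintro ⟨x, h1, h2, h⟩
    exact ⟨x, by omega, h⟩

theorem segList_append {k : Fin n} {p q r : ℕ} (h1 : p ≤ q) (h2 : q ≤ r) :
    σ.segList k p q ++ σ.segList k q r = σ.segList k p r := by
  unfold segList
  rw [← List.filterMap_append]
  congr 1
  have := List.range'_append (s := p) (m := q - p) (n := r - q) (step := 1)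
  rw [show r - p = q - p + (r - q) by omega, ← this]
  congr 2
  omega

theorem segList_eq_nil {k : Fin n} {p q : ℕ}
    (h : ∀ x, p ≤ x → x < q → ∀ c, ¬σ.At k x c) : σ.segList k p q = [] := by
  rw [List.eq_nil_iff_forall_not_mem]
  intro α hα
  obtain ⟨x, h1, h2, h3⟩ := mem_segList.mp hα
  exact h x h1 h2 _ (corner_spec h3).1

theorem segList_corner {α : σ.Arrow} {k : Fin n} {p : ℕ} (h : σ.corner α = some (k, p)) :
    σ.segList k p (σ.cornerEnd α) = [α] := by
  obtain ⟨-, -, h1, h2⟩ := corner_spec h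
  rw [← segList_append (Nat.le_succ p) h1]
  rw [segList_eq_nil (p := p.succ) fun x hx1 hx2 c => h2 x c hx1 hx2]
  simp [segList, cornerAt_eq_some.mpr h]

theorem segList_split {α : σ.Arrow} {k : Fin n} {p : ℕ} (h : σ.corner α = some (k, p)) :
    σ.segList k 0 (2 * n) =
      σ.segList k 0 p ++ α :: σ.segList k (σ.cornerEnd α) (2 * n) := by
  obtain ⟨-, h0, h1, -⟩ := corner_spec h
  have := h0.lt
  rw [← segList_append (Nat.zero_le p) (by omega : p ≤ 2 * n),
    ← segList_append h1.le (by omega : σ.cornerEnd α ≤ 2 * n), segList_corner h]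
  rfl

open Classical in
/-- The arrow around the puncture which starts at the arc from `r` to the puncture. -/
def puncAt (σ : TaggedTriangulation n) (r : Fin n) : Option σ.Arrow :=
  if h : ∃ T : σ.PunctureTriangle, T.r = r then some (.puncO h.choose) else none

theorem puncAt_r (T : σ.PunctureTriangle) : σ.puncAt T.r = some (.puncO T) := by
  classical
  unfold puncAt
  have h : ∃ T' : σ.PunctureTriangle, T'.r = T.r := ⟨T, rfl⟩
  rw [dif_pos h]
  exact congrArg (fun T => some (Arrow.puncO T)) (PunctureTriangle.eq_of_r_eq h.choose_spec)

theorem puncAt_eq_some {r : Fin n} {α : σ.Arrow} :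
    σ.puncAt r = some α ↔ ∃ T : σ.PunctureTriangle, T.r = r ∧ α = .puncO T := by
  classical
  constructor
  · intro h
    unfold puncAt at h
    split_ifs at h with h'
    exact ⟨h'.choose, h'.choose_spec, (Option.some.inj h).symm⟩
  · rintro ⟨T, rfl, rfl⟩
    exact puncAt_r T

/-- The arrows around the puncture which start at arcs to the vertices `k + i, …, k + j - 1`. -/
def puncList (σ : TaggedTriangulation n) (k : Fin n) (i j : ℕ) : List σ.Arrow :=
  ((List.range' i (j - i)).map (shift k)).filterMap σ.puncAt

theorem mem_puncList {k : Fin n} {i j : ℕ} {α : σ.Arrow} :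
    α ∈ σ.puncList k i j ↔
      ∃ x, i ≤ x ∧ x < j ∧ ∃ T : σ.PunctureTriangle, T.r = shift k x ∧ α = .puncO T := by
  simp only [puncList, List.mem_filterMap, List.mem_map, List.mem_range'_1, puncAt_eq_some]
  constructor
  · rintro ⟨_, ⟨x, hx, rfl⟩, h⟩
    exact ⟨x, by omega, by omega, h⟩
  · rintro ⟨x, h1, h2, h⟩
    exact ⟨_, ⟨x, by omega, rfl⟩, h⟩

theorem puncList_append {k : Fin n} {p q r : ℕ} (h1 : p ≤ q) (h2 : q ≤ r) :
    σ.puncList k p q ++ σ.puncList k q r = σ.puncList k p r := by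
  unfold puncList
  rw [← List.filterMap_append, ← List.map_append]
  congr 2
  have := List.range'_append (s := p) (m := q - p) (n := r - q) (step := 1)
  rw [show r - p = q - p + (r - q) by omega, ← this]
  congr 2
  omega

theorem puncList_shift (k : Fin n) (m i j : ℕ) :
    σ.puncList (shift k m) i j = σ.puncList k (m + i) (m + j) := by
  unfold puncList
  congr 1
  rw [show m + j - (m + i) = j - i by omega, ← List.map_add_range', List.map_map]
  exact List.map_congr_left fun x _ => shift_shift k m x

theorem puncList_succ (T : σ.PunctureTriangle) : σ.puncList T.r 0 1 = [.puncO T] := by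
  simp [puncList, puncAt_r]

/-- The vertices `r, r + 1, …, r + n - 1`, as a rotation of the list of all vertices. -/
theorem finRange_rotate (r : Fin n) :
    (List.finRange n).drop r ++ (List.finRange n).take r = (List.range' 0 n).map (shift r) := by
  rw [← List.rotate_eq_drop_append_take (by simp)]
  refine List.ext_getElem (by simp) fun i h1 h2 => ?_
  rw [List.getElem_rotate]
  simp only [List.getElem_map, List.getElem_range', List.getElem_finRange]
  refine Fin.ext ?_
  simp [shift, Fin.val_add, add_comm]

variable (σ) (K : Type*) [Field K]

/-- The path algebra of the quiver of `σ`. -/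
abbrev PA : Type _ := PathAlgebra K σ.quiver

/-- The product of the two other arrows of the triangle which contains a corner; inside a punctured
digon, the sum of the two paths parallel to it. -/
def compl : σ.Arrow → σ.PA K
  | .triR T => pathArrow K σ.quiver (.triT T) * pathArrow K σ.quiver (.triS T)
  | .triS T => pathArrow K σ.quiver (.triR T) * pathArrow K σ.quiver (.triT T)
  | .triT T => pathArrow K σ.quiver (.triS T) * pathArrow K σ.quiver (.triR T)
  | .puncR T => pathArrow K σ.quiver (.puncO T) * pathArrow K σ.quiver (.puncS T)
  | .puncS T => pathArrow K σ.quiver (.puncR T) * pathArrow K σ.quiver (.puncO T)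
  | .puncO T => pathArrow K σ.quiver (.puncS T) * pathArrow K σ.quiver (.puncR T)
  | .eta D => pathArrow K σ.quiver (.alpha D) * pathArrow K σ.quiver (.beta D)
      + pathArrow K σ.quiver (.gamma D) * pathArrow K σ.quiver (.delta D)
  | .alpha D => pathArrow K σ.quiver (.beta D) * pathArrow K σ.quiver (.eta D)
  | .beta D => pathArrow K σ.quiver (.eta D) * pathArrow K σ.quiver (.alpha D)
  | .gamma D => pathArrow K σ.quiver (.delta D) * pathArrow K σ.quiver (.eta D)
  | .delta D => pathArrow K σ.quiver (.eta D) * pathArrow K σ.quiver (.gamma D)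
  | .ext _ _ => 0

/-- The part of the cyclic derivatives of the potential which comes from the triangles. -/
theorem cyclicDeriv_triangles (α : σ.Arrow) :
    (∑ T : σ.Triangle, cyclicDerivWord K σ.quiver α [.triR T, .triT T, .triS T])
    + (∑ T : σ.PunctureTriangle, cyclicDerivWord K σ.quiver α [.puncR T, .puncO T, .puncS T])
    + (∑ D : σ.Digon, (cyclicDerivWord K σ.quiver α [.eta D, .alpha D, .beta D]
        + cyclicDerivWord K σ.quiver α [.eta D, .gamma D, .delta D])) =
    pathVertex K σ.quiver (σ.tgt α) * σ.compl K α := by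
  -- The cyclic derivatives of a cycle of length three.
  have h3 : ∀ x y z : σ.Arrow, x ≠ y → x ≠ z → y ≠ z →
      cyclicDerivWord K σ.quiver x [x, y, z] = pathVertex K σ.quiver (σ.tgt x) *
        (pathArrow K σ.quiver y * pathArrow K σ.quiver z) ∧
      cyclicDerivWord K σ.quiver y [x, y, z] = pathVertex K σ.quiver (σ.tgt y) *
        (pathArrow K σ.quiver z * pathArrow K σ.quiver x) ∧
      cyclicDerivWord K σ.quiver z [x, y, z] = pathVertex K σ.quiver (σ.tgt z) *
        (pathArrow K σ.quiver x * pathArrow K σ.quiver y) := by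
    intro x y z hxy hxz hyz
    refine ⟨?_, ?_, ?_⟩
    · have := cyclicDerivWord_append_cons K σ.quiver (α := x) (l₁ := []) (l₂ := [y, z])
        (by simp) (by simp [hxy, hxz])
      simp only [List.nil_append, List.append_nil, pathWord_cons, pathWord_nil, mul_one] at this
      exact this
    · have := cyclicDerivWord_append_cons K σ.quiver (α := y) (l₁ := [x]) (l₂ := [z])
        (by simp [hxy.symm]) (by simp [hyz])
      simp only [List.nil_append, List.cons_append, pathWord_cons, pathWord_nil, mul_one] at this
      exact this
    · have := cyclicDerivWord_append_cons K σ.quiver (α := z) (l₁ := [x, y]) (l₂ := [])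
        (by simp [hxz.symm, hyz.symm]) (by simp)
      simp only [List.nil_append, List.cons_append, pathWord_cons, pathWord_nil, mul_one] at this
      exact this
  rw [Finset.sum_add_distrib]
  cases α with
  | ext k h =>
    rw [sum_cyclicDerivWord_eq_zero _ _ (by simp), sum_cyclicDerivWord_eq_zero _ _ (by simp),
      sum_cyclicDerivWord_eq_zero _ _ (by simp), sum_cyclicDerivWord_eq_zero _ _ (by simp)]
    simp [compl]
  | triR T =>
    rw [sum_cyclicDerivWord_eq_single _ _ T (by simp [eq_comm]),
      sum_cyclicDerivWord_eq_zero _ _ (by simp),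
      sum_cyclicDerivWord_eq_zero _ _ (by simp), sum_cyclicDerivWord_eq_zero _ _ (by simp),
      (h3 _ _ _ (by simp) (by simp) (by simp)).1]
    simp [compl]
  | triS T =>
    rw [sum_cyclicDerivWord_eq_single _ _ T (by simp [eq_comm]),
      sum_cyclicDerivWord_eq_zero _ _ (by simp),
      sum_cyclicDerivWord_eq_zero _ _ (by simp), sum_cyclicDerivWord_eq_zero _ _ (by simp),
      (h3 _ _ _ (by simp) (by simp) (by simp)).2.2]
    simp [compl]
  | triT T =>
    rw [sum_cyclicDerivWord_eq_single _ _ T (by simp [eq_comm]),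
      sum_cyclicDerivWord_eq_zero _ _ (by simp),
      sum_cyclicDerivWord_eq_zero _ _ (by simp), sum_cyclicDerivWord_eq_zero _ _ (by simp),
      (h3 _ _ _ (by simp) (by simp) (by simp)).2.1]
    simp [compl]
  | puncR T =>
    rw [sum_cyclicDerivWord_eq_zero _ _ (by simp),
      sum_cyclicDerivWord_eq_single _ _ T (by simp [eq_comm]),
      sum_cyclicDerivWord_eq_zero _ _ (by simp), sum_cyclicDerivWord_eq_zero _ _ (by simp),
      (h3 _ _ _ (by simp) (by simp) (by simp)).1]
    simp [compl]
  | puncS T =>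
    rw [sum_cyclicDerivWord_eq_zero _ _ (by simp),
      sum_cyclicDerivWord_eq_single _ _ T (by simp [eq_comm]),
      sum_cyclicDerivWord_eq_zero _ _ (by simp), sum_cyclicDerivWord_eq_zero _ _ (by simp),
      (h3 _ _ _ (by simp) (by simp) (by simp)).2.2]
    simp [compl]
  | puncO T =>
    rw [sum_cyclicDerivWord_eq_zero _ _ (by simp),
      sum_cyclicDerivWord_eq_single _ _ T (by simp [eq_comm]),
      sum_cyclicDerivWord_eq_zero _ _ (by simp), sum_cyclicDerivWord_eq_zero _ _ (by simp),
      (h3 _ _ _ (by simp) (by simp) (by simp)).2.1]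
    simp [compl]
  | eta D =>
    rw [sum_cyclicDerivWord_eq_zero _ _ (by simp), sum_cyclicDerivWord_eq_zero _ _ (by simp),
      sum_cyclicDerivWord_eq_single _ _ D (by simp [eq_comm]),
      sum_cyclicDerivWord_eq_single _ _ D (by simp [eq_comm]),
      (h3 _ _ _ (by simp) (by simp) (by simp)).1, (h3 _ _ _ (by simp) (by simp) (by simp)).1]
    simp [compl, mul_add]
  | alpha D =>
    rw [sum_cyclicDerivWord_eq_zero _ _ (by simp), sum_cyclicDerivWord_eq_zero _ _ (by simp),
      sum_cyclicDerivWord_eq_single _ _ D (by simp [eq_comm]),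
      sum_cyclicDerivWord_eq_zero _ _ (by simp),
      (h3 _ _ _ (by simp) (by simp) (by simp)).2.1]
    simp [compl]
  | beta D =>
    rw [sum_cyclicDerivWord_eq_zero _ _ (by simp), sum_cyclicDerivWord_eq_zero _ _ (by simp),
      sum_cyclicDerivWord_eq_single _ _ D (by simp [eq_comm]),
      sum_cyclicDerivWord_eq_zero _ _ (by simp),
      (h3 _ _ _ (by simp) (by simp) (by simp)).2.2]
    simp [compl]
  | gamma D =>
    rw [sum_cyclicDerivWord_eq_zero _ _ (by simp), sum_cyclicDerivWord_eq_zero _ _ (by simp),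
      sum_cyclicDerivWord_eq_zero _ _ (by simp),
      sum_cyclicDerivWord_eq_single _ _ D (by simp [eq_comm]),
      (h3 _ _ _ (by simp) (by simp) (by simp)).2.1]
    simp [compl]
  | delta D =>
    rw [sum_cyclicDerivWord_eq_zero _ _ (by simp), sum_cyclicDerivWord_eq_zero _ _ (by simp),
      sum_cyclicDerivWord_eq_zero _ _ (by simp),
      sum_cyclicDerivWord_eq_single _ _ D (by simp [eq_comm]),
      (h3 _ _ _ (by simp) (by simp) (by simp)).2.2]
    simp [compl]

/-- The cyclic derivatives of the potential: the contributions of the triangles, of the external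
cycles and of the cycle around the puncture. -/
theorem cyclicDeriv_potential (α : σ.Arrow) :
    cyclicDeriv σ.quiver α (σ.potential K) =
      pathVertex K σ.quiver (σ.tgt α) * σ.compl K α
      - (∑ k : {k : Fin n // σ.HasArcAt k},
          cyclicDerivWord K σ.quiver α (σ.externalCycle k.1 k.2))
      - (open Classical in if Nonempty σ.Digon then 0 else
          cyclicDerivWord K σ.quiver α σ.puncturedCycle) := by
  classical
  rw [← cyclicDeriv_triangles, cyclicDeriv_eq, potential]
  simp only [map_add, map_sub, map_sum, Finsupp.linearCombination_single, one_smul]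
  congr 1
  split_ifs <;> simp

variable {σ}

/-- Cyclic derivative of the potential with respect to a corner at a vertex of the polygon. -/
theorem cyclicDeriv_corner {α : σ.Arrow} {k : Fin n} {p : ℕ} (h : σ.corner α = some (k, p))
    (hk : σ.HasArcAt k) :
    cyclicDeriv σ.quiver α (σ.potential K) =
      pathVertex K σ.quiver (σ.tgt α) * (σ.compl K α -
        pathWord K σ.quiver (σ.segList k (σ.cornerEnd α) (2 * n)) *
          pathArrow K σ.quiver (.ext k hk) * pathWord K σ.quiver (σ.segList k 0 p)) := by
  classical
  have hα : ∀ k h, α ≠ .ext k h := by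
    rintro k' h' rfl
    cases h
  -- The arrow lies on no cycle around the puncture, once on the external cycle around `k`, and on
  -- no other external cycle.
  rw [cyclicDeriv_potential,
    sum_cyclicDerivWord_eq_single K σ.quiver (f := fun k : {k : Fin n // σ.HasArcAt k} =>
      σ.externalCycle k.1 k.2) ⟨k, hk⟩]
  · have h1 : (if Nonempty σ.Digon then 0 else
          cyclicDerivWord K σ.quiver α σ.puncturedCycle) = 0 := by
      split_ifs
      · rfl
      refine cyclicDerivWord_of_notMem _ _ fun hm => ?_
      obtain ⟨r, -, hr⟩ := List.mem_filterMap.mp hm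
      obtain ⟨T, -, rfl⟩ := puncAt_eq_some.mp hr
      cases h
    rw [h1, sub_zero, mul_sub]
    congr 1
    dsimp only
    rw [externalCycle_eq, segList_split h, ← List.cons_append, cyclicDerivWord_append_cons]
    · rw [pathWord_append, pathWord_cons, mul_assoc]
      rfl
    · rw [List.mem_cons, not_or]
      refine ⟨hα _ _, fun hm => ?_⟩
      obtain ⟨x, -, hx, hx'⟩ := mem_segList.mp hm
      rw [h] at hx'
      simp only [Option.some.injEq, Prod.mk.injEq, true_and] at hx'
      omega
    · intro hm
      obtain ⟨x, hx, -, hx'⟩ := mem_segList.mp hm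
      have := (corner_spec h).2.2.1
      rw [h] at hx'
      simp only [Option.some.injEq, Prod.mk.injEq, true_and] at hx'
      omega
  · rintro ⟨k', hk'⟩ hm
    rw [externalCycle_eq, List.mem_cons] at hm
    rcases hm with hm | hm
    · exact absurd hm (hα _ _)
    · obtain ⟨x, -, -, hx'⟩ := mem_segList.mp hm
      rw [h] at hx'
      simp only [Option.some.injEq, Prod.mk.injEq] at hx'
      exact Subtype.ext hx'.1.symm

/-- An arrow which is neither external nor at a corner lies on no external cycle. -/
theorem cyclicDeriv_no_corner {α : σ.Arrow} (h : σ.corner α = none) (hα : ∀ k h, α ≠ .ext k h) :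
    cyclicDeriv σ.quiver α (σ.potential K) =
      pathVertex K σ.quiver (σ.tgt α) * σ.compl K α
      - (open Classical in if Nonempty σ.Digon then 0 else
          cyclicDerivWord K σ.quiver α σ.puncturedCycle) := by
  rw [cyclicDeriv_potential, sum_cyclicDerivWord_eq_zero, sub_zero]
  rintro ⟨k', hk'⟩ hm
  rw [externalCycle_eq, List.mem_cons] at hm
  rcases hm with hm | hm
  · exact absurd hm (hα _ _)
  · obtain ⟨x, -, -, hx'⟩ := mem_segList.mp hm
    rw [h] at hx'
    cases hx'

/-- Cyclic derivative of the potential with respect to an arrow around the puncture. -/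
theorem cyclicDeriv_puncO (T : σ.PunctureTriangle) :
    cyclicDeriv σ.quiver (.puncO T) (σ.potential K) =
      pathVertex K σ.quiver (σ.tgt (.puncO T)) * (σ.compl K (.puncO T) -
        pathWord K σ.quiver (σ.puncList T.r 1 n)) := by
  classical
  have hn : 0 < n := NeZero.pos n
  rw [cyclicDeriv_no_corner K rfl (by simp), if_neg fun ⟨D⟩ => T.not_digon D, mul_sub]
  congr 1
  -- Rotate the cycle around the puncture, such that it starts at `T.r`.
  have h1 := finRange_rotate T.r
  have h0 : List.range' 0 n = 0 :: List.range' 1 (n - 1) := by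
    conv_lhs => rw [← Nat.sub_add_cancel hn, List.range'_succ]
  rw [h0, List.map_cons, shift_zero] at h1
  have h2 : (List.finRange n).drop T.r = T.r :: (List.finRange n).drop (T.r + 1) := by
    rw [List.drop_eq_getElem_cons (by simp)]
    simp
  rw [h2, List.cons_append] at h1
  have h1' := List.tail_eq_of_cons_eq h1
  have h3 : σ.puncturedCycle = ((List.finRange n).take T.r).filterMap σ.puncAt ++
      .puncO T :: ((List.finRange n).drop (T.r + 1)).filterMap σ.puncAt := by
    change (List.finRange n).filterMap σ.puncAt = _
    conv_lhs => rw [← List.take_append_drop T.r (List.finRange n), h2]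
    rw [List.filterMap_append, List.filterMap_cons, puncAt_r]
  have hnd := List.nodup_finRange n
  rw [← List.take_append_drop T.r (List.finRange n), h2, List.nodup_append,
    List.nodup_cons] at hnd
  have hmem : ∀ l : List (Fin n), .puncO T ∈ l.filterMap σ.puncAt → T.r ∈ l := by
    intro l hl
    obtain ⟨r, hr, hr'⟩ := List.mem_filterMap.mp hl
    obtain ⟨T', rfl, h⟩ := puncAt_eq_some.mp hr'
    rw [Arrow.puncO.inj h]
    exact hr
  rw [h3, cyclicDerivWord_append_cons, ← List.filterMap_append, h1']
  · rfl
  · intro h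
    exact hnd.2.2 _ (hmem _ h) _ List.mem_cons_self rfl
  · intro h
    exact hnd.2.1.1 (hmem _ h)

/-- The two arrows at the notched arc of a punctured digon lie on only one term of the potential. -/
theorem cyclicDeriv_alpha_beta {α : σ.Arrow} (D : σ.Digon) (hα : α = .alpha D ∨ α = .beta D) :
    cyclicDeriv σ.quiver α (σ.potential K) =
      pathVertex K σ.quiver (σ.tgt α) * σ.compl K α := by
  rw [cyclicDeriv_no_corner, if_pos ⟨D⟩, sub_zero]
  · rcases hα with rfl | rfl <;> rfl
  · rcases hα with rfl | rfl <;> simp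

/-! ### Relations in the path algebra and in the frozen Jacobian algebra -/

theorem at_side (k : Fin n) : σ.At k 1 (σ.sideVertex k) := by
  have := At.out (σ := σ) (side_mem k)
  rwa [ccw_add_one] at this

theorem at_side_sub_one (k : Fin n) : σ.At k (2 * n - 1) (σ.sideVertex (k - 1)) := by
  have hn : 2 ≤ n := Nat.AtLeastTwo.prop
  have h1 : chord (k - 1) k ∈ σ.edges := chord_mem_of_ccw_eq_one (ccw_sub_one k)
  have h2 := At.inc (σ := σ) h1
  have h3 := ccw_add_ccw (ne_of_chord_mem h1)
  rw [ccw_sub_one] at h3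
  rw [show n + ccw k (k - 1) = 2 * n - 1 by omega] at h2
  convert h2 using 1
  refine Subtype.ext ?_
  simp [sideVertex, side]

theorem At.lt_of_ne {k : Fin n} {p : ℕ} {c : σ.Vertex} (h : σ.At k p c) :
    1 ≤ p ∧ p ≤ 2 * n - 1 := by
  have := h.pos
  have := h.lt
  omega

/-- A vertex has an incident arc of the triangulation iff some edge lies between the two sides at
that vertex, which are in the positions `1` and `2 * n - 1`. -/
theorem hasArcAt_iff {k : Fin n} :
    σ.HasArcAt k ↔ ∃ q c, 1 < q ∧ q < 2 * n - 1 ∧ σ.At k q c := by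
  have hn : 2 ≤ n := Nat.AtLeastTwo.prop
  have hlast : ∀ s, chord s k ∈ σ.edges → n + ccw k s = 2 * n - 1 → s + 1 = k := by
    intro s hs h
    have := ccw_add_ccw (ne_of_chord_mem hs)
    have h1 : ccw s k = 1 := by omega
    exact (ccw_eq_one.mp h1).symm
  constructor
  · rintro ⟨a, ha, hk⟩
    have hmem : a ∈ σ.edges := mem_edges.mpr (.inr ha)
    cases a with
    | chord r s =>
      have htag := σ.isTaggedArc _ ha
      have hne : r ≠ s := htag.1.symm
      have hsum := ccw_add_ccw hne
      have h1 : ccw r s ≠ 1 := fun h => htag.2 (ccw_eq_one.mp h)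
      have h0 := ccw_pos hne
      have h0' := ccw_pos hne.symm
      rcases hk with rfl | rfl
      · exact ⟨_, _, by omega, by omega, .out hmem⟩
      · exact ⟨_, _, by omega, by omega, .inc hmem⟩
    | spoke r τ =>
      obtain rfl : r = k := hk
      by_cases hp : spoke r .plain ∈ σ.edges
      · exact ⟨_, _, by omega, by omega, .mid hp (.inl rfl)⟩
      · exact ⟨_, _, by omega, by omega, .mid hmem (.inr hp)⟩
  · rintro ⟨q, c, h1, h2, h⟩
    cases h with
    | @out s h => exact ⟨_, chord_mem_arcs h (by omega), .inl rfl⟩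
    | mid h => exact ⟨_, spoke_mem_arcs h, rfl⟩
    | @inc s h =>
      refine ⟨_, chord_mem_arcs h ?_, .inr rfl⟩
      have := ccw_add_ccw (ne_of_chord_mem h)
      omega

/-- The sides at a vertex are in the first and in the last position. -/
theorem At.eq_of_frozen {k : Fin n} {p : ℕ} {c : σ.Vertex} (h : σ.At k p c)
    (hc : c ∈ σ.quiver.frozen) : p = 1 ∨ p = 2 * n - 1 := by
  obtain ⟨j, rfl⟩ := hc
  generalize hj : σ.sideVertex j = c at h
  cases h with
  | @out s h =>
    simp only [sideVertex, side, Subtype.mk.injEq, chord.injEq] at hj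
    obtain ⟨rfl, rfl⟩ := hj
    exact .inl (ccw_add_one _)
  | mid h => simp [sideVertex, side] at hj
  | @inc s h =>
    simp only [sideVertex, side, Subtype.mk.injEq, chord.injEq] at hj
    obtain ⟨rfl, rfl⟩ := hj
    have := ccw_add_ccw (ne_of_chord_mem h)
    rw [ccw_add_one] at this
    omega

/-- The product of the internal arrows around `k` between the positions `p` and `q`. -/
def segP (σ : TaggedTriangulation n) (k : Fin n) (p q : ℕ) : σ.PA K :=
  pathWord K σ.quiver (σ.segList k p q)

/-- Multiplication by a rotation around `k` exchanges the idempotents at its ends. -/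
theorem pathVertex_mul_segP {k : Fin n} {p q : ℕ} {c c' : σ.Vertex} (h : σ.At k p c)
    (h' : σ.At k q c') (hpq : p ≤ q) :
    pathVertex K σ.quiver c * segP K σ k p q = segP K σ k p q * pathVertex K σ.quiver c' := by
  induction hd : q - p using Nat.strong_induction_on generalizing p c with
  | _ d ih =>
    rcases hpq.eq_or_lt with rfl | hlt
    · rw [h.eq h']
      simp [segP, segList]
    · have := h'.lt
      obtain ⟨α, hα, rfl⟩ := h.exists_corner (by omega)
      obtain ⟨-, h2, h3, h4⟩ := corner_spec hα
      have h5 : σ.cornerEnd α ≤ q := by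
        by_contra! h6
        exact h4 _ _ hlt h6 h'
      have e0 := ih _ (by omega) h2 h5 rfl
      have e1 : pathVertex K σ.quiver (σ.src α) * pathArrow K σ.quiver α = pathArrow K σ.quiver α :=
        pathVertex_src_mul K σ.quiver α
      have e2 : pathArrow K σ.quiver α * pathVertex K σ.quiver (σ.tgt α) = pathArrow K σ.quiver α :=
        pathArrow_mul_tgt K σ.quiver α
      have e3 : segP K σ k p q = pathArrow K σ.quiver α * segP K σ k (σ.cornerEnd α) q := by
        unfold segP
        rw [← segList_append h3.le h5, segList_corner hα]
        exact pathWord_cons K σ.quiver α _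
      rw [e3, mul_assoc, ← e0, ← mul_assoc, ← mul_assoc, e1, e2]

/-- The class of an arrow in the frozen Jacobian algebra. -/
def arr (α : σ.Arrow) : σ.Gam K :=
  σ.quiver.toJacobian (σ.potential K) (pathArrow K σ.quiver α)

/-- The class in the frozen Jacobian algebra of the rotation around `k` from position `p` to
position `q`; it does not include the idempotents at the ends. -/
def S (σ : TaggedTriangulation n) (k : Fin n) (p q : ℕ) : σ.Gam K := σ.path K (σ.segList k p q)

theorem path_nil : σ.path K [] = 1 := map_one _

theorem path_cons (α : σ.Arrow) (w : List σ.Arrow) : σ.path K (α :: w) = arr K α * σ.path K w := by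
  unfold path word arr
  rw [pathWord_cons, map_mul]

theorem path_append (w w' : List σ.Arrow) :
    σ.path K (w ++ w') = σ.path K w * σ.path K w' := by
  unfold path word
  rw [pathWord_append, map_mul]

theorem path_singleton (α : σ.Arrow) : σ.path K [α] = arr K α := by
  rw [path_cons, path_nil, mul_one]

theorem e_mul_self (v : σ.Vertex) : σ.e K v * σ.e K v = σ.e K v := idem_mul_self _ _ v

theorem e_mul_of_ne {v w : σ.Vertex} (h : v ≠ w) : σ.e K v * σ.e K w = 0 := idem_mul_of_ne _ _ h

theorem sum_e : ∑ v, σ.e K v = 1 := by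
  have := congrArg (σ.quiver.toJacobian (σ.potential K)) (sum_pathVertex K σ.quiver)
  rwa [map_sum, map_one] at this

theorem e_src_mul (α : σ.Arrow) : σ.e K (σ.src α) * arr K α = arr K α := by
  have := congrArg (σ.quiver.toJacobian (σ.potential K)) (pathVertex_src_mul K σ.quiver α)
  rwa [map_mul] at this

theorem arr_mul_e (α : σ.Arrow) : arr K α * σ.e K (σ.tgt α) = arr K α := by
  have := congrArg (σ.quiver.toJacobian (σ.potential K)) (pathArrow_mul_tgt K σ.quiver α)
  rwa [map_mul] at this

theorem e_mul_arr_of_ne {α : σ.Arrow} {v : σ.Vertex} (h : v ≠ σ.src α) :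
    σ.e K v * arr K α = 0 := by
  rw [← e_src_mul, ← mul_assoc, e_mul_of_ne K h, zero_mul]

theorem arr_mul_e_of_ne {α : σ.Arrow} {v : σ.Vertex} (h : σ.tgt α ≠ v) :
    arr K α * σ.e K v = 0 := by
  rw [← arr_mul_e, mul_assoc, e_mul_of_ne K h, mul_zero]

theorem e_mul_S {k : Fin n} {p q : ℕ} {c c' : σ.Vertex} (h : σ.At k p c)
    (h' : σ.At k q c') (hpq : p ≤ q) : σ.e K c * S K σ k p q = S K σ k p q * σ.e K c' := by
  have := congrArg (σ.quiver.toJacobian (σ.potential K)) (pathVertex_mul_segP K h h' hpq)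
  rwa [map_mul, map_mul] at this

theorem S_mul_S {k : Fin n} {p q r : ℕ} (h1 : p ≤ q) (h2 : q ≤ r) :
    S K σ k p q * S K σ k q r = S K σ k p r := by
  unfold S
  rw [← path_append, segList_append h1 h2]

theorem S_self (k : Fin n) (p : ℕ) : S K σ k p p = 1 := by
  unfold S
  simp [segList, path_nil]

theorem S_zero_one (k : Fin n) : S K σ k 0 1 = 1 := by
  unfold S
  rw [segList_eq_nil, path_nil]
  intro x _ h c hc
  have := hc.pos
  omega

theorem S_last (k : Fin n) : S K σ k (2 * n - 1) (2 * n) = 1 := by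
  unfold S
  have : σ.segList k (2 * n - 1) (2 * n) = [] := by
    rw [List.eq_nil_iff_forall_not_mem]
    intro α hα
    obtain ⟨x, h1, h2, h3⟩ := mem_segList.mp hα
    obtain ⟨-, h4, h5, -⟩ := corner_spec h3
    have := h4.lt
    omega
  rw [this, path_nil]

theorem S_corner {α : σ.Arrow} {k : Fin n} {p : ℕ} (h : σ.corner α = some (k, p)) :
    S K σ k p (σ.cornerEnd α) = arr K α := by
  unfold S
  rw [segList_corner h, path_singleton]

theorem S_mul_arr {α : σ.Arrow} {k : Fin n} {p q : ℕ} (h : σ.corner α = some (k, p))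
    (hq : q ≤ p) : S K σ k q p * arr K α = S K σ k q (σ.cornerEnd α) := by
  rw [← S_corner K h, S_mul_S K hq (corner_spec h).2.2.1.le]

theorem arr_mul_S {α : σ.Arrow} {k : Fin n} {p q : ℕ} (h : σ.corner α = some (k, p))
    (hq : σ.cornerEnd α ≤ q) : arr K α * S K σ k (σ.cornerEnd α) q = S K σ k p q := by
  rw [← S_corner K h, S_mul_S K (corner_spec h).2.2.1.le hq]

theorem e_mul_S_last {k : Fin n} {p : ℕ} {c : σ.Vertex} (h : σ.At k p c) :
    σ.e K c * S K σ k p (2 * n) = S K σ k p (2 * n) * σ.e K (σ.sideVertex (k - 1)) := by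
  have h1 := h.lt_of_ne
  rw [← S_mul_S K h1.2 (Nat.sub_le _ _), S_last, mul_one,
    e_mul_S K h (at_side_sub_one k) h1.2]

theorem e_mul_S_first {k : Fin n} {p : ℕ} {c : σ.Vertex} (h : σ.At k p c) :
    σ.e K (σ.sideVertex k) * S K σ k 0 p = S K σ k 0 p * σ.e K c := by
  have h1 := h.lt_of_ne
  rw [← S_mul_S K (Nat.zero_le 1) h1.1, S_zero_one, one_mul, e_mul_S K (at_side k) h h1.1]

theorem toJacobian_cyclicDeriv {α : σ.Arrow}
    (h : σ.src α ∉ σ.quiver.frozen ∨ σ.tgt α ∉ σ.quiver.frozen) :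
    σ.quiver.toJacobian (σ.potential K) (cyclicDeriv σ.quiver α (σ.potential K)) = 0 := by
  have : σ.quiver.toJacobian (σ.potential K) _ = σ.quiver.toJacobian (σ.potential K) _ :=
    RingQuot.mkAlgHom_rel K (s := JacobianRel σ.quiver (σ.potential K)) ⟨α, h, rfl, rfl⟩
  rwa [map_zero] at this

/-- The class of the paths parallel to the rest of the cycle through an arrow. -/
def cmp (α : σ.Arrow) : σ.Gam K := σ.quiver.toJacobian (σ.potential K) (σ.compl K α)

theorem e_tgt_mul_compl (α : σ.Arrow) :
    pathVertex K σ.quiver (σ.tgt α) * σ.compl K α = σ.compl K α := by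
  have h : ∀ (β : σ.Arrow) (v : σ.Vertex) (w : σ.PA K), v = σ.src β →
      pathVertex K σ.quiver v * (pathArrow K σ.quiver β * w) = pathArrow K σ.quiver β * w := by
    rintro β v w rfl
    rw [← mul_assoc]
    exact congrArg (· * w) (pathVertex_src_mul K σ.quiver β)
  cases α with
  | ext k h => exact mul_zero _
  | eta D => exact (mul_add _ _ _).trans (congrArg₂ (· + ·) (h _ _ _ rfl) (h _ _ _ rfl))
  | _ => exact h _ _ _ rfl

theorem e_tgt_mul_cmp (α : σ.Arrow) : σ.e K (σ.tgt α) * cmp K α = cmp K α := by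
  have := congrArg (σ.quiver.toJacobian (σ.potential K)) (e_tgt_mul_compl K α)
  rwa [map_mul] at this

theorem e_mul_outer (k : Fin n) :
    σ.e K (σ.sideVertex (k - 1)) * σ.outer K k = σ.outer K k := by
  classical
  unfold outer
  have key : ∀ (x y : σ.Arrow), σ.src x = σ.sideVertex (k - 1) →
      σ.e K (σ.sideVertex (k - 1)) * σ.path K [x, y] = σ.path K [x, y] := by
    intro x y hx
    rw [path_cons, ← mul_assoc, ← hx, e_src_mul]
  -- Without arcs at `k`, an edge ending at `k` is a side.
  have hside : ∀ r, chord r k ∈ σ.edges → ¬σ.HasArcAt k → r + 1 = k := by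
    intro r hr h
    have h2 := ccw_add_ccw (ne_of_chord_mem hr)
    have h3 := ccw_pos (ne_of_chord_mem hr)
    by_contra hne
    refine h ⟨_, chord_mem_arcs hr ?_, .inr rfl⟩
    rw [ne_eq, ccw_eq_one]
    exact Ne.symm hne
  split_ifs with h
  · rw [path_singleton]
    exact e_src_mul K (.ext k h)
  · rw [mul_add, Finset.mul_sum, Finset.mul_sum]
    congr 1
    · refine Finset.sum_congr rfl fun T _ => ?_
      split_ifs with hT
      · refine key _ _ (Subtype.ext ?_)
        subst hT
        have := hside _ T.mem_rs h
        simp only [src, sideVertex, side, ← this, add_sub_cancel_right]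
      · exact mul_zero _
    · refine Finset.sum_congr rfl fun D _ => ?_
      split_ifs with hD
      · subst hD
        have := hside _ D.mem_rs h
        have hv : (⟨chord D.r D.s, D.mem_rs⟩ : σ.Vertex) = σ.sideVertex (D.s - 1) := by
          refine Subtype.ext ?_
          simp only [sideVertex, side, ← this, add_sub_cancel_right]
        rw [mul_add, key (.alpha D) _ hv, key (.gamma D) _ hv]
      · exact mul_zero _

theorem outer_mul_e (k : Fin n) : σ.outer K k * σ.e K (σ.sideVertex k) = σ.outer K k := by
  classical
  unfold outer
  have key : ∀ (x y : σ.Arrow), σ.tgt y = σ.sideVertex k →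
      σ.path K [x, y] * σ.e K (σ.sideVertex k) = σ.path K [x, y] := by
    intro x y hx
    rw [path_cons, path_singleton, mul_assoc, ← hx, arr_mul_e]
  -- Without arcs at `k`, an edge starting at `k` is a side.
  have hside : ∀ r, chord k r ∈ σ.edges → ¬σ.HasArcAt k → r = k + 1 := by
    intro r hr h
    by_contra hne
    refine h ⟨_, chord_mem_arcs hr ?_, .inl rfl⟩
    rw [ne_eq, ccw_eq_one]
    exact hne
  split_ifs with h
  · rw [path_singleton]
    exact arr_mul_e K (.ext k h)
  · rw [add_mul, Finset.sum_mul, Finset.sum_mul]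
    congr 1
    · refine Finset.sum_congr rfl fun T _ => ?_
      split_ifs with hT
      · refine key _ _ (Subtype.ext ?_)
        subst hT
        have := hside _ T.mem_st h
        simp only [tgt, sideVertex, side, this]
      · exact zero_mul _
    · refine Finset.sum_congr rfl fun D _ => ?_
      split_ifs with hD
      · subst hD
        have := hside _ D.mem_sr h
        have hv : (⟨chord D.s D.r, D.mem_sr⟩ : σ.Vertex) = σ.sideVertex D.s := by
          refine Subtype.ext ?_
          simp only [sideVertex, side, this]
        rw [add_mul, key _ (.beta D) hv, key _ (.delta D) hv]
      · exact zero_mul _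

/-- If no arc ends at `k`, then the path which replaces the external arrow at `k` is parallel to the
only internal arrow around `k`. -/
theorem outer_eq_cmp {α : σ.Arrow} {k : Fin n} {p : ℕ} (h : σ.corner α = some (k, p))
    (hk : ¬σ.HasArcAt k) : p = 1 ∧ σ.cornerEnd α = 2 * n - 1 ∧ σ.outer K k = cmp K α := by
  classical
  have hn : 2 ≤ n := Nat.AtLeastTwo.prop
  obtain ⟨h1, h2, h3, -⟩ := corner_spec h
  have hpos : ∀ {q c}, σ.At k q c → q = 1 ∨ q = 2 * n - 1 := by
    intro q c hq
    have := hq.lt_of_ne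
    by_contra! hne
    exact hk (hasArcAt_iff.mpr ⟨q, c, by omega, by omega, hq⟩)
  have hl1 := h2.lt
  have hp : p = 1 := by
    rcases hpos h1 with h | h
    · exact h
    · omega
  have hend : σ.cornerEnd α = 2 * n - 1 := by
    rcases hpos h2 with h | h
    · omega
    · exact h
  refine ⟨hp, hend, ?_⟩
  subst hp
  unfold outer
  rw [dif_neg hk]
  -- The corner at `k` is the only one, so exactly one summand in the definition of `outer`
  -- survives.
  have hfirst : ∀ β q, σ.corner β = some (k, q) → β = α := by
    intro β q hβ
    obtain ⟨b1, b2, b3, -⟩ := corner_spec hβ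
    have := b2.lt
    rcases hpos b1 with rfl | hq
    · exact corner_inj hβ h
    · omega
  cases α with
  | ext k h => cases h
  | alpha D => cases h
  | beta D => cases h
  | puncO T => cases h
  | triR T =>
    simp only [cornerEnd] at hend
    have := ccw_lt T.r T.t
    omega
  | triT T =>
    simp only [corner, Option.some.injEq, Prod.mk.injEq] at h
    omega
  | puncR T =>
    simp only [cornerEnd] at hend
    omega
  | puncS T =>
    simp only [corner, Option.some.injEq, Prod.mk.injEq] at h
    omega
  | gamma T =>
    simp only [cornerEnd] at hend
    omega
  | delta T =>
    simp only [corner, Option.some.injEq, Prod.mk.injEq] at h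
    omega
  | triS T =>
    have hT : T.s = k := by
      simp only [corner, Option.some.injEq, Prod.mk.injEq] at h
      exact h.1
    rw [Finset.sum_eq_single T, if_pos hT, Finset.sum_eq_zero, add_zero]
    · simp only [cmp, compl, map_mul, path_cons, path_nil, mul_one]
      rfl
    · intro D _
      refine if_neg fun hD => ?_
      have := hfirst (.eta D) _ (by rw [← hD]; rfl)
      cases this
    · intro T' _ hne
      refine if_neg fun hT' => hne ?_
      have := hfirst (.triS T') _ (by rw [← hT']; rfl)
      exact Arrow.triS.inj this
    · intro h
      exact absurd (Finset.mem_univ _) h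
  | eta D =>
    have hD : D.s = k := by
      simp only [corner, Option.some.injEq, Prod.mk.injEq] at h
      exact h.1
    rw [Finset.sum_eq_zero, zero_add, Finset.sum_eq_single D, if_pos hD]
    · simp only [cmp, compl, map_mul, map_add, path_cons, path_nil, mul_one]
      rfl
    · intro D' _ hne
      exact absurd (Subsingleton.elim _ _) hne
    · intro h
      exact absurd (Finset.mem_univ _) h
    · intro T' _
      refine if_neg fun hT' => ?_
      have := hfirst (.triS T') _ (by rw [← hT']; rfl)
      cases this

/-- The Jacobian relations at the corners of the triangles, including those given by arrows between
two frozen vertices, which hold by the choice of `outer`. -/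
theorem cmp_eq {α : σ.Arrow} {k : Fin n} {p : ℕ} (h : σ.corner α = some (k, p)) :
    cmp K α = S K σ k (σ.cornerEnd α) (2 * n) * σ.outer K k * S K σ k 0 p := by
  by_cases hk : σ.HasArcAt k
  · obtain ⟨h1, h2, h3, h4⟩ := corner_spec h
    -- An edge between the two sides at `k` would lie inside the corner if both its ends were
    -- frozen; so the cyclic derivative is one of the defining relations.
    have hfr : σ.src α ∉ σ.quiver.frozen ∨ σ.tgt α ∉ σ.quiver.frozen := by
      by_contra! hno
      have a1 := h1.eq_of_frozen hno.1
      have a2 := h2.eq_of_frozen hno.2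
      have a3 := h2.lt
      obtain ⟨q, c, hq1, hq2, hq⟩ := hasArcAt_iff.mp hk
      exact h4 q c (by omega) (by omega) hq
    have hrel := toJacobian_cyclicDeriv K hfr
    rw [cyclicDeriv_corner K h hk, map_mul, map_sub, map_mul, map_mul, mul_sub, sub_eq_zero] at hrel
    have e1 := e_tgt_mul_cmp K α
    have e2 := e_mul_S_last K h2
    have e3 : σ.outer K k = arr K (.ext k hk) := by
      unfold outer
      rw [dif_pos hk, path_singleton]
    have e4 := e_mul_outer (σ := σ) K k
    rw [e3] at e4 ⊢
    rw [← e1]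
    refine Eq.trans hrel ?_
    change σ.e K (σ.tgt α) * (S K σ k (σ.cornerEnd α) (2 * n) * arr K (.ext k hk) *
      S K σ k 0 p) = _
    rw [← mul_assoc, ← mul_assoc, e2, mul_assoc (S K σ k (σ.cornerEnd α) (2 * n)), e4]
  · obtain ⟨rfl, h2, h3⟩ := outer_eq_cmp K h hk
    rw [h3, h2, S_last, S_zero_one, one_mul, mul_one]

/-- The class of the path around the puncture which passes over the vertices `k + i, …, k + j - 1`.
-/
def P (σ : TaggedTriangulation n) (k : Fin n) (i j : ℕ) : σ.Gam K := σ.path K (σ.puncList k i j)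

theorem not_frozen_spoke {k : Fin n} {τ : Tag} (h : spoke k τ ∈ σ.edges) :
    (⟨spoke k τ, h⟩ : σ.Vertex) ∉ σ.quiver.frozen := by
  rintro ⟨j, hj⟩
  simp [sideVertex, side] at hj

theorem P_mul_P {k : Fin n} {p q r : ℕ} (h1 : p ≤ q) (h2 : q ≤ r) :
    P K σ k p q * P K σ k q r = P K σ k p r := by
  unfold P
  rw [← path_append, puncList_append h1 h2]

theorem P_shift (k : Fin n) (m i j : ℕ) :
    P K σ (shift k m) i j = P K σ k (m + i) (m + j) := by
  unfold P
  rw [puncList_shift]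

theorem P_eq_one {k : Fin n} {i j : ℕ}
    (h : ∀ x, i ≤ x → x < j → ∀ τ, spoke (shift k x) τ ∉ σ.edges) : P K σ k i j = 1 := by
  unfold P
  have : σ.puncList k i j = [] := by
    rw [List.eq_nil_iff_forall_not_mem]
    intro α hα
    obtain ⟨x, h1, h2, T, h3, -⟩ := mem_puncList.mp hα
    exact h x h1 h2 _ (h3 ▸ T.mem_r)
  rw [this, path_nil]

theorem P_puncO (T : σ.PunctureTriangle) : P K σ T.r 0 (ccw T.r T.s) = arr K (.puncO T) := by
  have h0 := ccw_pos T.ne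
  rw [← P_mul_P K (Nat.zero_le 1) h0, P_eq_one K (i := 1), mul_one]
  · unfold P
    rw [puncList_succ, path_singleton]
  · intro x h1 h2 τ hτ
    have := not_spoke_crossing T.mem_rs hτ
    have h3 := ccw_lt T.r T.s
    rw [ccw_shift _ (by omega)] at this
    omega

/-- The Jacobian relation at an arrow around the puncture. -/
theorem e_mul_P_one (T : σ.PunctureTriangle) :
    σ.e K ⟨spoke T.s T.tag, T.mem_s⟩ * P K σ T.r 1 n = arr K (.puncS T) * arr K (.puncR T) := by
  have h := toJacobian_cyclicDeriv K (σ := σ) (α := .puncO T) (.inl (not_frozen_spoke _))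
  rw [cyclicDeriv_puncO, map_mul, map_sub, mul_sub, sub_eq_zero] at h
  have e1 := e_tgt_mul_cmp K (.puncO T)
  refine Eq.trans h.symm (Eq.trans e1 ?_)
  simp only [cmp, compl, map_mul]
  rfl

/-- The Jacobian relation at `α`. -/
theorem beta_mul_eta (D : σ.Digon) : arr K (.beta D) * arr K (.eta D) = 0 := by
  have h := toJacobian_cyclicDeriv K (σ := σ) (α := .alpha D) (.inr (not_frozen_spoke _))
  rw [cyclicDeriv_alpha_beta K D (.inl rfl), e_tgt_mul_compl] at h
  simp only [compl, map_mul] at h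
  exact h

/-- The Jacobian relation at `β`. -/
theorem eta_mul_alpha (D : σ.Digon) : arr K (.eta D) * arr K (.alpha D) = 0 := by
  have h := toJacobian_cyclicDeriv K (σ := σ) (α := .beta D) (.inl (not_frozen_spoke _))
  rw [cyclicDeriv_alpha_beta K D (.inr rfl), e_tgt_mul_compl] at h
  simp only [compl, map_mul] at h
  exact h

/-! ### Rotations starting and ending at sides of the polygon -/

/-- The idempotent at the side which starts at `k`. -/
abbrev eS (σ : TaggedTriangulation n) (k : Fin n) : σ.Gam K := σ.e K (σ.sideVertex k)

/-- The rotation around `k` from the side which starts at `k` to the edge in position `p`. -/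
def In (σ : TaggedTriangulation n) (k : Fin n) (p : ℕ) : σ.Gam K := eS K σ k * S K σ k 0 p

/-- The rotation around `k` from the edge in position `p` to the side which ends at `k`. -/
def Out (σ : TaggedTriangulation n) (k : Fin n) (p : ℕ) : σ.Gam K :=
  S K σ k p (2 * n) * eS K σ (k - 1)

/-- The full rotation around `k`, from the side which starts at `k` to the side which ends at
`k`. -/
def y (σ : TaggedTriangulation n) (k : Fin n) : σ.Gam K := eS K σ k * S K σ k 0 (2 * n)

/-- The path of length `m` along the boundary which starts at the side from `i` to `i + 1`. -/
def xs (σ : TaggedTriangulation n) (i : Fin n) : ℕ → σ.Gam K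
  | 0 => eS K σ i
  | m + 1 => xs σ i m * σ.outer K (shift i (m + 1))

theorem eS_mul_In (k : Fin n) (p : ℕ) : eS K σ k * In K σ k p = In K σ k p := by
  unfold In
  rw [← mul_assoc, e_mul_self]

theorem Out_mul_eS (k : Fin n) (p : ℕ) : Out K σ k p * eS K σ (k - 1) = Out K σ k p := by
  unfold Out
  rw [mul_assoc, e_mul_self]

theorem In_mul_e {k : Fin n} {p : ℕ} {c : σ.Vertex} (h : σ.At k p c) :
    In K σ k p * σ.e K c = In K σ k p := by
  unfold In
  rw [e_mul_S_first K h, mul_assoc, e_mul_self]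

theorem e_mul_Out {k : Fin n} {p : ℕ} {c : σ.Vertex} (h : σ.At k p c) :
    σ.e K c * Out K σ k p = Out K σ k p := by
  unfold Out
  rw [← e_mul_S_last K h, ← mul_assoc, e_mul_self]

theorem In_mul_Out {k : Fin n} {p : ℕ} {c : σ.Vertex} (h : σ.At k p c) :
    In K σ k p * Out K σ k p = y K σ k := by
  have := h.lt
  have hk := at_side (σ := σ) k
  unfold In Out y
  have h1 := e_mul_S_last K hk
  rw [mul_assoc, ← mul_assoc (S K σ k 0 p), S_mul_S K (Nat.zero_le _) this.le, ← mul_assoc,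
    ← S_mul_S K (Nat.zero_le 1) (by omega : 1 ≤ 2 * n), S_zero_one, one_mul, h1, mul_assoc,
    e_mul_self]

theorem In_mul_arr {α : σ.Arrow} {k : Fin n} {p : ℕ} (h : σ.corner α = some (k, p)) :
    In K σ k p * arr K α = In K σ k (σ.cornerEnd α) := by
  unfold In
  rw [mul_assoc, S_mul_arr K h (Nat.zero_le _)]

theorem arr_mul_Out {α : σ.Arrow} {k : Fin n} {p : ℕ} (h : σ.corner α = some (k, p)) :
    arr K α * Out K σ k (σ.cornerEnd α) = Out K σ k p := by
  unfold Out
  rw [← mul_assoc, arr_mul_S K h (corner_spec h).2.1.lt.le]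

theorem In_one (k : Fin n) : In K σ k 1 = eS K σ k := by
  unfold In
  rw [S_zero_one, mul_one]

theorem Out_last (k : Fin n) : Out K σ k (2 * n - 1) = eS K σ (k - 1) := by
  unfold Out
  rw [S_last, one_mul]

theorem In_last (k : Fin n) : In K σ k (2 * n - 1) = y K σ k := by
  unfold In y
  rw [← S_mul_S K (Nat.zero_le (2 * n - 1)) (Nat.sub_le _ _), S_last, mul_one]

theorem Out_one (k : Fin n) : Out K σ k 1 = y K σ k := by
  rw [← In_mul_Out K (at_side k), In_one, e_mul_Out K (at_side k)]

theorem eS_mul_y (k : Fin n) : eS K σ k * y K σ k = y K σ k := by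
  rw [← In_last, eS_mul_In]

theorem y_mul_eS (k : Fin n) : y K σ k * eS K σ (k - 1) = y K σ k := by
  rw [← Out_one, Out_mul_eS]

/-- The Jacobian relation at a corner: the other two arrows of the triangle agree with the rest of
the external cycle, namely rotating out of the polygon, along the boundary, and back in. -/
theorem cmp_eq' {α : σ.Arrow} {k : Fin n} {p : ℕ} (h : σ.corner α = some (k, p)) :
    cmp K α = Out K σ k (σ.cornerEnd α) * σ.outer K k * In K σ k p := by
  rw [cmp_eq K h]
  unfold In Out
  rw [mul_assoc (S K σ k _ _) (eS K σ (k - 1)), e_mul_outer, ← mul_assoc, mul_assoc (S K σ k _ _)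
    (σ.outer K k) (eS K σ k), outer_mul_e]

/-! #### The boundary paths -/

theorem eS_mul_xs (i : Fin n) (m : ℕ) : eS K σ i * xs K σ i m = xs K σ i m := by
  induction m with
  | zero => exact e_mul_self K _
  | succ m ih => rw [xs, ← mul_assoc, ih]

theorem xs_mul_eS (i : Fin n) (m : ℕ) : xs K σ i m * eS K σ (shift i m) = xs K σ i m := by
  cases m with
  | zero => rw [shift_zero]; exact e_mul_self K _
  | succ m => rw [xs, mul_assoc, outer_mul_e]

theorem xs_mul_xs {i j : Fin n} {m : ℕ} (h : shift i m = j) (m' : ℕ) :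
    xs K σ i m * xs K σ j m' = xs K σ i (m + m') := by
  subst h
  induction m' with
  | zero => exact xs_mul_eS K i m
  | succ m' ih => rw [xs, ← mul_assoc, ih, shift_shift, ← add_assoc]; rfl

theorem xs_sub_one (i : Fin n) : xs K σ (i - 1) 1 = σ.outer K i := by
  have : shift (i - 1) 1 = i := by rw [shift_one, sub_add_cancel]
  rw [xs, zero_add, this]
  exact e_mul_outer K i

theorem xs_mul_outer {i j : Fin n} {m : ℕ} (h : shift i (m + 1) = j) :
    xs K σ i m * σ.outer K j = xs K σ i (m + 1) := by
  rw [xs, h]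

theorem outer_mul_xs (i : Fin n) (m : ℕ) :
    σ.outer K i * xs K σ i m = xs K σ (i - 1) (1 + m) := by
  rw [← xs_sub_one, xs_mul_xs K (by rw [shift_one, sub_add_cancel])]

theorem shift_eq {r t : Fin n} {m : ℕ} (h : ccw r t = m) : shift r m = t := by
  rw [← h, shift_ccw]

theorem shift_sub_one (i : Fin n) (m : ℕ) : shift (i - 1) (m + 1) = shift i m := by
  rw [shift_succ', sub_add_cancel]

theorem shift_n_add (i : Fin n) (m : ℕ) : shift i (n + m) = shift i m := by
  rw [← shift_shift, shift_n]

/-! #### The rotations and the Jacobian relations for the individual arrows -/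

theorem In_triR (T : σ.Triangle) :
    In K σ T.r (ccw T.r T.s) * arr K (.triR T) = In K σ T.r (ccw T.r T.t) :=
  In_mul_arr K (α := .triR T) rfl

theorem In_triS (T : σ.Triangle) :
    In K σ T.s (ccw T.s T.t) * arr K (.triS T) = In K σ T.s (n + ccw T.s T.r) :=
  In_mul_arr K (α := .triS T) rfl

theorem In_triT (T : σ.Triangle) :
    In K σ T.t (n + ccw T.t T.r) * arr K (.triT T) = In K σ T.t (n + ccw T.t T.s) :=
  In_mul_arr K (α := .triT T) rfl

theorem In_puncR (T : σ.PunctureTriangle) :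
    In K σ T.r (ccw T.r T.s) * arr K (.puncR T) = In K σ T.r n :=
  In_mul_arr K (α := .puncR T) rfl

theorem In_puncS (T : σ.PunctureTriangle) :
    In K σ T.s n * arr K (.puncS T) = In K σ T.s (n + ccw T.s T.r) :=
  In_mul_arr K (α := .puncS T) rfl

theorem In_eta (D : σ.Digon) :
    In K σ D.s (ccw D.s D.r) * arr K (.eta D) = In K σ D.s (n + ccw D.s D.r) :=
  In_mul_arr K (α := .eta D) rfl

theorem In_gamma (D : σ.Digon) :
    In K σ D.r (ccw D.r D.s) * arr K (.gamma D) = In K σ D.r n :=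
  In_mul_arr K (α := .gamma D) rfl

theorem In_delta (D : σ.Digon) :
    In K σ D.r n * arr K (.delta D) = In K σ D.r (n + ccw D.r D.s) :=
  In_mul_arr K (α := .delta D) rfl

theorem triR_Out (T : σ.Triangle) :
    arr K (.triR T) * Out K σ T.r (ccw T.r T.t) = Out K σ T.r (ccw T.r T.s) :=
  arr_mul_Out K (α := .triR T) rfl

theorem triS_Out (T : σ.Triangle) :
    arr K (.triS T) * Out K σ T.s (n + ccw T.s T.r) = Out K σ T.s (ccw T.s T.t) :=
  arr_mul_Out K (α := .triS T) rfl

theorem triT_Out (T : σ.Triangle) :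
    arr K (.triT T) * Out K σ T.t (n + ccw T.t T.s) = Out K σ T.t (n + ccw T.t T.r) :=
  arr_mul_Out K (α := .triT T) rfl

theorem puncR_Out (T : σ.PunctureTriangle) :
    arr K (.puncR T) * Out K σ T.r n = Out K σ T.r (ccw T.r T.s) :=
  arr_mul_Out K (α := .puncR T) rfl

theorem puncS_Out (T : σ.PunctureTriangle) :
    arr K (.puncS T) * Out K σ T.s (n + ccw T.s T.r) = Out K σ T.s n :=
  arr_mul_Out K (α := .puncS T) rfl

theorem eta_Out (D : σ.Digon) :
    arr K (.eta D) * Out K σ D.s (n + ccw D.s D.r) = Out K σ D.s (ccw D.s D.r) :=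
  arr_mul_Out K (α := .eta D) rfl

theorem gamma_Out (D : σ.Digon) :
    arr K (.gamma D) * Out K σ D.r n = Out K σ D.r (ccw D.r D.s) :=
  arr_mul_Out K (α := .gamma D) rfl

theorem delta_Out (D : σ.Digon) :
    arr K (.delta D) * Out K σ D.r (n + ccw D.r D.s) = Out K σ D.r n :=
  arr_mul_Out K (α := .delta D) rfl

theorem cmp_triR (T : σ.Triangle) : arr K (.triT T) * arr K (.triS T) =
    Out K σ T.r (ccw T.r T.t) * σ.outer K T.r * In K σ T.r (ccw T.r T.s) :=
  (map_mul _ _ _).symm.trans (cmp_eq' K (α := .triR T) rfl)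

theorem cmp_triS (T : σ.Triangle) : arr K (.triR T) * arr K (.triT T) =
    Out K σ T.s (n + ccw T.s T.r) * σ.outer K T.s * In K σ T.s (ccw T.s T.t) :=
  (map_mul _ _ _).symm.trans (cmp_eq' K (α := .triS T) rfl)

theorem cmp_triT (T : σ.Triangle) : arr K (.triS T) * arr K (.triR T) =
    Out K σ T.t (n + ccw T.t T.s) * σ.outer K T.t * In K σ T.t (n + ccw T.t T.r) :=
  (map_mul _ _ _).symm.trans (cmp_eq' K (α := .triT T) rfl)

theorem cmp_puncR (T : σ.PunctureTriangle) : arr K (.puncO T) * arr K (.puncS T) =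
    Out K σ T.r n * σ.outer K T.r * In K σ T.r (ccw T.r T.s) :=
  (map_mul _ _ _).symm.trans (cmp_eq' K (α := .puncR T) rfl)

theorem cmp_puncS (T : σ.PunctureTriangle) : arr K (.puncR T) * arr K (.puncO T) =
    Out K σ T.s (n + ccw T.s T.r) * σ.outer K T.s * In K σ T.s n :=
  (map_mul _ _ _).symm.trans (cmp_eq' K (α := .puncS T) rfl)

theorem cmp_gamma (D : σ.Digon) : arr K (.delta D) * arr K (.eta D) =
    Out K σ D.r n * σ.outer K D.r * In K σ D.r (ccw D.r D.s) :=
  (map_mul _ _ _).symm.trans (cmp_eq' K (α := .gamma D) rfl)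

theorem cmp_delta (D : σ.Digon) : arr K (.eta D) * arr K (.gamma D) =
    Out K σ D.r (n + ccw D.r D.s) * σ.outer K D.r * In K σ D.r n :=
  (map_mul _ _ _).symm.trans (cmp_eq' K (α := .delta D) rfl)

theorem cmp_eta (D : σ.Digon) :
    arr K (.alpha D) * arr K (.beta D) + arr K (.gamma D) * arr K (.delta D) =
    Out K σ D.s (n + ccw D.s D.r) * σ.outer K D.s * In K σ D.s (ccw D.s D.r) := by
  refine Eq.trans ?_ (cmp_eq' K (α := .eta D) rfl)
  simp only [cmp, compl, map_add, map_mul]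
  rfl

/-! ### Sweeping across the two sides of a chord -/

/-- Below a chord: rotating into it around its start and out of it around its end is the path along
the boundary. -/
theorem In_mul_Out_below {r t : Fin n} (h : chord r t ∈ σ.edges) :
    In K σ r (ccw r t) * Out K σ t (n + ccw t r) = xs K σ r (ccw r t - 1) := by
  induction hd : ccw r t using Nat.strong_induction_on generalizing r t with
  | _ d ih =>
    have h0 := ccw_pos (ne_of_chord_mem h)
    have hsum := ccw_add_ccw (ne_of_chord_mem h)
    rcases (show 1 ≤ ccw r t from h0).eq_or_lt with h1 | h1
    · rw [← hd, ← h1, show n + ccw t r = 2 * n - 1 by omega, In_one, Out_last,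
        ccw_eq_one.mp h1.symm, add_sub_cancel_right]
      exact e_mul_self K _
    · obtain ⟨s, hs0, hst, hrs, hs, -⟩ := exists_below h h1
      let T : σ.Triangle := ⟨r, s, t, hs0, hst, hrs, hs, h⟩
      have a1 := ccw_rel r s t
      have i1 := ih _ (by omega) hrs rfl
      have i2 := ih _ (by omega) hs rfl
      have e1 : In K σ r (ccw r s) * arr K (.triR T) = In K σ r (ccw r t) := In_triR K T
      have e2 : arr K (.triT T) * Out K σ t (n + ccw t s) = Out K σ t (n + ccw t r) :=
        triT_Out K T
      have e3 : arr K (.triR T) * arr K (.triT T) =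
        Out K σ s (n + ccw s r) * σ.outer K s * In K σ s (ccw s t) := cmp_triS K T
      -- The relation at the corner of `s` splits the sweep below `(r, t)` into those below `(r, s)`
      -- and `(s, t)`.
      calc In K σ r d * Out K σ t (n + ccw t r)
          = In K σ r (ccw r s) * (arr K (.triR T) * arr K (.triT T)) *
              Out K σ t (n + ccw t s) := by rw [← hd, ← e1, ← e2]; simp only [mul_assoc]
        _ = (In K σ r (ccw r s) * Out K σ s (n + ccw s r)) * σ.outer K s *
              (In K σ s (ccw s t) * Out K σ t (n + ccw t s)) := by rw [e3]; simp only [mul_assoc]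
        _ = _ := by
          rw [i1, i2, xs_mul_outer K (shift_eq (by omega)), xs_mul_xs K (shift_eq (by omega))]
          congr 1
          have := ccw_pos (ne_of_chord_mem hs)
          omega

theorem In_mul_Out_outer {r t : Fin n} (h : chord r t ∈ σ.edges) (z : σ.Gam K) :
    In K σ r (ccw r t) * (Out K σ t (n + ccw t r) * σ.outer K t * z) = xs K σ r (ccw r t) * z := by
  have h0 := ccw_pos (ne_of_chord_mem h)
  rw [← mul_assoc, ← mul_assoc, In_mul_Out_below K h, xs_mul_outer K (shift_eq (by omega)),
    Nat.sub_add_cancel h0]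

theorem outer_In_mul_Out {r t : Fin n} (h : chord r t ∈ σ.edges) (z : σ.Gam K) :
    z * σ.outer K r * In K σ r (ccw r t) * Out K σ t (n + ccw t r) =
      z * xs K σ (r - 1) (ccw r t) := by
  have h0 := ccw_pos (ne_of_chord_mem h)
  rw [mul_assoc, In_mul_Out_below K h, mul_assoc, outer_mul_xs, Nat.add_sub_cancel' h0]

/-- The external cycle around `k`, starting at the edge in position `p`. -/
def Cat (σ : TaggedTriangulation n) (k : Fin n) (p : ℕ) : σ.Gam K :=
  Out K σ k p * σ.outer K k * In K σ k p

/-- The external cycles around the two ends of a chord agree. -/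
theorem Cat_eq {r t : Fin n} (h : chord r t ∈ σ.edges) :
    Cat K σ r (ccw r t) = Cat K σ t (n + ccw t r) := by
  unfold Cat
  -- In every case the two corners at the ends of the chord lie in the same piece of `σ`, and the
  -- two external cycles are both equal to the cycle around that piece.
  rcases exists_beyond h with ⟨q, hq, hrq, htq⟩ | ⟨q, h1, h2, hqr, hqt⟩ | ⟨τ, hr, ht⟩ |
    ⟨h1, hr | ht⟩
  · let T : σ.Triangle := ⟨r, t, q, ccw_pos (ne_of_chord_mem h), hq, h, htq, hrq⟩
    have e1 : arr K (.triR T) * Out K σ r (ccw r q) = Out K σ r (ccw r t) := triR_Out K T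
    have e2 : In K σ t (ccw t q) * arr K (.triS T) = In K σ t (n + ccw t r) := In_triS K T
    have e3 := cmp_triR K T
    have e4 := cmp_triS K T
    rw [← e1, ← e2, mul_assoc, mul_assoc, ← mul_assoc _ (σ.outer K r)]
    refine Eq.trans (congrArg (arr K (.triR T) * ·) e3.symm) ?_
    rw [← mul_assoc, e4]
    simp only [mul_assoc]
    rfl
  · let T : σ.Triangle := ⟨q, r, t, h1, h2, hqr, h, hqt⟩
    have e1 : arr K (.triS T) * Out K σ r (n + ccw r q) = Out K σ r (ccw r t) := triS_Out K T
    have e2 : In K σ t (n + ccw t q) * arr K (.triT T) = In K σ t (n + ccw t r) := In_triT K T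
    have e3 := cmp_triS K T
    have e4 := cmp_triT K T
    rw [← e1, ← e2, mul_assoc, mul_assoc, ← mul_assoc _ (σ.outer K r)]
    refine Eq.trans (congrArg (arr K (.triS T) * ·) e3.symm) ?_
    rw [← mul_assoc, e4]
    simp only [mul_assoc]
    rfl
  · let T : σ.PunctureTriangle := ⟨τ, r, t, ne_of_chord_mem h, h, hr, ht⟩
    have e1 : arr K (.puncR T) * Out K σ r n = Out K σ r (ccw r t) := puncR_Out K T
    have e2 : In K σ t n * arr K (.puncS T) = In K σ t (n + ccw t r) := In_puncS K T
    have e3 := cmp_puncR K T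
    have e4 := cmp_puncS K T
    rw [← e1, ← e2, mul_assoc, mul_assoc, ← mul_assoc _ (σ.outer K r)]
    refine Eq.trans (congrArg (arr K (.puncR T) * ·) e3.symm) ?_
    rw [← mul_assoc, e4]
    simp only [mul_assoc]
    rfl
  -- In a punctured digon, the path through the notched arc is killed by the relations at `α` and
  -- `β`.
  · let D : σ.Digon := ⟨r, t, ne_of_chord_mem h, h, h1, hr _, hr _⟩
    have e1 : arr K (.gamma D) * Out K σ r n = Out K σ r (ccw r t) := gamma_Out K D
    have e2 : In K σ t (ccw t r) * arr K (.eta D) = In K σ t (n + ccw t r) := In_eta K D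
    have e3 := cmp_gamma K D
    have e4 : _ = Out K σ t (n + ccw t r) * σ.outer K t * In K σ t (ccw t r) := cmp_eta K D
    rw [← e1, ← e2, mul_assoc, mul_assoc, ← mul_assoc _ (σ.outer K r)]
    refine Eq.trans (congrArg (arr K (.gamma D) * ·) e3.symm) ?_
    rw [← mul_assoc (Out K σ t _ * _), ← e4, add_mul, mul_assoc (arr K (.alpha D)), beta_mul_eta,
      mul_zero, zero_add, mul_assoc]
  · let D : σ.Digon := ⟨t, r, ne_of_chord_mem h1, h1, h, ht _, ht _⟩
    have e1 : arr K (.eta D) * Out K σ r (n + ccw r t) = Out K σ r (ccw r t) := eta_Out K D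
    have e2 : In K σ t n * arr K (.delta D) = In K σ t (n + ccw t r) := In_delta K D
    have e3 : arr K (.eta D) * arr K (.gamma D) =
      Out K σ t (n + ccw t r) * σ.outer K t * In K σ t n := cmp_delta K D
    have e4 : _ = Out K σ r (n + ccw r t) * σ.outer K r * In K σ r (ccw r t) := cmp_eta K D
    rw [← e1, ← e2, ← mul_assoc (Out K σ t _ * _), ← e3, mul_assoc, mul_assoc,
      ← mul_assoc _ (σ.outer K r), ← e4, mul_add, ← mul_assoc, eta_mul_alpha, zero_mul, zero_add,
      mul_assoc]

/-- Full rotations commute with steps along the boundary: the case of a side of the equality of the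
external cycles. -/
theorem y_mul_outer (k : Fin n) :
    y K σ k * σ.outer K k = σ.outer K (k + 1) * y K σ (k + 1) := by
  have h := Cat_eq K (σ := σ) (side_mem k)
  have h2 := ccw_add_ccw (ne_of_chord_mem (σ := σ) (side_mem k))
  rw [ccw_add_one] at h h2
  rw [show n + ccw (k + 1) k = 2 * n - 1 by omega] at h
  unfold Cat at h
  rw [Out_one, In_one, Out_last, In_last, mul_assoc, outer_mul_e, e_mul_outer] at h
  exact h

theorem y_mul_xs (q : Fin n) (m : ℕ) :
    y K σ q * xs K σ (q - 1) m = xs K σ q m * y K σ (shift q m) := by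
  induction m with
  | zero => rw [shift_zero, xs, xs, y_mul_eS, eS_mul_y]
  | succ m ih =>
    rw [xs, ← mul_assoc, ih, shift_sub_one, mul_assoc, y_mul_outer, ← mul_assoc, xs, shift_succ]

/-- The rotation around the puncture between two arcs incident to it, seen from the sides. -/
theorem In_mul_puncO (T : σ.PunctureTriangle) :
    In K σ T.r n * arr K (.puncO T) = xs K σ T.r (ccw T.r T.s) * In K σ T.s n := by
  rw [← In_puncR, mul_assoc, cmp_puncS, In_mul_Out_outer K T.mem_rs]

/-- The dual of `In_mul_puncO`. -/
theorem puncO_mul_Out (T : σ.PunctureTriangle) :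
    arr K (.puncO T) * Out K σ T.s n = Out K σ T.r n * xs K σ (T.r - 1) (ccw T.r T.s) := by
  rw [← puncS_Out, ← mul_assoc, cmp_puncR, outer_In_mul_Out K T.mem_rs]

/-- Each triangle at the puncture is followed by another one around the puncture. -/
theorem PunctureTriangle.exists_next (T : σ.PunctureTriangle) :
    ∃ T' : σ.PunctureTriangle, T'.r = T.s := by
  have h : ∃ τ, spoke T.s τ ∉ σ.edges := by
    by_contra! h
    obtain ⟨D, -⟩ := exists_digon h
    exact T.not_digon D
  obtain ⟨τ, hτ⟩ := h
  obtain ⟨s, h1, h2, h3⟩ := exists_next_spoke T.mem_s hτ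
  exact ⟨⟨T.tag, T.s, s, h1, h3, T.mem_s, h2⟩, rfl⟩

theorem ccw_le_of_r_eq (T : σ.PunctureTriangle) {m : ℕ} (hm : 0 < m)
    {T' : σ.PunctureTriangle} (h : T'.r = shift T.r m) : ccw T.r T.s ≤ m := by
  by_contra! hlt
  have h1 := not_spoke_crossing T.mem_rs T'.mem_r
  have h2 := ccw_lt T.r T.s
  rw [h, ccw_shift _ (by omega)] at h1
  omega

/-- Rotating to an arc and walking around the puncture is the same as walking along the boundary and
then rotating to the last arc. -/
theorem In_mul_P (T : σ.PunctureTriangle) (m : ℕ) {T' : σ.PunctureTriangle}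
    (h : T'.r = shift T.r m) :
    In K σ T.r n * P K σ T.r 0 m = xs K σ T.r m * In K σ (shift T.r m) n := by
  induction m using Nat.strong_induction_on generalizing T with
  | _ m ih =>
    rcases Nat.eq_zero_or_pos m with rfl | hm
    · rw [P_eq_one K (fun x h1 h2 => absurd h2 (by omega)), mul_one, shift_zero]
      exact (eS_mul_In K _ _).symm
    · have h1 := ccw_le_of_r_eq T hm h
      have h0 := ccw_pos T.ne
      obtain ⟨T'', hT''⟩ := T.exists_next
      have hs : shift T.r (ccw T.r T.s) = T''.r := by rw [shift_ccw, hT'']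
      have h2 : shift T''.r (m - ccw T.r T.s) = shift T.r m := by
        rw [← hs, shift_shift, Nat.add_sub_cancel' h1]
      have h3 := ih (m - ccw T.r T.s) (by omega) T'' (by rw [h2, h])
      rw [← P_mul_P K (Nat.zero_le _) h1, P_puncO, ← mul_assoc, In_mul_puncO,
        mul_assoc, show In K σ T.s n = In K σ T''.r n by rw [hT'']]
      have h4 : P K σ T.r (ccw T.r T.s) m = P K σ T''.r 0 (m - ccw T.r T.s) := by
        rw [← hs, P_shift, add_zero, Nat.add_sub_cancel' h1]
      rw [h4, h3, ← mul_assoc, xs_mul_xs K hs, Nat.add_sub_cancel' h1, h2]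

/-- The dual of `In_mul_P`. -/
theorem P_mul_Out (T : σ.PunctureTriangle) (m : ℕ) {T' : σ.PunctureTriangle}
    (h : T'.r = shift T.r m) :
    P K σ T.r 0 m * Out K σ (shift T.r m) n = Out K σ T.r n * xs K σ (T.r - 1) m := by
  induction m using Nat.strong_induction_on generalizing T with
  | _ m ih =>
    rcases Nat.eq_zero_or_pos m with rfl | hm
    · rw [P_eq_one K (fun x h1 h2 => absurd h2 (by omega)), one_mul, shift_zero]
      exact (Out_mul_eS K _ _).symm
    · have h1 := ccw_le_of_r_eq T hm h
      have h0 := ccw_pos T.ne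
      obtain ⟨T'', hT''⟩ := T.exists_next
      have hs : shift T.r (ccw T.r T.s) = T''.r := by rw [shift_ccw, hT'']
      have h2 : shift T''.r (m - ccw T.r T.s) = shift T.r m := by
        rw [← hs, shift_shift, Nat.add_sub_cancel' h1]
      have h3 := ih (m - ccw T.r T.s) (by omega) T'' (by rw [h2, h])
      have h4 : P K σ T.r (ccw T.r T.s) m = P K σ T''.r 0 (m - ccw T.r T.s) := by
        rw [← hs, P_shift, add_zero, Nat.add_sub_cancel' h1]
      have h5 : shift (T.r - 1) (ccw T.r T.s) = T''.r - 1 := by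
        rw [← hs, eq_sub_iff_add_eq, ← shift_succ, shift_sub_one]
      have h6 := puncO_mul_Out K T
      rw [← hT''] at h6
      rw [← P_mul_P K (Nat.zero_le _) h1, P_puncO, mul_assoc, h4, ← h2, h3, ← mul_assoc,
        h6, mul_assoc, hT'', ← hT'', xs_mul_xs K (by rw [← h5, hT'']),
        Nat.add_sub_cancel' (hT'' ▸ h1)]

/-- The Jacobian relation at an arrow around the puncture, as an equality with the way around it
from `T.s` to `T.r`. -/
theorem puncS_mul_puncR (T : σ.PunctureTriangle) :
    arr K (.puncS T) * arr K (.puncR T) =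
      σ.e K ⟨spoke T.s T.tag, T.mem_s⟩ * P K σ T.s 0 (ccw T.s T.r) := by
  have h0 := ccw_pos T.ne
  have h1 := ccw_add_ccw T.ne
  have h2 : P K σ T.r (ccw T.r T.s) n = P K σ T.s 0 (ccw T.s T.r) := by
    conv_rhs => rw [← shift_ccw T.r T.s, P_shift, shift_ccw, add_zero, h1]
  rw [← e_mul_P_one, ← P_mul_P K (k := T.r) (p := 1) h0 (by omega : ccw T.r T.s ≤ n), h2,
    P_eq_one K (i := 1), one_mul]
  intro x hx1 hx2 τ hτ
  have := not_spoke_crossing T.mem_rs hτ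
  rw [ccw_shift _ (by omega)] at this
  omega

theorem In_mul_puncS_puncR (T : σ.PunctureTriangle) :
    In K σ T.s n * (arr K (.puncS T) * arr K (.puncR T)) =
      xs K σ T.s (ccw T.s T.r) * In K σ T.r n := by
  obtain ⟨T', hT'⟩ := T.exists_next
  have h : T.r = shift T'.r (ccw T.s T.r) := by rw [hT', shift_ccw]
  have := In_mul_P K T' _ h
  rw [← h, hT'] at this
  rw [puncS_mul_puncR, ← mul_assoc, In_mul_e K T.at_s, this]

theorem puncS_puncR_mul_Out (T : σ.PunctureTriangle) :
    arr K (.puncS T) * arr K (.puncR T) * Out K σ T.r n =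
      Out K σ T.s n * xs K σ (T.s - 1) (ccw T.s T.r) := by
  obtain ⟨T', hT'⟩ := T.exists_next
  have h : T.r = shift T'.r (ccw T.s T.r) := by rw [hT', shift_ccw]
  have := P_mul_Out K T' _ h
  rw [← h, hT'] at this
  rw [puncS_mul_puncR, mul_assoc, this, ← mul_assoc, e_mul_Out K T.at_s]

/-- Beyond a chord: rotating into it around its end and out of it around its start is, up to a full
rotation, the path along the boundary. -/
theorem In_mul_Out_beyond {r t : Fin n} (h : chord r t ∈ σ.edges) :
    In K σ t (n + ccw t r) * Out K σ r (ccw r t) = xs K σ t (ccw t r) * y K σ r := by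
  induction hd : ccw t r using Nat.strong_induction_on generalizing r t with
  | _ d ih =>
    have h0 := ccw_pos (ne_of_chord_mem h)
    have hsum := ccw_add_ccw (ne_of_chord_mem h)
    rw [← hd]
    -- The two arrows around the chord inside the piece beyond it are replaced, by the relation at
    -- the remaining corner, by a way outside; what is left is the sweep below or beyond another
    -- chord, or a full rotation.
    rcases exists_beyond h with ⟨q, hq, hrq, htq⟩ | ⟨q, h1, h2, hqr, hqt⟩ | ⟨τ, hr, ht⟩ |
      ⟨h1, hr | ht⟩
    · let T : σ.Triangle := ⟨r, t, q, h0, hq, h, htq, hrq⟩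
      have a1 := ccw_rel r t q
      have a2 := ccw_add_ccw (ne_of_chord_mem hrq)
      have a3 := ccw_pos (ne_of_chord_mem htq)
      have e1 : arr K (.triR T) * Out K σ r (ccw r q) = Out K σ r (ccw r t) := triR_Out K T
      have e2 : In K σ t (ccw t q) * arr K (.triS T) = In K σ t (n + ccw t r) := In_triS K T
      have e3 : arr K (.triS T) * arr K (.triR T) = _ := cmp_triT K T
      rw [← e1, ← e2, mul_assoc, ← mul_assoc (arr K _), e3, mul_assoc (_ * _),
        ih _ (by omega) hrq rfl, In_mul_Out_outer K htq, ← mul_assoc, xs_mul_xs K (shift_ccw _ _)]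
      congr 2
      omega
    · let T : σ.Triangle := ⟨q, r, t, h1, h2, hqr, h, hqt⟩
      have a1 := ccw_rel q r t
      have a2 := ccw_add_ccw (ne_of_chord_mem hqt)
      have a3 := ccw_add_ccw (ne_of_chord_mem hqr)
      have e1 : arr K (.triS T) * Out K σ r (n + ccw r q) = Out K σ r (ccw r t) := triS_Out K T
      have e2 : In K σ t (n + ccw t q) * arr K (.triT T) = In K σ t (n + ccw t r) := In_triT K T
      have e3 : arr K (.triT T) * arr K (.triS T) = _ := cmp_triR K T
      rw [← e1, ← e2, mul_assoc, ← mul_assoc (arr K _), e3, outer_In_mul_Out K hqr, ← mul_assoc,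
        ih _ (by omega) hqt rfl, mul_assoc, y_mul_xs, shift_ccw, ← mul_assoc,
        xs_mul_xs K (shift_ccw _ _)]
      congr 2
      omega
    · let T : σ.PunctureTriangle := ⟨τ, r, t, ne_of_chord_mem h, h, hr, ht⟩
      have e1 : arr K (.puncR T) * Out K σ r n = Out K σ r (ccw r t) := puncR_Out K T
      have e2 : In K σ t n * arr K (.puncS T) = In K σ t (n + ccw t r) := In_puncS K T
      have e3 : In K σ t n * (arr K (.puncS T) * arr K (.puncR T)) = _ := In_mul_puncS_puncR K T
      rw [← e1, ← e2, mul_assoc, ← mul_assoc (arr K _), ← mul_assoc, e3, mul_assoc,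
        In_mul_Out K T.at_r]
    · let D : σ.Digon := ⟨r, t, ne_of_chord_mem h, h, h1, hr _, hr _⟩
      have e1 : arr K (.gamma D) * Out K σ r n = Out K σ r (ccw r t) := gamma_Out K D
      have e2 : In K σ t (ccw t r) * arr K (.eta D) = In K σ t (n + ccw t r) := In_eta K D
      have e3 : arr K (.eta D) * arr K (.gamma D) = _ := cmp_delta K D
      rw [← e1, ← e2, mul_assoc, ← mul_assoc (arr K _), e3, mul_assoc (_ * _),
        In_mul_Out K (.mid (hr .plain) (.inl rfl)), In_mul_Out_outer K h1]
    · let D : σ.Digon := ⟨t, r, ne_of_chord_mem h1, h1, h, ht _, ht _⟩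
      have e1 : arr K (.eta D) * Out K σ r (n + ccw r t) = Out K σ r (ccw r t) := eta_Out K D
      have e2 : In K σ t n * arr K (.delta D) = In K σ t (n + ccw t r) := In_delta K D
      have e3 : arr K (.delta D) * arr K (.eta D) = _ := cmp_gamma K D
      rw [← e1, ← e2, mul_assoc, ← mul_assoc (arr K _), e3, outer_In_mul_Out K h1, ← mul_assoc,
        In_mul_Out K (.mid (ht .plain) (.inl rfl)), y_mul_xs, shift_ccw]

/-- A full rotation around the start `r` of a chord, continued up to the chord, amounts to going
along the boundary to its end `t` and rotating into it there. -/
theorem y_mul_outer_mul_In {r t : Fin n} (h : chord r t ∈ σ.edges) :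
    y K σ r * σ.outer K r * In K σ r (ccw r t) = xs K σ r (ccw r t) * In K σ t (n + ccw t r) := by
  have := Cat_eq K h
  unfold Cat at this
  rw [← In_mul_Out_outer K h, ← this, ← In_mul_Out K (.out h)]
  simp only [mul_assoc]

/-- The dual of `y_mul_outer_mul_In`. -/
theorem Out_mul_outer_mul_y {r t : Fin n} (h : chord r t ∈ σ.edges) :
    Out K σ t (n + ccw t r) * σ.outer K t * y K σ t =
      Out K σ r (ccw r t) * xs K σ (r - 1) (ccw r t) := by
  have := Cat_eq K h
  unfold Cat at this
  rw [← outer_In_mul_Out K h, this, ← In_mul_Out K (.inc h)]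
  simp only [mul_assoc]

/-! ### Rotations into an edge followed by an arrow around its other end -/

theorem In_mul_triR (T : σ.Triangle) : In K σ T.s (n + ccw T.s T.r) * arr K (.triR T) =
    xs K σ T.s (ccw T.s T.t) * In K σ T.t (n + ccw T.t T.r) := by
  rw [← In_triS, mul_assoc, cmp_triT, In_mul_Out_outer K T.mem_st]

theorem In_mul_triT (T : σ.Triangle) : In K σ T.r (ccw T.r T.t) * arr K (.triT T) =
    xs K σ T.r (ccw T.r T.s) * In K σ T.s (ccw T.s T.t) := by
  rw [← In_triR, mul_assoc, cmp_triS, In_mul_Out_outer K T.mem_rs]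

theorem In_mul_triS (T : σ.Triangle) : In K σ T.t (n + ccw T.t T.s) * arr K (.triS T) =
    xs K σ T.t (ccw T.t T.s) * In K σ T.s (n + ccw T.s T.r) := by
  have a1 := ccw_rel T.r T.s T.t
  have a2 := ccw_add_ccw (ne_of_chord_mem T.mem_rt)
  have a3 := ccw_add_ccw (ne_of_chord_mem T.mem_st)
  have a4 := T.lt
  rw [← In_triT, mul_assoc, cmp_triR, mul_assoc (Out _ _ _ _), ← mul_assoc,
    In_mul_Out_beyond K T.mem_rt, mul_assoc, ← mul_assoc (y _ _ _), y_mul_outer_mul_In K T.mem_rs,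
    ← mul_assoc, xs_mul_xs K (shift_ccw _ _)]
  congr 2
  omega

theorem In_mul_puncR (T : σ.PunctureTriangle) : In K σ T.s (n + ccw T.s T.r) * arr K (.puncR T) =
    xs K σ T.s (ccw T.s T.r) * In K σ T.r n := by
  rw [← In_puncS, mul_assoc, In_mul_puncS_puncR]

theorem In_mul_eta (D : σ.Digon) : In K σ D.r (n + ccw D.r D.s) * arr K (.eta D) =
    xs K σ D.r (ccw D.r D.s) * In K σ D.s (n + ccw D.s D.r) := by
  rw [← In_delta, mul_assoc, cmp_gamma, mul_assoc (Out _ _ _ _), ← mul_assoc,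
    In_mul_Out K (.mid D.mem_plain (.inl rfl)), ← mul_assoc, y_mul_outer_mul_In K D.mem_rs]

theorem In_mul_gamma (D : σ.Digon) : In K σ D.s (n + ccw D.s D.r) * arr K (.gamma D) =
    xs K σ D.s (ccw D.s D.r) * In K σ D.r n := by
  rw [← In_eta, mul_assoc, cmp_delta, In_mul_Out_outer K D.mem_sr]

theorem In_mul_alpha (D : σ.Digon) : In K σ D.s (n + ccw D.s D.r) * arr K (.alpha D) = 0 := by
  rw [← In_eta, mul_assoc, eta_mul_alpha, mul_zero]

theorem In_mul_alpha_mul_beta (D : σ.Digon) :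
    In K σ D.r (ccw D.r D.s) * arr K (.alpha D) * arr K (.beta D) =
      xs K σ D.r (ccw D.r D.s) * In K σ D.s (ccw D.s D.r) - In K σ D.r (n + ccw D.r D.s) := by
  have h : arr K (.alpha D) * arr K (.beta D) = _ := eq_sub_of_add_eq (cmp_eta K D)
  rw [mul_assoc, h, mul_sub, In_mul_Out_outer K D.mem_rs, ← mul_assoc, In_gamma, In_delta]

/-! ### Rotations out of an edge preceded by an arrow around its other end -/

theorem triR_mul_Out (T : σ.Triangle) : arr K (.triR T) * Out K σ T.t (n + ccw T.t T.r) =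
    Out K σ T.s (n + ccw T.s T.r) * xs K σ (T.s - 1) (ccw T.s T.t) := by
  rw [← triT_Out, ← mul_assoc, cmp_triS, outer_In_mul_Out K T.mem_st]

theorem triT_mul_Out (T : σ.Triangle) : arr K (.triT T) * Out K σ T.s (ccw T.s T.t) =
    Out K σ T.r (ccw T.r T.t) * xs K σ (T.r - 1) (ccw T.r T.s) := by
  rw [← triS_Out, ← mul_assoc, cmp_triR, outer_In_mul_Out K T.mem_rs]

theorem triS_mul_Out (T : σ.Triangle) : arr K (.triS T) * Out K σ T.r (ccw T.r T.s) =
    Out K σ T.s (ccw T.s T.t) * xs K σ (T.s - 1) (ccw T.s T.r) := by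
  have a1 := ccw_rel T.r T.s T.t
  have a2 := ccw_add_ccw (ne_of_chord_mem T.mem_rt)
  have a3 := ccw_add_ccw (ne_of_chord_mem T.mem_rs)
  have a4 := T.lt
  have a5 := ccw_pos (ne_of_chord_mem T.mem_st)
  have h := y_mul_xs K (σ := σ) T.t (ccw T.t T.r)
  rw [shift_ccw] at h
  rw [← triR_Out, ← mul_assoc, cmp_triT, mul_assoc, In_mul_Out_beyond K T.mem_rt, ← h, ← mul_assoc,
    Out_mul_outer_mul_y K T.mem_st, mul_assoc, xs_mul_xs K]
  · congr 2
    omega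
  · rw [eq_sub_iff_add_eq, ← shift_succ, shift_sub_one, shift_ccw]

theorem puncS_mul_Out (T : σ.PunctureTriangle) : arr K (.puncS T) * Out K σ T.r (ccw T.r T.s) =
    Out K σ T.s n * xs K σ (T.s - 1) (ccw T.s T.r) := by
  rw [← puncR_Out, ← mul_assoc, puncS_puncR_mul_Out]

theorem eta_mul_Out (D : σ.Digon) : arr K (.eta D) * Out K σ D.r (ccw D.r D.s) =
    Out K σ D.s (ccw D.s D.r) * xs K σ (D.s - 1) (ccw D.s D.r) := by
  rw [← gamma_Out, ← mul_assoc, cmp_delta, mul_assoc, In_mul_Out K (.mid D.mem_plain (.inl rfl)),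
    Out_mul_outer_mul_y K D.mem_sr]

theorem delta_mul_Out (D : σ.Digon) : arr K (.delta D) * Out K σ D.s (ccw D.s D.r) =
    Out K σ D.r n * xs K σ (D.r - 1) (ccw D.r D.s) := by
  rw [← eta_Out, ← mul_assoc, cmp_gamma, outer_In_mul_Out K D.mem_rs]

theorem beta_mul_Out (D : σ.Digon) : arr K (.beta D) * Out K σ D.s (ccw D.s D.r) = 0 := by
  rw [← eta_Out, ← mul_assoc, beta_mul_eta, zero_mul]

theorem alpha_mul_beta_mul_Out (D : σ.Digon) :
    arr K (.alpha D) * (arr K (.beta D) * Out K σ D.r (n + ccw D.r D.s)) =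
      Out K σ D.s (n + ccw D.s D.r) * xs K σ (D.s - 1) (ccw D.s D.r)
        - Out K σ D.r (ccw D.r D.s) := by
  have h : arr K (.alpha D) * arr K (.beta D) = _ := eq_sub_of_add_eq (cmp_eta K D)
  rw [← mul_assoc, h, sub_mul, outer_In_mul_Out K D.mem_sr, mul_assoc, delta_Out, gamma_Out]

/-! ### The two central elements -/

/-- In the punctured digon, the path from the side which starts at `D.r` to the notched arc. -/
def notchedIn (D : σ.Digon) : σ.Gam K := In K σ D.r (ccw D.r D.s) * arr K (.alpha D)

/-- In the punctured digon, the path from the notched arc to the side which ends at `D.r`. -/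
def notchedOut (D : σ.Digon) : σ.Gam K := arr K (.beta D) * Out K σ D.r (n + ccw D.r D.s)

open Classical in
/-- The planar cycle at an edge; it is zero at the notched arc of a punctured digon. -/
def cycleAt : σ.Vertex → σ.Gam K
  | ⟨chord r t, _⟩ => Cat K σ r (ccw r t)
  | ⟨spoke k τ, _⟩ => if τ = .plain ∨ spoke k .plain ∉ σ.edges then Cat K σ k n else 0

open Classical in
/-- The big cycle at an edge, which runs once around the polygon. At a plain arc, and at a notched
arc outside punctured digons, it agrees with the planar cycle. -/
def bigAt : σ.Vertex → σ.Gam K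
  | ⟨chord r t, _⟩ =>
    Out K σ t (n + ccw t r) * xs K σ (t - 1) (ccw t r + 1) * In K σ r (ccw r t)
  | ⟨spoke k τ, _⟩ => if τ = .plain ∨ spoke k .plain ∉ σ.edges then Cat K σ k n else
      ∑ D : σ.Digon, notchedOut K D * σ.outer K D.r * notchedIn K D

theorem cycleAt_eq {k : Fin n} {p : ℕ} {c : σ.Vertex} (h : σ.At k p c) :
    cycleAt K c = Cat K σ k p := by
  cases h with
  | out h => rfl
  | mid h hτ => exact if_pos hτ
  | inc h => exact Cat_eq K h

theorem bigAt_eq {k : Fin n} {p : ℕ} {c : σ.Vertex} (h : σ.At k p c) (hp : p = n) :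
    bigAt K c = Cat K σ k n := by
  cases h with
  | @out s h =>
    have := ccw_lt k s
    omega
  | mid h hτ => exact if_pos hτ
  | @inc s h =>
    have := ccw_pos (ne_of_chord_mem h).symm
    omega

theorem bigAt_mid {k : Fin n} {c : σ.Vertex} (h : σ.At k n c) : bigAt K c = Cat K σ k n :=
  bigAt_eq K h rfl

theorem cycleAt_notched (D : σ.Digon) : cycleAt K ⟨spoke D.r .notched, D.mem_notched⟩ = 0 :=
  if_neg (by simp [D.mem_plain])

theorem bigAt_notched (D : σ.Digon) : bigAt K ⟨spoke D.r .notched, D.mem_notched⟩ =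
    notchedOut K D * σ.outer K D.r * notchedIn K D := by
  refine (if_neg (by simp [D.mem_plain])).trans ?_
  rw [Fintype.sum_subsingleton _ D]

theorem notchedIn_mul_e (D : σ.Digon) :
    notchedIn K D * σ.e K ⟨spoke D.r .notched, D.mem_notched⟩ = notchedIn K D := by
  unfold notchedIn
  rw [mul_assoc]
  exact congrArg _ (arr_mul_e K (.alpha D))

theorem e_mul_notchedOut (D : σ.Digon) :
    σ.e K ⟨spoke D.r .notched, D.mem_notched⟩ * notchedOut K D = notchedOut K D := by
  unfold notchedOut
  rw [← mul_assoc]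
  exact congrArg (· * _) (e_src_mul K (.beta D))

/-- Every edge is in some position, except the notched arc of a punctured digon. -/
theorem At.exists_or_notched (c : σ.Vertex) :
    (∃ k p, σ.At k p c) ∨ ∃ D : σ.Digon, c = ⟨spoke D.r .notched, D.mem_notched⟩ := by
  rcases c with ⟨⟨r, s⟩ | ⟨k, τ⟩, h⟩
  · exact .inl ⟨r, _, .out h⟩
  · by_cases hτ : τ = .plain ∨ spoke k .plain ∉ σ.edges
    · exact .inl ⟨k, n, .mid h hτ⟩
    · push Not at hτ
      have h' : τ = .notched := by
        cases τ
        · exact absurd rfl hτ.1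
        · rfl
      subst h'
      obtain ⟨D, rfl⟩ := exists_digon (σ := σ) (k := k) (by
        rintro ⟨⟩
        · exact hτ.2
        · exact h)
      exact .inr ⟨D, rfl⟩

theorem e_mul_Cat {k : Fin n} {p : ℕ} {c : σ.Vertex} (h : σ.At k p c) :
    σ.e K c * Cat K σ k p = Cat K σ k p := by
  unfold Cat
  rw [← mul_assoc, ← mul_assoc, e_mul_Out K h]

theorem Cat_mul_e {k : Fin n} {p : ℕ} {c : σ.Vertex} (h : σ.At k p c) :
    Cat K σ k p * σ.e K c = Cat K σ k p := by
  unfold Cat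
  rw [mul_assoc, In_mul_e K h]

theorem e_mul_cycleAt (c : σ.Vertex) : σ.e K c * cycleAt K c = cycleAt K c := by
  rcases At.exists_or_notched c with ⟨k, p, h⟩ | ⟨D, rfl⟩
  · rw [cycleAt_eq K h, e_mul_Cat K h]
  · rw [cycleAt_notched, mul_zero]

theorem cycleAt_mul_e (c : σ.Vertex) : cycleAt K c * σ.e K c = cycleAt K c := by
  rcases At.exists_or_notched c with ⟨k, p, h⟩ | ⟨D, rfl⟩
  · rw [cycleAt_eq K h, Cat_mul_e K h]
  · rw [cycleAt_notched, zero_mul]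

theorem e_mul_bigAt (c : σ.Vertex) : σ.e K c * bigAt K c = bigAt K c := by
  rcases At.exists_or_notched c with ⟨k, p, h⟩ | ⟨D, rfl⟩
  · cases h with
    | out h =>
      change _ * (_ * _ * _) = _ * _ * _
      rw [← mul_assoc, ← mul_assoc, e_mul_Out K (.inc h)]
    | mid h hτ => rw [bigAt_mid K (.mid h hτ), e_mul_Cat K (.mid h hτ)]
    | inc h =>
      change _ * (_ * _ * _) = _ * _ * _
      rw [← mul_assoc, ← mul_assoc, e_mul_Out K (.inc h)]
  · rw [bigAt_notched, ← mul_assoc, ← mul_assoc, e_mul_notchedOut]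

theorem bigAt_mul_e (c : σ.Vertex) : bigAt K c * σ.e K c = bigAt K c := by
  rcases At.exists_or_notched c with ⟨k, p, h⟩ | ⟨D, rfl⟩
  · cases h with
    | out h =>
      change _ * _ * _ * _ = _ * _ * _
      rw [mul_assoc, In_mul_e K (.out h)]
    | mid h hτ => rw [bigAt_mid K (.mid h hτ), Cat_mul_e K (.mid h hτ)]
    | inc h =>
      change _ * _ * _ * _ = _ * _ * _
      rw [mul_assoc, In_mul_e K (.out h)]
  · rw [bigAt_notched, mul_assoc, notchedIn_mul_e]

theorem Cat_mul_arr {α : σ.Arrow} {k : Fin n} {p : ℕ} (h : σ.corner α = some (k, p)) :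
    Cat K σ k p * arr K α = Out K σ k p * σ.outer K k * In K σ k (σ.cornerEnd α) := by
  unfold Cat
  rw [mul_assoc, In_mul_arr K h]

theorem arr_mul_Cat {α : σ.Arrow} {k : Fin n} {p : ℕ} (h : σ.corner α = some (k, p)) :
    arr K α * Cat K σ k (σ.cornerEnd α) =
      Out K σ k p * σ.outer K k * In K σ k (σ.cornerEnd α) := by
  unfold Cat
  rw [← mul_assoc, ← mul_assoc, arr_mul_Out K h]

theorem cycleAt_side (k : Fin n) : cycleAt K (σ.sideVertex k) = y K σ k * σ.outer K k := by
  rw [cycleAt_eq K (at_side k)]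
  unfold Cat
  rw [Out_one, In_one, mul_assoc, outer_mul_e]

theorem bigAt_side (k : Fin n) : bigAt K (σ.sideVertex k) = xs K σ k n := by
  have h2 := ccw_add_ccw (ne_of_chord_mem (σ := σ) (side_mem k))
  rw [ccw_add_one] at h2
  change Out K σ (k + 1) _ * xs K σ (k + 1 - 1) _ * In K σ k _ = _
  have hn : 2 ≤ n := Nat.AtLeastTwo.prop
  rw [ccw_add_one, show n + ccw (k + 1) k = 2 * n - 1 by omega, In_one, Out_last,
    show ccw (k + 1) k + 1 = n by omega, add_sub_cancel_right, eS_mul_xs]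
  have := xs_mul_eS K (σ := σ) k n
  rwa [shift_n] at this

theorem outer_eq_arr {k : Fin n} (h : σ.HasArcAt k) : σ.outer K k = arr K (.ext k h) := by
  unfold outer
  rw [dif_pos h, path_singleton]

theorem outer_mul_xs_n (k : Fin n) :
    xs K σ (k - 1) n * σ.outer K k = σ.outer K k * xs K σ k n := by
  rw [outer_mul_xs, xs_mul_outer K (by rw [shift_sub_one, shift_n]), add_comm]

theorem y_mul_outer' (k : Fin n) :
    y K σ (k - 1) * σ.outer K (k - 1) = σ.outer K k * y K σ k := by
  have := y_mul_outer K (σ := σ) (k - 1)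
  rwa [sub_add_cancel] at this

/-- The planar cycles commute with the arrows. -/
theorem cycleAt_mul_arr (α : σ.Arrow) :
    cycleAt K (σ.src α) * arr K α = arr K α * cycleAt K (σ.tgt α) := by
  have key : ∀ {k p}, σ.corner α = some (k, p) →
      cycleAt K (σ.src α) * arr K α = arr K α * cycleAt K (σ.tgt α) := by
    intro k p h
    obtain ⟨h1, h2, -⟩ := corner_spec h
    rw [cycleAt_eq K h1, cycleAt_eq K h2, Cat_mul_arr K h, arr_mul_Cat K h]
  cases α with
  | ext k h =>
    rw [← outer_eq_arr K h]
    change cycleAt K (σ.sideVertex (k - 1)) * _ = _ * cycleAt K (σ.sideVertex k)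
    rw [cycleAt_side, cycleAt_side, y_mul_outer', mul_assoc]
  | alpha D =>
    change cycleAt K ⟨chord D.r D.s, D.mem_rs⟩ * _ = _
    rw [cycleAt_eq K (.inc D.mem_rs)]
    unfold Cat
    rw [mul_assoc, In_mul_alpha, mul_zero]
    exact (mul_eq_zero_of_right _ (cycleAt_notched K D)).symm
  | beta D =>
    change cycleAt K ⟨spoke D.r .notched, D.mem_notched⟩ * _ =
      _ * cycleAt K ⟨chord D.s D.r, D.mem_sr⟩
    rw [cycleAt_notched, zero_mul, cycleAt_eq K (.out D.mem_sr)]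
    unfold Cat
    rw [← mul_assoc, ← mul_assoc, beta_mul_Out, zero_mul, zero_mul]
  | puncO T =>
    change cycleAt K ⟨spoke T.r T.tag, T.mem_r⟩ * _ = _ * cycleAt K ⟨spoke T.s T.tag, T.mem_s⟩
    rw [cycleAt_eq K T.at_r, cycleAt_eq K T.at_s]
    unfold Cat
    have h : shift (T.r - 1) (ccw T.r T.s + 1) = T.s := by rw [shift_sub_one, shift_ccw]
    rw [mul_assoc, In_mul_puncO, ← mul_assoc, ← mul_assoc, ← mul_assoc, puncO_mul_Out,
      mul_assoc _ _ (xs _ _ _ _), outer_mul_xs, mul_assoc _ _ (σ.outer K T.s), xs_mul_outer K h,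
      add_comm]
  | _ => exact key rfl

/-- An arrow winding around the puncture: the big cycle and the planar cycle agree on it. -/
def Crossing : σ.Arrow → Prop
  | .triS _ | .puncR _ | .puncS _ | .puncO _ | .eta _ | .gamma _ | .delta _ => True
  | _ => False

/-- Into a chord, one can rotate around either end; preceding an arrow around the puncture, the two
choices differ by a path along the boundary, which turns the external cycle into the big one. -/
theorem bigAt_mul_arr_of_crossing {α : σ.Arrow} (hα : Crossing α) :
    bigAt K (σ.src α) * arr K α = cycleAt K (σ.src α) * arr K α := by
  have key : ∀ {r t : Fin n} (h : chord r t ∈ σ.edges) (z w : σ.Gam K),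
      In K σ r (ccw r t) * z = w →
      In K σ t (n + ccw t r) * z = xs K σ t (ccw t r) * w →
      bigAt K ⟨chord r t, h⟩ * z = cycleAt K ⟨chord r t, h⟩ * z := by
    intro r t h z w h1 h2
    rw [cycleAt_eq K (.inc h)]
    unfold Cat
    change _ * _ * _ * _ = _
    rw [mul_assoc, mul_assoc _ _ z, h1, h2, ← mul_assoc, mul_assoc _ _ (xs _ _ _ _), outer_mul_xs,
      add_comm 1]
  cases α with
  | triS T => exact key _ _ _ (In_triS K T) (In_mul_triS K T)
  | puncR T => exact key _ _ _ (In_puncR K T) (In_mul_puncR K T)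
  | eta D => exact key _ _ _ (In_eta K D) (In_mul_eta K D)
  | gamma D => exact key _ _ _ (In_gamma K D) (In_mul_gamma K D)
  | puncS T =>
    change bigAt K ⟨spoke T.s T.tag, T.mem_s⟩ * _ = cycleAt K ⟨spoke T.s T.tag, T.mem_s⟩ * _
    rw [bigAt_mid K T.at_s, cycleAt_eq K T.at_s]
  | puncO T =>
    change bigAt K ⟨spoke T.r T.tag, T.mem_r⟩ * _ = cycleAt K ⟨spoke T.r T.tag, T.mem_r⟩ * _
    rw [bigAt_mid K T.at_r, cycleAt_eq K T.at_r]
  | delta D =>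
    have h : σ.At D.r n ⟨spoke D.r .plain, D.mem_plain⟩ := .mid D.mem_plain (.inl rfl)
    change bigAt K ⟨spoke D.r .plain, D.mem_plain⟩ * _ =
      cycleAt K ⟨spoke D.r .plain, D.mem_plain⟩ * _
    rw [bigAt_mid K h, cycleAt_eq K h]
  | _ => exact hα.elim

/-- The dual of `bigAt_mul_arr_of_crossing`. -/
theorem arr_mul_bigAt_of_crossing {α : σ.Arrow} (hα : Crossing α) :
    arr K α * bigAt K (σ.tgt α) = arr K α * cycleAt K (σ.tgt α) := by
  have key : ∀ {r t : Fin n} (h : chord r t ∈ σ.edges) (z w : σ.Gam K),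
      z * Out K σ t (n + ccw t r) = w →
      z * Out K σ r (ccw r t) = w * xs K σ (t - 1) (ccw t r) →
      z * bigAt K ⟨chord r t, h⟩ = z * cycleAt K ⟨chord r t, h⟩ := by
    intro r t h z w h1 h2
    rw [cycleAt_eq K (.out h)]
    unfold Cat
    change _ * (_ * _ * _) = _
    rw [← mul_assoc, ← mul_assoc, h1, ← mul_assoc, ← mul_assoc, h2, mul_assoc _ _ (σ.outer K r),
      xs_mul_outer K (by rw [shift_sub_one, shift_ccw])]
  cases α with
  | triS T => exact key _ _ _ (triS_Out K T) (triS_mul_Out K T)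
  | puncS T => exact key _ _ _ (puncS_Out K T) (puncS_mul_Out K T)
  | eta D => exact key _ _ _ (eta_Out K D) (eta_mul_Out K D)
  | delta D => exact key _ _ _ (delta_Out K D) (delta_mul_Out K D)
  | puncR T =>
    change _ * bigAt K ⟨spoke T.r T.tag, T.mem_r⟩ = _ * cycleAt K ⟨spoke T.r T.tag, T.mem_r⟩
    rw [bigAt_mid K T.at_r, cycleAt_eq K T.at_r]
  | puncO T =>
    change _ * bigAt K ⟨spoke T.s T.tag, T.mem_s⟩ = _ * cycleAt K ⟨spoke T.s T.tag, T.mem_s⟩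
    rw [bigAt_mid K T.at_s, cycleAt_eq K T.at_s]
  | gamma D =>
    have h : σ.At D.r n ⟨spoke D.r .plain, D.mem_plain⟩ := .mid D.mem_plain (.inl rfl)
    change _ * bigAt K ⟨spoke D.r .plain, D.mem_plain⟩ =
      _ * cycleAt K ⟨spoke D.r .plain, D.mem_plain⟩
    rw [bigAt_mid K h, cycleAt_eq K h]
  | _ => exact hα.elim

/-- The big cycles commute with the arrows. -/
theorem bigAt_mul_arr (α : σ.Arrow) :
    bigAt K (σ.src α) * arr K α = arr K α * bigAt K (σ.tgt α) := by
  by_cases hα : Crossing α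
  · rw [bigAt_mul_arr_of_crossing K hα, arr_mul_bigAt_of_crossing K hα, cycleAt_mul_arr]
  -- The arrows which do not wind around the puncture are the external ones, those at the starting
  -- and the last vertex of a triangle, and those at the notched arc of a digon.
  cases α with
  | ext k h =>
    rw [← outer_eq_arr K h]
    change bigAt K (σ.sideVertex (k - 1)) * _ = _ * bigAt K (σ.sideVertex k)
    rw [bigAt_side, bigAt_side, outer_mul_xs_n]
  | triR T =>
    change Out K σ T.s _ * xs K σ (T.s - 1) _ * In K σ T.r _ * _ =
      _ * (Out K σ T.t _ * xs K σ (T.t - 1) _ * In K σ T.r _)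
    have a1 := ccw_rel T.r T.s T.t
    have a2 := ccw_add_ccw (ne_of_chord_mem T.mem_rt)
    have a3 := ccw_add_ccw (ne_of_chord_mem T.mem_rs)
    have a4 := T.lt
    have h : shift (T.s - 1) (ccw T.s T.t) = T.t - 1 := by
      rw [eq_sub_iff_add_eq, ← shift_succ, shift_sub_one, shift_ccw]
    rw [mul_assoc, In_triR, ← mul_assoc, ← mul_assoc, triR_mul_Out,
      mul_assoc (Out _ _ _ _) (xs K σ _ (ccw T.s T.t)), xs_mul_xs K h]
    congr 3
    omega
  | triT T =>
    change Out K σ T.t _ * xs K σ (T.t - 1) _ * In K σ T.r _ * _ =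
      _ * (Out K σ T.t _ * xs K σ (T.t - 1) _ * In K σ T.s _)
    have a1 := ccw_rel T.r T.s T.t
    have a2 := ccw_add_ccw (ne_of_chord_mem T.mem_rt)
    have a3 := ccw_add_ccw (ne_of_chord_mem T.mem_st)
    have a4 := T.lt
    have h : shift (T.t - 1) (ccw T.t T.r + 1) = T.r := by rw [shift_sub_one, shift_ccw]
    rw [mul_assoc, In_mul_triT, ← mul_assoc, ← mul_assoc, ← mul_assoc, triT_Out,
      mul_assoc (Out _ _ _ _), xs_mul_xs K h]
    congr 3
    omega
  | alpha D =>
    -- The planar cycle is zero at the notched arc, hence its product with `α` is zero.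
    have h0 : Out K σ D.r (ccw D.r D.s) * σ.outer K D.r * notchedIn K D = 0 := by
      have h := cycleAt_mul_arr K (.alpha D)
      have h' : arr K (.alpha D) * cycleAt K (σ.tgt (.alpha D)) = 0 :=
        mul_eq_zero_of_right _ (cycleAt_notched K D)
      rw [h'] at h
      rw [← h]
      unfold notchedIn
      rw [← mul_assoc]
      rfl
    change Out K σ D.s _ * xs K σ (D.s - 1) _ * In K σ D.r _ * _ =
      _ * bigAt K ⟨spoke D.r .notched, D.mem_notched⟩
    rw [bigAt_notched, ← mul_assoc, ← mul_assoc]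
    conv_rhs => rw [notchedOut, alpha_mul_beta_mul_Out, sub_mul, sub_mul, h0, sub_zero]
    rw [mul_assoc _ _ (σ.outer K D.r), xs_mul_outer K (by rw [shift_sub_one, shift_ccw]), mul_assoc]
    rfl
  | beta D =>
    -- The planar cycle is zero at the notched arc, hence its product with `β` is zero.
    have h0 : notchedOut K D * σ.outer K D.r * In K σ D.r (n + ccw D.r D.s) = 0 := by
      have h := cycleAt_mul_arr K (.beta D)
      have h' : cycleAt K (σ.src (.beta D)) * arr K (.beta D) = 0 :=
        mul_eq_zero_of_left (cycleAt_notched K D) _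
      have h'' : cycleAt K (σ.tgt (.beta D)) = Cat K σ D.r (n + ccw D.r D.s) :=
        cycleAt_eq K (.inc D.mem_sr)
      rw [h', h''] at h
      rw [h]
      unfold notchedOut Cat
      simp only [mul_assoc]
    change bigAt K ⟨spoke D.r .notched, D.mem_notched⟩ * _ =
      _ * (Out K σ D.r _ * xs K σ (D.r - 1) _ * In K σ D.s _)
    rw [bigAt_notched, mul_assoc]
    conv_lhs => rw [notchedIn, In_mul_alpha_mul_beta, mul_sub, h0, sub_zero, ← mul_assoc,
      mul_assoc _ _ (xs _ _ _ _), outer_mul_xs, add_comm]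
    unfold notchedOut
    simp only [mul_assoc]
  | _ => exact absurd trivial hα

/-- The sum of the planar cycles, a central element. -/
def planarSum (σ : TaggedTriangulation n) : σ.Gam K := ∑ c, cycleAt K c

/-- The sum of the big cycles, a central element. -/
def bigSum (σ : TaggedTriangulation n) : σ.Gam K := ∑ c, bigAt K c

theorem e_mul_sum {f : σ.Vertex → σ.Gam K} (hf : ∀ c, σ.e K c * f c = f c) (c : σ.Vertex) :
    σ.e K c * ∑ c, f c = f c := by
  rw [Finset.mul_sum, Finset.sum_eq_single c]
  · exact hf c
  · intro b _ hb
    rw [← hf b, ← mul_assoc, e_mul_of_ne K hb.symm, zero_mul]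
  · exact fun h => absurd (Finset.mem_univ _) h

theorem sum_mul_e {f : σ.Vertex → σ.Gam K} (hf : ∀ c, f c * σ.e K c = f c) (c : σ.Vertex) :
    (∑ c, f c) * σ.e K c = f c := by
  rw [Finset.sum_mul, Finset.sum_eq_single c]
  · exact hf c
  · intro b _ hb
    rw [← hf b, mul_assoc, e_mul_of_ne K hb, mul_zero]
  · exact fun h => absurd (Finset.mem_univ _) h

theorem e_mul_planarSum (c : σ.Vertex) : σ.e K c * planarSum K σ = cycleAt K c :=
  e_mul_sum K (e_mul_cycleAt K) c

theorem e_mul_bigSum (c : σ.Vertex) : σ.e K c * bigSum K σ = bigAt K c :=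
  e_mul_sum K (e_mul_bigAt K) c

theorem planarSum_mul_e (c : σ.Vertex) : planarSum K σ * σ.e K c = cycleAt K c :=
  sum_mul_e K (cycleAt_mul_e K) c

theorem bigSum_mul_e (c : σ.Vertex) : bigSum K σ * σ.e K c = bigAt K c :=
  sum_mul_e K (bigAt_mul_e K) c

/-- The frozen Jacobian algebra is generated by the idempotents and the arrows: a subspace which is
stable under right multiplication by them is a right ideal. -/
theorem mul_mem_of_generators (N : Submodule K (σ.Gam K))
    (he : ∀ x ∈ N, ∀ c, x * σ.e K c ∈ N) (ha : ∀ x ∈ N, ∀ α, x * arr K α ∈ N) {x : σ.Gam K}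
    (hx : x ∈ N) (z : σ.Gam K) : x * z ∈ N := by
  let f : FreeAlgebra K (σ.Vertex ⊕ σ.Arrow) →ₐ[K] σ.Gam K :=
    (σ.quiver.toJacobian (σ.potential K)).comp (toPathAlgebra K σ.quiver)
  have hf : Function.Surjective f :=
    (RingQuot.mkAlgHom_surjective K (JacobianRel σ.quiver (σ.potential K))).comp
      (RingQuot.mkAlgHom_surjective K (PathRel K σ.quiver))
  obtain ⟨z, rfl⟩ := hf z
  induction z generalizing x with
  | grade0 r =>
    rw [AlgHom.commutes, ← Algebra.commutes, ← Algebra.smul_def]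
    exact N.smul_mem r hx
  | grade1 g =>
    rcases g with c | α
    · exact he x hx c
    · exact ha x hx α
  | mul a b ha hb =>
    rw [map_mul, ← mul_assoc]
    exact hb (ha hx)
  | add a b ha hb =>
    rw [map_add, mul_add]
    exact N.add_mem (ha hx) (hb hx)

/-- An element which commutes with the idempotents and the arrows is central. -/
theorem commute_of_generators {z : σ.Gam K} (he : ∀ c, σ.e K c * z = z * σ.e K c)
    (ha : ∀ α, z * arr K α = arr K α * z) (x : σ.Gam K) : z * x = x * z := by
  -- The commutant of `z` is stable under right multiplication by the generators.
  let N : Submodule K (σ.Gam K) :=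
    { carrier := {x | z * x = x * z}
      add_mem' := fun {a b} h1 h2 => by
        rw [Set.mem_ofPred_eq] at h1 h2 ⊢
        rw [mul_add, add_mul, h1, h2]
      zero_mem' := by rw [Set.mem_ofPred_eq, mul_zero, zero_mul]
      smul_mem' := fun c a h => by
        rw [Set.mem_ofPred_eq] at h ⊢
        rw [mul_smul_comm, smul_mul_assoc, h] }
  have h1 : (1 : σ.Gam K) ∈ N := by
    change z * 1 = 1 * z
    rw [mul_one, one_mul]
  have := mul_mem_of_generators K N
    (fun x (hx : z * x = x * z) c => by
      change z * (x * _) = x * _ * z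
      rw [← mul_assoc, hx, mul_assoc, mul_assoc, he])
    (fun x (hx : z * x = x * z) α => by
      change z * (x * _) = x * _ * z
      rw [← mul_assoc, hx, mul_assoc, mul_assoc, ha]) h1 x
  rwa [one_mul] at this

theorem planarSum_mul (x : σ.Gam K) : planarSum K σ * x = x * planarSum K σ := by
  refine commute_of_generators K (fun c => ?_) (fun α => ?_) x
  · rw [e_mul_planarSum, planarSum_mul_e]
  · rw [← e_src_mul, ← mul_assoc, planarSum_mul_e, e_src_mul, cycleAt_mul_arr, ← e_mul_planarSum,
      ← mul_assoc, arr_mul_e]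

theorem bigSum_mul (x : σ.Gam K) : bigSum K σ * x = x * bigSum K σ := by
  refine commute_of_generators K (fun c => ?_) (fun α => ?_) x
  · rw [e_mul_bigSum, bigSum_mul_e]
  · rw [← e_src_mul, ← mul_assoc, bigSum_mul_e, e_src_mul, bigAt_mul_arr, ← e_mul_bigSum,
      ← mul_assoc, arr_mul_e]

theorem bigSum_mul_arr {α : σ.Arrow} (hα : Crossing α) :
    bigSum K σ * arr K α = planarSum K σ * arr K α := by
  rw [← e_src_mul, ← mul_assoc, ← mul_assoc, bigSum_mul_e, planarSum_mul_e,
    bigAt_mul_arr_of_crossing K hα]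

theorem arr_mul_cmp {α : σ.Arrow} {k : Fin n} {p : ℕ} (h : σ.corner α = some (k, p)) :
    arr K α * cmp K α = cycleAt K (σ.src α) := by
  rw [cmp_eq' K h, cycleAt_eq K (corner_spec h).1, ← mul_assoc, ← mul_assoc, arr_mul_Out K h]
  rfl

theorem cmp_mul_arr {α : σ.Arrow} {k : Fin n} {p : ℕ} (h : σ.corner α = some (k, p)) :
    cmp K α * arr K α = cycleAt K (σ.tgt α) := by
  rw [cmp_eq' K h, cycleAt_eq K (corner_spec h).2.1, mul_assoc, In_mul_arr K h]
  rfl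

/-- On planar cycles, the two central elements agree, as each planar cycle contains an arrow winding
around the puncture. -/
theorem bigSum_mul_cycleAt (c : σ.Vertex) :
    bigSum K σ * cycleAt K c = planarSum K σ * cycleAt K c := by
  have key : ∀ {α : σ.Arrow}, Crossing α → ∀ {z : σ.Gam K}, (∃ x w, x * arr K α * w = z) →
      bigSum K σ * z = planarSum K σ * z := by
    rintro α hα z ⟨x, w, rfl⟩
    rw [← mul_assoc, ← mul_assoc, bigSum_mul, ← mul_assoc, ← mul_assoc, planarSum_mul,
      mul_assoc x, mul_assoc x (planarSum K σ), bigSum_mul_arr K hα]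
  -- At an edge followed by a corner, the planar cycle is the cycle around the piece of the
  -- triangulation which contains that corner.
  have main : ∀ {k p c}, σ.At k p c → p < 2 * n - 1 →
      bigSum K σ * cycleAt K c = planarSum K σ * cycleAt K c := by
    intro k p c h hp
    · obtain ⟨α, hα, rfl⟩ := h.exists_corner hp
      rw [← arr_mul_cmp K hα]
      cases α with
      | triR T =>
        refine key (α := .triS T) trivial ⟨arr K (.triR T) * arr K (.triT T), 1, ?_⟩
        simp only [cmp, compl, map_mul, mul_one]
        exact mul_assoc _ _ _
      | triT T =>
        refine key (α := .triS T) trivial ⟨arr K (.triT T), arr K (.triR T), ?_⟩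
        simp only [cmp, compl, map_mul]
        exact mul_assoc _ _ _
      | triS T => exact key (α := .triS T) trivial ⟨1, _, by rw [one_mul]⟩
      | puncR T => exact key (α := .puncR T) trivial ⟨1, _, by rw [one_mul]⟩
      | puncS T => exact key (α := .puncS T) trivial ⟨1, _, by rw [one_mul]⟩
      | eta T => exact key (α := .eta T) trivial ⟨1, _, by rw [one_mul]⟩
      | gamma T => exact key (α := .gamma T) trivial ⟨1, _, by rw [one_mul]⟩
      | delta T => exact key (α := .delta T) trivial ⟨1, _, by rw [one_mul]⟩
      | _ => cases hα
  have hn : 2 ≤ n := Nat.AtLeastTwo.prop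
  rcases At.exists_or_notched c with ⟨k, p, h⟩ | ⟨D, rfl⟩
  · by_cases hp : p < 2 * n - 1
    · exact main h hp
    · have hp' : p = 2 * n - 1 := by
        have := h.lt
        omega
      have h' : c = σ.sideVertex (k - 1) := h.eq (hp' ▸ at_side_sub_one k)
      exact h' ▸ main (at_side (k - 1)) (by omega)
  · rw [cycleAt_notched]
    simp only [mul_zero]

/-! ### The planar cycles and the big cycles of the sides -/

/-- The relation `C² = D C` between the central elements `C` and `D` given by the planar and the big
cycles. -/
theorem planarSum_mul_planarSum :
    planarSum K σ * planarSum K σ = bigSum K σ * planarSum K σ := by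
  conv_lhs => rw [planarSum, Finset.mul_sum]
  conv_rhs => rw [planarSum, Finset.mul_sum]
  exact Finset.sum_congr rfl fun c _ => (bigSum_mul_cycleAt K c).symm

theorem isRotated_triple {A : Type*} {w : List A} {x y z : A} (h : w ~r [x, y, z]) :
    w = [x, y, z] ∨ w = [y, z, x] ∨ w = [z, x, y] := by
  obtain ⟨i, hi, rfl⟩ := List.isRotated_iff_mod.mp h.symm
  simp only [List.length_cons, List.length_nil] at hi
  interval_cases i <;> simp [List.rotate_cons_succ]

/-- Two rotations of a list without repetitions are equal if they start with the same element. -/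
theorem eq_of_isRotated_of_head {A : Type*} {l w w' : List A} (hl : l.Nodup) (h : w ~r l)
    (h' : w' ~r l) {x : A} (hx : x ∈ w.head?) (hx' : x ∈ w'.head?) : w = w' := by
  have hw : w.Nodup := h.nodup_iff.mpr hl
  obtain ⟨i, hi, rfl⟩ := List.isRotated_iff_mod.mp (h.trans h'.symm)
  have hpos : 0 < w.length := List.length_pos_iff.mpr (by rintro rfl; simp at hx)
  rcases hi.eq_or_lt with rfl | hi
  · rw [List.rotate_length]
  · rw [List.head?_rotate hi] at hx'
    rw [List.head?_eq_getElem?] at hx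
    have h1 := List.getElem?_eq_some_iff.mp hx
    have h2 := List.getElem?_eq_some_iff.mp hx'
    have := (hw.getElem_inj_iff (hi := h1.1) (hj := h2.1)).mp (h1.2.trans h2.2.symm)
    subst this
    exact (List.rotate_zero _).symm

theorem nodup_segList (k : Fin n) (p q : ℕ) : (σ.segList k p q).Nodup := by
  refine List.Nodup.filterMap (fun a a' b hb hb' => ?_) List.nodup_range'
  have h1 := cornerAt_eq_some.mp hb
  have h2 := cornerAt_eq_some.mp hb'
  rw [h1] at h2
  simpa using h2

/-- The external cycle, rotated such that it starts with an internal arrow. -/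
theorem path_externalCycle_rotate {α : σ.Arrow} {k : Fin n} {p : ℕ} (hk : σ.HasArcAt k)
    (h : σ.corner α = some (k, p)) :
    σ.path K (α :: σ.segList k (σ.cornerEnd α) (2 * n) ++ (.ext k hk :: σ.segList k 0 p)) =
      cycleAt K (σ.src α) := by
  obtain ⟨h1, h2, h3, -⟩ := corner_spec h
  rw [path_append, path_cons, path_cons, ← outer_eq_arr, cycleAt_eq K h1]
  change arr K α * S K σ k _ _ * (_ * S K σ k 0 p) = _
  rw [arr_mul_S K h h2.lt.le]
  unfold Cat Out In
  rw [mul_assoc (S K σ k p _), e_mul_outer, ← mul_assoc (_ * _), mul_assoc (S K σ k p _),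
    outer_mul_e, mul_assoc]

theorem path_externalCycle (k : Fin n) (hk : σ.HasArcAt k) :
    σ.path K (σ.externalCycle k hk) = cycleAt K (σ.sideVertex (k - 1)) := by
  rw [externalCycle_eq, path_cons, ← outer_eq_arr, cycleAt_side, y_mul_outer', y, ← mul_assoc,
    outer_mul_e]
  rfl

theorem path_puncturedCycle (T : σ.PunctureTriangle) :
    σ.path K (σ.puncList T.r 0 n) = cycleAt K ⟨spoke T.r T.tag, T.mem_r⟩ := by
  have h0 := ccw_pos T.ne
  have h1 := ccw_add_ccw T.ne
  change P K σ T.r 0 n = _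
  have h2 : P K σ T.r (ccw T.r T.s) n = P K σ T.s 0 (ccw T.s T.r) := by
    conv_rhs => rw [← shift_ccw T.r T.s, P_shift, shift_ccw, add_zero, h1]
  have h3 := cmp_mul_arr K (α := .puncR T) rfl
  rw [← P_mul_P K (Nat.zero_le _) (ccw_lt T.r T.s).le, P_puncO, h2, ← arr_mul_e, mul_assoc]
  change _ * (σ.e K ⟨spoke T.s T.tag, T.mem_s⟩ * _) = _
  rw [← puncS_mul_puncR, ← mul_assoc]
  refine Eq.trans ?_ h3
  simp only [cmp, compl, map_mul]
  rfl

theorem puncturedCycle_eq : σ.puncturedCycle = (List.finRange n).filterMap σ.puncAt := rfl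

theorem puncList_isRotated (r : Fin n) : σ.puncList r 0 n ~r σ.puncturedCycle := by
  rw [puncturedCycle_eq]
  unfold puncList
  rw [Nat.sub_zero, ← finRange_rotate, List.filterMap_append]
  conv_rhs => rw [← List.take_append_drop r (List.finRange n), List.filterMap_append]
  exact List.isRotated_append

theorem nodup_puncturedCycle : (σ.puncturedCycle).Nodup := by
  rw [puncturedCycle_eq]
  refine List.Nodup.filterMap (fun a a' b hb hb' => ?_) (List.nodup_finRange n)
  obtain ⟨T, rfl, rfl⟩ := puncAt_eq_some.mp hb
  obtain ⟨T', rfl, h⟩ := puncAt_eq_some.mp hb'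
  rw [Arrow.puncO.injEq] at h
  rw [h]

/-- All planar cycles at an edge, except those through the notched arc of a punctured digon, give
the same element of the frozen Jacobian algebra. -/
theorem path_planarCycle {a : σ.Vertex} {w : List σ.Arrow} (h : σ.IsPlanarCycleAt a w) :
    σ.path K w = σ.e K a * planarSum K σ := by
  obtain ⟨⟨w', hw', hr⟩, α, hα, rfl⟩ := h
  rw [e_mul_planarSum]
  cases hw' with
  | tri T =>
    have h1 := arr_mul_cmp K (α := .triR T) rfl
    have h2 := arr_mul_cmp K (α := .triS T) rfl
    have h3 := arr_mul_cmp K (α := .triT T) rfl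
    simp only [cmp, compl, map_mul] at h1 h2 h3
    rcases isRotated_triple hr with rfl | rfl | rfl <;>
      (simp only [List.head?_cons, Option.mem_def, Option.some.injEq] at hα
       subst hα
       rw [path_cons, path_cons, path_singleton]
       assumption)
  | punc T =>
    have h1 := arr_mul_cmp K (α := .puncR T) rfl
    have h2 := arr_mul_cmp K (α := .puncS T) rfl
    have h3 := cmp_mul_arr K (α := .puncR T) rfl
    simp only [cmp, compl, map_mul, mul_assoc] at h1 h2 h3
    rcases isRotated_triple hr with rfl | rfl | rfl <;>
      (simp only [List.head?_cons, Option.mem_def, Option.some.injEq] at hα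
       subst hα
       rw [path_cons, path_cons, path_singleton]
       assumption)
  | digon D =>
    have h1 := arr_mul_cmp K (α := .gamma D) rfl
    have h2 := arr_mul_cmp K (α := .delta D) rfl
    have h3 := cmp_mul_arr K (α := .delta D) rfl
    simp only [cmp, compl, map_mul, mul_assoc] at h1 h2 h3
    rcases isRotated_triple hr with rfl | rfl | rfl <;>
      (simp only [List.head?_cons, Option.mem_def, Option.some.injEq] at hα
       subst hα
       rw [path_cons, path_cons, path_singleton]
       assumption)
  | ext k hk =>
    have hl : (σ.externalCycle k hk).Nodup := by
      rw [externalCycle_eq, List.nodup_cons]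
      refine ⟨fun hm => ?_, nodup_segList k _ _⟩
      obtain ⟨x, -, -, hx⟩ := mem_segList.mp hm
      cases hx
    have hm : α ∈ σ.externalCycle k hk := hr.mem_iff.mp (List.mem_of_mem_head? hα)
    rw [externalCycle_eq, List.mem_cons] at hm
    -- The head of a cycle determines the rotation.
    rcases hm with rfl | hm
    · have : w = σ.externalCycle k hk :=
        eq_of_isRotated_of_head hl hr (List.IsRotated.refl _) hα (by rw [externalCycle_eq]; rfl)
      rw [this, path_externalCycle]
      rfl
    · obtain ⟨p, -, -, hp⟩ := mem_segList.mp hm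
      have h2 : (α :: σ.segList k (σ.cornerEnd α) (2 * n) ++ (.ext k hk :: σ.segList k 0 p)) ~r
          σ.externalCycle k hk := by
        rw [externalCycle_eq, segList_split hp, ← List.cons_append]
        exact List.isRotated_append
      rw [eq_of_isRotated_of_head hl hr h2 hα rfl, path_externalCycle_rotate K hk hp]
  | puncture hD =>
    have hm : α ∈ σ.puncturedCycle := hr.mem_iff.mp (List.mem_of_mem_head? hα)
    rw [puncturedCycle_eq, List.mem_filterMap] at hm
    obtain ⟨r, -, hr'⟩ := hm
    obtain ⟨T, rfl, rfl⟩ := puncAt_eq_some.mp hr'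
    have h2 : Arrow.puncO T ∈ (σ.puncList T.r 0 n).head? := by
      have hn : 1 ≤ n := NeZero.one_le
      rw [← puncList_append (Nat.zero_le 1) hn, puncList_succ]
      rfl
    rw [eq_of_isRotated_of_head nodup_puncturedCycle hr (puncList_isRotated T.r) hα h2,
      path_puncturedCycle]
    rfl

/-- The big cycle of a side in the sense of products of outer paths is the component of `bigSum`. -/
theorem bigCycle_eq (k : Fin n) : σ.bigCycle K k = σ.e K (σ.sideVertex k) * bigSum K σ := by
  have key : ∀ m, ((List.range (m + 1)).map fun j => σ.outer K (shift (k + 1) j)).prod =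
      xs K σ k (m + 1) := by
    intro m
    induction m with
    | zero =>
      have := xs_sub_one K (σ := σ) (k + 1)
      rw [add_sub_cancel_right] at this
      simp [this]
    | succ m ih =>
      rw [List.range_succ, List.map_append, List.prod_append, ih, List.map_singleton,
        List.prod_singleton, xs_mul_outer K (shift_succ' _ _)]
  have hn : n - 1 + 1 = n := Nat.sub_add_cancel NeZero.one_le
  have hkey := key (n - 1)
  rw [hn] at hkey
  rw [e_mul_bigSum, bigAt_side, ← hkey, bigCycle, List.range_eq_range']
  have h0 := finRange_rotate (0 : Fin n)
  rw [Fin.val_zero, List.drop_zero, List.take_zero, List.append_nil] at h0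
  rw [h0, List.map_map]
  congr 2
  funext j
  simp [shift]

end TaggedTriangulation

/-! ### Representations by matrices with entries in a commutative ring -/

namespace IceQuiver

variable {V A : Type*} [Fintype V] [DecidableEq V] (K : Type*) [Field K] (Q : IceQuiver V A)
  {B : Type*} [CommRing B] [Algebra K B]

/-- The representation of the path algebra by matrices which sends each arrow to a multiple of a
matrix unit. -/
def pathRep (val : A → B) : PathAlgebra K Q →ₐ[K] Matrix V V B :=
  RingQuot.liftAlgHom K ⟨FreeAlgebra.lift K (Sum.elim (fun v => Matrix.single v v 1)
    fun a => Matrix.single (Q.src a) (Q.tgt a) (val a)), by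
      intro x y h
      cases h with
      | idem v => simp
      | orth v w h => simp [Matrix.single_mul_single_of_ne, h]
      | one =>
        simp only [map_sum, FreeAlgebra.lift_ι_apply, Sum.elim_inl, map_one]
        exact Matrix.sum_single_one
      | src_mul a => simp
      | mul_tgt a => simp⟩

theorem pathRep_vertex (val : A → B) (v : V) :
    pathRep K Q val (pathVertex K Q v) = Matrix.single v v 1 := by
  unfold pathRep pathVertex toPathAlgebra
  exact (RingQuot.liftAlgHom_mkAlgHom_apply _ _ _ _).trans (by simp)

theorem pathRep_arrow (val : A → B) (a : A) :
    pathRep K Q val (pathArrow K Q a) = Matrix.single (Q.src a) (Q.tgt a) (val a) := by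
  unfold pathRep pathArrow toPathAlgebra
  exact (RingQuot.liftAlgHom_mkAlgHom_apply _ _ _ _).trans (by simp)

variable {K}

/-- The representation of the frozen Jacobian algebra by matrices given by a representation of the
path algebra which satisfies the relations. -/
def jacobianRep {W : List A →₀ K} {val : A → B}
    (h : ∀ a, (Q.src a ∉ Q.frozen ∨ Q.tgt a ∉ Q.frozen) →
      pathRep K Q val (cyclicDeriv Q a W) = 0) : FrozenJacobian Q W →ₐ[K] Matrix V V B :=
  RingQuot.liftAlgHom K ⟨pathRep K Q val, by
    rintro x y ⟨a, ha, rfl, rfl⟩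
    rw [h a ha, map_zero]⟩

theorem jacobianRep_apply {W : List A →₀ K} {val : A → B}
    (h : ∀ a, (Q.src a ∉ Q.frozen ∨ Q.tgt a ∉ Q.frozen) →
      pathRep K Q val (cyclicDeriv Q a W) = 0) (x : PathAlgebra K Q) :
    jacobianRep Q h (toJacobian Q W x) = pathRep K Q val x :=
  RingQuot.liftAlgHom_mkAlgHom_apply _ _ _ _

end IceQuiver

namespace TaggedTriangulation

open IceQuiver

set_option linter.unusedSectionVars false

variable {n : ℕ} [NeZero n] [n.AtLeastTwo] {σ : TaggedTriangulation n} (K : Type*) [Field K]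

/-! ### The values of the arrows -/

theorem single_eq_mul {V B : Type*} [Fintype V] [DecidableEq V] [CommRing B] (i j : V) (x : B) :
    Matrix.single i j x = Matrix.single i j x * Matrix.single j j 1 := by
  rw [Matrix.single_mul_single_same, mul_one]

/-- Powers of `u` are collected on the left. -/
theorem u_mul_u_mul (a b : ℤ) (x y : BigR K n) :
    BigR.u K n a * x * (BigR.u K n b * y) = BigR.u K n (a + b) * (x * y) := by
  rw [BigR.u_add]
  ring

/-- The value of a rotation around a vertex of the polygon from position `p` to position `q`, given
the value `ω` of crossing the position of the puncture. -/
def wt (ω : BigR K n) (p q : ℕ) : BigR K n :=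
  BigR.u K n (q - p) * if p ≤ n ∧ n ≤ q ∧ p < q then ω else 1

/-- The values of the arrows, which depend on an idempotent `ω`: a power of `u`, the exponent of
which measures the angle swept by the arrow, times `ω` for the arrows which meet the ray through the
puncture. The arrows at the notched arc of a digon take the complementary idempotent. -/
def val (ω : BigR K n) : σ.Arrow → BigR K n
  | .ext _ _ => BigR.u K n 2
  | .puncO T => BigR.u K n (2 * ccw T.r T.s) * ω
  | .alpha D => BigR.u K n (ccw D.s D.r) * (1 - ω)
  | .beta D => BigR.u K n (ccw D.r D.s) * (1 - ω)
  | .triR T => wt K ω (ccw T.r T.s) (ccw T.r T.t)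
  | .triS T => wt K ω (ccw T.s T.t) (n + ccw T.s T.r)
  | .triT T => wt K ω (n + ccw T.t T.r) (n + ccw T.t T.s)
  | .puncR T => wt K ω (ccw T.r T.s) n
  | .puncS T => wt K ω n (n + ccw T.s T.r)
  | .eta D => wt K ω (ccw D.s D.r) (n + ccw D.s D.r)
  | .gamma D => wt K ω (ccw D.r D.s) n
  | .delta D => wt K ω n (n + ccw D.r D.s)

variable {K} {ω : BigR K n} (hω : ω * ω = ω)

theorem wt_self (p : ℕ) : wt K ω p p = 1 := by
  unfold wt
  rw [if_neg (by omega), sub_self, BigR.u_zero, one_mul]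

theorem wt_cross {p q : ℕ} (h1 : p ≤ n) (h2 : n ≤ q) (h3 : p < q) :
    wt K ω p q = BigR.u K n (q - p) * ω := by
  unfold wt
  rw [if_pos ⟨h1, h2, h3⟩]

theorem wt_low {p q : ℕ} (h1 : q < n) : wt K ω p q = BigR.u K n (q - p) * 1 := by
  unfold wt
  rw [if_neg (by omega)]

theorem wt_high {p q : ℕ} (h1 : n < p) : wt K ω p q = BigR.u K n (q - p) * 1 := by
  unfold wt
  rw [if_neg (by omega)]

include hω in
/-- Weights are multiplicative, as `ω` is idempotent. -/
theorem wt_mul_wt {p q r : ℕ} (h1 : p ≤ q) (h2 : q ≤ r) :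
    wt K ω p q * wt K ω q r = wt K ω p r := by
  rcases h1.eq_or_lt with rfl | h1
  · rw [wt_self, one_mul]
  rcases h2.eq_or_lt with rfl | h2
  · rw [wt_self, mul_one]
  unfold wt
  rw [u_mul_u_mul]
  congr 1
  · congr 1
    ring
  · split_ifs <;> first | omega | simp

theorem val_corner {α : σ.Arrow} {k : Fin n} {p : ℕ} (h : σ.corner α = some (k, p)) :
    val K ω α = wt K ω p (σ.cornerEnd α) := by
  cases α <;> simp only [corner, reduceCtorEq, Option.some.injEq, Prod.mk.injEq] at h <;>
    obtain ⟨rfl, rfl⟩ := h <;> rfl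

variable (K) in
/-- The representation of the path algebra with the values of the arrows. -/
abbrev rho (σ : TaggedTriangulation n) (ω : BigR K n) :
    σ.PA K →ₐ[K] Matrix σ.Vertex σ.Vertex (BigR K n) :=
  pathRep K σ.quiver (val K ω)

theorem rho_arrow (α : σ.Arrow) : rho K σ ω (pathArrow K σ.quiver α) =
    Matrix.single (σ.src α) (σ.tgt α) (val K ω α) :=
  pathRep_arrow K σ.quiver _ α

theorem rho_vertex (c : σ.Vertex) : rho K σ ω (pathVertex K σ.quiver c) = Matrix.single c c 1 :=
  pathRep_vertex K σ.quiver _ c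

include hω in
/-- The value of a rotation around a vertex. -/
theorem single_mul_rho_segP {k : Fin n} {p q : ℕ} {c c' : σ.Vertex} (h : σ.At k p c)
    (h' : σ.At k q c') (hpq : p ≤ q) :
    Matrix.single c c 1 * rho K σ ω (segP K σ k p q) = Matrix.single c c' (wt K ω p q) := by
  induction hd : q - p using Nat.strong_induction_on generalizing p c with
  | _ d ih =>
    rcases hpq.eq_or_lt with rfl | hlt
    · rw [h.eq h', wt_self]
      simp [segP, segList]
    · obtain ⟨α, hα, rfl⟩ := h.exists_corner (by have := h'.lt; omega)
      obtain ⟨-, h2, h3, h4⟩ := corner_spec hα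
      have h5 : σ.cornerEnd α ≤ q := by
        by_contra! h5
        exact h4 _ _ hlt h5 h'
      have h6 := ih _ (by omega) h2 h5 rfl
      have h7 : segP K σ k p q = pathArrow K σ.quiver α * segP K σ k (σ.cornerEnd α) q := by
        unfold segP
        rw [← segList_append h3.le h5, segList_corner hα]
        rfl
      have h8 : rho K σ ω (pathArrow K σ.quiver α) =
          rho K σ ω (pathArrow K σ.quiver α) * Matrix.single (σ.tgt α) (σ.tgt α) 1 := by
        rw [rho_arrow]
        simp
      rw [h7, map_mul, h8, mul_assoc, h6, rho_arrow, val_corner hα, ← mul_assoc]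
      simp [wt_mul_wt hω h3.le h5]

include hω in
/-- The values satisfy the Jacobian relations at the corners. -/
theorem rho_compl {α : σ.Arrow} {k : Fin n} {p : ℕ} (h : σ.corner α = some (k, p)) :
    rho K σ ω (σ.compl K α) = Matrix.single (σ.tgt α) (σ.src α)
      (wt K ω (σ.cornerEnd α) (2 * n - 1) * (BigR.u K n 2 * 1) * wt K ω 1 p) := by
  have hn : 2 ≤ n := Nat.AtLeastTwo.prop
  have hs : ∀ (x y z : σ.Vertex) (a b c : BigR K n), a * b = c →
      Matrix.single x y a * Matrix.single y z b = Matrix.single x z c := by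
    rintro x y z a b c rfl
    simp
  have b1 : ∀ r s : Fin n, ccw r s < n := ccw_lt
  cases α <;> simp only [corner, reduceCtorEq, Option.some.injEq, Prod.mk.injEq] at h <;>
    obtain ⟨rfl, rfl⟩ := h <;> simp only [compl, map_mul, map_add, rho_arrow]
  case triR T =>
    have a1 := ccw_rel T.r T.s T.t
    have a2 := ccw_add_ccw (ne_of_chord_mem T.mem_rt)
    have a3 := ccw_add_ccw (ne_of_chord_mem T.mem_st)
    have a4 := ccw_add_ccw (ne_of_chord_mem T.mem_rs)
    have a5 := T.lt
    have a6 := T.pos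
    have c1 := b1 T.r T.t
    have c2 := b1 T.s T.t
    refine hs _ _ _ _ _ _ ?_
    simp only [val, cornerEnd]
    rw [wt_high (by omega), wt_cross (by omega) (by omega) (by omega),
      wt_cross (p := ccw T.r T.t) (by omega) (by omega) (by omega), wt_low (by omega)]
    simp only [u_mul_u_mul]
    simp only [mul_one, one_mul]
    congr 2
    omega
  case triS T =>
    have a1 := ccw_rel T.r T.s T.t
    have a2 := ccw_add_ccw (ne_of_chord_mem T.mem_rt)
    have a3 := ccw_add_ccw (ne_of_chord_mem T.mem_st)
    have a4 := ccw_add_ccw (ne_of_chord_mem T.mem_rs)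
    have a5 := T.lt
    have a6 := T.pos
    have c1 := b1 T.r T.t
    have c2 := b1 T.s T.t
    refine hs _ _ _ _ _ _ ?_
    simp only [val, cornerEnd]
    rw [wt_low (by omega), wt_high (by omega), wt_high (by omega), wt_low (by omega)]
    simp only [u_mul_u_mul]
    simp only [mul_one]
    congr 1
    omega
  case triT T =>
    have a1 := ccw_rel T.r T.s T.t
    have a2 := ccw_add_ccw (ne_of_chord_mem T.mem_rt)
    have a3 := ccw_add_ccw (ne_of_chord_mem T.mem_st)
    have a4 := ccw_add_ccw (ne_of_chord_mem T.mem_rs)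
    have a5 := T.lt
    have a6 := T.pos
    have c1 := b1 T.r T.t
    have c2 := b1 T.s T.t
    refine hs _ _ _ _ _ _ ?_
    simp only [val, cornerEnd]
    rw [wt_cross (by omega) (by omega) (by omega), wt_low (by omega), wt_high (by omega),
      wt_cross (by omega) (by omega) (by omega)]
    simp only [u_mul_u_mul]
    simp only [mul_one, one_mul]
    congr 2
    omega
  case puncR T =>
    have a4 := ccw_add_ccw T.ne
    have a6 := ccw_pos T.ne
    have a7 := ccw_pos T.ne.symm
    refine hs _ _ _ _ _ _ ?_
    simp only [val, cornerEnd]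
    rw [wt_cross (by omega) (by omega) (by omega), wt_cross (by omega) (by omega) (by omega),
      wt_low (by omega)]
    simp only [u_mul_u_mul]
    simp only [mul_one, hω]
    congr 2
    omega
  case puncS T =>
    have a4 := ccw_add_ccw T.ne
    have a6 := ccw_pos T.ne
    have a7 := ccw_pos T.ne.symm
    refine hs _ _ _ _ _ _ ?_
    simp only [val, cornerEnd]
    rw [wt_cross (by omega) (by omega) (by omega),
      wt_cross (p := 1) (by omega) (by omega) (by omega), wt_high (by omega)]
    simp only [u_mul_u_mul]
    simp only [mul_one, one_mul, hω]
    congr 2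
    omega
  case gamma D =>
    have a4 := ccw_add_ccw D.ne
    have a6 := ccw_pos D.ne
    have a7 := ccw_pos D.ne.symm
    refine hs _ _ _ _ _ _ ?_
    simp only [val, cornerEnd]
    rw [wt_cross (by omega) (by omega) (by omega),
      wt_cross (p := ccw D.s D.r) (by omega) (by omega) (by omega),
      wt_cross (by omega) (by omega) (by omega), wt_low (by omega)]
    simp only [u_mul_u_mul]
    simp only [mul_one, hω]
    congr 2
    omega
  case delta D =>
    have a4 := ccw_add_ccw D.ne
    have a6 := ccw_pos D.ne
    have a7 := ccw_pos D.ne.symm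
    refine hs _ _ _ _ _ _ ?_
    simp only [val, cornerEnd]
    rw [wt_cross (by omega) (by omega) (by omega),
      wt_cross (p := ccw D.r D.s) (by omega) (by omega) (by omega),
      wt_cross (p := 1) (by omega) (by omega) (by omega), wt_high (by omega)]
    simp only [u_mul_u_mul]
    simp only [mul_one, one_mul, hω]
    congr 2
    omega
  -- Inside the digon, the contributions of the plain and of the notched arc add up to
  -- `ω + (1 - ω) = 1`.
  case eta D =>
    have a4 := ccw_add_ccw D.ne
    have a6 := ccw_pos D.ne
    have a7 := ccw_pos D.ne.symm
    have hω' : (1 - ω) * (1 - ω) = 1 - ω := by linear_combination hω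
    refine (congrArg₂ (· + ·) (hs _ _ _ _ _ _ rfl) (hs _ _ _ _ _ _ rfl)).trans ?_
    refine (Matrix.single_add _ _ _ _).symm.trans ?_
    refine congrArg (Matrix.single _ _) ?_
    simp only [val, cornerEnd]
    rw [wt_cross (by omega) (by omega) (by omega), wt_cross (by omega) (by omega) (by omega),
      wt_high (by omega), wt_low (by omega)]
    simp only [u_mul_u_mul]
    simp only [mul_one, hω, hω']
    rw [show ((n : ℕ) : ℤ) - (ccw D.r D.s : ℕ) + (((n + ccw D.r D.s : ℕ) : ℤ) - (n : ℕ)) =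
      (ccw D.s D.r : ℤ) + ccw D.r D.s by omega, ← mul_add, sub_add_cancel, mul_one]
    congr 1
    omega

/-- No arc to the puncture lies strictly between those of a triangle. -/
theorem puncList_one (T : σ.PunctureTriangle) : σ.puncList T.r 1 (ccw T.r T.s) = [] := by
  rw [List.eq_nil_iff_forall_not_mem]
  intro α hα
  obtain ⟨x, h1, h2, T', h3, -⟩ := mem_puncList.mp hα
  have := not_spoke_crossing T.mem_rs T'.mem_r
  have h4 := ccw_lt T.r T.s
  rw [h3, ccw_shift _ (by omega)] at this
  omega

theorem PunctureTriangle.spoke_eq {T T' : σ.PunctureTriangle} (h : T'.r = T.s) :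
    (⟨spoke T.s T.tag, T.mem_s⟩ : σ.Vertex) = ⟨spoke T'.r T'.tag, T'.mem_r⟩ := by
  have h1 := tag_eq T'.mem_s T.mem_s (fun h' => T'.ne (h.trans h'.symm))
  simp only [h, h1]

include hω in
/-- The value of a path around the puncture. -/
theorem single_mul_rho_puncList (T T' : σ.PunctureTriangle) (m : ℕ) (hm : 0 < m)
    (h : T'.r = shift T.r m) :
    Matrix.single ⟨spoke T.r T.tag, T.mem_r⟩ ⟨spoke T.r T.tag, T.mem_r⟩ 1 *
        rho K σ ω (pathWord K σ.quiver (σ.puncList T.r 0 m)) =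
      Matrix.single ⟨spoke T.r T.tag, T.mem_r⟩ ⟨spoke T'.r T'.tag, T'.mem_r⟩
        (BigR.u K n (2 * m) * ω) := by
  induction m using Nat.strong_induction_on generalizing T with
  | _ m ih =>
    have h1 := ccw_le_of_r_eq T hm h
    have h0 := ccw_pos T.ne
    obtain ⟨T'', hT''⟩ := T.exists_next
    have hs : shift T.r (ccw T.r T.s) = T''.r := by rw [shift_ccw, hT'']
    have hv := PunctureTriangle.spoke_eq hT''
    have h2 : σ.puncList T.r 0 m =
        .puncO T :: σ.puncList T''.r 0 (m - ccw T.r T.s) := by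
      rw [← hs, puncList_shift, add_zero, Nat.add_sub_cancel' h1,
        ← puncList_append (Nat.zero_le 1) (by omega : 1 ≤ m), puncList_succ,
        ← puncList_append h0 h1, puncList_one]
      rfl
    have h3 : rho K σ ω (pathArrow K σ.quiver (.puncO T)) =
        Matrix.single ⟨spoke T.r T.tag, T.mem_r⟩ ⟨spoke T''.r T''.tag, T''.mem_r⟩
          (BigR.u K n (2 * ccw T.r T.s) * ω) := by
      rw [rho_arrow, ← hv]
      rfl
    rw [h2, pathWord_cons, map_mul, h3, ← mul_assoc, Matrix.single_mul_single_same, one_mul]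
    rcases h1.eq_or_lt with h1 | h1
    · obtain rfl : T' = T'' := PunctureTriangle.eq_of_r_eq (by rw [h, ← hs, h1])
      rw [h1]
      simp [puncList]
    · have h4 := ih (m - ccw T.r T.s) (by omega) T'' (by omega)
        (by rw [h, ← hs, shift_shift, Nat.add_sub_cancel' h1.le])
      have h5 := single_eq_mul (⟨spoke T.r T.tag, T.mem_r⟩ : σ.Vertex)
        (⟨spoke T''.r T''.tag, T''.mem_r⟩ : σ.Vertex) (BigR.u K n (2 * ccw T.r T.s) * ω)
      rw [h5, mul_assoc, h4, Matrix.single_mul_single_same, u_mul_u_mul, hω]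
      congr 3
      omega

include hω in
/-- The values of the arrows satisfy the Jacobian relations. -/
theorem rho_cyclicDeriv (α : σ.Arrow)
    (hα : σ.quiver.src α ∉ σ.quiver.frozen ∨ σ.quiver.tgt α ∉ σ.quiver.frozen) :
    rho K σ ω (cyclicDeriv σ.quiver α (σ.potential K)) = 0 := by
  have hω' : (1 - ω) * ω = 0 := by linear_combination -hω
  have hω'' : ω * (1 - ω) = 0 := by linear_combination -hω
  have key : ∀ {k p}, σ.corner α = some (k, p) →
      rho K σ ω (cyclicDeriv σ.quiver α (σ.potential K)) = 0 := by
    intro k p h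
    obtain ⟨h1, h2, h3, h4⟩ := corner_spec h
    have hlt := h2.lt_of_ne
    have hlt1 := h1.lt_of_ne
    -- Without an arc at `k`, the corner has both its ends frozen and there is no relation.
    have hk : σ.HasArcAt k := by
      rw [hasArcAt_iff]
      by_contra! hno
      have a1 : p = 1 := by
        by_contra hp
        exact hno p _ (by omega) (by omega) h1
      have a2 : σ.cornerEnd α = 2 * n - 1 := by
        by_contra hp
        exact hno _ _ (by omega) (by omega) h2
      have e1 := h1.eq (a1 ▸ at_side k)
      have e2 := h2.eq (a2 ▸ at_side_sub_one k)
      rcases hα with hα | hα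
      · exact hα ⟨k, e1.symm⟩
      · exact hα ⟨k - 1, e2.symm⟩
    have e1 : rho K σ ω (pathWord K σ.quiver (σ.segList k (σ.cornerEnd α) (2 * n))) =
        rho K σ ω (segP K σ k (σ.cornerEnd α) (2 * n - 1)) := by
      have : σ.segList k (2 * n - 1) (2 * n) = [] := by
        rw [List.eq_nil_iff_forall_not_mem]
        intro α hα
        obtain ⟨x, h1, h2, h3⟩ := mem_segList.mp hα
        obtain ⟨-, h4, h5, -⟩ := corner_spec h3
        have := h4.lt_of_ne
        omega
      rw [segP, ← segList_append hlt.2 (Nat.sub_le _ 1), this, List.append_nil]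
    have e2 : rho K σ ω (pathWord K σ.quiver (σ.segList k 0 p)) =
        rho K σ ω (segP K σ k 1 p) := by
      rw [segP, ← segList_append (Nat.zero_le 1) hlt1.1, segList_eq_nil (p := 0), List.nil_append]
      intro x _ hx c hc
      have := hc.pos
      omega
    have e3 : rho K σ ω (pathArrow K σ.quiver (.ext k hk)) =
        Matrix.single (σ.sideVertex (k - 1)) (σ.sideVertex k) (BigR.u K n 2) *
        Matrix.single (σ.sideVertex k) (σ.sideVertex k) 1 := by
      rw [rho_arrow, Matrix.single_mul_single_same, mul_one]
      rfl
    have e4 : Matrix.single (σ.tgt α) (σ.tgt α) 1 *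
        (rho K σ ω (segP K σ k (σ.cornerEnd α) (2 * n - 1)) *
          (Matrix.single (σ.sideVertex (k - 1)) (σ.sideVertex k) (BigR.u K n 2) *
        Matrix.single (σ.sideVertex k) (σ.sideVertex k) 1) * rho K σ ω (segP K σ k 1 p)) =
        (Matrix.single (σ.tgt α) (σ.tgt α) 1 *
          rho K σ ω (segP K σ k (σ.cornerEnd α) (2 * n - 1))) *
        Matrix.single (σ.sideVertex (k - 1)) (σ.sideVertex k) (BigR.u K n 2) *
        (Matrix.single (σ.sideVertex k) (σ.sideVertex k) 1 * rho K σ ω (segP K σ k 1 p)) := by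
      simp only [mul_assoc]
    rw [cyclicDeriv_corner K h hk, map_mul, map_sub, rho_compl hω h, rho_vertex, mul_sub, map_mul,
      map_mul, e1, e2, e3, e4, single_mul_rho_segP hω (at_side k) h1 hlt1.1,
      single_mul_rho_segP hω h2 (at_side_sub_one k) hlt.2]
    simp
  cases α with
  | ext k h =>
    rcases hα with hα | hα
    · exact absurd ⟨_, rfl⟩ hα
    · exact absurd ⟨_, rfl⟩ hα
  -- The relations at `α` and `β` hold because `ω` and `1 - ω` are orthogonal.
  | alpha D =>
    rw [cyclicDeriv_alpha_beta K D (.inl rfl), map_mul]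
    have : rho K σ ω (σ.compl K (.alpha D)) = 0 := by
      simp only [compl, map_mul, rho_arrow, val]
      rw [wt_cross (ccw_lt _ _).le (Nat.le_add_right _ _) (by have := ccw_lt D.s D.r; omega)]
      refine (Matrix.single_mul_single_same _ _ _ _ _).trans ?_
      rw [u_mul_u_mul, hω', mul_zero, Matrix.single_zero]
    rw [this, mul_zero]
  | beta D =>
    rw [cyclicDeriv_alpha_beta K D (.inr rfl), map_mul]
    have : rho K σ ω (σ.compl K (.beta D)) = 0 := by
      simp only [compl, map_mul, rho_arrow, val]
      rw [wt_cross (ccw_lt _ _).le (Nat.le_add_right _ _) (by have := ccw_lt D.s D.r; omega)]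
      refine (Matrix.single_mul_single_same _ _ _ _ _).trans ?_
      rw [u_mul_u_mul, hω'', mul_zero, Matrix.single_zero]
    rw [this, mul_zero]
  | puncO T =>
    obtain ⟨T'', hT''⟩ := T.exists_next
    have h0 := ccw_pos T.ne
    have h0' := ccw_pos T.ne.symm
    have h1 := ccw_add_ccw T.ne
    have hs : shift T.r (ccw T.r T.s) = T''.r := by rw [shift_ccw, hT'']
    have hv := PunctureTriangle.spoke_eq hT''
    have h2 : σ.puncList T.r 1 n = σ.puncList T''.r 0 (ccw T.s T.r) := by
      rw [← hs, puncList_shift, add_zero, h1, ← puncList_append h0 (ccw_lt _ _).le, puncList_one,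
        List.nil_append]
    -- The rest of the cycle around the puncture has value `u ^ (2 * ccw T.s T.r) * ω`.
    have h3 := single_mul_rho_puncList hω T'' T (ccw T.s T.r) h0' (by rw [hT'', shift_ccw])
    have h4 : σ.tgt (.puncO T) = ⟨spoke T''.r T''.tag, T''.mem_r⟩ := hv
    rw [cyclicDeriv_puncO, map_mul, map_sub, rho_vertex, mul_sub, h2, h4, h3, sub_eq_zero, ← hv]
    simp only [compl, map_mul, rho_arrow, val]
    rw [wt_cross le_rfl (Nat.le_add_right _ _) (by omega),
      wt_cross (ccw_lt _ _).le le_rfl (ccw_lt _ _)]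
    refine (congrArg _ (Matrix.single_mul_single_same _ _ _ _ _)).trans ?_
    refine (Matrix.single_mul_single_same _ _ _ _ _).trans ?_
    rw [u_mul_u_mul, hω, one_mul]
    congr 3
    omega
  | _ => exact key rfl

end TaggedTriangulation

/-! ### The coefficient rings -/

section Coefficients

variable (K : Type*) [Field K] (n : ℕ)

/-- The idempotent `u⁻¹ v`. -/
def eps : BigR K n := BigR.u K n (-1) * BigR.v K n

theorem eps_mul_eps : eps K n * eps K n = eps K n := by
  unfold eps
  have h := BigR.v_mul_v K n
  have h2 : BigR.u K n (-1) * BigR.u K n 1 = 1 := by rw [← BigR.u_add, neg_add_cancel, BigR.u_zero]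
  linear_combination BigR.u K n (-1) ^ 2 * h + BigR.u K n (-1) * BigR.v K n * h2

theorem u_mul_eps (m : ℤ) : BigR.u K n m * eps K n = BigR.u K n (m - 1) * BigR.v K n := by
  unfold eps
  rw [← mul_assoc, ← BigR.u_add]
  rfl

theorem v_pow_eq {m : ℕ} (hm : 0 < m) : BigR.v K n ^ m = BigR.u K n m * eps K n := by
  obtain ⟨m, rfl⟩ := Nat.exists_eq_succ_of_ne_zero hm.ne'
  rw [Nat.succ_eq_add_one, BigR.v_pow, u_mul_eps]
  congr 2
  push_cast
  ring

theorem u_mul_one_sub_eps (m : ℤ) :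
    BigR.u K n m * (1 - eps K n) = BigR.u K n (m - 1) * (BigR.u K n 1 - BigR.v K n) := by
  rw [mul_sub, mul_sub, u_mul_eps, ← BigR.u_add, mul_one, sub_add_cancel]

/-- The two components of `K[u^{±1}, v] / (v u - v²)`: `v ↦ 0` and `v ↦ u`. -/
def component (b : Bool) : BigR K n →+* LaurentPolynomial K :=
  AdjoinRoot.lift (RingHom.id _) (if b then LaurentPolynomial.T 1 else 0) <| by
    rw [eval₂_mul, eval₂_sub, eval₂_X, eval₂_C]
    cases b <;> simp

theorem component_u (b : Bool) (m : ℤ) : component K n b (BigR.u K n m) = LaurentPolynomial.T m :=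
  AdjoinRoot.lift_of _

theorem component_eps (b : Bool) : component K n b (eps K n) = if b then 1 else 0 := by
  have h : component K n b (BigR.v K n) = if b then LaurentPolynomial.T 1 else 0 :=
    AdjoinRoot.lift_root _
  unfold eps
  rw [map_mul, h, component_u]
  cases b
  · simp
  · simp only [if_true]
    rw [← LaurentPolynomial.T_add, neg_add_cancel, LaurentPolynomial.T_zero]

theorem component_ofPoly (b : Bool) (f : K[X]) :
    component K n b (BigR.ofPoly K n f) = toLaurent (expand K (2 * n) f) := by
  have hC : ∀ a : K, component K n b (algebraMap K _ a) = LaurentPolynomial.C a := fun a =>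
    AdjoinRoot.lift_of _
  induction f using Polynomial.induction_on' with
  | add p q hp hq => simp [hp, hq]
  | monomial m a =>
    unfold BigR.ofPoly
    rw [aeval_monomial, map_mul, map_pow, component_u, hC, expand_monomial, toLaurent_C_mul_T,
      LaurentPolynomial.T_pow]
    push_cast
    ring_nf

variable {K n}

theorem eq_zero_of_component {b : Bool} [NeZero n] {f : K[X]} {m : ℤ}
    (h : component K n b (BigR.ofPoly K n f * BigR.u K n m) = 0) : f = 0 := by
  rw [map_mul, component_u, component_ofPoly] at h
  have h1 : toLaurent (expand K (2 * n) f) = 0 := by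
    have := congrArg (· * LaurentPolynomial.T (-m)) h
    rwa [mul_assoc, ← LaurentPolynomial.T_add, add_neg_cancel, LaurentPolynomial.T_zero, mul_one,
      zero_mul] at this
  have h2 := (map_eq_zero_iff _ toLaurent_injective).mp h1
  exact (map_eq_zero_iff _ (expand_injective (by have := NeZero.pos n; omega))).mp h2

/-- The values of the two possible windings around the puncture: the two nontrivial idempotents. -/
def IsWinding (ω : BigR K n) : Prop := ω = eps K n ∨ ω = 1 - eps K n

theorem IsWinding.mul_self {ω : BigR K n} (h : IsWinding ω) : ω * ω = ω := by
  have h0 := eps_mul_eps K n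
  rcases h with rfl | rfl
  · exact h0
  · linear_combination h0

theorem IsWinding.one_sub {ω : BigR K n} (h : IsWinding ω) : IsWinding (1 - ω) := by
  rcases h with rfl | rfl
  · exact .inr rfl
  · exact .inl (sub_sub_cancel _ _)

/-- A winding vanishes in one component and is one in the other. -/
theorem IsWinding.exists_component {ω : BigR K n} (h : IsWinding ω) :
    ∃ b, component K n b ω = 0 ∧ component K n (!b) ω = 1 := by
  rcases h with rfl | rfl
  · exact ⟨false, by simp [component_eps], by simp [component_eps]⟩
  · exact ⟨true, by simp [component_eps], by simp [component_eps]⟩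

theorem IsWinding.eq_zero [NeZero n] {ω : BigR K n} (h : IsWinding ω) {f : K[X]} {m : ℤ}
    (hf : BigR.ofPoly K n f * (BigR.u K n m * ω) = 0) : f = 0 := by
  obtain ⟨b, -, hb⟩ := h.exists_component
  refine eq_zero_of_component (n := n) (b := !b) (m := m) ?_
  have := congrArg (component K n (!b)) hf
  rw [← mul_assoc, map_mul, hb, mul_one, map_zero] at this
  exact this

/-- Linear independence over `K[u^{2n}]` of a power of `u` and of a power of `u` times a winding. -/
theorem IsWinding.eq_zero_and_eq_zero [NeZero n] {ω : BigR K n} (h : IsWinding ω) {f g : K[X]}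
    {a b : ℤ} (hfg : BigR.ofPoly K n f * BigR.u K n a
      + BigR.ofPoly K n g * (BigR.u K n b * ω) = 0) : f = 0 ∧ g = 0 := by
  obtain ⟨c, hc, -⟩ := h.exists_component
  have hf : f = 0 := by
    refine eq_zero_of_component (n := n) (b := c) (m := a) ?_
    have := congrArg (component K n c) hfg
    rw [map_add, ← mul_assoc, map_mul _ _ ω, hc, mul_zero, add_zero, map_zero] at this
    exact this
  subst hf
  rw [map_zero, zero_mul, zero_add] at hfg
  exact ⟨rfl, h.eq_zero hfg⟩

/-- `R'` is generated by `1` and `Y` over `K[X]`. -/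
theorem RPrime.exists_eq (r : RPrime K) :
    ∃ f g : K[X], r = AdjoinRoot.of _ f + AdjoinRoot.of _ g * RPrime.y K := by
  have hy : RPrime.y K * RPrime.y K = RPrime.x K * RPrime.y K := RPrime.y_mul_y K
  unfold RPrime.x at hy
  induction r using AdjoinRoot.induction_on with
  | ih p =>
    induction p using Polynomial.induction_on' with
    | add p q hp hq =>
      obtain ⟨f, g, h⟩ := hp
      obtain ⟨f', g', h'⟩ := hq
      exact ⟨f + f', g + g', by rw [map_add, h, h', map_add, map_add]; ring⟩
    | monomial m a =>
      rw [← C_mul_X_pow_eq_monomial, map_mul, map_pow, AdjoinRoot.mk_C, AdjoinRoot.mk_X]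
      change ∃ f g, _ * RPrime.y K ^ m = _
      cases m with
      | zero => exact ⟨a, 0, by simp⟩
      | succ m =>
        refine ⟨0, a * X ^ m, ?_⟩
        have : RPrime.y K ^ (m + 1) = AdjoinRoot.of _ X ^ m * RPrime.y K := by
          induction m with
          | zero => simp
          | succ m ih => rw [pow_succ, ih, mul_assoc, hy]; ring
        rw [this, map_zero, zero_add, map_mul, map_pow]
        ring

theorem incl_of (f : K[X]) : BigR.incl K n (AdjoinRoot.of _ f) = BigR.ofPoly K n f :=
  AdjoinRoot.lift_of _

theorem incl_y [NeZero n] : BigR.incl K n (RPrime.y K) = BigR.u K n (2 * n : ℕ) * eps K n := by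
  rw [← v_pow_eq K n (by have := NeZero.pos n; omega)]
  exact AdjoinRoot.lift_root _

theorem ofPoly_X : BigR.ofPoly K n X = BigR.u K n (2 * n : ℕ) := aeval_X _

theorem incl_x : BigR.incl K n (RPrime.x K) = BigR.u K n (2 * n : ℕ) := by
  unfold RPrime.x
  rw [incl_of, ofPoly_X]

theorem smul_eq (r : RPrime K) (b : BigR K n) : r • b = BigR.incl K n r * b := rfl

variable [NeZero n]

/-- The submodule `u^m R'` in terms of either winding: it is spanned over `K[u^{2n}]` by `u^m` and
`u^{m + 2n} ω`. -/
theorem mem_span_u_iff {ω : BigR K n} (h : IsWinding ω) {m : ℤ} {x : BigR K n} :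
    x ∈ Submodule.span (RPrime K) {BigR.u K n m} ↔
      ∃ f g : K[X], x = BigR.ofPoly K n f * BigR.u K n m
        + BigR.ofPoly K n g * (BigR.u K n (m + (2 * n : ℕ)) * ω) := by
  rw [Submodule.mem_span_singleton]
  constructor
  · rintro ⟨r, rfl⟩
    obtain ⟨f, g, rfl⟩ := RPrime.exists_eq r
    rw [smul_eq, map_add, map_mul, incl_of, incl_of, incl_y]
    rcases h with rfl | rfl
    · refine ⟨f, g, ?_⟩
      rw [BigR.u_add]
      ring
    · refine ⟨f + g * X, -g, ?_⟩
      rw [BigR.u_add, map_add, map_mul, map_neg, ofPoly_X]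
      ring
  · rintro ⟨f, g, rfl⟩
    rcases h with rfl | rfl
    · refine ⟨AdjoinRoot.of _ f + AdjoinRoot.of _ g * RPrime.y K, ?_⟩
      rw [smul_eq, map_add, map_mul, incl_of, incl_of, incl_y, BigR.u_add]
      ring
    · refine ⟨AdjoinRoot.of _ (f + g * X) - AdjoinRoot.of _ g * RPrime.y K, ?_⟩
      rw [smul_eq, map_sub, map_mul, incl_of, incl_of, incl_y, map_add, map_mul, ofPoly_X,
        BigR.u_add]
      ring

/-- On the part cut out by a winding, `R'` acts through `K[u^{2n}]`. -/
theorem mem_span_winding_iff {ω : BigR K n} (h : IsWinding ω) {m : ℤ} {x : BigR K n} :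
    x ∈ Submodule.span (RPrime K) {BigR.u K n m * ω} ↔
      ∃ f : K[X], x = BigR.ofPoly K n f * (BigR.u K n m * ω) := by
  have h0 := eps_mul_eps K n
  rw [Submodule.mem_span_singleton]
  constructor
  · rintro ⟨r, rfl⟩
    obtain ⟨f, g, rfl⟩ := RPrime.exists_eq r
    rw [smul_eq, map_add, map_mul, incl_of, incl_of, incl_y]
    rcases h with rfl | rfl
    · refine ⟨f + g * X, ?_⟩
      rw [map_add, map_mul, ofPoly_X]
      linear_combination BigR.ofPoly K n g * BigR.u K n (2 * n : ℕ) * BigR.u K n m * h0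
    · refine ⟨f, ?_⟩
      linear_combination -BigR.ofPoly K n g * BigR.u K n (2 * n : ℕ) * BigR.u K n m * h0
  · rintro ⟨f, rfl⟩
    exact ⟨AdjoinRoot.of _ f, by rw [smul_eq, incl_of]⟩

/-- The submodule `u^m R' + v^m R'` for `m > 0`, in terms of either winding: it is spanned over
`K[u^{2n}]` by `u^m` and `u^m ω`. -/
theorem mem_span_u_sup_iff {ω : BigR K n} (h : IsWinding ω) {m : ℤ} {x : BigR K n} :
    x ∈ Submodule.span (RPrime K) {BigR.u K n m}
        ⊔ Submodule.span (RPrime K) {BigR.u K n m * eps K n} ↔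
      ∃ f g : K[X], x = BigR.ofPoly K n f * BigR.u K n m
        + BigR.ofPoly K n g * (BigR.u K n m * ω) := by
  rw [Submodule.mem_sup]
  constructor
  · rintro ⟨y, hy, z, hz, rfl⟩
    obtain ⟨f, g, rfl⟩ := (mem_span_u_iff h).mp hy
    obtain ⟨f', rfl⟩ := (mem_span_winding_iff (.inl rfl)).mp hz
    rcases h with rfl | rfl
    · refine ⟨f, g * X + f', ?_⟩
      rw [map_add, map_mul, ofPoly_X, BigR.u_add]
      ring
    · refine ⟨f + f', g * X - f', ?_⟩
      rw [map_add, map_sub, map_mul, ofPoly_X, BigR.u_add]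
      ring
  · rintro ⟨f, g, rfl⟩
    rcases h with rfl | rfl
    · exact ⟨_, (mem_span_u_iff (.inl rfl)).mpr ⟨f, 0, rfl⟩, _,
        (mem_span_winding_iff (.inl rfl)).mpr ⟨g, rfl⟩, by simp⟩
    · refine ⟨_, (mem_span_u_iff (.inl rfl)).mpr ⟨f + g, 0, rfl⟩, _,
        (mem_span_winding_iff (.inl rfl)).mpr ⟨-g, rfl⟩, ?_⟩
      rw [map_add, map_neg, map_zero]
      ring

end Coefficients

namespace TaggedTriangulation

open IceQuiver

set_option linter.unusedSectionVars false

variable {n : ℕ} [NeZero n] [n.AtLeastTwo] {σ : TaggedTriangulation n} (K : Type*) [Field K]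

/-! ### The representation of the frozen Jacobian algebra -/

theorem At.chord_cases {k : Fin n} {p : ℕ} {r t : Fin n} {h : chord r t ∈ σ.edges}
    (hA : σ.At k p ⟨chord r t, h⟩) : (k = r ∧ p = ccw r t) ∨ (k = t ∧ p = n + ccw t r) := by
  cases hA with
  | out => exact .inl ⟨rfl, rfl⟩
  | inc => exact .inr ⟨rfl, rfl⟩

theorem At.spoke_cases {k : Fin n} {p : ℕ} {r : Fin n} {τ : Tag} {h : spoke r τ ∈ σ.edges}
    (hA : σ.At k p ⟨spoke r τ, h⟩) :
    k = r ∧ p = n ∧ (τ = .plain ∨ spoke r .plain ∉ σ.edges) := by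
  cases hA with
  | mid h hτ => exact ⟨rfl, rfl, hτ⟩

theorem sideVertex_injective : Function.Injective σ.sideVertex := by
  intro i j h
  simp only [sideVertex, side, Subtype.mk.injEq, chord.injEq] at h
  exact h.1

section Representation

variable {K} {ω : BigR K n} (hω : ω * ω = ω)

/-- The representation of the frozen Jacobian algebra given by the values of the arrows. It need not
be faithful, but it is so on `e_F Γ` when `ω` is a winding. -/
def rep (σ : TaggedTriangulation n) {ω : BigR K n} (hω : ω * ω = ω) :
    σ.Gam K →ₐ[K] Matrix σ.Vertex σ.Vertex (BigR K n) :=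
  jacobianRep σ.quiver (rho_cyclicDeriv hω)

theorem rep_toJacobian (x : σ.PA K) :
    rep σ hω (σ.quiver.toJacobian (σ.potential K) x) = rho K σ ω x :=
  jacobianRep_apply _ _ _

theorem rep_e (c : σ.Vertex) : rep σ hω (σ.e K c) = Matrix.single c c 1 :=
  (rep_toJacobian hω _).trans (rho_vertex c)

theorem rep_arr (α : σ.Arrow) :
    rep σ hω (arr K α) = Matrix.single (σ.src α) (σ.tgt α) (val K ω α) :=
  (rep_toJacobian hω _).trans (rho_arrow α)

theorem rep_S {k : Fin n} {p q : ℕ} {c c' : σ.Vertex} (h : σ.At k p c) (h' : σ.At k q c')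
    (hpq : p ≤ q) :
    Matrix.single c c 1 * rep σ hω (S K σ k p q) = Matrix.single c c' (wt K ω p q) :=
  (congrArg _ (rep_toJacobian hω _)).trans (single_mul_rho_segP hω h h' hpq)

theorem rep_In {k : Fin n} {p : ℕ} {c : σ.Vertex} (h : σ.At k p c) :
    rep σ hω (In K σ k p) = Matrix.single (σ.sideVertex k) c (wt K ω 1 p) := by
  have h1 := h.lt_of_ne
  unfold In
  rw [← S_mul_S K (Nat.zero_le 1) h1.1, S_zero_one, one_mul, map_mul, rep_e,
    rep_S hω (at_side k) h h1.1]

theorem rep_outer (k : Fin n) : rep σ hω (σ.outer K k) =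
    Matrix.single (σ.sideVertex (k - 1)) (σ.sideVertex k) (BigR.u K n 2) := by
  by_cases hk : σ.HasArcAt k
  · rw [outer_eq_arr K hk, rep_arr]
    rfl
  -- Without an external arrow, the outer path is parallel to the only corner at `k`.
  · obtain ⟨α, hα, h1⟩ := (at_side (σ := σ) k).exists_corner
      (by have : 2 ≤ n := Nat.AtLeastTwo.prop
          omega)
    obtain ⟨-, h2, h3⟩ := outer_eq_cmp K hα hk
    have h4 : σ.tgt α = σ.sideVertex (k - 1) :=
      (corner_spec hα).2.1.eq (h2 ▸ at_side_sub_one k)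
    rw [h3]
    refine (rep_toJacobian hω _).trans ?_
    rw [rho_compl hω hα, h2, h1, h4, wt_self, wt_self, one_mul, mul_one, mul_one]

theorem rep_xs (i : Fin n) (m : ℕ) : rep σ hω (xs K σ i m) =
    Matrix.single (σ.sideVertex i) (σ.sideVertex (shift i m)) (BigR.u K n (2 * m)) := by
  induction m with
  | zero =>
    rw [xs, rep_e, shift_zero, Nat.cast_zero, mul_zero, BigR.u_zero]
  | succ m ih =>
    rw [xs, map_mul, ih, rep_outer, shift_succ, add_sub_cancel_right, Matrix.single_mul_single_same,
      ← BigR.u_add]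
    congr 2

theorem rep_xs_mul_In {i k : Fin n} {m p : ℕ} {c : σ.Vertex} (hm : shift i m = k)
    (h : σ.At k p c) : rep σ hω (xs K σ i m * In K σ k p) =
      Matrix.single (σ.sideVertex i) c (BigR.u K n (2 * m) * wt K ω 1 p) := by
  rw [map_mul, rep_xs, rep_In hω h, hm, Matrix.single_mul_single_same]

theorem rep_notchedIn (D : σ.Digon) : rep σ hω (notchedIn K D) =
    Matrix.single (σ.sideVertex D.r) ⟨spoke D.r .notched, D.mem_notched⟩
      (BigR.u K n (n - 1) * (1 - ω)) := by
  have h1 := ccw_add_ccw D.ne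
  have h0 := ccw_pos D.ne
  unfold notchedIn
  rw [map_mul, rep_In hω (.out D.mem_rs), rep_arr, wt_low (ccw_lt _ _)]
  refine (Matrix.single_mul_single_same _ _ _ _ _).trans ?_
  rw [val, u_mul_u_mul, one_mul]
  refine congrArg (Matrix.single _ _) ?_
  congr 2
  omega

end Representation

/-! ### A spanning set of `e_F Γ` -/

variable (σ) in
/-- The paths from the sides of the polygon which follow the boundary and then turn around a vertex
of the polygon. -/
def rowGen : Set (σ.Gam K) :=
  {x | (∃ i m k p c, shift i m = k ∧ σ.At k p c ∧ xs K σ i m * In K σ k p = x) ∨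
    ∃ i m, ∃ D : σ.Digon, shift i m = D.r ∧ xs K σ i m * notchedIn K D = x}

theorem xs_mul_In_mem {i k : Fin n} {m p : ℕ} {c : σ.Vertex} (hm : shift i m = k)
    (h : σ.At k p c) : xs K σ i m * In K σ k p ∈ Submodule.span K (rowGen σ K) :=
  Submodule.subset_span (.inl ⟨i, m, k, p, c, hm, h, rfl⟩)

theorem xs_mul_xs_mul_In_mem {i k k' : Fin n} {m m' p : ℕ} {c : σ.Vertex} (hm : shift i m = k)
    (hm' : shift k m' = k') (h : σ.At k' p c) :
    xs K σ i m * (xs K σ k m' * In K σ k' p) ∈ Submodule.span K (rowGen σ K) := by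
  rw [← mul_assoc, xs_mul_xs K hm]
  exact xs_mul_In_mem K (by rw [← shift_shift, hm, hm']) h

/-- A generating path followed by an arrow: either the arrow continues the rotation, or the rotation
is exchanged for one around the other end of the edge, at the cost of a path along the boundary. -/
theorem xs_mul_In_mul_arr_mem {i k : Fin n} {m p : ℕ} (hm : shift i m = k) (α : σ.Arrow)
    (h : σ.At k p (σ.src α)) :
    xs K σ i m * (In K σ k p * arr K α) ∈ Submodule.span K (rowGen σ K) := by
  have key : σ.corner α = some (k, p) →
      xs K σ i m * (In K σ k p * arr K α) ∈ Submodule.span K (rowGen σ K) := by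
    intro hα
    rw [In_mul_arr K hα]
    exact xs_mul_In_mem K hm (corner_spec hα).2.1
  have hsh : ∀ r s : Fin n, shift r (ccw r s) = s := shift_ccw
  cases α with
  | ext j hj =>
    rw [← outer_eq_arr K hj]
    rcases At.chord_cases h with ⟨rfl, rfl⟩ | ⟨rfl, rfl⟩
    · have := xs_mul_outer K (σ := σ) (i := j - 1) (m := 0) (j := j)
        (by rw [zero_add, shift_one, sub_add_cancel])
      have h1 := xs_mul_xs_mul_In_mem K (σ := σ) hm (k' := j) (m' := 1)
        (by rw [shift_one, sub_add_cancel]) (at_side j)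
      rw [ccw_add_one, In_one]
      rw [In_one, xs_sub_one, outer_mul_e] at h1
      rwa [e_mul_outer]
    · have hc := ccw_add_ccw (ne_of_chord_mem (σ := σ) (side_mem (j - 1)))
      rw [ccw_add_one] at hc
      have hj := sub_add_cancel j 1
      have h1 := xs_mul_xs_mul_In_mem K hm (k' := j - 1 + 1 + 1) (m' := 1)
        (shift_one _) (at_side_sub_one (σ := σ) _)
      have h2 := xs_sub_one K (σ := σ) (j - 1 + 1 + 1)
      rw [add_sub_cancel_right] at h2
      rw [h2, In_last, hj, ← y_mul_outer K j] at h1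
      rwa [show n + ccw (j - 1 + 1) (j - 1) = 2 * n - 1 by omega, In_last, hj]
  | triR T =>
    rcases At.chord_cases h with ⟨rfl, rfl⟩ | ⟨rfl, rfl⟩
    · exact key rfl
    · rw [In_mul_triR]
      exact xs_mul_xs_mul_In_mem K hm (hsh _ _) (.inc T.mem_rt)
  | triS T =>
    rcases At.chord_cases h with ⟨rfl, rfl⟩ | ⟨rfl, rfl⟩
    · exact key rfl
    · rw [In_mul_triS]
      exact xs_mul_xs_mul_In_mem K hm (hsh _ _) (.inc T.mem_rs)
  | triT T =>
    rcases At.chord_cases h with ⟨rfl, rfl⟩ | ⟨rfl, rfl⟩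
    · rw [In_mul_triT]
      exact xs_mul_xs_mul_In_mem K hm (hsh _ _) (.out T.mem_st)
    · exact key rfl
  | puncR T =>
    rcases At.chord_cases h with ⟨rfl, rfl⟩ | ⟨rfl, rfl⟩
    · exact key rfl
    · rw [In_mul_puncR]
      exact xs_mul_xs_mul_In_mem K hm (hsh _ _) T.at_r
  | puncS T =>
    obtain ⟨rfl, rfl, -⟩ := At.spoke_cases h
    exact key rfl
  | puncO T =>
    obtain ⟨rfl, rfl, -⟩ := At.spoke_cases h
    rw [In_mul_puncO]
    exact xs_mul_xs_mul_In_mem K hm (hsh _ _) T.at_s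
  | eta D =>
    rcases At.chord_cases h with ⟨rfl, rfl⟩ | ⟨rfl, rfl⟩
    · exact key rfl
    · rw [In_mul_eta]
      exact xs_mul_xs_mul_In_mem K hm (hsh _ _) (.inc D.mem_rs)
  | gamma D =>
    rcases At.chord_cases h with ⟨rfl, rfl⟩ | ⟨rfl, rfl⟩
    · exact key rfl
    · rw [In_mul_gamma]
      exact xs_mul_xs_mul_In_mem K hm (hsh _ _) (.mid D.mem_plain (.inl rfl))
  | delta D =>
    obtain ⟨rfl, rfl, -⟩ := At.spoke_cases h
    exact key rfl
  | alpha D =>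
    rcases At.chord_cases h with ⟨rfl, rfl⟩ | ⟨rfl, rfl⟩
    · exact Submodule.subset_span (.inr ⟨i, m, D, hm, rfl⟩)
    · rw [In_mul_alpha, mul_zero]
      exact Submodule.zero_mem _
  | beta D =>
    obtain ⟨rfl, rfl, h'⟩ := At.spoke_cases h
    rcases h' with h' | h'
    · cases h'
    · exact absurd D.mem_plain h'

/-- The paths in `rowGen` span `e_F Γ`: their span is stable under right multiplication by arrows.
-/
theorem e_mul_mem_rowSpan (i : Fin n) (x : σ.Gam K) :
    eS K σ i * x ∈ Submodule.span K (rowGen σ K) := by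
  refine mul_mem_of_generators K _ (fun x hx c => ?_) (fun x hx α => ?_) ?_ x
  · induction hx using Submodule.span_induction with
    | zero => rw [zero_mul]; exact Submodule.zero_mem _
    | add a b _ _ ha hb => rw [add_mul]; exact Submodule.add_mem _ ha hb
    | smul r a _ ha => rw [smul_mul_assoc]; exact Submodule.smul_mem _ _ ha
    | mem a ha =>
      obtain ⟨i, m, k, p, c', hm, h, rfl⟩ | ⟨i, m, D, hm, rfl⟩ := ha
      · by_cases hc : c' = c
        · subst hc
          rw [mul_assoc, In_mul_e K h]
          exact xs_mul_In_mem K hm h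
        · rw [mul_assoc, ← In_mul_e K h, mul_assoc, e_mul_of_ne K hc, mul_zero, mul_zero]
          exact Submodule.zero_mem _
      · by_cases hc : (⟨spoke D.r .notched, D.mem_notched⟩ : σ.Vertex) = c
        · subst hc
          rw [mul_assoc, notchedIn_mul_e]
          exact Submodule.subset_span (.inr ⟨i, m, D, hm, rfl⟩)
        · rw [mul_assoc, ← notchedIn_mul_e, mul_assoc, e_mul_of_ne K hc, mul_zero, mul_zero]
          exact Submodule.zero_mem _
  · induction hx using Submodule.span_induction with
    | zero => rw [zero_mul]; exact Submodule.zero_mem _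
    | add a b _ _ ha hb => rw [add_mul]; exact Submodule.add_mem _ ha hb
    | smul r a _ ha => rw [smul_mul_assoc]; exact Submodule.smul_mem _ _ ha
    | mem a ha =>
      obtain ⟨i, m, k, p, c', hm, h, rfl⟩ | ⟨i, m, D, hm, rfl⟩ := ha
      · by_cases hc : c' = σ.src α
        · subst hc
          rw [mul_assoc]
          exact xs_mul_In_mul_arr_mem K hm α h
        · rw [mul_assoc, ← In_mul_e K h, mul_assoc, e_mul_arr_of_ne K hc, mul_zero, mul_zero]
          exact Submodule.zero_mem _
      · by_cases hc : (⟨spoke D.r .notched, D.mem_notched⟩ : σ.Vertex) = σ.src α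
        · have hα : α = .beta D := by
            cases α with
            | beta D' => rw [Subsingleton.elim D' D]
            | puncS T => exact (T.not_digon D).elim
            | puncO T => exact (T.not_digon D).elim
            | ext j hj => simp [src, sideVertex, side] at hc
            | _ => simp [src] at hc
          subst hα
          unfold notchedIn
          rw [mul_assoc, In_mul_alpha_mul_beta, mul_sub]
          exact Submodule.sub_mem _ (xs_mul_xs_mul_In_mem K hm (shift_ccw _ _) (.out D.mem_sr))
            (xs_mul_In_mem K hm (.inc D.mem_sr))
        · rw [mul_assoc, ← notchedIn_mul_e, mul_assoc, e_mul_arr_of_ne K hc, mul_zero, mul_zero]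
          exact Submodule.zero_mem _
  · have := xs_mul_In_mem K (σ := σ) (shift_zero i) (at_side i)
    rwa [In_one, xs, e_mul_self] at this

/-! ### The rows of `e_F Γ` -/

/-- The central element `∑ D_c` of the big cycles. -/
def bigC (σ : TaggedTriangulation n) : Subalgebra.center K (σ.Gam K) :=
  ⟨bigSum K σ, Subalgebra.mem_center_iff.mpr fun x => (bigSum_mul K x).symm⟩

/-- The central element `∑ C_c` of the planar cycles. -/
def planarC (σ : TaggedTriangulation n) : Subalgebra.center K (σ.Gam K) :=
  ⟨planarSum K σ, Subalgebra.mem_center_iff.mpr fun x => (planarSum_mul K x).symm⟩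

variable {K}

/-- The value of a polynomial at the sum of the big cycles; this makes `Γ` an algebra over `K[X]`.
-/
def cp (σ : TaggedTriangulation n) (f : K[X]) : σ.Gam K := (aeval (bigC K σ) f).1

theorem cp_mul_comm (f : K[X]) (x : σ.Gam K) : cp σ f * x = x * cp σ f :=
  (Subalgebra.mem_center_iff.mp (aeval (bigC K σ) f).2 x).symm

theorem cp_mul_left_comm (f : K[X]) (x z : σ.Gam K) : x * (cp σ f * z) = cp σ f * (x * z) := by
  rw [← mul_assoc, ← cp_mul_comm, mul_assoc]

theorem cp_add (f g : K[X]) : cp σ (f + g) = cp σ f + cp σ g := by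
  unfold cp
  rw [map_add]
  rfl

theorem cp_mul (f g : K[X]) : cp σ (f * g) = cp σ f * cp σ g := by
  unfold cp
  rw [map_mul]
  rfl

theorem cp_zero : cp σ (0 : K[X]) = 0 := by
  unfold cp
  rw [map_zero]
  rfl

theorem cp_one : cp σ (1 : K[X]) = 1 := by
  unfold cp
  rw [map_one]
  rfl

theorem cp_X : cp σ (X : K[X]) = bigSum K σ := by
  unfold cp
  rw [aeval_X]
  rfl

theorem cp_C (r : K) : cp σ (C r) = algebraMap K (σ.Gam K) r := by
  unfold cp
  rw [aeval_C]
  rfl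

variable (K)

/-- The boundary path of length `n` is the big cycle. -/
theorem xs_n (i : Fin n) : xs K σ i n = eS K σ i * cp σ X := by
  rw [cp_X, e_mul_bigSum, bigAt_side]

/-- A boundary path between two sides is the shortest one times a power of the big cycle. -/
theorem xs_eq_cp_mul {i k : Fin n} {m : ℕ} (h : shift i m = k) :
    ∃ q : ℕ, xs K σ i m = cp σ (X ^ q) * xs K σ i (ccw i k) := by
  induction m using Nat.strong_induction_on with
  | _ m ih =>
    rcases lt_or_ge m n with hm | hm
    · refine ⟨0, ?_⟩
      rw [← h, ccw_shift i hm, pow_zero, cp_one, one_mul]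
    · obtain ⟨m, rfl⟩ := Nat.exists_eq_add_of_le hm
      rw [shift_n_add] at h
      obtain ⟨q, hq⟩ := ih m (by have := NeZero.pos n; omega) h
      refine ⟨q + 1, ?_⟩
      rw [← xs_mul_xs K (shift_n i), hq, xs_n, ← cp_mul_comm, pow_succ', cp_mul, mul_assoc,
        mul_assoc, ← eS_mul_xs K i, cp_mul_left_comm, ← mul_assoc (eS K σ i), e_mul_self]

/-- For sides `i` and chords `a`, the `K[X]`-module `e_i Γ e_a` is generated by two elements: the
boundary path to one of the two ends of the chord, followed by the rotation into the chord. -/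
theorem row_chord {r t : Fin n} (h : chord r t ∈ σ.edges) (i : Fin n) (x : σ.Gam K) :
    ∃ f g : K[X], eS K σ i * x * σ.e K ⟨chord r t, h⟩ =
      cp σ f * (xs K σ i (ccw i r) * In K σ r (ccw r t))
        + cp σ g * (xs K σ i (ccw i t) * In K σ t (n + ccw t r)) := by
  have hx := e_mul_mem_rowSpan K i x
  rw [show eS K σ i * x = eS K σ i * (eS K σ i * x) by rw [← mul_assoc, e_mul_self]]
  generalize eS K σ i * x = w at hx ⊢
  induction hx using Submodule.span_induction with
  | zero => exact ⟨0, 0, by simp [cp_zero]⟩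
  | add a b _ _ ha hb =>
    obtain ⟨f, g, h1⟩ := ha
    obtain ⟨f', g', h2⟩ := hb
    refine ⟨f + f', g + g', ?_⟩
    rw [mul_add, add_mul, h1, h2, cp_add, cp_add]
    noncomm_ring
  | smul c a _ ha =>
    obtain ⟨f, g, h1⟩ := ha
    refine ⟨C c * f, C c * g, ?_⟩
    rw [mul_smul_comm, smul_mul_assoc, h1, cp_mul, cp_mul, cp_C, Algebra.smul_def, mul_add,
      mul_assoc, mul_assoc]
  -- Spanning paths which start or end elsewhere are killed by the idempotents.
  | mem a ha =>
    obtain ⟨j, m, k, p, c, hm, hk, rfl⟩ | ⟨j, m, D, hm, rfl⟩ := ha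
    · by_cases hc : c = ⟨chord r t, h⟩
      swap
      · refine ⟨0, 0, ?_⟩
        rw [← In_mul_e K hk, mul_assoc, mul_assoc, mul_assoc, e_mul_of_ne K hc]
        simp [cp_zero]
      subst hc
      by_cases hj : j = i
      swap
      · refine ⟨0, 0, ?_⟩
        rw [← eS_mul_xs, ← mul_assoc, ← mul_assoc,
          e_mul_of_ne K (fun h => hj (sideVertex_injective h).symm)]
        simp [cp_zero]
      subst hj
      obtain ⟨q, hq⟩ := xs_eq_cp_mul K (σ := σ) hm
      have h1 : eS K σ j * (xs K σ j m * In K σ k p) * σ.e K ⟨chord r t, h⟩ =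
          cp σ (X ^ q) * (xs K σ j (ccw j k) * In K σ k p) := by
        rw [← mul_assoc, eS_mul_xs, mul_assoc, In_mul_e K hk, hq, mul_assoc]
      rw [h1]
      rcases At.chord_cases hk with ⟨rfl, rfl⟩ | ⟨rfl, rfl⟩
      · exact ⟨X ^ q, 0, by rw [cp_zero, zero_mul, add_zero]⟩
      · exact ⟨0, X ^ q, by rw [cp_zero, zero_mul, zero_add]⟩
    · refine ⟨0, 0, ?_⟩
      rw [← notchedIn_mul_e, mul_assoc, mul_assoc, mul_assoc, e_mul_of_ne K (by simp)]
      simp [cp_zero]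

/-- If there is only one way `γ` to rotate into the edge `a`, then `e_i Γ e_a` is a cyclic
`K[X]`-module for each side `i`. -/
theorem row_of_generator {k : Fin n} {a : σ.Vertex} {γ : σ.Gam K} (hγ : γ * σ.e K a = γ)
    (h1 : ∀ k' p, σ.At k' p a → k' = k ∧ In K σ k' p = γ)
    (h2 : ∀ D : σ.Digon, (⟨spoke D.r .notched, D.mem_notched⟩ : σ.Vertex) = a →
      D.r = k ∧ notchedIn K D = γ)
    (i : Fin n) (x : σ.Gam K) :
    ∃ f : K[X], eS K σ i * x * σ.e K a = cp σ f * (xs K σ i (ccw i k) * γ) := by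
  have hx := e_mul_mem_rowSpan K i x
  rw [show eS K σ i * x = eS K σ i * (eS K σ i * x) by rw [← mul_assoc, e_mul_self]]
  generalize eS K σ i * x = w at hx ⊢
  induction hx using Submodule.span_induction with
  | zero => exact ⟨0, by simp [cp_zero]⟩
  | add a b _ _ ha hb =>
    obtain ⟨f, h1⟩ := ha
    obtain ⟨f', h2⟩ := hb
    refine ⟨f + f', ?_⟩
    rw [mul_add, add_mul, h1, h2, cp_add, add_mul]
  | smul c a _ ha =>
    obtain ⟨f, h1⟩ := ha
    refine ⟨C c * f, ?_⟩
    rw [mul_smul_comm, smul_mul_assoc, h1, cp_mul, cp_C, Algebra.smul_def, mul_assoc]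
  -- Spanning paths which start or end elsewhere are killed by the idempotents.
  | mem b hb =>
    have key : ∀ (j : Fin n) (m : ℕ), shift j m = k →
        ∃ f : K[X], eS K σ i * (xs K σ j m * γ) * σ.e K a = cp σ f * (xs K σ i (ccw i k) * γ) := by
      intro j m hm
      by_cases hj : j = i
      swap
      · refine ⟨0, ?_⟩
        rw [← eS_mul_xs, ← mul_assoc, ← mul_assoc,
          e_mul_of_ne K (fun h => hj (sideVertex_injective h).symm)]
        simp [cp_zero]
      subst hj
      obtain ⟨q, hq⟩ := xs_eq_cp_mul K (σ := σ) hm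
      refine ⟨X ^ q, ?_⟩
      rw [← mul_assoc, eS_mul_xs, mul_assoc, hγ, hq, mul_assoc]
    obtain ⟨j, m, k', p, c, hm, hk, rfl⟩ | ⟨j, m, D, hm, rfl⟩ := hb
    · by_cases hc : c = a
      swap
      · refine ⟨0, ?_⟩
        rw [← In_mul_e K hk, mul_assoc, mul_assoc, mul_assoc, e_mul_of_ne K hc]
        simp [cp_zero]
      subst hc
      obtain ⟨rfl, h4⟩ := h1 _ _ hk
      rw [h4]
      exact key j m hm
    · by_cases hc : (⟨spoke D.r .notched, D.mem_notched⟩ : σ.Vertex) = a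
      swap
      · refine ⟨0, ?_⟩
        rw [← notchedIn_mul_e, mul_assoc, mul_assoc, mul_assoc, e_mul_of_ne K hc]
        simp [cp_zero]
      obtain ⟨h3, h4⟩ := h2 _ hc
      rw [h4]
      exact key j m (hm.trans h3)

/-- For a plain arc, and for a notched arc outside punctured digons, `e_i Γ e_a` is cyclic over
`K[X]`. -/
theorem row_mid {k : Fin n} {τ : Tag} {h : spoke k τ ∈ σ.edges} (hA : σ.At k n ⟨spoke k τ, h⟩)
    (i : Fin n) (x : σ.Gam K) : ∃ f : K[X], eS K σ i * x * σ.e K ⟨spoke k τ, h⟩ =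
      cp σ f * (xs K σ i (ccw i k) * In K σ k n) := by
  refine row_of_generator K (In_mul_e K hA) (fun k' p h' => ?_) (fun D hD => ?_) i x
  · obtain ⟨rfl, rfl, -⟩ := At.spoke_cases h'
    exact ⟨rfl, rfl⟩
  · rw [Subtype.mk.injEq, spoke.injEq] at hD
    obtain ⟨rfl, rfl⟩ := hD
    rcases (At.spoke_cases hA).2.2 with h' | h'
    · cases h'
    · exact absurd D.mem_plain h'

/-- For the notched arc of a punctured digon, `e_i Γ e_a` is cyclic over `K[X]`. -/
theorem row_notched (D : σ.Digon) (i : Fin n) (x : σ.Gam K) :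
    ∃ f : K[X], eS K σ i * x * σ.e K ⟨spoke D.r .notched, D.mem_notched⟩ =
      cp σ f * (xs K σ i (ccw i D.r) * notchedIn K D) := by
  refine row_of_generator K (notchedIn_mul_e K D) (fun k' p h' => ?_) (fun D' _ => ?_) i x
  · rcases (At.spoke_cases h').2.2 with h' | h'
    · cases h'
    · exact absurd D.mem_plain h'
  · rw [Subsingleton.elim D' D]
    exact ⟨rfl, rfl⟩

/-- An arc to the puncture has a position unless it is the notched arc of a punctured digon. -/
theorem spoke_cases {k : Fin n} {τ : Tag} (h : spoke k τ ∈ σ.edges) :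
    σ.At k n ⟨spoke k τ, h⟩ ∨ ∃ D : σ.Digon, D.r = k ∧ τ = .notched := by
  rcases At.exists_or_notched (σ := σ) ⟨spoke k τ, h⟩ with ⟨k', p, hA⟩ | ⟨D, hD⟩
  · obtain ⟨rfl, rfl, -⟩ := At.spoke_cases hA
    exact .inl hA
  · rw [Subtype.mk.injEq, spoke.injEq] at hD
    exact .inr ⟨D, hD.1.symm, hD.2⟩

section Values

variable {K} {ω : BigR K n} (hω : ω * ω = ω)

theorem rep_eS_mul_cp (i : Fin n) (f : K[X]) : rep σ hω (eS K σ i * cp σ f) =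
    Matrix.single (σ.sideVertex i) (σ.sideVertex i) (BigR.ofPoly K n f) := by
  have hX : rep σ hω (eS K σ i * cp σ X) =
      Matrix.single (σ.sideVertex i) (σ.sideVertex i) (BigR.ofPoly K n X) := by
    rw [← xs_n, rep_xs, shift_n, ofPoly_X]
    push_cast
    rfl
  have hmul : ∀ f g : K[X], rep σ hω (eS K σ i * cp σ (f * g)) =
      rep σ hω (eS K σ i * cp σ f) * rep σ hω (eS K σ i * cp σ g) := by
    intro f g
    rw [← map_mul, mul_assoc, cp_mul_left_comm, ← mul_assoc (eS K σ i), e_mul_self, cp_mul,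
      cp_mul_left_comm]
  induction f using Polynomial.induction_on with
  | C r =>
    rw [cp_C, ← Algebra.commutes, ← Algebra.smul_def, map_smul, rep_e, ← Polynomial.algebraMap_eq,
      AlgHom.commutes, Algebra.algebraMap_eq_smul_one, Matrix.smul_single]
  | add f g hf hg =>
    rw [cp_add, mul_add, map_add, hf, hg, map_add, Matrix.single_add]
  | monomial m r h =>
    rw [pow_succ, ← mul_assoc, hmul, h, hX, Matrix.single_mul_single_same, ← map_mul]

theorem rep_cp_mul (i : Fin n) (f : K[X]) {x : σ.Gam K} {a : σ.Vertex} {z : BigR K n}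
    (hi : eS K σ i * x = x) (hx : rep σ hω x = Matrix.single (σ.sideVertex i) a z) :
    rep σ hω (cp σ f * x) = Matrix.single (σ.sideVertex i) a (BigR.ofPoly K n f * z) := by
  rw [← hi, ← mul_assoc, cp_mul_comm, map_mul, rep_eS_mul_cp, hx, Matrix.single_mul_single_same]

/-- The value of the first generator of `e_i Γ e_a`, for a chord `a`. -/
theorem rep_first {r t : Fin n} (h : chord r t ∈ σ.edges) (i : Fin n) :
    rep σ hω (xs K σ i (ccw i r) * In K σ r (ccw r t)) =
      Matrix.single (σ.sideVertex i) ⟨chord r t, h⟩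
        (BigR.u K n (2 * ccw i r + ccw r t - 1)) := by
  rw [rep_xs_mul_In hω (shift_ccw i r) (.out h), wt_low (ccw_lt r t), mul_one, ← BigR.u_add]
  congr 2
  push_cast
  ring

/-- The value of the second generator of `e_i Γ e_a`, for a chord `a`: the rotation around the end
of the chord crosses the position of the puncture. -/
theorem rep_second {r t : Fin n} (h : chord r t ∈ σ.edges) (i : Fin n) :
    rep σ hω (xs K σ i (ccw i t) * In K σ t (n + ccw t r)) =
      Matrix.single (σ.sideVertex i) ⟨chord r t, h⟩
        (BigR.u K n (2 * ccw i t + 2 * n - 1 - ccw r t) * ω) := by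
  have h1 := ccw_add_ccw (ne_of_chord_mem h)
  have h2 := NeZero.pos n
  have h3 := ccw_pos (ne_of_chord_mem h).symm
  rw [rep_xs_mul_In hω (shift_ccw i t) (.inc h), wt_cross h2 (by omega) (by omega), ← mul_assoc,
    ← BigR.u_add]
  congr 3
  push_cast
  omega

theorem rep_mid {k : Fin n} {c : σ.Vertex} (hA : σ.At k n c) (i : Fin n) :
    rep σ hω (xs K σ i (ccw i k) * In K σ k n) =
      Matrix.single (σ.sideVertex i) c (BigR.u K n (2 * ccw i k + n - 1) * ω) := by
  have h2 : 2 ≤ n := Nat.AtLeastTwo.prop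
  rw [rep_xs_mul_In hω (shift_ccw i k) hA, wt_cross (by omega) le_rfl (by omega), ← mul_assoc,
    ← BigR.u_add]
  congr 3
  push_cast
  omega

theorem rep_notched (D : σ.Digon) (i : Fin n) :
    rep σ hω (xs K σ i (ccw i D.r) * notchedIn K D) =
      Matrix.single (σ.sideVertex i) ⟨spoke D.r .notched, D.mem_notched⟩
        (BigR.u K n (2 * ccw i D.r + n - 1) * (1 - ω)) := by
  rw [map_mul, rep_xs, shift_ccw, rep_notchedIn, Matrix.single_mul_single_same, ← mul_assoc,
    ← BigR.u_add]
  congr 3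
  omega

end Values

/-! ### The two-sided ideal generated by `e_F` -/

variable (σ) in
/-- The two-sided ideal `Γ e_F Γ`, described by the paths which turn around a vertex of the polygon
until they reach its boundary. -/
def frozenIdeal : Submodule K (σ.Gam K) :=
  Submodule.span K {x | (∃ k p c z, σ.At k p c ∧ Out K σ k p * z = x) ∨
    ∃ D z, notchedOut K (σ := σ) D * z = x}

theorem Out_mul_mem {k : Fin n} {p : ℕ} {c : σ.Vertex} (h : σ.At k p c) (z : σ.Gam K) :
    Out K σ k p * z ∈ frozenIdeal σ K :=
  Submodule.subset_span (.inl ⟨k, p, c, z, h, rfl⟩)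

theorem notchedOut_mul_mem (D : σ.Digon) (z : σ.Gam K) :
    notchedOut K D * z ∈ frozenIdeal σ K :=
  Submodule.subset_span (.inr ⟨D, z, rfl⟩)

theorem eS_mul_mem (i : Fin n) (z : σ.Gam K) : eS K σ i * z ∈ frozenIdeal σ K := by
  have := Out_mul_mem K (at_side_sub_one (σ := σ) (i + 1)) z
  rwa [Out_last, add_sub_cancel_right] at this

theorem frozenIdeal_mul_mem {x : σ.Gam K} (hx : x ∈ frozenIdeal σ K) (z : σ.Gam K) :
    x * z ∈ frozenIdeal σ K := by
  induction hx using Submodule.span_induction with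
  | zero => rw [zero_mul]; exact Submodule.zero_mem _
  | add a b _ _ ha hb => rw [add_mul]; exact Submodule.add_mem _ ha hb
  | smul r a _ ha => rw [smul_mul_assoc]; exact Submodule.smul_mem _ _ ha
  | mem a ha =>
    obtain ⟨k, p, c, z', h, rfl⟩ | ⟨D, z', rfl⟩ := ha
    · rw [mul_assoc]
      exact Out_mul_mem K h _
    · rw [mul_assoc]
      exact notchedOut_mul_mem K D _

theorem Out_mul_mul_mem {k : Fin n} {p : ℕ} {c : σ.Vertex} (h : σ.At k p c) (w z : σ.Gam K) :
    Out K σ k p * w * z ∈ frozenIdeal σ K := by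
  rw [mul_assoc]
  exact Out_mul_mem K h _

/-- An arrow followed by a rotation towards the boundary: either the arrow belongs to the rotation,
or the rotation is exchanged for one around another vertex, followed by a boundary path. -/
theorem arr_mul_Out_mul_mem {k : Fin n} {p : ℕ} (α : σ.Arrow) (h : σ.At k p (σ.tgt α))
    (z : σ.Gam K) : arr K α * (Out K σ k p * z) ∈ frozenIdeal σ K := by
  have key : ∀ p', σ.corner α = some (k, p') → σ.cornerEnd α = p →
      arr K α * (Out K σ k p * z) ∈ frozenIdeal σ K := by
    rintro p' hα rfl
    rw [← mul_assoc, arr_mul_Out K hα]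
    exact Out_mul_mem K (corner_spec hα).1 z
  rw [← mul_assoc] at *
  cases α with
  | ext j hj =>
    rcases At.chord_cases h with ⟨rfl, rfl⟩ | ⟨rfl, rfl⟩
    · rw [ccw_add_one, Out_one, ← outer_eq_arr K hj, ← y_mul_outer', ← Out_one]
      exact Out_mul_mul_mem K (at_side _) _ _
    · rw [← outer_eq_arr K hj, ← e_mul_outer]
      rw [mul_assoc, mul_assoc]
      exact eS_mul_mem K _ _
  | triR T =>
    rcases At.chord_cases h with ⟨rfl, rfl⟩ | ⟨rfl, rfl⟩
    · exact key _ rfl rfl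
    · rw [triR_mul_Out]
      exact Out_mul_mul_mem K (.inc T.mem_rs) _ _
  | triS T =>
    rcases At.chord_cases h with ⟨rfl, rfl⟩ | ⟨rfl, rfl⟩
    · rw [triS_mul_Out]
      exact Out_mul_mul_mem K (.out T.mem_st) _ _
    · exact key _ rfl rfl
  | triT T =>
    rcases At.chord_cases h with ⟨rfl, rfl⟩ | ⟨rfl, rfl⟩
    · rw [triT_mul_Out]
      exact Out_mul_mul_mem K (.out T.mem_rt) _ _
    · exact key _ rfl rfl
  | puncR T =>
    obtain ⟨rfl, rfl, -⟩ := At.spoke_cases h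
    exact key _ rfl rfl
  | puncS T =>
    rcases At.chord_cases h with ⟨rfl, rfl⟩ | ⟨rfl, rfl⟩
    · rw [puncS_mul_Out]
      exact Out_mul_mul_mem K T.at_s _ _
    · exact key _ rfl rfl
  | puncO T =>
    obtain ⟨rfl, rfl, -⟩ := At.spoke_cases h
    rw [puncO_mul_Out]
    exact Out_mul_mul_mem K T.at_r _ _
  | eta D =>
    rcases At.chord_cases h with ⟨rfl, rfl⟩ | ⟨rfl, rfl⟩
    · rw [eta_mul_Out]
      exact Out_mul_mul_mem K (.out D.mem_sr) _ _
    · exact key _ rfl rfl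
  | gamma D =>
    obtain ⟨rfl, rfl, -⟩ := At.spoke_cases h
    exact key _ rfl rfl
  | delta D =>
    rcases At.chord_cases h with ⟨rfl, rfl⟩ | ⟨rfl, rfl⟩
    · rw [delta_mul_Out]
      exact Out_mul_mul_mem K (.mid D.mem_plain (.inl rfl)) _ _
    · exact key _ rfl rfl
  | beta D =>
    rcases At.chord_cases h with ⟨rfl, rfl⟩ | ⟨rfl, rfl⟩
    · rw [beta_mul_Out, zero_mul]
      exact Submodule.zero_mem _
    · exact notchedOut_mul_mem K D z
  | alpha D =>
    obtain ⟨rfl, rfl, h'⟩ := At.spoke_cases h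
    rcases h' with h' | h'
    · cases h'
    · exact absurd D.mem_plain h'

theorem arr_mul_notchedOut_mul_mem (α : σ.Arrow) (D : σ.Digon)
    (h : σ.tgt α = ⟨spoke D.r .notched, D.mem_notched⟩) (z : σ.Gam K) :
    arr K α * (notchedOut K D * z) ∈ frozenIdeal σ K := by
  -- Only one arrow ends at the notched arc of a digon.
  have hα : α = .alpha D := by
    cases α with
    | alpha D' => rw [Subsingleton.elim D' D]
    | puncR T => exact (T.not_digon D).elim
    | puncO T => exact (T.not_digon D).elim
    | ext j hj => simp [tgt, sideVertex, side] at h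
    | _ => simp [tgt] at h
  subst hα
  unfold notchedOut
  rw [← mul_assoc, alpha_mul_beta_mul_Out, sub_mul]
  exact Submodule.sub_mem _ (Out_mul_mul_mem K (.inc D.mem_rs) _ _)
    (Out_mul_mem K (.out D.mem_rs) _)

/-- The span of the paths towards the boundary is also a left ideal. -/
theorem mul_frozenIdeal_mem {x : σ.Gam K} (hx : x ∈ frozenIdeal σ K) (z : σ.Gam K) :
    z * x ∈ frozenIdeal σ K := by
  -- It suffices to multiply the spanning elements.
  have hgen : ∀ w : σ.Gam K,
      (∀ k p c z, σ.At k p c → w * (Out K σ k p * z) ∈ frozenIdeal σ K) →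
      (∀ D z, w * (notchedOut K D * z) ∈ frozenIdeal σ K) →
      ∀ x ∈ frozenIdeal σ K, w * x ∈ frozenIdeal σ K := by
    intro w h1 h2 x hx
    induction hx using Submodule.span_induction with
    | zero => rw [mul_zero]; exact Submodule.zero_mem _
    | add a b _ _ ha hb => rw [mul_add]; exact Submodule.add_mem _ ha hb
    | smul r a _ ha => rw [mul_smul_comm]; exact Submodule.smul_mem _ _ ha
    | mem a ha =>
      obtain ⟨k, p, c, z', h, rfl⟩ | ⟨D, z', rfl⟩ := ha
      · exact h1 k p c z' h
      · exact h2 D z'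
  -- The elements `z` which multiply the ideal into itself are stable under multiplication by
  -- idempotents and arrows.
  let N : Submodule K (σ.Gam K) :=
    { carrier := {z | ∀ x ∈ frozenIdeal σ K, z * x ∈ frozenIdeal σ K}
      add_mem' := fun h1 h2 x hx => by
        rw [add_mul]
        exact Submodule.add_mem _ (h1 x hx) (h2 x hx)
      zero_mem' := fun x _ => by
        rw [zero_mul]
        exact Submodule.zero_mem _
      smul_mem' := fun c z h x hx => by
        rw [smul_mul_assoc]
        exact Submodule.smul_mem _ _ (h x hx) }
  have h1 : (1 : σ.Gam K) ∈ N := fun x hx => by rwa [one_mul]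
  have h2 := mul_mem_of_generators K N
    (fun w hw c x hx => by
      rw [mul_assoc]
      refine hw _ (hgen _ (fun k p c' z h => ?_) (fun D z => ?_) x hx)
      · rw [← mul_assoc]
        by_cases hc : c = c'
        · subst hc
          rw [e_mul_Out K h]
          exact Out_mul_mem K h z
        · rw [← e_mul_Out K h, ← mul_assoc, e_mul_of_ne K hc, zero_mul, zero_mul]
          exact Submodule.zero_mem _
      · rw [← mul_assoc]
        by_cases hc : c = ⟨spoke D.r .notched, D.mem_notched⟩
        · subst hc
          rw [e_mul_notchedOut]
          exact notchedOut_mul_mem K D z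
        · rw [← e_mul_notchedOut, ← mul_assoc, e_mul_of_ne K hc, zero_mul, zero_mul]
          exact Submodule.zero_mem _)
    (fun w hw α x hx => by
      rw [mul_assoc]
      refine hw _ (hgen _ (fun k p c' z h => ?_) (fun D z => ?_) x hx)
      · by_cases hc : σ.tgt α = c'
        · subst hc
          exact arr_mul_Out_mul_mem K α h z
        · rw [← e_mul_Out K h, ← mul_assoc, ← mul_assoc, arr_mul_e_of_ne K hc, zero_mul, zero_mul]
          exact Submodule.zero_mem _
      · by_cases hc : σ.tgt α = ⟨spoke D.r .notched, D.mem_notched⟩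
        · exact arr_mul_notchedOut_mul_mem K α D hc z
        · rw [← e_mul_notchedOut, ← mul_assoc, ← mul_assoc, arr_mul_e_of_ne K hc, zero_mul,
            zero_mul]
          exact Submodule.zero_mem _) h1 z
  rw [one_mul] at h2
  exact h2 x hx

/-! ### The local rings modulo the ideal generated by `e_F` -/

theorem cmp_mem {α : σ.Arrow} {k : Fin n} {p : ℕ} (h : σ.corner α = some (k, p)) :
    cmp K α ∈ frozenIdeal σ K := by
  rw [cmp_eq' K h, mul_assoc]
  exact Out_mul_mem K (corner_spec h).2.1 _

theorem cycleAt_mem (c : σ.Vertex) : cycleAt K c ∈ frozenIdeal σ K := by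
  rcases At.exists_or_notched c with ⟨k, p, h⟩ | ⟨D, rfl⟩
  · rw [cycleAt_eq K h]
    unfold Cat
    rw [mul_assoc]
    exact Out_mul_mem K h _
  · rw [cycleAt_notched]
    exact Submodule.zero_mem _

theorem corner_eq_of_end_eq {α β : σ.Arrow} {k : Fin n} {p q : ℕ}
    (hα : σ.corner α = some (k, p)) (hβ : σ.corner β = some (k, q))
    (h : σ.cornerEnd α = σ.cornerEnd β) : α = β := by
  have h1 := corner_spec hα
  have h2 := corner_spec hβ
  have : p = q := by
    by_contra hpq
    rcases Nat.lt_or_gt_of_ne hpq with h3 | h3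
    · exact h1.2.2.2 q _ h3 (h ▸ h2.2.2.1) h2.1
    · exact h2.2.2.2 p _ h3 (h ▸ h1.2.2.1) h1.1
  subst this
  exact corner_inj hα hβ

/-- An arrow which comes after a rotation around a vertex of the polygon continues the rotation, up
to `Γ e_F Γ`, unless the two arrows belong to a triangle with two sides ending at the puncture. -/
theorem arr_mul_arr_cases {α β : σ.Arrow} {k : Fin n} {p : ℕ} (hα : σ.corner α = some (k, p))
    (h : σ.src β = σ.tgt α) :
    σ.corner β = some (k, σ.cornerEnd α) ∨ arr K α * arr K β ∈ frozenIdeal σ K ∨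
      (∃ T, α = .puncS T ∧ β = .puncR T) ∨
      ∃ D, β = .alpha D ∧ k = D.r ∧ σ.cornerEnd α = ccw D.r D.s := by
  have hA := (corner_spec hα).2.1
  rw [← h] at hA
  -- Two successive arrows of a triangle which belong to different corners agree with the complement
  -- of its third corner, which lies in `Γ e_F Γ`.
  have key : ∀ {α' γ : σ.Arrow} {q k' q' : _}, σ.corner α' = some (k, q) →
      σ.cornerEnd α' = σ.cornerEnd α → σ.corner γ = some (k', q') →
      arr K α' * arr K β = cmp K γ → arr K α * arr K β ∈ frozenIdeal σ K := by
    intro α' γ q k' q' h1 h2 h3 h4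
    rw [← corner_eq_of_end_eq h1 hα h2, h4]
    exact cmp_mem K h3
  have hcmp : ∀ {α' γ : σ.Arrow},
      σ.compl K γ = pathArrow K σ.quiver α' * pathArrow K σ.quiver β →
      arr K α' * arr K β = cmp K γ := by
    intro α' γ h
    unfold cmp arr
    rw [h, map_mul]
  cases β with
  | ext j hj =>
    refine .inr (.inl ?_)
    rw [← outer_eq_arr K hj, ← e_mul_outer]
    exact mul_frozenIdeal_mem K (eS_mul_mem K _ _) _
  | triR T =>
    rcases At.chord_cases hA with ⟨rfl, hp⟩ | ⟨rfl, hp⟩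
    · exact .inl (by rw [hp]; rfl)
    · exact .inr (.inl (key (α' := .triS T) (γ := .triT T) rfl hp.symm rfl (hcmp rfl)))
  | triS T =>
    rcases At.chord_cases hA with ⟨rfl, hp⟩ | ⟨rfl, hp⟩
    · exact .inl (by rw [hp]; rfl)
    · exact .inr (.inl (key (α' := .triT T) (γ := .triR T) rfl hp.symm rfl (hcmp rfl)))
  | triT T =>
    rcases At.chord_cases hA with ⟨rfl, hp⟩ | ⟨rfl, hp⟩
    · exact .inr (.inl (key (α' := .triR T) (γ := .triS T) rfl hp.symm rfl (hcmp rfl)))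
    · exact .inl (by rw [hp]; rfl)
  | puncR T =>
    rcases At.chord_cases hA with ⟨rfl, hp⟩ | ⟨rfl, hp⟩
    · exact .inl (by rw [hp]; rfl)
    · exact .inr (.inr (.inl ⟨T, (corner_eq_of_end_eq (α := .puncS T) rfl hα hp.symm).symm, rfl⟩))
  | puncS T =>
    obtain ⟨rfl, hp, -⟩ := At.spoke_cases hA
    exact .inl (by rw [hp]; rfl)
  | puncO T =>
    obtain ⟨rfl, hp, -⟩ := At.spoke_cases hA
    exact .inr (.inl (key (α' := .puncR T) (γ := .puncS T) rfl hp.symm rfl (hcmp rfl)))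
  | eta D =>
    rcases At.chord_cases hA with ⟨rfl, hp⟩ | ⟨rfl, hp⟩
    · exact .inl (by rw [hp]; rfl)
    · exact .inr (.inl (key (α' := .delta D) (γ := .gamma D) rfl hp.symm rfl (hcmp rfl)))
  | gamma D =>
    rcases At.chord_cases hA with ⟨rfl, hp⟩ | ⟨rfl, hp⟩
    · exact .inl (by rw [hp]; rfl)
    · exact .inr (.inl (key (α' := .eta D) (γ := .delta D) rfl hp.symm rfl (hcmp rfl)))
  | delta D =>
    obtain ⟨rfl, hp, -⟩ := At.spoke_cases hA
    exact .inl (by rw [hp]; rfl)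
  | alpha D =>
    rcases At.chord_cases hA with ⟨rfl, hp⟩ | ⟨rfl, hp⟩
    · exact .inr (.inr (.inr ⟨D, rfl, rfl, hp⟩))
    · rw [← corner_eq_of_end_eq (α := .eta D) rfl hα hp.symm, eta_mul_alpha]
      exact .inr (.inl (Submodule.zero_mem _))
  | beta D =>
    obtain ⟨rfl, hp, h'⟩ := At.spoke_cases hA
    rcases h' with h' | h'
    · cases h'
    · exact absurd D.mem_plain h'

/-- Paths starting at `a` (with their final vertices) which span `e_a Γ` modulo `Γ e_F Γ`: rotations
around a vertex of the polygon or around the puncture, the paths through the notched arc of a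
punctured digon being treated separately. -/
inductive Seg (a : σ.Vertex) : σ.Gam K → σ.Vertex → Prop
  | triv : Seg a (σ.e K a) a
  | rot {k : Fin n} {p₀ p : ℕ} {α : σ.Arrow} (h : σ.At k p₀ a) (hα : σ.corner α = some (k, p))
      (hp : p₀ ≤ p) : Seg a (σ.e K a * S K σ k p₀ p * arr K α) (σ.tgt α)
  | punc {m : ℕ} (T T' : σ.PunctureTriangle) (ha : a = ⟨spoke T.r T.tag, T.mem_r⟩) (hm : 0 < m)
      (hm' : m < n) (hT : T'.r = shift T.r m) :
      Seg a (σ.e K a * P K σ T.r 0 m) ⟨spoke T'.r T'.tag, T'.mem_r⟩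
  | notched {p₀ : ℕ} (D : σ.Digon) (h : σ.At D.r p₀ a) (hp : p₀ ≤ ccw D.r D.s) :
      Seg a (σ.e K a * S K σ D.r p₀ (ccw D.r D.s) * arr K (.alpha D))
        ⟨spoke D.r .notched, D.mem_notched⟩
  | beta (D : σ.Digon) (ha : a = ⟨spoke D.r .notched, D.mem_notched⟩) :
      Seg a (arr K (.beta D)) ⟨chord D.s D.r, D.mem_sr⟩
  | beta_rot {p : ℕ} {α : σ.Arrow} (D : σ.Digon)
      (ha : a = ⟨spoke D.r .notched, D.mem_notched⟩) (hα : σ.corner α = some (D.r, p))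
      (hp : n + ccw D.r D.s ≤ p) :
      Seg a (arr K (.beta D) * S K σ D.r (n + ccw D.r D.s) p * arr K α) (σ.tgt α)

variable {K}

theorem Seg.mul_e {a b : σ.Vertex} {x : σ.Gam K} (h : Seg K a x b) : x * σ.e K b = x := by
  cases h with
  | triv => exact e_mul_self K _
  | rot h hα hp => rw [mul_assoc, arr_mul_e]
  | @punc m T T' ha hm hm' hT =>
    subst ha
    induction m using Nat.strong_induction_on generalizing T with
    | _ m ih =>
      have h1 := ccw_le_of_r_eq T hm hT
      have h0 := ccw_pos T.ne
      obtain ⟨T₁, hT₁⟩ := T.exists_next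
      rw [← P_mul_P K (Nat.zero_le _) h1, P_puncO]
      rcases h1.eq_or_lt with h2 | h2
      · rw [← h2, P_eq_one K (fun x h1 h2 => absurd h2 (by omega)), mul_one]
        have : T' = T₁ := PunctureTriangle.eq_of_r_eq (by rw [hT, hT₁, ← h2, shift_ccw])
        subst this
        rw [mul_assoc, ← PunctureTriangle.spoke_eq hT₁]
        exact congrArg _ (arr_mul_e K (.puncO T))
      · have h3 : P K σ T.r (ccw T.r T.s) m = P K σ T₁.r 0 (m - ccw T.r T.s) := by
          conv_rhs => rw [hT₁, ← shift_ccw T.r T.s, P_shift, shift_ccw, add_zero,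
            Nat.add_sub_cancel' h1]
        have h4 := ih (m - ccw T.r T.s) (by omega) T₁ (by omega) (by omega)
          (by rw [hT, hT₁, ← Nat.add_sub_cancel' h1, ← shift_shift, shift_ccw,
            Nat.add_sub_cancel_left])
        have h5 : arr K (.puncO T) * σ.e K ⟨spoke T₁.r T₁.tag, T₁.mem_r⟩ = arr K (.puncO T) := by
          rw [← PunctureTriangle.spoke_eq hT₁]
          exact arr_mul_e K (.puncO T)
        rw [h3, ← h5, mul_assoc (arr K (.puncO T)), mul_assoc, mul_assoc, h4]
  | notched D h hp =>
    rw [mul_assoc]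
    exact congrArg _ (arr_mul_e K (.alpha D))
  | beta D ha => exact arr_mul_e K (.beta D)
  | beta_rot D ha hα hp => rw [mul_assoc, arr_mul_e]

/-- The only closed path among those of `Seg` is the trivial one, as rotations stop before they
return. -/
theorem Seg.eq_of_eq {a b : σ.Vertex} {x : σ.Gam K} (h : Seg K a x b) (hb : b = a) :
    x = σ.e K a := by
  cases h with
  | triv => rfl
  | rot h hα hp =>
    have h1 := corner_spec hα
    have := h.pos_eq (hb ▸ h1.2.1)
    omega
  | @punc m T T' ha hm hm' hT =>
    rw [ha, Subtype.mk.injEq, spoke.injEq] at hb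
    have h1 := ccw_shift T.r hm'
    rw [← hT, hb.1, ccw_self] at h1
    omega
  | notched D h hp =>
    subst hb
    rcases (At.spoke_cases h).2.2 with h' | h'
    · cases h'
    · exact absurd D.mem_plain h'
  | beta D ha =>
    rw [ha] at hb
    simp at hb
  | beta_rot D ha hα hp =>
    have h1 := (corner_spec hα).2.1
    rw [hb, ha] at h1
    rcases (At.spoke_cases h1).2.2 with h' | h'
    · cases h'
    · exact absurd D.mem_plain h'

variable (K)

/-- A rotation cannot be continued around the puncture modulo `Γ e_F Γ`: by the relation at the
puncture, it would contain two arrows of one triangle. -/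
theorem rot_mul_puncS_mul_puncR_mem (z : σ.Gam K) (T : σ.PunctureTriangle) {p₀ : ℕ}
    {c : σ.Vertex} (h : σ.At T.s p₀ c) (hp : p₀ < n) :
    z * S K σ T.s p₀ n * arr K (.puncS T) * arr K (.puncR T) ∈ frozenIdeal σ K := by
  obtain ⟨T₁, hT₁⟩ := T.exists_next
  have h0 := ccw_pos T.ne.symm
  have hc : σ.corner (.puncR T₁) = some (T.s, ccw T₁.r T₁.s) := by rw [← hT₁]; rfl
  have h1 : p₀ ≤ ccw T₁.r T₁.s := by
    by_contra! hlt
    exact (corner_spec hc).2.2.2 p₀ c hlt hp h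
  have h2 : S K σ T.s p₀ n = S K σ T.s p₀ (ccw T₁.r T₁.s) * arr K (.puncR T₁) :=
    (S_mul_arr K hc h1).symm
  have h3 : ccw T₁.r T₁.s ≤ ccw T.s T.r :=
    ccw_le_of_r_eq T₁ h0 (T' := T) (by rw [hT₁, shift_ccw])
  have h4 : arr K (.puncR T₁) * σ.e K ⟨spoke T.s T.tag, T.mem_s⟩ = arr K (.puncR T₁) := by
    rw [PunctureTriangle.spoke_eq hT₁]
    exact arr_mul_e K (.puncR T₁)
  have h5 : arr K (.puncR T₁) * arr K (.puncO T₁) = cmp K (.puncS T₁) := by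
    simp only [cmp, compl, map_mul]
    rfl
  have h6 : arr K (.puncS T) * arr K (.puncR T) = σ.e K ⟨spoke T.s T.tag, T.mem_s⟩ *
      (arr K (.puncO T₁) * P K σ T₁.r (ccw T₁.r T₁.s) (ccw T.s T.r)) := by
    rw [← P_puncO, P_mul_P K (Nat.zero_le _) h3, puncS_mul_puncR, hT₁]
  rw [mul_assoc _ (arr K (.puncS T)), h6, h2, ← mul_assoc, mul_assoc _ _ (σ.e K _),
    mul_assoc _ _ (σ.e K _), h4, ← mul_assoc, ← mul_assoc z,
    mul_assoc _ (arr K _) (arr K _), h5]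
  exact frozenIdeal_mul_mem K (mul_frozenIdeal_mem K (cmp_mem K rfl) _) _

variable (σ) in
/-- The span of `Γ e_F Γ` and of the paths `Seg`. -/
def segSpan (a : σ.Vertex) : Submodule K (σ.Gam K) :=
  frozenIdeal σ K ⊔ Submodule.span K {x | ∃ b, Seg K a x b}

variable {K}

theorem Seg.mem {a b : σ.Vertex} {x : σ.Gam K} (h : Seg K a x b) : x ∈ segSpan σ K a :=
  Submodule.mem_sup_right (Submodule.subset_span ⟨b, h⟩)

/-- Right multiplication by an arrow preserves the span of `Γ e_F Γ` and of the paths `Seg`: either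
the path is continued, or it acquires two successive arrows of a triangle with different corners,
which give an element of `Γ e_F Γ`. -/
theorem Seg.mul_arr_mem {a b : σ.Vertex} {x : σ.Gam K} (h : Seg K a x b) (β : σ.Arrow)
    (hb : σ.src β = b) : x * arr K β ∈ segSpan σ K a := by
  have hx := h.mul_e
  have hJ : ∀ {z : σ.Gam K}, z ∈ frozenIdeal σ K → z ∈ segSpan σ K a :=
    fun hz => Submodule.mem_sup_left hz
  cases h with
  | triv =>
    subst hb
    have hrot : ∀ k p, σ.corner β = some (k, p) →
        σ.e K (σ.src β) * arr K β ∈ segSpan σ K (σ.src β) := by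
      intro k p hβ
      have := Seg.rot (K := K) (corner_spec hβ).1 hβ le_rfl
      rw [S_self, mul_one] at this
      exact this.mem
    cases β with
    | ext k hk =>
      refine hJ (eS_mul_mem K _ _)
    | puncO T =>
      obtain ⟨T', hT'⟩ := T.exists_next
      have := Seg.punc (K := K) (m := ccw T.r T.s) T T' rfl (ccw_pos T.ne) (ccw_lt _ _)
        (by rw [hT', shift_ccw])
      rw [P_puncO] at this
      exact this.mem
    | alpha D =>
      have := Seg.notched (K := K) D (.out D.mem_rs) le_rfl
      rw [S_self, mul_one] at this
      exact this.mem
    | beta D =>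
      rw [e_src_mul]
      exact (Seg.beta (K := K) D rfl).mem
    | _ => exact hrot _ _ rfl
  | @rot k p₀ p α h hα hp =>
    have h1 := corner_spec hα
    rcases arr_mul_arr_cases K hα hb with h2 | h2 | ⟨T, rfl, rfl⟩ | ⟨D, rfl, rfl, h2⟩
    · rw [mul_assoc (σ.e K a), S_mul_arr K hα hp]
      exact (Seg.rot (K := K) h h2 (hp.trans h1.2.2.1.le)).mem
    · rw [mul_assoc]
      exact hJ (mul_frozenIdeal_mem K h2 _)
    · obtain ⟨rfl, rfl⟩ : T.s = k ∧ n = p := by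
        simpa only [corner, Option.some.injEq, Prod.mk.injEq] using hα
      -- The two arrows lead from an arc to the puncture to the preceding one: this is a path around
      -- the puncture if nothing comes before, and lies in `Γ e_F Γ` otherwise.
      rcases hp.eq_or_lt with rfl | hp
      · obtain ⟨T', hT'⟩ := T.exists_next
        have ha : a = ⟨spoke T'.r T'.tag, T'.mem_r⟩ := by
          rw [← PunctureTriangle.spoke_eq hT']
          exact h.eq T.at_s
        have := Seg.punc (K := K) (m := ccw T.s T.r) T' T ha (ccw_pos T.ne.symm) (ccw_lt _ _)
          (by rw [hT', shift_ccw])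
        rw [S_self, mul_one, mul_assoc, puncS_mul_puncR, ← h.eq T.at_s, ← mul_assoc, e_mul_self,
          ← hT']
        rw [hT'] at this ⊢
        exact this.mem
      · exact hJ (rot_mul_puncS_mul_puncR_mem K _ T h hp)
    · rw [mul_assoc (σ.e K a), S_mul_arr K hα hp, h2]
      exact (Seg.notched (K := K) D h (h2 ▸ hp.trans h1.2.2.1.le)).mem
  | @punc m T T' ha hm hm' hT =>
    rw [mul_assoc]
    cases β with
    | puncO T₁ =>
      have hT₁ : T₁ = T' := by
        simp only [src, Subtype.mk.injEq, spoke.injEq] at hb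
        exact PunctureTriangle.eq_of_r_eq hb.1
      subst hT₁
      have h1 : P K σ T.r 0 m * arr K (.puncO T₁) = P K σ T.r 0 (m + ccw T₁.r T₁.s) := by
        rw [← P_mul_P K (Nat.zero_le m) (Nat.le_add_right _ _), ← P_puncO, hT]
        congr 1
        conv_lhs => rw [P_shift, add_zero]
      rw [h1]
      -- The path around the puncture is continued, unless it contains a full turn, which is a
      -- planar cycle.
      rcases lt_or_ge (m + ccw T₁.r T₁.s) n with h2 | h2
      · obtain ⟨T₂, hT₂⟩ := T₁.exists_next
        exact (Seg.punc (K := K) T T₂ ha (by omega) h2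
          (by rw [hT₂, ← shift_shift, ← hT, shift_ccw])).mem
      · rw [← P_mul_P K (Nat.zero_le _) h2]
        refine hJ (mul_frozenIdeal_mem K (frozenIdeal_mul_mem K ?_ _) _)
        unfold P
        rw [path_puncturedCycle]
        exact cycleAt_mem K _
    | puncS T₁ =>
      have hs : T₁.s = T'.r := by
        simp only [src, Subtype.mk.injEq, spoke.injEq] at hb
        exact hb.1
      have hd := ccw_add_ccw T₁.ne
      -- The last arrow of the path around the puncture and the next one belong to the same
      -- triangle.
      have h1 : ccw T₁.r T₁.s ≤ m := by
        by_contra! hlt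
        have h2 := not_spoke_crossing T₁.mem_rs T.mem_r
        have h3 : ccw T.r T₁.s = m := by rw [hs, hT, ccw_shift _ hm']
        have h4 := ccw_rel T₁.r T.r T₁.s
        have h5 := ccw_lt T₁.r T.r
        omega
      have h2 : shift T.r (m - ccw T₁.r T₁.s) = T₁.r := by
        have h3 : shift (shift T.r m) (ccw T₁.s T₁.r) = T₁.r := by rw [← hT, ← hs, shift_ccw]
        rw [shift_shift, show m + ccw T₁.s T₁.r = n + (m - ccw T₁.r T₁.s) by omega,
          shift_n_add] at h3
        exact h3
      have h3 : P K σ T.r 0 m = P K σ T.r 0 (m - ccw T₁.r T₁.s) * arr K (.puncO T₁) := by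
        rw [← P_mul_P K (Nat.zero_le _) (Nat.sub_le m (ccw T₁.r T₁.s)), ← P_puncO]
        congr 1
        conv_rhs => rw [← h2, P_shift, h2, add_zero, Nat.sub_add_cancel h1]
      have h4 : arr K (.puncO T₁) * arr K (.puncS T₁) = cmp K (.puncR T₁) := by
        simp only [cmp, compl, map_mul]
        rfl
      rw [h3, mul_assoc (P K σ _ _ _), h4]
      exact hJ (mul_frozenIdeal_mem K (mul_frozenIdeal_mem K (cmp_mem K rfl) _) _)
    | beta D => exact (T.not_digon D).elim
    | delta D => exact (T.not_digon D).elim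
    | ext j hj => simp [src, sideVertex, side] at hb
    | _ => simp [src] at hb
  | @notched p₀ D h hp =>
    cases β with
    | beta D' =>
      obtain rfl := Subsingleton.elim D D'
      -- The relation at `η` replaces the path through the notched arc by the one through the plain
      -- arc.
      have h1 : arr K (.alpha D) * arr K (.beta D) =
          cmp K (.eta D) - arr K (.gamma D) * arr K (.delta D) := by
        rw [eq_sub_iff_add_eq]
        simp only [cmp, compl, map_add, map_mul]
        rfl
      have h2 : S K σ D.r p₀ (ccw D.r D.s) * arr K (.gamma D) = S K σ D.r p₀ n :=
        S_mul_arr K (α := .gamma D) rfl hp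
      have h3 := Seg.rot (K := K) h (α := .delta D) rfl (hp.trans (ccw_lt _ _).le)
      rw [mul_assoc, h1, mul_sub, ← mul_assoc _ (arr K (.gamma D)),
        mul_assoc _ (S K σ D.r p₀ (ccw D.r D.s)) (arr K (.gamma D)), h2]
      exact Submodule.sub_mem _ (hJ (mul_frozenIdeal_mem K (cmp_mem K rfl) _)) h3.mem
    | puncS T => exact (T.not_digon D).elim
    | puncO T => exact (T.not_digon D).elim
    | ext j hj => simp [src, sideVertex, side] at hb
    | _ => simp [src] at hb
  | beta D ha =>
    have hcor : ∀ k p, σ.corner β = some (k, p) → arr K (.beta D) * arr K β ∈ segSpan σ K a := by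
      intro k p hβ
      have h1 := (corner_spec hβ).1
      rw [hb] at h1
      rcases At.chord_cases h1 with ⟨rfl, rfl⟩ | ⟨rfl, rfl⟩
      · rw [corner_inj hβ (β := .eta D) rfl, beta_mul_eta]
        exact Submodule.zero_mem _
      · have := Seg.beta_rot (K := K) D ha hβ le_rfl
        rw [S_self, mul_one] at this
        exact this.mem
    cases β with
    | ext j hj =>
      rw [← outer_eq_arr K hj, ← e_mul_outer]
      exact hJ (mul_frozenIdeal_mem K (eS_mul_mem K _ _) _)
    | alpha D' =>
      obtain rfl := Subsingleton.elim D D'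
      simp only [src, Subtype.mk.injEq, chord.injEq] at hb
      exact (D.ne hb.1).elim
    | beta D' => simp [src] at hb
    | puncO T => simp [src] at hb
    | _ => exact hcor _ _ rfl
  | @beta_rot p α D ha hα hp =>
    have h1 := corner_spec hα
    rcases arr_mul_arr_cases K hα hb with h2 | h2 | ⟨T, rfl, rfl⟩ | ⟨D', rfl, h3, h2⟩
    · rw [mul_assoc (arr K (.beta D)), S_mul_arr K hα hp]
      exact (Seg.beta_rot (K := K) D ha h2 (hp.trans h1.2.2.1.le)).mem
    · rw [mul_assoc]
      exact hJ (mul_frozenIdeal_mem K h2 _)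
    · exact (T.not_digon D).elim
    · have := ccw_lt D'.r D'.s
      omega

theorem mul_e_mem_segSpan {a : σ.Vertex} {x : σ.Gam K} (hx : x ∈ segSpan σ K a) (c : σ.Vertex) :
    x * σ.e K c ∈ frozenIdeal σ K ⊔ Submodule.span K {x | Seg K a x c} := by
  obtain ⟨y, hy, z, hz, rfl⟩ := Submodule.mem_sup.mp hx
  rw [add_mul]
  refine Submodule.add_mem _ (Submodule.mem_sup_left (frozenIdeal_mul_mem K hy _))
    (Submodule.mem_sup_right ?_)
  clear hx
  induction hz using Submodule.span_induction with
  | zero => rw [zero_mul]; exact Submodule.zero_mem _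
  | add a b _ _ ha hb =>
    rw [add_mul]
    exact Submodule.add_mem _ ha hb
  | smul r a _ ha =>
    rw [smul_mul_assoc]
    exact Submodule.smul_mem _ _ ha
  | mem z hz =>
    obtain ⟨b, hb⟩ := hz
    by_cases hc : b = c
    · subst hc
      rw [hb.mul_e]
      exact Submodule.subset_span hb
    · rw [← hb.mul_e, mul_assoc, e_mul_of_ne K hc, mul_zero]
      exact Submodule.zero_mem _

theorem mul_arr_mem_segSpan {a : σ.Vertex} {x : σ.Gam K} (hx : x ∈ segSpan σ K a) (β : σ.Arrow) :
    x * arr K β ∈ segSpan σ K a := by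
  rw [← e_src_mul, ← mul_assoc]
  obtain ⟨y, hy, z, hz, h⟩ := Submodule.mem_sup.mp (mul_e_mem_segSpan hx (σ.src β))
  rw [← h, add_mul]
  refine Submodule.add_mem _ (Submodule.mem_sup_left (frozenIdeal_mul_mem K hy _)) ?_
  clear h
  induction hz using Submodule.span_induction with
  | zero => rw [zero_mul]; exact Submodule.zero_mem _
  | add a b _ _ ha hb => rw [add_mul]; exact Submodule.add_mem _ ha hb
  | smul r a _ ha => rw [smul_mul_assoc]; exact Submodule.smul_mem _ _ ha
  | mem z hz => exact Seg.mul_arr_mem hz β rfl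

/-- The algebra `e_a Γ e_a / e_a Γ e_F Γ e_a` has dimension at most one. -/
theorem e_mul_mul_e_mem (a : σ.Vertex) (x : σ.Gam K) :
    ∃ (r : K), σ.e K a * x * σ.e K a - r • σ.e K a ∈ frozenIdeal σ K := by
  have h1 := mul_mem_of_generators K (segSpan σ K a)
    (fun x hx c => by
      obtain ⟨y, hy, z, hz, h⟩ := Submodule.mem_sup.mp (mul_e_mem_segSpan hx c)
      rw [← h]
      exact Submodule.add_mem _ (Submodule.mem_sup_left hy)
        (Submodule.mem_sup_right (Submodule.span_mono
          (fun w (hw : Seg K a w c) => (⟨c, hw⟩ : ∃ b, Seg K a w b)) hz)))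
    (fun x hx β => mul_arr_mem_segSpan hx β) (Seg.triv (K := K) (a := a)).mem x
  obtain ⟨y, hy, z, hz, h⟩ := Submodule.mem_sup.mp (mul_e_mem_segSpan h1 a)
  have h2 : {x | Seg K a x a} ⊆ {σ.e K a} := fun w hw => hw.eq_of_eq rfl
  obtain ⟨r, rfl⟩ := Submodule.mem_span_singleton.mp (Submodule.span_mono h2 hz)
  exact ⟨r, by rwa [← h, add_sub_cancel_right]⟩

variable (K)

/-! ### The centre -/

theorem vertex_eq_sideVertex {r t : Fin n} (h : chord r t ∈ σ.edges) (hd : ccw r t = 1) :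
    (⟨chord r t, h⟩ : σ.Vertex) = σ.sideVertex r :=
  Subtype.ext (congrArg (chord r) (ccw_eq_one.mp hd))

/-- Out of an edge, one step along the boundary, and back into the edge around the same vertex: this
is the planar cycle. -/
theorem Out_mul_In_same {k : Fin n} {p : ℕ} {c : σ.Vertex} (h : σ.At k p c) :
    Out K σ k p * (xs K σ (k - 1) (ccw (k - 1) k) * In K σ k p) = cycleAt K c := by
  rw [ccw_sub_one, xs_sub_one, cycleAt_eq K h, ← mul_assoc]
  rfl

/-- If a chord cuts off all the sides but one, turning around its start to that side and around its
end from it is the planar cycle. -/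
theorem Out_mul_In_of_ccw_eq {r t : Fin n} (h : chord r t ∈ σ.edges) (hd : ccw r t + 1 = n) :
    Out K σ r (ccw r t) * In K σ t (n + ccw t r) = cycleAt K ⟨chord r t, h⟩ := by
  have hrt := ccw_add_ccw (ne_of_chord_mem h)
  have htr : ccw t r = 1 := by omega
  have hside := chord_mem_of_ccw_eq_one (σ := σ) htr
  have hr1 : r - 1 = t := by rw [ccw_eq_one.mp htr, add_sub_cancel_right]
  have hOut : Out K σ r (n + ccw r t) = eS K σ t := by
    rw [show n + ccw r t = 2 * n - 1 by omega, Out_last, hr1]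
  have hside' : eS K σ t = σ.e K ⟨chord t r, hside⟩ :=
    congrArg _ (vertex_eq_sideVertex hside htr).symm
  have hIn : In K σ t (ccw t r) = eS K σ t := by rw [htr, In_one]
  -- The remaining side belongs to the piece beyond the chord, which is a triangle at the puncture
  -- or a digon.
  rcases exists_beyond h with ⟨q, h1, -⟩ | ⟨q, h1, h2, h3, h4⟩ | ⟨τ, h1, h2⟩ | ⟨-, h1 | h1⟩
  · have := ccw_lt r q
    omega
  · have h5 := ccw_rel q r t
    have h6 := ccw_lt q t
    omega
  · have h5 := (ne_of_chord_mem h).symm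
    let T : σ.PunctureTriangle := ⟨τ, r, t, h5.symm, h, h1, h2⟩
    let T' : σ.PunctureTriangle := ⟨τ, t, r, h5, hside, h2, h1⟩
    have e1 : arr K (.puncR T) * Out K σ r n = Out K σ r (ccw r t) := puncR_Out K T
    have e2 : arr K (.puncS T') * Out K σ r (n + ccw r t) = Out K σ r n := puncS_Out K T'
    have e3 : In K σ t (ccw t r) * arr K (.puncR T') = In K σ t n := In_puncR K T'
    have e4 : In K σ t n * arr K (.puncS T) = In K σ t (n + ccw t r) := In_puncS K T
    have e5 : arr K (.puncS T') * eS K σ t = arr K (.puncS T') := by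
      rw [hside']
      exact arr_mul_e K (.puncS T')
    have e6 : arr K (.puncS T') * arr K (.puncR T') = arr K (.puncO T) := by
      rw [puncS_mul_puncR]
      change σ.e K (σ.src (.puncO T)) * P K σ T.r 0 (ccw T.r T.s) = _
      rw [P_puncO, e_src_mul]
    have e7 := arr_mul_cmp K (α := .puncR T) rfl
    simp only [cmp, compl, map_mul] at e7
    rw [← e1, ← e2, hOut, e5, ← e4, ← e3, hIn, mul_assoc, ← mul_assoc (arr K (.puncS T')),
      ← mul_assoc (arr K (.puncS T')), e5, e6]
    exact e7
  · let D : σ.Digon := ⟨r, t, ne_of_chord_mem h, h, hside, h1 _, h1 _⟩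
    have e1 : arr K (.gamma D) * Out K σ r n = Out K σ r (ccw r t) := gamma_Out K D
    have e2 : arr K (.delta D) * Out K σ r (n + ccw r t) = Out K σ r n := delta_Out K D
    have e3 : In K σ t (ccw t r) * arr K (.eta D) = In K σ t (n + ccw t r) := In_eta K D
    have e5 : arr K (.delta D) * eS K σ t = arr K (.delta D) := by
      rw [hside']
      exact arr_mul_e K (.delta D)
    have e7 := arr_mul_cmp K (α := .gamma D) rfl
    simp only [cmp, compl, map_mul] at e7
    rw [← e1, ← e2, hOut, e5, ← e3, hIn, mul_assoc, ← mul_assoc (arr K (.delta D)), e5]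
    exact e7
  · let D : σ.Digon := ⟨t, r, (ne_of_chord_mem h).symm, hside, h, h1 _, h1 _⟩
    have e1 : arr K (.eta D) * Out K σ r (n + ccw r t) = Out K σ r (ccw r t) := eta_Out K D
    have e3 : In K σ t (ccw t r) * arr K (.gamma D) = In K σ t n := In_gamma K D
    have e4 : In K σ t n * arr K (.delta D) = In K σ t (n + ccw t r) := In_delta K D
    have e5 : arr K (.eta D) * eS K σ t = arr K (.eta D) := by
      rw [hside']
      exact arr_mul_e K (.eta D)
    have e6 : arr K (.eta D) * arr K (.alpha D) = 0 := eta_mul_alpha K D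
    have e7 := arr_mul_cmp K (α := .eta D) rfl
    simp only [cmp, compl, map_mul, map_add] at e7
    rw [mul_add] at e7
    have e8 : arr K (.eta D) * (arr K (.alpha D) * arr K (.beta D)) = 0 := by
      rw [← mul_assoc, e6, zero_mul]
    rw [← e1, hOut, e5, ← e4, ← e3, hIn, ← mul_assoc, ← mul_assoc, e5, mul_assoc]
    exact (zero_add _).symm.trans ((congrArg (· + _) e8.symm).trans e7)

/-- Out of a chord around its start and back into it around its end: a multiple of the planar cycle.
-/
theorem Out_mul_In_second {r t : Fin n} (h : chord r t ∈ σ.edges) :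
    ∃ f : K[X], Out K σ r (ccw r t) * (xs K σ (r - 1) (ccw (r - 1) t) * In K σ t (n + ccw t r)) =
      cp σ f * cycleAt K ⟨chord r t, h⟩ := by
  have h1 := ccw_rel (r - 1) r t
  rw [ccw_sub_one] at h1
  have h2 := ccw_lt (r - 1) t
  have h3 := ccw_lt r t
  by_cases hd : ccw r t + 1 = n
  · refine ⟨1, ?_⟩
    have ht : r - 1 = t := by
      have := shift_ccw (r - 1) t
      rwa [show ccw (r - 1) t = 0 by omega, shift_zero] at this
    have h4 : eS K σ t * In K σ t (n + ccw t r) = In K σ t (n + ccw t r) := eS_mul_In K _ _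
    rw [cp_one, one_mul, ht, ccw_self, xs, h4, Out_mul_In_of_ccw_eq K h hd]
  · refine ⟨X, ?_⟩
    have h4 := y_mul_outer_mul_In K h
    have h5 : cycleAt K ⟨chord r t, h⟩ = σ.e K ⟨chord r t, h⟩ * planarSum K σ :=
      (e_mul_planarSum K _).symm
    -- Here the path is the square of the planar cycle, by the sweep across the chord.
    have h6 : cycleAt K ⟨chord r t, h⟩ * cycleAt K ⟨chord r t, h⟩ =
        bigSum K σ * cycleAt K ⟨chord r t, h⟩ := by
      rw [h5, mul_assoc, planarSum_mul K (_ * _), mul_assoc, planarSum_mul_planarSum,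
        ← mul_assoc, e_mul_self, ← mul_assoc, ← bigSum_mul, mul_assoc]
    rw [show ccw (r - 1) t = 1 + ccw r t by omega, ← outer_mul_xs, mul_assoc, ← h4, cp_X, ← h6,
      cycleAt_eq K (.out h), ← In_mul_Out K (.out h)]
    simp only [Cat, mul_assoc]

/-- Out of a chord around its end and back into it around its start: the big cycle. -/
theorem Out_mul_In_first {r t : Fin n} (h : chord r t ∈ σ.edges) (hd1 : ccw r t ≠ 1) :
    Out K σ t (n + ccw t r) * (xs K σ (t - 1) (ccw (t - 1) r) * In K σ r (ccw r t)) =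
      bigAt K ⟨chord r t, h⟩ := by
  have h1 := ccw_rel (t - 1) t r
  rw [ccw_sub_one] at h1
  have h2 := ccw_lt (t - 1) r
  have h3 := ccw_add_ccw (ne_of_chord_mem h)
  have h4 := ccw_lt t r
  rw [show ccw (t - 1) r = ccw t r + 1 by omega, ← mul_assoc]
  rfl

/-- The elements of `Γ e_F Γ` with both ends at an inner edge are combinations of the big cycle and
of the planar cycle. -/
theorem e_mul_mul_e_of_mem_frozenIdeal {a : σ.Vertex} (ha : ∀ k, a ≠ σ.sideVertex k) {x : σ.Gam K}
    (hx : x ∈ frozenIdeal σ K) : ∃ f g : K[X],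
      σ.e K a * x * σ.e K a = cp σ f * cycleAt K a + cp σ g * bigAt K a := by
  induction hx using Submodule.span_induction with
  | zero => exact ⟨0, 0, by simp [cp_zero]⟩
  | add a b _ _ ha hb =>
    obtain ⟨f, g, h1⟩ := ha
    obtain ⟨f', g', h2⟩ := hb
    refine ⟨f + f', g + g', ?_⟩
    rw [mul_add, add_mul, h1, h2, cp_add, cp_add]
    noncomm_ring
  | smul c a _ ha =>
    obtain ⟨f, g, h1⟩ := ha
    refine ⟨C c * f, C c * g, ?_⟩
    rw [mul_smul_comm, smul_mul_assoc, h1, cp_mul, cp_mul, cp_C, Algebra.smul_def, mul_add,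
      mul_assoc, mul_assoc]
  | mem b hb =>
    obtain ⟨k, p, c, z, hk, rfl⟩ | ⟨D, z, rfl⟩ := hb
    · by_cases hc : a = c
      swap
      · refine ⟨0, 0, ?_⟩
        rw [← e_mul_Out K hk, ← mul_assoc, ← mul_assoc, e_mul_of_ne K hc]
        simp [cp_zero]
      subst hc
      have h1 : σ.e K a * (Out K σ k p * z) * σ.e K a =
          Out K σ k p * (eS K σ (k - 1) * z * σ.e K a) := by
        rw [← mul_assoc, e_mul_Out K hk, ← mul_assoc, ← mul_assoc, Out_mul_eS]
      rw [h1]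
      cases hk with
      | @out t h =>
        have hd : ccw k t ≠ 1 := fun h' => ha k (vertex_eq_sideVertex h h')
        obtain ⟨f, g, h2⟩ := row_chord K h (k - 1) z
        obtain ⟨q, h3⟩ := Out_mul_In_second K h
        refine ⟨f + g * q, 0, ?_⟩
        rw [h2, mul_add, cp_mul_left_comm, cp_mul_left_comm, Out_mul_In_same K (.out h), h3,
          cp_zero, zero_mul, add_zero, cp_add, cp_mul, add_mul, mul_assoc]
      | @mid τ h hτ =>
        obtain ⟨f, h2⟩ := row_mid K (.mid h hτ) (k - 1) z
        refine ⟨f, 0, ?_⟩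
        rw [h2, cp_mul_left_comm, Out_mul_In_same K (.mid h hτ), cp_zero, zero_mul, add_zero]
      | @inc r h =>
        have hd : ccw r k ≠ 1 := fun h' => ha r (vertex_eq_sideVertex h h')
        obtain ⟨f, g, h2⟩ := row_chord K h (k - 1) z
        refine ⟨g, f, ?_⟩
        rw [h2, mul_add, cp_mul_left_comm, cp_mul_left_comm, Out_mul_In_same K (.inc h),
          Out_mul_In_first K h hd, add_comm]
    · by_cases hc : a = ⟨spoke D.r .notched, D.mem_notched⟩
      swap
      · refine ⟨0, 0, ?_⟩
        rw [← e_mul_notchedOut, ← mul_assoc, ← mul_assoc, e_mul_of_ne K hc]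
        simp [cp_zero]
      subst hc
      obtain ⟨f, h2⟩ := row_notched K D (D.r - 1) z
      refine ⟨0, f, ?_⟩
      have h1 : notchedOut K D * eS K σ (D.r - 1) = notchedOut K D := by
        unfold notchedOut
        rw [mul_assoc, Out_mul_eS]
      rw [← mul_assoc, e_mul_notchedOut, mul_assoc, ← h1, mul_assoc, ← mul_assoc (eS K σ _), h2,
        cp_mul_left_comm, ccw_sub_one, xs_sub_one, ← mul_assoc (notchedOut K D), bigAt_notched,
        cp_zero, zero_mul, zero_add]

theorem single_eq_zero_iff {V B : Type*} [DecidableEq V] [Zero B] {i j : V} {x : B} :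
    Matrix.single i j x = 0 ↔ x = 0 := by
  constructor
  · intro h
    have := congrFun (congrFun h i) j
    rwa [Matrix.single_apply_same] at this
  · rintro rfl
    exact Matrix.single_zero i j

section Centre

variable {K} {ω : BigR K n} (hω : IsWinding ω)

/-- The planar cycle of a side is the second generator of `e_i Γ e_i`. -/
theorem eS_mul_planarSum (i : Fin n) :
    eS K σ i * planarSum K σ = xs K σ i 1 * In K σ (i + 1) (2 * n - 1) := by
  have := xs_sub_one K (σ := σ) (i + 1)
  rw [add_sub_cancel_right] at this
  rw [e_mul_planarSum, cycleAt_side, this, In_last, y_mul_outer]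

theorem rep_eS_mul_planarSum (i : Fin n) : rep σ hω.mul_self (eS K σ i * planarSum K σ) =
    Matrix.single (σ.sideVertex i) (σ.sideVertex i) (BigR.u K n (2 * n : ℕ) * ω) := by
  have h2 : 2 ≤ n := Nat.AtLeastTwo.prop
  have h := at_side_sub_one (σ := σ) (i + 1)
  rw [add_sub_cancel_right] at h
  rw [eS_mul_planarSum, rep_xs_mul_In _ (shift_one i) h, wt_cross (by omega) (by omega) (by omega),
    ← mul_assoc, ← BigR.u_add]
  congr 3
  push_cast
  omega

/-- Each side `i` has the ring `e_i Γ e_i`, which is spanned over `K[X]` by the idempotent and the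
planar cycle. -/
theorem eS_mul_mul_eS (i : Fin n) (x : σ.Gam K) : ∃ f g : K[X],
    eS K σ i * x * eS K σ i = eS K σ i * (cp σ f + cp σ g * planarSum K σ) := by
  obtain ⟨f, g, h⟩ := row_chord K (side_mem (σ := σ) i) i x
  refine ⟨f, g, ?_⟩
  have h1 := ccw_add_ccw (ne_of_chord_mem (σ := σ) (side_mem i))
  rw [ccw_add_one] at h1
  refine h.trans ?_
  rw [ccw_self, ccw_add_one, xs, In_one, e_mul_self,
    show n + ccw (i + 1) i = 2 * n - 1 by omega, ← eS_mul_planarSum, mul_add, cp_mul_left_comm,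
    cp_mul_comm f]

include hω in
/-- A central element which annihilates one side of the polygon annihilates all of them. -/
theorem eS_mul_eq_zero {z : σ.Gam K} (hz : ∀ x, x * z = z * x) {i : Fin n}
    (hi : eS K σ i * z = 0) (j : Fin n) : eS K σ j * z = 0 := by
  obtain ⟨f, g, h⟩ := eS_mul_mul_eS j z
  rw [mul_assoc, ← hz, ← mul_assoc, e_mul_self] at h
  -- Transport along the boundary from the side `i` to the side `j`; its value is invertible in the
  -- representation.
  have h1 : xs K σ i (ccw i j) * (eS K σ j * z) = 0 := by
    have := xs_mul_eS K (σ := σ) i (ccw i j)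
    rw [shift_ccw] at this
    rw [← mul_assoc, this, ← eS_mul_xs, mul_assoc, hz, ← mul_assoc, hi, zero_mul]
  have h2 := congrArg (rep σ hω.mul_self) h1
  rw [h, mul_add, cp_mul_left_comm, map_zero, map_mul, map_add, rep_xs, rep_eS_mul_cp,
    rep_cp_mul _ _ _ (by rw [← mul_assoc, e_mul_self]) (rep_eS_mul_planarSum hω j), shift_ccw,
    ← Matrix.single_add, Matrix.single_mul_single_same, single_eq_zero_iff] at h2
  have h3 := hω.eq_zero_and_eq_zero (f := f) (g := g) (a := 2 * ccw i j)
    (b := 2 * ccw i j + (2 * n : ℕ)) (by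
      rw [← h2, BigR.u_add]
      ring)
  rw [h, h3.1, h3.2, cp_zero, zero_mul, add_zero, mul_zero]

theorem C_mul_add_mul_X_eq_zero {r : K} {f : K[X]} (h : C r + f * X = 0) : r = 0 ∧ f = 0 := by
  have h0 : r = 0 := by
    have := congrArg (fun p => coeff p 0) h
    simpa using this
  subst h0
  rw [C_0, zero_add] at h
  exact ⟨rfl, (mul_eq_zero.mp h).resolve_right X_ne_zero⟩

include hω in
/-- A central element which annihilates the sides of the polygon is zero. -/
theorem eq_zero_of_eS_mul_eq_zero {z : σ.Gam K} (hz : ∀ x, x * z = z * x)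
    (hi : ∀ i, eS K σ i * z = 0) : z = 0 := by
  have main : ∀ a, σ.e K a * z = 0 := by
    intro a
    by_cases ha : ∀ k, a ≠ σ.sideVertex k
    swap
    · push Not at ha
      obtain ⟨k, rfl⟩ := ha
      exact hi k
    -- Modulo `Γ e_F Γ`, the component of `z` at an inner edge is a scalar `r`; the rest is a
    -- combination of the planar and the big cycle.
    obtain ⟨r, hr⟩ := e_mul_mul_e_mem a z
    obtain ⟨f, g, h1⟩ := e_mul_mul_e_of_mem_frozenIdeal K ha hr
    have h2 : σ.e K a * z * σ.e K a = σ.e K a * z := by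
      rw [mul_assoc, ← hz, ← mul_assoc, e_mul_self]
    rw [mul_sub, sub_mul, mul_smul_comm, smul_mul_assoc, e_mul_self, e_mul_self,
      ← mul_assoc, ← mul_assoc, e_mul_self, h2, h2, sub_eq_iff_eq_add, ← h2] at h1
    -- As `z` annihilates the sides, it annihilates every path from a side to the edge `a`.
    have h3 : ∀ k x, eS K σ k * x * σ.e K a * (σ.e K a * z) = 0 := by
      intro k x
      rw [hz (σ.e K a), ← mul_assoc, hz (_ * _), ← mul_assoc, ← mul_assoc, ← hz (eS K σ k), hi]
      simp only [zero_mul]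
    have h4 : ∀ {k x}, eS K σ k * x = x → x * σ.e K a = x → cp σ f * (x * planarSum K σ)
        + cp σ g * (x * bigSum K σ) + r • x = 0 := by
      intro k x h5 h6
      have := h3 k x
      rw [h5, h6, ← h2, h1, ← e_mul_planarSum, ← e_mul_bigSum, mul_add, mul_add, cp_mul_left_comm,
        cp_mul_left_comm, ← mul_assoc x, ← mul_assoc x, mul_smul_comm, h6] at this
      exact this
    -- On such a path, `r` and the coefficient of the big cycle combine to the polynomial `r + g X`,
    -- and both vanish together with it.
    have h5 : ∀ x : σ.Gam K, cp σ g * (x * bigSum K σ) + r • x = cp σ (C r + g * X) * x := by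
      intro x
      rw [cp_add, cp_mul, cp_C, cp_X, add_mul, ← Algebra.smul_def, mul_assoc, bigSum_mul, add_comm]
    suffices h : r = 0 ∧ cp σ f * cycleAt K a + cp σ g * bigAt K a = 0 by
      rw [← h2, h1, h.1, h.2, zero_smul, add_zero]
    obtain ⟨⟨k, t⟩ | ⟨k, τ⟩, h⟩ := a
    · have h6 : In K σ k (ccw k t) * planarSum K σ =
          xs K σ k (ccw k t) * In K σ t (n + ccw t k) := by
        rw [← In_mul_e K (.out h), mul_assoc, e_mul_planarSum, cycleAt_eq K (.out h), Cat,
          ← y_mul_outer_mul_In K h, ← In_mul_Out K (.out h)]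
        simp only [mul_assoc]
      have h7 := h4 (eS_mul_In K k _) (In_mul_e K (.out h))
      have h8 := rep_first hω.mul_self h k
      rw [ccw_self, xs, eS_mul_In] at h8
      have h9 := congrArg (rep σ hω.mul_self) h7
      rw [add_assoc, h5, h6, map_add, map_zero, rep_cp_mul _ _ _ (eS_mul_In K _ _) h8,
        rep_cp_mul _ _ _ (by rw [← mul_assoc, eS_mul_xs]) (rep_second hω.mul_self h k),
        ← Matrix.single_add, single_eq_zero_iff, add_comm] at h9
      obtain ⟨h10, rfl⟩ := hω.eq_zero_and_eq_zero h9
      obtain ⟨rfl, rfl⟩ := C_mul_add_mul_X_eq_zero h10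
      exact ⟨rfl, by simp [cp_zero]⟩
    · rcases spoke_cases h with hA | ⟨D, rfl, rfl⟩
      · have h6 : planarSum K σ * In K σ k n = bigSum K σ * In K σ k n := by
          rw [← In_mul_e K hA, planarSum_mul, bigSum_mul, mul_assoc, mul_assoc, e_mul_planarSum,
            e_mul_bigSum, bigAt_mid K hA, cycleAt_eq K hA]
        have h7 := h4 (eS_mul_In K k _) (In_mul_e K hA)
        have h8 := rep_mid hω.mul_self hA k
        rw [ccw_self, xs, eS_mul_In] at h8
        have h9 := congrArg (rep σ hω.mul_self) h7
        have h10 : cp σ f * (In K σ k n * planarSum K σ) = cp σ (f * X) * In K σ k n := by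
          rw [← planarSum_mul, h6, cp_mul, cp_X, mul_assoc]
        rw [add_assoc, h5, h10, ← add_mul, ← cp_add, map_zero,
          rep_cp_mul _ _ _ (eS_mul_In K _ _) h8, single_eq_zero_iff] at h9
        have h11 := hω.eq_zero h9
        obtain ⟨rfl, h12⟩ := C_mul_add_mul_X_eq_zero (r := r) (f := f + g) (by
          rw [← h11]
          ring)
        refine ⟨rfl, ?_⟩
        rw [bigAt_mid K hA, cycleAt_eq K hA, ← add_mul, ← cp_add, h12, cp_zero, zero_mul]
      · have h6 : notchedIn K D * planarSum K σ = 0 := by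
          rw [← notchedIn_mul_e, mul_assoc, e_mul_planarSum, cycleAt_notched, mul_zero]
        have h7' : eS K σ D.r * notchedIn K D = notchedIn K D := by
          unfold notchedIn
          rw [← mul_assoc, eS_mul_In]
        have h7 := h4 h7' (notchedIn_mul_e K D)
        have h9 := congrArg (rep σ hω.mul_self) h7
        have h8 := rep_notchedIn hω.mul_self D
        rw [add_assoc, h5, h6, mul_zero, zero_add, map_zero, rep_cp_mul _ _ _ h7' h8,
          single_eq_zero_iff] at h9
        obtain ⟨rfl, rfl⟩ := C_mul_add_mul_X_eq_zero (hω.one_sub.eq_zero h9)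
        refine ⟨rfl, ?_⟩
        rw [cycleAt_notched, cp_zero, mul_zero, zero_mul, add_zero]
  have := sum_e K (σ := σ)
  rw [← one_mul z, ← this, Finset.sum_mul]
  exact Finset.sum_eq_zero fun a _ => main a

variable (n) in
theorem isWinding_eps : IsWinding (eps K n) := .inl rfl

/-- The centre is generated over `K` by the big cycles and the planar cycles. -/
theorem exists_eq_of_mem_center {z : σ.Gam K} (hz : ∀ x, x * z = z * x) :
    ∃ f g : K[X], z = cp σ f + cp σ g * planarSum K σ := by
  -- Read off the coefficients at one side; the difference annihilates that side, hence all of them,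
  -- hence is zero.
  obtain ⟨f, g, h⟩ := eS_mul_mul_eS 0 z
  refine ⟨f, g, ?_⟩
  rw [mul_assoc, ← hz, ← mul_assoc, e_mul_self] at h
  have hz' : ∀ x, x * (z - (cp σ f + cp σ g * planarSum K σ)) =
      (z - (cp σ f + cp σ g * planarSum K σ)) * x := by
    intro x
    rw [mul_sub, sub_mul, hz, mul_add, add_mul, ← cp_mul_comm, cp_mul_left_comm, mul_assoc,
      planarSum_mul]
  have h1 := eS_mul_eq_zero (isWinding_eps n) hz' (i := 0) (by rw [mul_sub, h, sub_self])
  exact sub_eq_zero.mp (eq_zero_of_eS_mul_eq_zero (isWinding_eps n) hz' h1)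

end Centre

/-! ### The isomorphism of `R'` with the centre -/

section CentreEquiv

open Classical in
variable (σ) in
/-- The value of winding once around the puncture: the idempotent `u⁻¹ v` if some plain arc of `σ`
is incident to the puncture, and the complementary one otherwise. -/
def winding : BigR K n := if σ.HasPlain then eps K n else 1 - eps K n

variable (σ) in
theorem isWinding_winding : IsWinding (winding σ K) := by
  unfold winding IsWinding
  split_ifs <;> simp

open Classical in
variable (σ) in
/-- The image of `Y` in the centre: the sum of the planar cycles if some plain arc of `σ` is
incident to the puncture, and its complement in the sum of the big cycles otherwise. -/
def yC : Subalgebra.center K (σ.Gam K) :=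
  if σ.HasPlain then planarC K σ else bigC K σ - planarC K σ

theorem planarC_mul_planarC : planarC K σ * planarC K σ = bigC K σ * planarC K σ :=
  Subtype.ext (planarSum_mul_planarSum K)

theorem yC_mul_yC : yC σ K * yC σ K = bigC K σ * yC σ K := by
  have h := planarC_mul_planarC K (σ := σ)
  unfold yC
  split_ifs
  · exact h
  · have h1 : planarSum K σ * planarSum K σ = bigSum K σ * planarSum K σ := congrArg Subtype.val h
    have h2 := planarSum_mul K (bigSum K σ)
    refine Subtype.ext ?_
    change (bigSum K σ - planarSum K σ) * (bigSum K σ - planarSum K σ) =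
      bigSum K σ * (bigSum K σ - planarSum K σ)
    simp only [mul_sub, sub_mul, h1, h2, sub_self, sub_zero]

variable (σ) in
/-- The homomorphism from `R'` to the centre of `Γ_σ`. -/
def centreHom : RPrime K →ₐ[K] Subalgebra.center K (σ.Gam K) :=
  AdjoinRoot.liftAlgHom _ (aeval (bigC K σ)) (yC σ K) (by
    rw [eval₂_mul, eval₂_sub, eval₂_X, eval₂_C]
    have : (aeval (bigC K σ) : K[X] →ₐ[K] _) X = bigC K σ := aeval_X _
    change yC σ K * (yC σ K - aeval (bigC K σ) X) = 0
    rw [this]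
    refine Subtype.ext ?_
    change (yC σ K).1 * ((yC σ K).1 - bigSum K σ) = 0
    rw [mul_sub, sub_eq_zero, ← bigSum_mul]
    exact congrArg Subtype.val (yC_mul_yC K))

variable {K}

theorem centreHom_of (f : K[X]) :
    centreHom σ K (AdjoinRoot.of _ f) = aeval (bigC K σ) f :=
  AdjoinRoot.liftAlgHom_of _ _ _ _ _

theorem centreHom_y : centreHom σ K (RPrime.y K) = yC σ K :=
  AdjoinRoot.liftAlgHom_root _ _ _ _

theorem centreHom_x : centreHom σ K (RPrime.x K) = bigC K σ := by
  unfold RPrime.x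
  rw [centreHom_of, aeval_X]

theorem rep_eS_mul_yC (i : Fin n) :
    rep σ (isWinding_winding σ K).mul_self (eS K σ i * (yC σ K).1) =
      Matrix.single (σ.sideVertex i) (σ.sideVertex i) (BigR.u K n (2 * n : ℕ) * eps K n) := by
  have h1 := rep_eS_mul_planarSum (σ := σ) (isWinding_winding σ K) i
  have h2 := rep_eS_mul_cp (σ := σ) (isWinding_winding σ K).mul_self i X
  rw [cp_X, ofPoly_X] at h2
  by_cases h : σ.HasPlain
  · rw [show (yC σ K).1 = planarSum K σ from congrArg _ (if_pos h), h1, winding, if_pos h]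
  · rw [show (yC σ K).1 = bigSum K σ - planarSum K σ from congrArg _ (if_neg h), mul_sub, map_sub,
      h1, h2, winding, if_neg h, sub_eq_iff_eq_add, ← Matrix.single_add]
    congr 1
    ring

theorem rep_eS_mul_centreHom (i : Fin n) (r : RPrime K) :
    rep σ (isWinding_winding σ K).mul_self (eS K σ i * (centreHom σ K r).1) =
      Matrix.single (σ.sideVertex i) (σ.sideVertex i) (BigR.incl K n r) := by
  obtain ⟨f, g, rfl⟩ := RPrime.exists_eq r
  have h : (centreHom σ K (AdjoinRoot.of _ f + AdjoinRoot.of _ g * RPrime.y K)).1 =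
      cp σ f + cp σ g * (yC σ K).1 := by
    rw [map_add, map_mul, centreHom_of, centreHom_of, centreHom_y]
    rfl
  rw [h, mul_add, cp_mul_left_comm, map_add, rep_eS_mul_cp,
    rep_cp_mul _ _ _ (by rw [← mul_assoc, e_mul_self]) (rep_eS_mul_yC i), ← Matrix.single_add,
    map_add, map_mul, incl_of, incl_of, incl_y]

theorem incl_injective : Function.Injective (BigR.incl K n) := by
  rw [injective_iff_map_eq_zero]
  intro r hr
  obtain ⟨f, g, rfl⟩ := RPrime.exists_eq r
  rw [map_add, map_mul, incl_of, incl_of, incl_y, ← mul_one (BigR.ofPoly K n f),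
    ← BigR.u_zero] at hr
  obtain ⟨rfl, rfl⟩ := (isWinding_eps n).eq_zero_and_eq_zero hr
  rw [map_zero, zero_mul, add_zero]

variable (σ K) in
/-- Injectivity is seen at one side, in the representation. -/
theorem centreHom_bijective : Function.Bijective (centreHom σ K) := by
  constructor
  · rw [injective_iff_map_eq_zero]
    intro r hr
    have h := rep_eS_mul_centreHom (σ := σ) 0 r
    rw [hr, ZeroMemClass.coe_zero, mul_zero, map_zero, eq_comm, single_eq_zero_iff] at h
    exact (injective_iff_map_eq_zero _).mp (incl_injective (n := n)) r h
  · intro z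
    obtain ⟨f, g, h⟩ := exists_eq_of_mem_center (z := z.1) (Subalgebra.mem_center_iff.mp z.2)
    by_cases hp : σ.HasPlain
    · refine ⟨AdjoinRoot.of _ f + AdjoinRoot.of _ g * RPrime.y K, Subtype.ext ?_⟩
      rw [map_add, map_mul, centreHom_of, centreHom_of, centreHom_y, h, yC, if_pos hp]
      rfl
    · refine ⟨AdjoinRoot.of _ (f + g * X) - AdjoinRoot.of _ g * RPrime.y K, Subtype.ext ?_⟩
      rw [map_sub, map_mul, centreHom_of, centreHom_of, centreHom_y, h, yC, if_neg hp]
      change cp σ (f + g * X) - cp σ g * (bigSum K σ - planarSum K σ) = _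
      rw [cp_add, cp_mul, cp_X]
      noncomm_ring

variable (σ K) in
/-- The isomorphism from `R'` to the centre of `Γ_σ`. -/
def centreEquiv : RPrime K ≃ₐ[K] Subalgebra.center K (σ.Gam K) :=
  AlgEquiv.ofBijective (centreHom σ K) (centreHom_bijective σ K)

theorem e_mul_centreEquiv_x (k : Fin n) :
    σ.e K (σ.sideVertex k) * (centreEquiv σ K (RPrime.x K)).1 = σ.bigCycle K k := by
  rw [bigCycle_eq]
  exact congrArg (fun z => σ.e K (σ.sideVertex k) * Subtype.val z) centreHom_x

theorem e_mul_centreEquiv_y_of_hasPlain {a : σ.Vertex} {w : List σ.Arrow}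
    (hw : σ.IsPlanarCycleAt a w) (h : σ.HasPlain) :
    σ.e K a * (centreEquiv σ K (RPrime.y K)).1 = σ.path K w := by
  rw [path_planarCycle K hw]
  change σ.e K a * (centreHom σ K (RPrime.y K)).1 = _
  rw [centreHom_y, yC, if_pos h]
  rfl

theorem e_mul_centreEquiv_y_of_not_hasPlain {a : σ.Vertex} {w : List σ.Arrow}
    (hw : σ.IsPlanarCycleAt a w) (h : ¬σ.HasPlain) :
    σ.e K a * (centreEquiv σ K (RPrime.y K)).1 =
      σ.e K a * (centreEquiv σ K (RPrime.x K)).1 - σ.path K w := by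
  rw [path_planarCycle K hw, ← mul_sub]
  change σ.e K a * (centreHom σ K (RPrime.y K)).1 =
    σ.e K a * ((centreHom σ K (RPrime.x K)).1 - _)
  rw [centreHom_y, centreHom_x, yC, if_neg h]
  rfl

theorem e_mul_centreEquiv_y_notched (D : σ.Digon) :
    σ.e K ⟨spoke D.r .notched, D.mem_notched⟩ * (centreEquiv σ K (RPrime.y K)).1 = 0 := by
  change σ.e K _ * (centreHom σ K (RPrime.y K)).1 = _
  rw [centreHom_y, yC, if_pos ⟨D.r, spoke_mem_arcs D.mem_plain⟩]
  exact (e_mul_planarSum K _).trans (cycleAt_notched K D)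

end CentreEquiv

/-! ### The frozen part and its modules -/

section FrozenPart

variable {K}

/-- The entry of the representation of `x` at a side of the polygon and an edge. -/
def entry (i : Fin n) (a : σ.Vertex) (x : σ.Gam K) : BigR K n :=
  rep σ (isWinding_winding σ K).mul_self x (σ.sideVertex i) a

theorem entry_add (i : Fin n) (a : σ.Vertex) (x z : σ.Gam K) :
    entry i a (x + z) = entry i a x + entry i a z := by
  unfold entry
  rw [map_add, Matrix.add_apply]

theorem single_entry (i : Fin n) (a : σ.Vertex) (x : σ.Gam K) :
    rep σ (isWinding_winding σ K).mul_self (eS K σ i * x * σ.e K a) =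
      Matrix.single (σ.sideVertex i) a (entry i a x) := by
  rw [map_mul, map_mul, rep_e, rep_e, Matrix.single_mul_mul_single, one_mul, mul_one]
  rfl

theorem entry_eq_of_single {i : Fin n} {a : σ.Vertex} {x : σ.Gam K} {b : BigR K n}
    (h : rep σ (isWinding_winding σ K).mul_self x = Matrix.single (σ.sideVertex i) a b) :
    entry i a x = b := by
  unfold entry
  rw [h, Matrix.single_apply_same]

/-- The value at the puncture of an arc with a given tag. -/
def tagWinding (K : Type*) [Field K] (n : ℕ) : Tag → BigR K n
  | .plain => eps K n
  | .notched => 1 - eps K n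

theorem isWinding_tagWinding (τ : Tag) : IsWinding (tagWinding K n τ) := by
  cases τ
  · exact .inl rfl
  · exact .inr rfl

/-- Outside punctured digons, the winding is given by the common tag of the arcs. -/
theorem winding_eq_of_at {k : Fin n} {τ : Tag} {h : spoke k τ ∈ σ.edges}
    (hA : σ.At k n ⟨spoke k τ, h⟩) : winding σ K = tagWinding K n τ := by
  cases τ with
  | plain => exact if_pos ⟨k, spoke_mem_arcs h⟩
  | notched =>
    refine if_neg ?_
    rintro ⟨r, hr⟩
    have hr' : spoke r .plain ∈ σ.edges := mem_edges.mpr (.inr hr)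
    rcases (At.spoke_cases hA).2.2 with h' | h'
    · cases h'
    · by_cases hk : k = r
      · exact h' (hk ▸ hr')
      · cases tag_eq h hr' hk

theorem one_sub_winding_of_digon (D : σ.Digon) : 1 - winding σ K = tagWinding K n .notched := by
  unfold winding
  rw [if_pos ⟨D.r, spoke_mem_arcs D.mem_plain⟩]
  rfl

/-- The rows of the representation at a chord, and the fact that it is faithful there. -/
theorem entry_chord {r t : Fin n} (h : chord r t ∈ σ.edges) (i : Fin n) (x : σ.Gam K) :
    (∃ f g : K[X], entry i ⟨chord r t, h⟩ x =
      BigR.ofPoly K n f * BigR.u K n (2 * ccw i r + ccw r t - 1) +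
        BigR.ofPoly K n g * (BigR.u K n (2 * ccw i t + 2 * n - 1 - ccw r t) * winding σ K)) ∧
    (entry i ⟨chord r t, h⟩ x = 0 → eS K σ i * x * σ.e K ⟨chord r t, h⟩ = 0) := by
  obtain ⟨f, g, h1⟩ := row_chord K h i x
  have h2 := single_entry i ⟨chord r t, h⟩ x
  have hω := (isWinding_winding σ K).mul_self
  rw [h1, map_add, rep_cp_mul _ _ _ (by rw [← mul_assoc, eS_mul_xs]) (rep_first hω h i),
    rep_cp_mul _ _ _ (by rw [← mul_assoc, eS_mul_xs]) (rep_second hω h i),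
    ← Matrix.single_add] at h2
  have h3 := congrFun (congrFun h2 (σ.sideVertex i)) ⟨chord r t, h⟩
  rw [Matrix.single_apply_same, Matrix.single_apply_same] at h3
  refine ⟨⟨f, g, h3.symm⟩, fun h4 => ?_⟩
  obtain ⟨rfl, rfl⟩ := (isWinding_winding σ K).eq_zero_and_eq_zero (h3.trans h4)
  rw [h1, cp_zero, zero_mul, zero_mul, add_zero]

/-- Every combination of the two generators is attained at a chord. -/
theorem exists_entry_chord {r t : Fin n} (h : chord r t ∈ σ.edges) (i : Fin n) (f g : K[X]) :
    ∃ x : σ.Gam K, entry i ⟨chord r t, h⟩ x =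
      BigR.ofPoly K n f * BigR.u K n (2 * ccw i r + ccw r t - 1) +
        BigR.ofPoly K n g * (BigR.u K n (2 * ccw i t + 2 * n - 1 - ccw r t) * winding σ K) := by
  refine ⟨cp σ f * (xs K σ i (ccw i r) * In K σ r (ccw r t))
        + cp σ g * (xs K σ i (ccw i t) * In K σ t (n + ccw t r)), entry_eq_of_single ?_⟩
  have hω := (isWinding_winding σ K).mul_self
  rw [map_add, rep_cp_mul _ _ _ (by rw [← mul_assoc, eS_mul_xs]) (rep_first hω h i),
    rep_cp_mul _ _ _ (by rw [← mul_assoc, eS_mul_xs]) (rep_second hω h i),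
    ← Matrix.single_add]

/-- For an arc to the puncture, `e_i Γ e_a` is a cyclic `K[X]`-module, whose generator takes a value
determined by the tag of the arc. -/
theorem exists_generator_spoke {k : Fin n} {τ : Tag} (h : spoke k τ ∈ σ.edges) (i : Fin n) :
    ∃ γ : σ.Gam K, eS K σ i * γ = γ ∧
      (∀ x : σ.Gam K, ∃ f : K[X], eS K σ i * x * σ.e K ⟨spoke k τ, h⟩ = cp σ f * γ) ∧
      rep σ (isWinding_winding σ K).mul_self γ = Matrix.single (σ.sideVertex i) ⟨spoke k τ, h⟩
        (BigR.u K n (2 * ccw i k + n - 1) * tagWinding K n τ) := by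
  rcases spoke_cases h with hA | ⟨D, rfl, rfl⟩
  · refine ⟨xs K σ i (ccw i k) * In K σ k n, by rw [← mul_assoc, eS_mul_xs], row_mid K hA i, ?_⟩
    rw [rep_mid _ hA, winding_eq_of_at hA]
  · refine ⟨xs K σ i (ccw i D.r) * notchedIn K D, by rw [← mul_assoc, eS_mul_xs],
      row_notched K D i, ?_⟩
    rw [rep_notched, one_sub_winding_of_digon D]

/-- The rows of the representation at an arc to the puncture, and the fact that it is faithful
there. -/
theorem entry_spoke {k : Fin n} {τ : Tag} (h : spoke k τ ∈ σ.edges) (i : Fin n) (x : σ.Gam K) :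
    (∃ f : K[X], entry i ⟨spoke k τ, h⟩ x =
      BigR.ofPoly K n f * (BigR.u K n (2 * ccw i k + n - 1) * tagWinding K n τ)) ∧
    (entry i ⟨spoke k τ, h⟩ x = 0 → eS K σ i * x * σ.e K ⟨spoke k τ, h⟩ = 0) := by
  obtain ⟨γ, hγ, h0, hγ'⟩ := exists_generator_spoke (K := K) h i
  obtain ⟨f, h1⟩ := h0 x
  have h2 := single_entry i ⟨spoke k τ, h⟩ x
  rw [h1, rep_cp_mul _ _ _ hγ hγ'] at h2
  have h3 := congrFun (congrFun h2 (σ.sideVertex i)) ⟨spoke k τ, h⟩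
  rw [Matrix.single_apply_same, Matrix.single_apply_same] at h3
  refine ⟨⟨f, h3.symm⟩, fun h4 => ?_⟩
  rw [h1, (isWinding_tagWinding τ).eq_zero (h3.trans h4), cp_zero, zero_mul]

/-- Every multiple of the generator is attained at an arc to the puncture. -/
theorem exists_entry_spoke {k : Fin n} {τ : Tag} (h : spoke k τ ∈ σ.edges) (i : Fin n)
    (f : K[X]) : ∃ x : σ.Gam K, entry i ⟨spoke k τ, h⟩ x =
      BigR.ofPoly K n f * (BigR.u K n (2 * ccw i k + n - 1) * tagWinding K n τ) := by
  obtain ⟨γ, hγ, -, hγ'⟩ := exists_generator_spoke (K := K) h i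
  exact ⟨cp σ f * γ, entry_eq_of_single (rep_cp_mul _ _ _ hγ hγ')⟩

/-- The representation is faithful on `e_F Γ`. -/
theorem eq_zero_of_entry_eq_zero {i : Fin n} {a : σ.Vertex} {x : σ.Gam K}
    (h : entry i a x = 0) : eS K σ i * x * σ.e K a = 0 := by
  obtain ⟨⟨r, t⟩ | ⟨k, τ⟩, ha⟩ := a
  · exact (entry_chord ha i x).2 h
  · exact (entry_spoke ha i x).2 h

/-- At a chord `r → t` the exponent of the first description is that of the first generator
`u^(2 d(i,r) + d(r,t) - 1)`. The exponent of the second generator is the same if the pair is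
turning, and is larger by `2n` otherwise. -/
theorem thetaLength_chord {r t : Fin n} (h : r ≠ t) (i : Fin n) :
    (thetaLength (side i) (chord r t) : ℤ) = 2 * ccw i r + ccw r t - 1 ∧
      ((Turns (side i) (chord r t) ∧ 2 * (ccw i t : ℤ) + 2 * n - 1 - ccw r t =
          thetaLength (side i) (chord r t)) ∨
        (¬Turns (side i) (chord r t) ∧ 2 * (ccw i t : ℤ) + 2 * n - 1 - ccw r t =
          thetaLength (side i) (chord r t) + (2 * n : ℕ))) := by
  have h1 := ccw_rel i r t
  have h2 := ccw_rel i (i + 1) r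
  have h3 := ccw_rel i (i + 1) t
  have h4 := ccw_add_one i
  have h5 := ccw_lt i r
  have h6 := ccw_lt i t
  have h7 := ccw_lt (i + 1) r
  have h8 := ccw_lt (i + 1) t
  have h9 := ccw_add_ccw (r := i) (s := i + 1) (ne_of_ccw_pos (by omega))
  have h10 := ccw_pos h
  have hn : 2 ≤ n := Nat.AtLeastTwo.prop
  have e1 : thetaLength (side i) (chord r t) = ccw i r + ccw (i + 1) t +
      if (ccw (i + 1) r < ccw (i + 1) i ↔ ccw (i + 1) r < ccw (i + 1) t) then 0 else n := by
    unfold thetaLength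
    classical
    exact congrArg _ (if_congr Iff.rfl rfl rfl)
  have e2 : Turns (side i) (chord r t) ↔ ccw i t < ccw i (i + 1) ∨ ccw i t < ccw i r := Iff.rfl
  rw [e2, e1]
  split_ifs <;> refine ⟨?_, ?_⟩ <;> push_cast <;> omega

/-- The exponent of the first description at an arc to the puncture. -/
theorem thetaLength_spoke (i k : Fin n) (τ : Tag) :
    (thetaLength (side i) (spoke k τ) : ℤ) = 2 * ccw i k + n - 1 := by
  have h2 := ccw_rel i (i + 1) k
  have h4 := ccw_add_one i
  have h5 := ccw_lt i k
  have h7 := ccw_lt (i + 1) k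
  have h9 := ccw_add_ccw (r := i) (s := i + 1) (ne_of_ccw_pos (by omega))
  have hn : 2 ≤ n := Nat.AtLeastTwo.prop
  have e1 : thetaLength (side i) (spoke k τ) = ccw i k + ccw (i + 1) k +
      if (ccw (i + 1) k < ccw (i + 1) i ↔ ccw (i + 1) k < ccw (i + 1) k) then 0 else n := by
    unfold thetaLength
    classical
    exact congrArg _ (if_congr Iff.rfl rfl rfl)
  rw [e1]
  split_ifs <;> push_cast <;> omega

/-- The values attained by the representation at the side `i` and the edge `a` are exactly the
elements of the submodule `A_{i,a}` of the first description. -/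
theorem exists_entry_iff {a : σ.Vertex} {i : Fin n} {b : BigR K n} :
    (∃ x, entry i a x = b) ↔ b ∈ sideEntry K (side i) a.1 := by
  obtain ⟨⟨r, t⟩ | ⟨k, τ⟩, ha⟩ := a
  · obtain ⟨h1, h2⟩ := thetaLength_chord (ne_of_chord_mem ha) i
    have hd := ccw_pos (ne_of_chord_mem ha)
    have h0 : (∃ x : σ.Gam K, entry i ⟨chord r t, ha⟩ x = b) ↔ ∃ f g : K[X], b =
      BigR.ofPoly K n f * BigR.u K n (2 * ccw i r + ccw r t - 1) +
        BigR.ofPoly K n g *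
          (BigR.u K n (2 * ccw i t + 2 * n - 1 - ccw r t) * winding σ K) := by
      constructor
      · rintro ⟨x, rfl⟩
        exact (entry_chord ha i x).1
      · rintro ⟨f, g, rfl⟩
        exact exists_entry_chord ha i f g
    rw [h0, ← h1]
    unfold sideEntry
    -- Two generators with the same exponent give `u^ℓ R' + v^ℓ R'`. If the second exponent is
    -- larger by `2n`, the second generator already lies in `u^ℓ R'`.
    rcases h2 with ⟨h2, h3⟩ | ⟨h2, h3⟩
    · have h4 : 0 < thetaLength (side i) (chord r t) := by
        have hn : 2 ≤ n := Nat.AtLeastTwo.prop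
        have := ccw_lt r t
        omega
      rw [h3]
      dsimp only
      rw [if_pos h2, v_pow_eq K n h4, mem_span_u_sup_iff (isWinding_winding σ K)]
    · rw [h3]
      dsimp only
      rw [if_neg h2, sup_bot_eq, mem_span_u_iff (isWinding_winding σ K)]
  · have h0 : (∃ x : σ.Gam K, entry i ⟨spoke k τ, ha⟩ x = b) ↔ ∃ f : K[X], b =
        BigR.ofPoly K n f * (BigR.u K n (thetaLength (side i) (spoke k τ)) *
          tagWinding K n τ) := by
      rw [thetaLength_spoke]
      constructor
      · rintro ⟨x, rfl⟩
        exact (entry_spoke ha i x).1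
      · rintro ⟨f, rfl⟩
        exact exists_entry_spoke ha i f
    rw [h0, ← mem_span_winding_iff (isWinding_tagWinding τ)]
    cases τ
    · unfold sideEntry tagWinding
      dsimp only
      rw [u_mul_eps]
    · unfold sideEntry tagWinding
      dsimp only
      rw [u_mul_one_sub_eps]

/-- At a side, the submodules `A_{i,j}` are the entries of the frozen part. -/
theorem sideEntry_side (i j : Fin n) : sideEntry K (side i) (side j) = frozenEntry K i j := by
  have hj := ccw_add_one j
  obtain ⟨h1, h2⟩ := thetaLength_chord (r := j) (t := j + 1) (ne_of_ccw_pos (by omega)) i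
  have h3 : thetaLength (side i) (side j) = 2 * ccw i j := by
    change thetaLength (side i) (chord j (j + 1)) = _
    omega
  have h4 : Turns (side i) (side j) ↔ j = i - 1 := by
    have e2 : Turns (side i) (side j) ↔
      ccw i (j + 1) < ccw i (i + 1) ∨ ccw i (j + 1) < ccw i j := Iff.rfl
    have h5 := ccw_rel i j (j + 1)
    have h6 := ccw_lt i j
    rw [e2, ccw_add_one, eq_sub_iff_add_eq, ← ccw_inj (b := i), ccw_self]
    omega
  classical
  unfold frozenEntry
  rw [← h3]
  change Submodule.span _ _ ⊔ (if Turns (side i) (side j) then _ else ⊥) = _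
  congr 1
  exact if_congr h4 rfl rfl

end FrozenPart

/-! ### The frozen part as an algebra of matrices -/

section Matrices

theorem frozenIdem_mul_e_of_ne {c : σ.Vertex} (hc : ∀ k, c ≠ σ.sideVertex k) :
    frozenIdem σ.quiver (σ.potential K) * σ.e K c = 0 := by
  classical
  unfold frozenIdem
  rw [Finset.sum_mul]
  refine Finset.sum_eq_zero fun v _ => ?_
  split_ifs with hv
  · obtain ⟨k, rfl⟩ := hv
    exact e_mul_of_ne K (hc k).symm
  · exact zero_mul _

theorem eS_mul_frozenIdem (k : Fin n) :
    eS K σ k * frozenIdem σ.quiver (σ.potential K) = eS K σ k :=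
  idem_mul_frozenIdem _ _ ⟨k, rfl⟩

theorem frozenIdem_mul_eS (k : Fin n) :
    frozenIdem σ.quiver (σ.potential K) * eS K σ k = eS K σ k :=
  frozenIdem_mul_idem _ _ ⟨k, rfl⟩

theorem frozenIdem_eq_sum : frozenIdem σ.quiver (σ.potential K) = ∑ k, eS K σ k := by
  classical
  unfold frozenIdem
  symm
  refine Fintype.sum_of_injective σ.sideVertex sideVertex_injective _ _ (fun c hc => if_neg hc)
    (fun k => (if_pos ⟨k, rfl⟩).symm)

variable {K}

/-- The representation of a product whose first factor ends at the sides of the polygon. -/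
theorem entry_mul {x : σ.Gam K} (hx : x * frozenIdem σ.quiver (σ.potential K) = x) (z : σ.Gam K)
    (i : Fin n) (a : σ.Vertex) :
    entry i a (x * z) = ∑ k, entry i (σ.sideVertex k) x * entry k a z := by
  unfold entry
  rw [map_mul, Matrix.mul_apply]
  symm
  refine Fintype.sum_of_injective σ.sideVertex sideVertex_injective _ _ (fun c hc => ?_)
    (fun k => rfl)
  have h : rep σ (isWinding_winding σ K).mul_self (x * σ.e K c) = 0 := by
    rw [← hx, mul_assoc, frozenIdem_mul_e_of_ne K fun k h => hc ⟨k, h.symm⟩, mul_zero, map_zero]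
  rw [map_mul, rep_e] at h
  have h1 := congrFun (congrFun h (σ.sideVertex i)) c
  rw [Matrix.mul_single_apply_same, mul_one] at h1
  rw [h1]
  exact zero_mul _

theorem entry_eS_mul (i k : Fin n) (x : σ.Gam K) (a : σ.Vertex) :
    entry i a (eS K σ k * x) = if k = i then entry i a x else 0 := by
  unfold entry
  rw [map_mul, rep_e]
  split_ifs with h
  · subst h
    rw [Matrix.single_mul_apply_same, one_mul]
  · exact Matrix.single_mul_apply_of_ne _ _ _ _ _ (fun h' => h (sideVertex_injective h'.symm)) _

theorem entry_mul_e (i : Fin n) (x : σ.Gam K) (a : σ.Vertex) :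
    entry i a (x * σ.e K a) = entry i a x := by
  unfold entry
  rw [map_mul, rep_e, Matrix.mul_single_apply_same, mul_one]

variable (σ K) in
/-- The column of the representation at the edge `a`, as a map from `M_a`. -/
def columnMap (a : σ.Vertex) : σ.M K a →+ (Fin n → BigR K n) where
  toFun m i := entry i a m.1
  map_zero' := funext fun i => by
    change entry i a 0 = 0
    unfold entry
    rw [map_zero]
    rfl
  map_add' m m' := funext fun i => entry_add i a m.1 m'.1

/-- An element of `M_a` is the sum of its components at the sides, on which the representation is
faithful. -/
theorem columnMap_injective (a : σ.Vertex) : Function.Injective (columnMap σ K a) := by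
  rw [injective_iff_map_eq_zero]
  intro m hm
  have h : ∀ i, eS K σ i * m.1 = 0 := fun i => by
    have := eq_zero_of_entry_eq_zero (congrFun hm i)
    rwa [mul_assoc, m.2.2] at this
  refine Subtype.ext ?_
  have h1 := m.2.1
  rw [frozenIdem_eq_sum, Finset.sum_mul, Finset.sum_eq_zero fun i _ => h i] at h1
  exact h1.symm

theorem entry_sum (i : Fin n) (a : σ.Vertex) (x : Fin n → σ.Gam K) :
    entry i a (∑ k, eS K σ k * x k) = entry i a (x i) := by
  have : entry i a (∑ k, eS K σ k * x k) = ∑ k, entry i a (eS K σ k * x k) := by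
    unfold entry
    rw [map_sum, Matrix.sum_apply]
  rw [this]
  simp [entry_eS_mul]

theorem range_columnMap (a : σ.Vertex) : Set.range (columnMap σ K a) =
    {c | ∀ i, c i ∈ sideEntry K (side i) a.1} := by
  ext c
  constructor
  · rintro ⟨m, rfl⟩ i
    exact exists_entry_iff.mp ⟨m.1, rfl⟩
  · intro hc
    choose x hx using fun i => exists_entry_iff.mpr (hc i)
    refine ⟨⟨(∑ k, eS K σ k * x k) * σ.e K a, ?_, ?_⟩, funext fun i => ?_⟩
    · rw [← mul_assoc, Finset.mul_sum]
      simp only [← mul_assoc, frozenIdem_mul_eS]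
    · rw [mul_assoc, e_mul_self]
    · change entry i a _ = _
      rw [entry_mul_e, entry_sum, hx]

variable (σ K) in
/-- The structure of `R'`-algebra of the frozen part. -/
instance frozenPartCentreAlgebra : Algebra (RPrime K) (σ.FrozenPart K) :=
  σ.quiver.frozenPartAlgebra (σ.potential K)
    (centreEquiv σ K : RPrime K →+* Subalgebra.center K (σ.Gam K))

variable (σ K) in
/-- The representation of the frozen part. -/
def frozenHom : σ.FrozenPart K →ₐ[RPrime K] Matrix (Fin n) (Fin n) (BigR K n) where
  toFun x := Matrix.of fun i j => entry i (σ.sideVertex j) x.1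
  map_one' := by
    ext i j
    change entry i _ (frozenIdem σ.quiver (σ.potential K)) = _
    rw [← entry_mul_e, frozenIdem_mul_eS, Matrix.one_apply]
    unfold entry
    rw [rep_e, Matrix.single_apply]
    refine if_congr ⟨fun h => (sideVertex_injective h.1).symm, fun h => ?_⟩ rfl rfl
    subst h
    exact ⟨rfl, rfl⟩
  map_mul' x z := by
    ext i j
    rw [Matrix.mul_apply]
    exact entry_mul (frozenPart_right _ _ x) z.1 i _
  map_zero' := by
    ext i j
    change entry i _ 0 = 0
    unfold entry
    rw [map_zero]
    rfl
  map_add' x z := by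
    ext i j
    exact entry_add i _ x.1 z.1
  commutes' r := by
    ext i j
    rw [Matrix.algebraMap_matrix_apply]
    change entry i (σ.sideVertex j) (frozenIdem _ _ * (centreHom σ K r).1 * frozenIdem _ _) = _
    have h := entry_eS_mul i i (frozenIdem _ _ * (centreHom σ K r).1 * frozenIdem _ _)
      (σ.sideVertex j)
    rw [if_pos rfl, ← mul_assoc, ← mul_assoc, eS_mul_frozenIdem] at h
    rw [← h, ← entry_mul_e, mul_assoc, frozenIdem_mul_eS, entry_mul_e]
    unfold entry
    rw [rep_eS_mul_centreHom, Matrix.single_apply]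
    refine if_congr ⟨fun h => sideVertex_injective h.2, fun h => ?_⟩ rfl rfl
    subst h
    exact ⟨rfl, rfl⟩

theorem frozenHom_injective : Function.Injective (frozenHom σ K) := by
  rw [injective_iff_map_eq_zero]
  intro x hx
  have h : ∀ i j, eS K σ i * x.1 * eS K σ j = 0 := fun i j =>
    eq_zero_of_entry_eq_zero (congrFun (congrFun hx i) j)
  refine Subtype.ext ?_
  change x.1 = 0
  have h1 := frozenPart_left _ _ x
  have h2 := frozenPart_right _ _ x
  generalize x.1 = z at h h1 h2 ⊢
  rw [frozenIdem_eq_sum] at h1 h2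
  rw [← h2, ← h1, Finset.mul_sum]
  refine Finset.sum_eq_zero fun j _ => ?_
  rw [Finset.sum_mul, Finset.sum_mul]
  exact Finset.sum_eq_zero fun i _ => h i j

/-- The first description of the frozen part: every matrix with the prescribed entries is attained.
-/
theorem range_frozenHom : Set.range (frozenHom σ K) =
    {m | ∀ i j, m i j ∈ frozenEntry K i j} := by
  ext m
  constructor
  · rintro ⟨x, rfl⟩ i j
    rw [← sideEntry_side]
    exact (exists_entry_iff (a := σ.sideVertex j)).mp ⟨x.1, rfl⟩
  · intro hm
    have hm' : ∀ i j, ∃ x, entry i (σ.sideVertex j) x = m i j := fun i j => by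
      have := hm i j
      rw [← sideEntry_side] at this
      exact (exists_entry_iff (a := σ.sideVertex j)).mpr this
    choose x hx using hm'
    refine ⟨σ.quiver.toFrozenPart (σ.potential K)
      (∑ i, eS K σ i * ∑ j, x i j * eS K σ j), ?_⟩
    ext i j
    change entry i (σ.sideVertex j) (frozenIdem _ _ * _ * frozenIdem _ _) = _
    have h1 : frozenIdem σ.quiver (σ.potential K) * (∑ i, eS K σ i * ∑ j, x i j * eS K σ j) =
        ∑ i, eS K σ i * ∑ j, x i j * eS K σ j := by
      rw [Finset.mul_sum]
      simp only [← mul_assoc, frozenIdem_mul_eS]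
    have h2 : (∑ j', x i j' * eS K σ j') * eS K σ j = x i j * eS K σ j := by
      rw [Finset.sum_mul, Finset.sum_eq_single j]
      · rw [mul_assoc, e_mul_self]
      · intro j' _ hj
        rw [mul_assoc, e_mul_of_ne K (fun h => hj (sideVertex_injective h)), mul_zero]
      · exact fun h => absurd (Finset.mem_univ j) h
    rw [h1, ← entry_mul_e, mul_assoc, frozenIdem_mul_eS, entry_mul_e, entry_sum, ← entry_mul_e, h2,
      entry_mul_e, hx]

theorem frozenHom_frozenE (k : Fin n) :
    frozenHom σ K (σ.frozenE K k) = Matrix.single k k 1 := by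
  ext i j
  change entry i (σ.sideVertex j) (frozenIdem _ _ * eS K σ k * frozenIdem _ _) = _
  rw [frozenIdem_mul_eS, eS_mul_frozenIdem]
  unfold entry
  rw [rep_e, Matrix.single_apply, Matrix.single_apply]
  exact if_congr (and_congr sideVertex_injective.eq_iff sideVertex_injective.eq_iff) rfl rfl

/-- The column map is linear for the action of the frozen part by matrices. -/
theorem columnMap_smul (a : σ.Vertex) (x : σ.FrozenPart K) (m : σ.M K a) :
    columnMap σ K a (x • m) = (frozenHom σ K x).mulVec (columnMap σ K a m) :=
  funext fun i => entry_mul (frozenPart_right _ _ x) m.1 i a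

end Matrices

/-! ### The order `Λ` -/

section Lambda

variable {K}

theorem isUnit_incl_x : IsUnit (BigR.incl K n (RPrime.x K)) := by
  rw [incl_x]
  refine IsUnit.of_mul_eq_one (BigR.u K n (-(2 * n : ℕ))) ?_
  rw [← BigR.u_add, add_neg_cancel, BigR.u_zero]

/-- The extension of `R' → K[u^{±1}, v] / (v u - v²)` to `R'[X⁻¹]`. -/
def inclLoc (K : Type*) [Field K] (n : ℕ) [NeZero n] [n.AtLeastTwo] :
    RPrimeLoc K →ₐ[RPrime K] BigR K n where
  __ := IsLocalization.Away.lift (RPrime.x K) (isUnit_incl_x (K := K) (n := n))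
  commutes' r := IsLocalization.Away.lift_eq _ _ r

theorem inclLoc_algebraMap (r : RPrime K) :
    inclLoc K n (algebraMap (RPrime K) (RPrimeLoc K) r) = BigR.incl K n r :=
  (inclLoc K n).commutes r

theorem inclLoc_injective : Function.Injective (inclLoc K n) := by
  rw [injective_iff_map_eq_zero]
  intro z hz
  obtain ⟨m, r, h⟩ := IsLocalization.Away.surj (RPrime.x K) z
  have h1 := congrArg (inclLoc K n) h
  rw [map_mul, hz, zero_mul, inclLoc_algebraMap, eq_comm] at h1
  rw [(injective_iff_map_eq_zero _).mp incl_injective r h1, map_zero] at h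
  exact (IsUnit.mul_left_eq_zero
    ((IsLocalization.Away.algebraMap_isUnit (RPrime.x K)).pow m)).mp h

theorem inclLoc_xInv_mul_y : inclLoc K n (RPrimeLoc.xInv K *
    algebraMap (RPrime K) (RPrimeLoc K) (RPrime.y K)) = eps K n := by
  have h := congrArg (inclLoc K n) (RPrimeLoc.x_mul_xInv K)
  rw [map_mul, map_one, inclLoc_algebraMap, incl_x] at h
  rw [map_mul, inclLoc_algebraMap, incl_y, ← mul_assoc, mul_comm _ (BigR.u K n _), h, one_mul]

/-- Multiplication by a power of `u`. -/
def mulU (K : Type*) [Field K] (n : ℕ) (m : ℤ) : BigR K n →ₗ[RPrime K] BigR K n :=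
  LinearMap.mulLeft (RPrime K) (BigR.u K n m)

theorem u_mul_cancel {m : ℤ} {a b : BigR K n} (h : BigR.u K n m * a = BigR.u K n m * b) :
    a = b := by
  have := congrArg (BigR.u K n (-m) * ·) h
  simpa only [← mul_assoc, ← BigR.u_add, neg_add_cancel, BigR.u_zero, one_mul] using this

/-- If multiplication by `u^m` identifies `B` with the image of `A ⊆ R'[X⁻¹]`, then an element lies
in `B` when its product with `u^m` is the image of an element of `A`. -/
theorem mem_iff_of_map_eq {A : Submodule (RPrime K) (RPrimeLoc K)}
    {B : Submodule (RPrime K) (BigR K n)} {m : ℤ}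
    (h : A.map (inclLoc K n).toLinearMap = B.map (mulU K n m)) (b : BigR K n) :
    b ∈ B ↔ ∃ z ∈ A, inclLoc K n z = BigR.u K n m * b := by
  have h1 : (∃ z ∈ A, inclLoc K n z = BigR.u K n m * b) ↔
      BigR.u K n m * b ∈ A.map (inclLoc K n).toLinearMap := Iff.rfl
  rw [h1, h]
  constructor
  · exact fun hb => ⟨b, hb, rfl⟩
  · rintro ⟨b', hb', h2⟩
    exact u_mul_cancel h2 ▸ hb'

theorem mem_of_map_eq {A : Submodule (RPrime K) (RPrimeLoc K)}
    {B : Submodule (RPrime K) (BigR K n)} {m : ℤ}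
    (h : A.map (inclLoc K n).toLinearMap = B.map (mulU K n m)) {z : RPrimeLoc K} {b : BigR K n}
    (hz : inclLoc K n z = BigR.u K n m * b) : b ∈ B ↔ z ∈ A := by
  rw [mem_iff_of_map_eq h]
  constructor
  · rintro ⟨z', hz', h1⟩
    exact inclLoc_injective (h1.trans hz.symm) ▸ hz'
  · exact fun h' => ⟨z, h', hz⟩

theorem map_mulU_span (m e : ℤ) (b : BigR K n) :
    (Submodule.span (RPrime K) {BigR.u K n e * b}).map (mulU K n m) =
      Submodule.span (RPrime K) {BigR.u K n (m + e) * b} := by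
  rw [Submodule.map_span, Set.image_singleton]
  unfold mulU
  rw [LinearMap.mulLeft_apply, ← mul_assoc, ← BigR.u_add]

theorem map_mulU_span_u (m e : ℤ) :
    (Submodule.span (RPrime K) {BigR.u K n e}).map (mulU K n m) =
      Submodule.span (RPrime K) {BigR.u K n (m + e)} := by
  simpa only [mul_one] using map_mulU_span m e (1 : BigR K n)

/-- A submodule of `K[u^{±1}, v] / (v u - v²)` generated by a power of `u`, and possibly by its
component at `v`. -/
def monomialSpan (K : Type*) [Field K] (n : ℕ) (e : ℤ) (p : Prop) [Decidable p] :
    Submodule (RPrime K) (BigR K n) :=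
  Submodule.span (RPrime K) {BigR.u K n e} ⊔
    if p then Submodule.span (RPrime K) {BigR.u K n e * eps K n} else ⊥

theorem map_mulU_monomialSpan (m e : ℤ) (p : Prop) [Decidable p] :
    (monomialSpan K n e p).map (mulU K n m) = monomialSpan K n (m + e) p := by
  unfold monomialSpan
  rw [Submodule.map_sup, map_mulU_span_u]
  split_ifs
  · rw [map_mulU_span]
  · rw [Submodule.map_bot]

theorem map_inclLoc_span_singleton (z : RPrimeLoc K) :
    (Submodule.span (RPrime K) {z}).map (inclLoc K n).toLinearMap =
      Submodule.span (RPrime K) {inclLoc K n z} := by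
  rw [Submodule.map_span, Set.image_singleton]
  rfl

theorem map_inclLoc_span_pair (z w : RPrimeLoc K) :
    (Submodule.span (RPrime K) {z, w}).map (inclLoc K n).toLinearMap =
      Submodule.span (RPrime K) {inclLoc K n z} ⊔ Submodule.span (RPrime K) {inclLoc K n w} := by
  rw [Submodule.span_insert, Submodule.map_sup, map_inclLoc_span_singleton,
    map_inclLoc_span_singleton]

theorem inclLoc_x : inclLoc K n (algebraMap (RPrime K) (RPrimeLoc K) (RPrime.x K)) =
    BigR.u K n (2 * n : ℕ) := by
  rw [inclLoc_algebraMap, incl_x]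

theorem inclLoc_y : inclLoc K n (algebraMap (RPrime K) (RPrimeLoc K) (RPrime.y K)) =
    BigR.u K n (2 * n : ℕ) * eps K n := by
  rw [inclLoc_algebraMap, incl_y]

theorem inclLoc_one : inclLoc K n 1 = BigR.u K n 0 := by rw [map_one, BigR.u_zero]

/-- The entries of a matrix with `j = i - 1` are those at the largest cyclic distance. -/
theorem val_sub_one (i j : Fin n) : j = i - 1 ↔ ccw i j + 1 = n := by
  have h2 := ccw_add_one j
  have h3 := ccw_rel i j (j + 1)
  have h4 := ccw_lt i j
  have h5 := ccw_lt i (j + 1)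
  rw [eq_sub_iff_add_eq, ← ccw_inj (b := i), ccw_self]
  omega

/-- The cyclic distance in terms of the representatives in `{0, …, n - 1}`. -/
theorem ccw_val (i j : Fin n) : (i.val ≤ j.val ∧ ccw i j + i.val = j.val) ∨
    (j.val < i.val ∧ ccw i j + i.val = n + j.val) := by
  have h1 := ccw_rel 0 i j
  have h2 : ∀ k : Fin n, ccw 0 k = k.val := fun k => by
    unfold ccw
    rw [sub_zero]
  rwa [h2, h2] at h1

theorem frozenEntry_eq (i j : Fin n) :
    frozenEntry K i j = monomialSpan K n (2 * ccw i j : ℕ) (j = i - 1) := by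
  unfold frozenEntry monomialSpan
  congr 1
  have hn : 2 ≤ n := Nat.AtLeastTwo.prop
  split_ifs with h
  · rw [val_sub_one] at h
    rw [v_pow_eq K n (by omega)]
  · rfl

/-- The entry `(i, j)` of `Λ` is the corresponding entry of the frozen part multiplied by
`u^(2i - 2j)`, so that `Λ` is conjugate to the frozen part by the diagonal matrix of the `u^(2i)`.
-/
theorem map_lamEntry (i j : Fin n) : (lamEntry K i j).map (inclLoc K n).toLinearMap =
    (frozenEntry K i j).map (mulU K n (2 * i.val - 2 * j.val)) := by
  have h1 := val_sub_one i j
  have h2 := ccw_val i j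
  have h3 := ccw_lt i j
  have hi := i.isLt
  have hj := j.isLt
  have hn : 2 ≤ n := Nat.AtLeastTwo.prop
  rw [frozenEntry_eq, map_mulU_monomialSpan]
  unfold lamEntry monomialSpan
  split_ifs with h4 h5 h6 h7
  any_goals omega
  · rw [show (2 * i.val - 2 * j.val + (2 * ccw i j : ℕ) : ℤ) = 0 by omega, map_inclLoc_span_pair,
      inclLoc_xInv_mul_y, inclLoc_one, BigR.u_zero, one_mul]
  · rw [show (2 * i.val - 2 * j.val + (2 * ccw i j : ℕ) : ℤ) = 0 by omega,
      map_inclLoc_span_singleton, inclLoc_one, sup_bot_eq]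
  · rw [show (2 * i.val - 2 * j.val + (2 * ccw i j : ℕ) : ℤ) = (2 * n : ℕ) by omega,
      map_inclLoc_span_pair, inclLoc_x, inclLoc_y]
  · rw [show (2 * i.val - 2 * j.val + (2 * ccw i j : ℕ) : ℤ) = (2 * n : ℕ) by omega,
      map_inclLoc_span_singleton, inclLoc_x, sup_bot_eq]

variable (σ K) in
/-- The representation of the frozen part, conjugated by a diagonal matrix of powers of `u`. -/
def shiftedHom : σ.FrozenPart K →ₐ[RPrime K] Matrix (Fin n) (Fin n) (BigR K n) where
  toFun x := Matrix.of fun i j => BigR.u K n (2 * i.val - 2 * j.val) * frozenHom σ K x i j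
  map_one' := by
    ext i j
    rw [Matrix.of_apply, map_one, Matrix.one_apply]
    split_ifs with h
    · rw [h, sub_self, BigR.u_zero, one_mul]
    · exact mul_zero _
  map_mul' x z := by
    ext i j
    rw [Matrix.of_apply, map_mul, Matrix.mul_apply, Matrix.mul_apply, Finset.mul_sum]
    refine Finset.sum_congr rfl fun k _ => ?_
    rw [Matrix.of_apply, Matrix.of_apply, u_mul_u_mul]
    congr 2
    ring
  map_zero' := by
    ext i j
    rw [Matrix.of_apply, map_zero]
    exact mul_zero _
  map_add' x z := by
    ext i j
    rw [Matrix.of_apply, map_add]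
    exact mul_add _ _ _
  commutes' r := by
    ext i j
    rw [Matrix.of_apply, AlgHom.commutes, Matrix.algebraMap_matrix_apply]
    split_ifs with h
    · rw [h, sub_self, BigR.u_zero, one_mul]
    · exact mul_zero _

theorem shiftedHom_injective : Function.Injective (shiftedHom σ K) := fun x z h =>
  frozenHom_injective (by
    ext i j
    exact u_mul_cancel (congrFun (congrFun h i) j))

/-- The order `Λ` as an algebra of matrices over `K[u^{±1}, v] / (v u - v²)`. -/
def lamHom (K : Type*) [Field K] (n : ℕ) [NeZero n] [n.AtLeastTwo] :
    Lam K n →ₐ[RPrime K] Matrix (Fin n) (Fin n) (BigR K n) :=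
  (inclLoc K n).mapMatrix.comp (Lam K n).val

theorem lamHom_injective : Function.Injective (lamHom K n) := fun m m' h =>
  Subtype.ext (by
    ext i j
    exact inclLoc_injective (congrFun (congrFun h i) j))

/-- The conjugated frozen part and `Λ` are the same algebra of matrices over
`K[u^{±1}, v] / (v u - v²)`. -/
theorem range_shiftedHom : (shiftedHom σ K).range = (lamHom K n).range := by
  ext m
  constructor
  · rintro ⟨x, rfl⟩
    have h : ∀ i j, ∃ z ∈ lamEntry K i j, inclLoc K n z =
        BigR.u K n (2 * i.val - 2 * j.val) * frozenHom σ K x i j := by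
      intro i j
      rw [← mem_iff_of_map_eq (map_lamEntry i j)]
      have : frozenHom σ K x ∈ Set.range (frozenHom σ K) := ⟨x, rfl⟩
      rw [range_frozenHom] at this
      exact this i j
    choose z hz hz' using h
    refine ⟨⟨Matrix.of z, hz⟩, ?_⟩
    ext i j
    exact hz' i j
  · rintro ⟨z, rfl⟩
    have h : Matrix.of (fun i j : Fin n => BigR.u K n (2 * j.val - 2 * i.val) *
        inclLoc K n (z.1 i j)) ∈ Set.range (frozenHom σ K) := by
      rw [range_frozenHom]
      intro i j
      refine (mem_of_map_eq (map_lamEntry i j) (z := z.1 i j) ?_).mpr (z.2 i j)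
      rw [Matrix.of_apply, ← mul_assoc, ← BigR.u_add, sub_add_sub_cancel, sub_self, BigR.u_zero,
        one_mul]
    obtain ⟨x, hx⟩ := h
    refine ⟨x, ?_⟩
    ext i j
    change BigR.u K n (2 * i.val - 2 * j.val) * frozenHom σ K x i j = inclLoc K n (z.1 i j)
    rw [hx, Matrix.of_apply, ← mul_assoc, ← BigR.u_add, sub_add_sub_cancel, sub_self, BigR.u_zero,
      one_mul]

variable (σ K) in
/-- The isomorphism from the frozen part to `Λ`. -/
def frozenEquivLam : σ.FrozenPart K ≃ₐ[RPrime K] Lam K n :=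
  ((AlgEquiv.ofInjective (shiftedHom σ K) shiftedHom_injective).trans
    (Subalgebra.equivOfEq _ _ range_shiftedHom)).trans
      (AlgEquiv.ofInjective (lamHom K n) lamHom_injective).symm

theorem lamHom_frozenEquivLam (x : σ.FrozenPart K) :
    lamHom K n (frozenEquivLam σ K x) = shiftedHom σ K x := by
  have := AlgEquiv.apply_symm_apply (AlgEquiv.ofInjective (lamHom K n) lamHom_injective)
    (Subalgebra.equivOfEq _ _ range_shiftedHom
      (AlgEquiv.ofInjective (shiftedHom σ K) shiftedHom_injective x))
  exact congrArg Subtype.val this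

theorem inclLoc_frozenEquivLam (x : σ.FrozenPart K) (i j : Fin n) :
    inclLoc K n ((frozenEquivLam σ K x).1 i j) =
      BigR.u K n (2 * i.val - 2 * j.val) * frozenHom σ K x i j :=
  congrFun (congrFun (lamHom_frozenEquivLam x) i) j

theorem frozenEquivLam_frozenE (k : Fin n) :
    (frozenEquivLam σ K (σ.frozenE K k)).1 = Matrix.single k k 1 := by
  ext i j
  refine inclLoc_injective (n := n) ?_
  rw [inclLoc_frozenEquivLam, frozenHom_frozenE, Matrix.single_apply, Matrix.single_apply]
  split_ifs with h
  · rw [← h.1, ← h.2, sub_self, BigR.u_zero, one_mul, map_one]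
  · rw [mul_zero, map_zero]

/-- The power of `u` by which the columns at the edge `a` are multiplied in order to be compared
with ideals of `R'`. -/
def columnShift : Edge n → ℤ
  | chord r t => 1 - 2 * r.val - ccw r t + if r < t then 0 else 2 * n
  | spoke r _ => n + 1 - 2 * r.val

/-- The submodule `A_{i,a}` at a chord, where `p` is any condition which holds exactly when the
exponents of the two generators are equal. -/
theorem sideEntry_chord (i : Fin n) {r t : Fin n} (h : r ≠ t) (p : Prop) [Decidable p]
    (hp : (p ∧ 2 * (ccw i t : ℤ) + 2 * n - 1 - ccw r t = 2 * ccw i r + ccw r t - 1) ∨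
      (¬p ∧ 2 * (ccw i t : ℤ) + 2 * n - 1 - ccw r t = 2 * ccw i r + ccw r t - 1 + (2 * n : ℕ))) :
    sideEntry K (side i) (chord r t) = monomialSpan K n (2 * ccw i r + ccw r t - 1) p := by
  obtain ⟨h1, h2⟩ := thetaLength_chord h i
  have hn : 2 ≤ n := Nat.AtLeastTwo.prop
  have hd := ccw_lt r t
  have h3 : Turns (side i) (chord r t) ↔ p := by
    constructor
    · intro h'
      by_contra hp'
      simp only [h', hp', not_true, false_and, true_and, not_false_eq_true, or_false,
        false_or] at h2 hp
      omega
    · intro h'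
      by_contra hp'
      simp only [h', hp', not_true, false_and, true_and, not_false_eq_true, or_false,
        false_or] at h2 hp
      omega
  classical
  unfold sideEntry monomialSpan
  dsimp only
  rw [← h1]
  congr 1
  split_ifs with h4 h5 h5
  · have : 0 < thetaLength (side i) (chord r t) := by
      rcases h2 with h2 | h2
      · omega
      · exact absurd h4 h2.1
    rw [v_pow_eq K n this]
  · exact absurd (h3.mp h4) h5
  · exact absurd (h3.mpr h5) h4
  · rfl

theorem map_span_algebraMap (s : Set (RPrime K)) :
    Submodule.map (Algebra.linearMap (RPrime K) (RPrimeLoc K)) (Ideal.span s) =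
      Submodule.span (RPrime K) (algebraMap (RPrime K) (RPrimeLoc K) '' s) :=
  Submodule.map_span _ _

end Lambda

/-! ### The columns over `Λ` -/

section Columns

variable {K}

theorem eps_sq_u (m : ℤ) : (BigR.u K n m * eps K n) ^ 2 = BigR.u K n (m + m) * eps K n := by
  rw [pow_two, u_mul_u_mul, eps_mul_eps]

theorem inclLoc_y_sq : inclLoc K n (algebraMap (RPrime K) (RPrimeLoc K) (RPrime.y K ^ 2)) =
    BigR.u K n (4 * n : ℕ) * eps K n := by
  rw [map_pow, map_pow, inclLoc_y, eps_sq_u]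
  congr 2
  push_cast
  ring

theorem inclLoc_x_sq : inclLoc K n (algebraMap (RPrime K) (RPrimeLoc K) (RPrime.x K ^ 2)) =
    BigR.u K n (4 * n : ℕ) := by
  rw [map_pow, map_pow, inclLoc_x, pow_two, ← BigR.u_add]
  congr 1
  push_cast
  ring

/-- The ideals in the column at a chord correspond to submodules generated by a power of `u`, and
possibly by its component at `v`. The disjunction lists the exponent `e`, and whether the second
generator is present, in each block of the column. -/
theorem map_columnIdeal_chord (r t i : Fin n) :
    ∃ (e : ℤ) (p : Prop) (_ : Decidable p),
      (Submodule.map (Algebra.linearMap (RPrime K) (RPrimeLoc K))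
        (columnIdeal K (chord r t) i)).map (inclLoc K n).toLinearMap = monomialSpan K n e p ∧
      ((r < t ∧ i ≤ r ∧ e = 0 ∧ ¬p) ∨ (r < t ∧ r < i ∧ i ≤ t ∧ e = 2 * n ∧ p) ∨
        (r < t ∧ t < i ∧ e = 2 * n ∧ ¬p) ∨ (t ≤ r ∧ i ≤ t ∧ e = 2 * n ∧ p) ∨
        (t ≤ r ∧ t < i ∧ i ≤ r ∧ e = 2 * n ∧ ¬p) ∨ (t ≤ r ∧ r < i ∧ e = 4 * n ∧ p)) := by
  have h2 : ((2 * n : ℕ) : ℤ) = 2 * n := by push_cast; ring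
  have h4 : ((4 * n : ℕ) : ℤ) = 4 * n := by push_cast; ring
  have h0 : (⊤ : Ideal (RPrime K)) = Ideal.span {1} := Ideal.span_singleton_one.symm
  unfold columnIdeal
  dsimp only
  split_ifs with h5 h6 h7 h6 h7
  · refine ⟨0, False, inferInstance, ?_, by simp [h5, h6]⟩
    rw [h0, map_span_algebraMap, Set.image_singleton, map_inclLoc_span_singleton, map_one,
      inclLoc_one]
    simp [monomialSpan]
  · refine ⟨(2 * n : ℕ), True, inferInstance, ?_, by simp [h5, h7, not_le.mp h6]⟩
    rw [map_span_algebraMap, Set.image_pair, map_inclLoc_span_pair, inclLoc_x, inclLoc_y]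
    simp [monomialSpan]
  · refine ⟨(2 * n : ℕ), False, inferInstance, ?_, by simp [h5, not_le.mp h7]⟩
    rw [map_span_algebraMap, Set.image_singleton, map_inclLoc_span_singleton, inclLoc_x]
    simp [monomialSpan]
  · refine ⟨(2 * n : ℕ), True, inferInstance, ?_, by simp [not_lt.mp h5, h6]⟩
    rw [map_span_algebraMap, Set.image_pair, map_inclLoc_span_pair, inclLoc_x, inclLoc_y]
    simp [monomialSpan]
  · refine ⟨(2 * n : ℕ), False, inferInstance, ?_, by simp [not_lt.mp h5, not_le.mp h6, h7]⟩
    rw [map_span_algebraMap, Set.image_singleton, map_inclLoc_span_singleton, inclLoc_x]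
    simp [monomialSpan]
  · refine ⟨(4 * n : ℕ), True, inferInstance, ?_, by simp [not_lt.mp h5, not_le.mp h7]⟩
    rw [map_span_algebraMap, Set.image_pair, map_inclLoc_span_pair, inclLoc_x_sq, inclLoc_y_sq]
    simp [monomialSpan]

theorem map_columnIdeal_spoke (k i : Fin n) (τ : Tag) :
    (Submodule.map (Algebra.linearMap (RPrime K) (RPrimeLoc K))
      (columnIdeal K (spoke k τ) i)).map (inclLoc K n).toLinearMap =
      Submodule.span (RPrime K)
        {BigR.u K n (if i ≤ k then (2 * n : ℕ) else (4 * n : ℕ)) * tagWinding K n τ} := by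
  cases τ <;> unfold columnIdeal <;> dsimp only <;> split_ifs <;>
    rw [map_span_algebraMap, Set.image_singleton, map_inclLoc_span_singleton]
  · rw [inclLoc_y]; rfl
  · rw [inclLoc_y_sq]; rfl
  · rw [map_sub, map_sub, inclLoc_x, inclLoc_y, ← mul_one_sub]
    rfl
  · rw [map_sub, map_sub, inclLoc_x_sq, inclLoc_y_sq, ← mul_one_sub]
    rfl

theorem sideEntry_spoke (i k : Fin n) (τ : Tag) : sideEntry K (side i) (spoke k τ) =
    Submodule.span (RPrime K) {BigR.u K n (2 * ccw i k + n - 1) * tagWinding K n τ} := by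
  have h := thetaLength_spoke i k τ
  cases τ <;> unfold sideEntry tagWinding <;> dsimp only <;> rw [h]
  · rw [u_mul_eps]
  · rw [u_mul_one_sub_eps]

/-- The ideals in the column at the edge `a` are the submodules `A_{i,a}` of the first description,
multiplied by `u^(2i)` and by a power of `u` which depends on `a` only. -/
theorem map_columnIdeal {a : Edge n} (ha : ∀ r, a ≠ chord r r) (i : Fin n) :
    (Submodule.map (Algebra.linearMap (RPrime K) (RPrimeLoc K))
      (columnIdeal K a i)).map (inclLoc K n).toLinearMap =
      (sideEntry K (side i) a).map (mulU K n (2 * i.val + columnShift a)) := by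
  have hn : 2 ≤ n := Nat.AtLeastTwo.prop
  have hi := i.isLt
  obtain ⟨r, t⟩ | ⟨k, τ⟩ := a
  · have hrt : r ≠ t := fun h => ha r (by rw [h])
    have h1 := ccw_val i r
    have h2 := ccw_val i t
    have h3 := ccw_val r t
    have h4 := ccw_lt i r
    have h5 := ccw_lt i t
    have h6 := ccw_lt r t
    have hrt' : r.val ≠ t.val := fun h => hrt (Fin.ext h)
    obtain ⟨e, p, hp, h, h'⟩ := map_columnIdeal_chord (K := K) r t i
    simp only [Fin.lt_def, Fin.le_def] at h'
    rw [h, sideEntry_chord i hrt p, map_mulU_monomialSpan]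
    · congr 1
      unfold columnShift
      dsimp only
      split_ifs with h7 <;> rw [Fin.lt_def] at h7 <;> omega
    · by_cases hp' : p
      · simp only [hp', not_true, and_false, and_true, or_false, false_or, true_and,
          false_and] at h' ⊢
        omega
      · simp only [hp', not_false_eq_true, and_false, and_true, or_false, false_or, true_and,
          false_and] at h' ⊢
        omega
  · have h1 := ccw_val i k
    rw [map_columnIdeal_spoke, sideEntry_spoke, map_mulU_span]
    congr 4
    unfold columnShift
    dsimp only
    split_ifs with h7 <;> rw [Fin.le_def] at h7 <;> omega

theorem exists_column (a : σ.Vertex) (m : σ.M K a) (i : Fin n) :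
    ∃ z : RPrimeLoc K,
      inclLoc K n z = BigR.u K n (2 * i.val + columnShift a.1) * columnMap σ K a m i := by
  have h : columnMap σ K a m ∈ Set.range (columnMap σ K a) := ⟨m, rfl⟩
  rw [range_columnMap] at h
  obtain ⟨z, _, hz⟩ := (mem_iff_of_map_eq (map_columnIdeal
    (fun r hr => ne_of_chord_mem (r := r) (s := r) (hr ▸ a.2) rfl) i) _).mp (h i)
  exact ⟨z, hz⟩

variable (σ K) in
/-- The isomorphism from `M_a` to a column of ideals of `R'`. -/
def lamColumnMap (a : σ.Vertex) : σ.M K a →+ (Fin n → RPrimeLoc K) :=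
  AddMonoidHom.mk' (fun m i => (exists_column a m i).choose) fun m m' => by
    ext i
    refine inclLoc_injective (n := n) ?_
    refine (exists_column a (m + m') i).choose_spec.trans ?_
    rw [map_add, Pi.add_apply, mul_add, Pi.add_apply, map_add]
    exact (congrArg₂ (· + ·) (exists_column a m i).choose_spec
      (exists_column a m' i).choose_spec).symm

theorem inclLoc_lamColumnMap (a : σ.Vertex) (m : σ.M K a) (i : Fin n) :
    inclLoc K n (lamColumnMap σ K a m i) =
      BigR.u K n (2 * i.val + columnShift a.1) * columnMap σ K a m i :=
  (exists_column a m i).choose_spec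

theorem lamColumnMap_injective (a : σ.Vertex) : Function.Injective (lamColumnMap σ K a) :=
  fun m m' h => columnMap_injective a (by
    ext i
    refine u_mul_cancel (m := 2 * i.val + columnShift a.1) ?_
    rw [← inclLoc_lamColumnMap, ← inclLoc_lamColumnMap, h])

theorem range_lamColumnMap (a : σ.Vertex) : Set.range (lamColumnMap σ K a) =
    {c | ∀ i, c i ∈ Submodule.map
      (Algebra.linearMap (RPrime K) (RPrimeLoc K)) (columnIdeal K a.1 i)} := by
  have ha : ∀ r, a.1 ≠ chord r r := fun r hr => ne_of_chord_mem (r := r) (s := r) (hr ▸ a.2) rfl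
  ext c
  constructor
  · rintro ⟨m, rfl⟩ i
    have h : columnMap σ K a m ∈ Set.range (columnMap σ K a) := ⟨m, rfl⟩
    rw [range_columnMap] at h
    exact (mem_of_map_eq (map_columnIdeal ha i) (inclLoc_lamColumnMap a m i)).mp (h i)
  · intro hc
    have hu : ∀ i : Fin n, inclLoc K n (c i) = BigR.u K n (2 * i.val + columnShift a.1) *
        (BigR.u K n (-(2 * i.val + columnShift a.1)) * inclLoc K n (c i)) := fun i => by
      rw [← mul_assoc, ← BigR.u_add, add_neg_cancel, BigR.u_zero, one_mul]
    have h : (fun i : Fin n => BigR.u K n (-(2 * i.val + columnShift a.1)) * inclLoc K n (c i)) ∈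
        Set.range (columnMap σ K a) := by
      rw [range_columnMap]
      exact fun i => (mem_of_map_eq (map_columnIdeal ha i) (hu i)).mpr (hc i)
    obtain ⟨m, hm⟩ := h
    refine ⟨m, ?_⟩
    ext i
    refine inclLoc_injective (n := n) ?_
    rw [inclLoc_lamColumnMap, hm, ← hu]

theorem lamColumnMap_smul (a : σ.Vertex) (x : σ.FrozenPart K) (m : σ.M K a) :
    lamColumnMap σ K a (x • m) = (frozenEquivLam σ K x).1.mulVec (lamColumnMap σ K a m) := by
  ext i
  refine inclLoc_injective (n := n) ?_
  rw [inclLoc_lamColumnMap, columnMap_smul, Matrix.mulVec, dotProduct, Matrix.mulVec, dotProduct,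
    map_sum, Finset.mul_sum]
  refine Finset.sum_congr rfl fun k _ => ?_
  rw [map_mul, inclLoc_frozenEquivLam, inclLoc_lamColumnMap, u_mul_u_mul]
  congr 2
  ring

end Columns

/-! ### Self-duality of `Λ` -/

section Gorenstein

variable {K}

/-- The exponent of `X` in the first generator of the entry `(i, j)` of `Λ` over `K[X]`. -/
def lowerExp (i j : Fin n) : ℕ := if j < i then 1 else 0

/-- The exponent of `X` in the generator of the entry `(i, j)` of `Λ` over `K[X]` which is a
multiple of `X⁻¹ Y`. -/
def upperExp (i j : Fin n) : ℕ := lowerExp i j + if j = i - 1 then 0 else 1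

/-- The `K[X]`-linear map `(f, g) ↦ f X^c + g X^d (X⁻¹ Y)`. -/
def monomialMap (K : Type*) [Field K] (c d : ℕ) : K[X] × K[X] →ₗ[K[X]] RPrimeLoc K :=
  (LinearMap.toSpanSingleton K[X] (RPrimeLoc K) (algebraMap K[X] _ (X ^ c))).coprod
    (LinearMap.toSpanSingleton K[X] (RPrimeLoc K) (algebraMap K[X] _ (X ^ d) *
      (RPrimeLoc.xInv K * algebraMap (RPrime K) (RPrimeLoc K) (RPrime.y K))))

theorem inclLoc_algebraMap_poly (f : K[X]) :
    inclLoc K n (algebraMap K[X] (RPrimeLoc K) f) = BigR.ofPoly K n f := by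
  rw [IsScalarTower.algebraMap_apply K[X] (RPrime K) (RPrimeLoc K), inclLoc_algebraMap]
  exact incl_of f

theorem ofPoly_X_pow (c : ℕ) : BigR.ofPoly K n (X ^ c) = BigR.u K n (2 * n * c : ℕ) := by
  rw [map_pow, ofPoly_X]
  induction c with
  | zero => rw [pow_zero, mul_zero, Nat.cast_zero, BigR.u_zero]
  | succ c ih => rw [pow_succ, ih, ← BigR.u_add, ← Nat.cast_add, mul_add_one]

theorem inclLoc_monomialMap (c d : ℕ) (p : K[X] × K[X]) : inclLoc K n (monomialMap K c d p) =
    BigR.ofPoly K n p.1 * BigR.u K n (2 * n * c : ℕ) +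
      BigR.ofPoly K n p.2 * (BigR.u K n (2 * n * d : ℕ) * eps K n) := by
  unfold monomialMap
  rw [LinearMap.coprod_apply, LinearMap.toSpanSingleton_apply, LinearMap.toSpanSingleton_apply,
    Algebra.smul_def, Algebra.smul_def, map_add, map_mul, map_mul, map_mul, inclLoc_xInv_mul_y,
    inclLoc_algebraMap_poly, inclLoc_algebraMap_poly, inclLoc_algebraMap_poly,
    inclLoc_algebraMap_poly, ofPoly_X_pow, ofPoly_X_pow]

theorem monomialMap_injective (c d : ℕ) : Function.Injective (monomialMap K c d) := by
  rw [injective_iff_map_eq_zero]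
  intro p hp
  have h := inclLoc_monomialMap (n := 2) c d p
  rw [hp, map_zero] at h
  exact Prod.ext_iff.mpr ((isWinding_eps 2).eq_zero_and_eq_zero h.symm)

/-- Each entry of `Λ` is free over `K[X]`, generated by `X^c` and `X^d (X⁻¹ Y)` for
`c = lowerExp i j` and `d = upperExp i j`. -/
theorem mem_lamEntry_iff (i j : Fin n) (z : RPrimeLoc K) : z ∈ lamEntry K i j ↔
    ∃ p, monomialMap K (lowerExp i j) (upperExp i j) p = z := by
  have h1 := ccw_val i j
  have hl : ((2 * n * lowerExp i j : ℕ) : ℤ) = 2 * i.val - 2 * j.val + (2 * ccw i j : ℕ) := by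
    unfold lowerExp
    split_ifs with h <;> rw [Fin.lt_def] at h <;> omega
  have h : z ∈ lamEntry K i j ↔
      inclLoc K n z ∈ monomialSpan K n (2 * n * lowerExp i j : ℕ) (j = i - 1) := by
    rw [hl, ← map_mulU_monomialSpan, ← frozenEntry_eq, ← map_lamEntry]
    exact (Function.Injective.mem_set_image (inclLoc_injective (K := K) (n := n))).symm
  have h2 : (∃ p, monomialMap K (lowerExp i j) (upperExp i j) p = z) ↔ ∃ f g, inclLoc K n z =
      BigR.ofPoly K n f * BigR.u K n (2 * n * lowerExp i j : ℕ) +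
        BigR.ofPoly K n g * (BigR.u K n (2 * n * upperExp i j : ℕ) * eps K n) := by
    constructor
    · rintro ⟨p, rfl⟩
      exact ⟨p.1, p.2, inclLoc_monomialMap _ _ _⟩
    · rintro ⟨f, g, h⟩
      exact ⟨(f, g), inclLoc_injective ((inclLoc_monomialMap _ _ _).trans h.symm)⟩
  rw [h, h2]
  unfold monomialSpan upperExp
  split_ifs
  · rw [mem_span_u_sup_iff (isWinding_eps n), add_zero]
  · rw [sup_bot_eq, mem_span_u_iff (isWinding_eps n), mul_add_one, Nat.cast_add]

/-- The coordinates of the elements of `Λ` over `K[X]`. -/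
def lamEquiv (K : Type*) [Field K] (n : ℕ) [NeZero n] [n.AtLeastTwo] :
    (Fin n → Fin n → K[X] × K[X]) ≃ₗ[K[X]] Lam K n :=
  LinearEquiv.ofBijective
    { toFun p := ⟨Matrix.of fun i j => monomialMap K (lowerExp i j) (upperExp i j) (p i j),
        fun i j => (mem_lamEntry_iff i j _).mpr ⟨_, rfl⟩⟩
      map_add' p q := Subtype.ext (by
        ext i j
        exact map_add (monomialMap K (lowerExp i j) (upperExp i j)) _ _)
      map_smul' r p := Subtype.ext (by
        ext i j
        exact map_smul (monomialMap K (lowerExp i j) (upperExp i j)) _ _) }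
    ⟨fun p q h => by
      ext1 i
      ext1 j
      exact monomialMap_injective _ _ (congrFun (congrFun (congrArg Subtype.val h) i) j),
    fun m => by
      choose p hp using fun i j => (mem_lamEntry_iff i j _).mp (m.2 i j)
      exact ⟨p, Subtype.ext (by ext i j; exact hp i j)⟩⟩

theorem lamEquiv_apply (p : Fin n → Fin n → K[X] × K[X]) (i j : Fin n) :
    (lamEquiv K n p).1 i j = monomialMap K (lowerExp i j) (upperExp i j) (p i j) := rfl

/-- The exponents of `X` in the entries `(j, i)` and `(i, j - 2)` of `Λ` are complementary. -/
theorem exponents (i j : Fin n) :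
    lowerExp j i + upperExp i (j - 1 - 1) = upperExp j (j - 1 - 1) ∧
      upperExp j i + lowerExp i (j - 1 - 1) = upperExp j (j - 1 - 1) ∧
      lowerExp j (j - 1 - 1) ≤ lowerExp j i + lowerExp i (j - 1 - 1) ∧
      upperExp j i + upperExp i (j - 1 - 1) =
        upperExp j (j - 1 - 1) + if i = j - 1 then 0 else 1 := by
  have hn : 2 ≤ n := Nat.AtLeastTwo.prop
  have h1 := ccw_val (j - 1) j
  have h2 := ccw_val (j - 1 - 1) (j - 1)
  rw [ccw_sub_one] at h1 h2
  have hj := j.isLt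
  have hi := i.isLt
  have h3 : j - 1 - 1 = i - 1 ↔ i = j - 1 := by rw [sub_left_inj, eq_comm]
  have h4 : ¬ j - 1 - 1 = j - 1 := fun h => by
    rw [h] at h2
    omega
  have h5 : i = j - 1 ↔ i.val = (j - 1).val := Fin.ext_iff
  unfold upperExp lowerExp
  simp only [h3, h4, h5, Fin.lt_def, if_false]
  clear h3 h4 h5
  generalize j - 1 - 1 = j₂ at *
  generalize j - 1 = j₁ at *
  split_ifs <;> omega

/-- The pairing, with values in the coefficients of `X⁻¹ Y`, of two entries of `Λ` in complementary
positions; `e` is the ratio of the two generators of these entries. -/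
def entryPairing (e : K[X]) (p q : K[X] × K[X]) : K[X] :=
  p.1 * q.2 + p.2 * q.1 + p.2 * q.2 * e

/-- The product of an element of the entry `(j, i)` and one of the entry `(i, j - 2)` has the
pairing of the two as its coefficient at the generator which is a multiple of `X⁻¹ Y`. -/
theorem exists_monomialMap_mul (i j : Fin n) (p q : K[X] × K[X]) : ∃ f : K[X],
    monomialMap K (lowerExp j i) (upperExp j i) p *
      monomialMap K (lowerExp i (j - 1 - 1)) (upperExp i (j - 1 - 1)) q =
      monomialMap K (lowerExp j (j - 1 - 1)) (upperExp j (j - 1 - 1))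
        (f, entryPairing (if i = j - 1 then 1 else X) p q) := by
  obtain ⟨h1, h2, h3, h4⟩ := exponents i j
  obtain ⟨m, hm⟩ := Nat.exists_eq_add_of_le h3
  have he : ((if i = j - 1 then 1 else X : K[X])) = X ^ (if i = j - 1 then 0 else 1) := by
    split_ifs
    · rw [pow_zero]
    · rw [pow_one]
  have hX : ∀ a b : ℕ, BigR.u K n (2 * n * a : ℕ) * BigR.u K n (2 * n * b : ℕ) =
      BigR.u K n (2 * n * (a + b) : ℕ) := fun a b => by
    rw [← BigR.u_add, ← Nat.cast_add, mul_add]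
  refine ⟨p.1 * q.1 * X ^ m, inclLoc_injective (n := n) ?_⟩
  rw [he, map_mul, inclLoc_monomialMap, inclLoc_monomialMap, inclLoc_monomialMap]
  unfold entryPairing
  simp only [map_add, map_mul, ofPoly_X_pow]
  have e1 := hX (lowerExp j i) (upperExp i (j - 1 - 1))
  have e2 := hX (upperExp j i) (lowerExp i (j - 1 - 1))
  have e3 := hX (lowerExp j i) (lowerExp i (j - 1 - 1))
  have e4 := hX (upperExp j i) (upperExp i (j - 1 - 1))
  rw [h1] at e1
  rw [h2] at e2
  rw [hm, ← hX] at e3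
  rw [h4, ← hX] at e4
  have e5 := eps_mul_eps K n
  linear_combination (BigR.ofPoly K n p.1 * BigR.ofPoly K n q.2 * eps K n) * e1 +
    (BigR.ofPoly K n p.2 * BigR.ofPoly K n q.1 * eps K n) * e2 +
    (BigR.ofPoly K n p.1 * BigR.ofPoly K n q.1) * e3 +
    (BigR.ofPoly K n p.2 * BigR.ofPoly K n q.2 * eps K n) * e4 +
    (BigR.ofPoly K n p.2 * BigR.ofPoly K n q.2 * BigR.u K n (2 * n * upperExp j i : ℕ) *
      BigR.u K n (2 * n * upperExp i (j - 1 - 1) : ℕ)) * e5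

/-- The linear form on `Λ` which generates the dual of `Λ`: the sum of the coefficients of the
generators which are multiples of `X⁻¹ Y` in the entries `(j, j - 2)`. -/
def lamForm (K : Type*) [Field K] (n : ℕ) [NeZero n] [n.AtLeastTwo] : Lam K n →ₗ[K[X]] K[X] where
  toFun z := ∑ j, ((lamEquiv K n).symm z j (j - 1 - 1)).2
  map_add' z z' := by
    rw [← Finset.sum_add_distrib]
    exact Finset.sum_congr rfl fun j _ => by rw [map_add]; rfl
  map_smul' r z := by
    rw [RingHom.id_apply, Finset.smul_sum]
    exact Finset.sum_congr rfl fun j _ => by rw [map_smul]; rfl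

theorem lamForm_mul (p q : Fin n → Fin n → K[X] × K[X]) :
    lamForm K n (lamEquiv K n q * lamEquiv K n p) =
      ∑ j, ∑ i, entryPairing (if i = j - 1 then 1 else X) (q j i) (p i (j - 1 - 1)) := by
  change ∑ j, ((lamEquiv K n).symm (lamEquiv K n q * lamEquiv K n p) j (j - 1 - 1)).2 = _
  refine Finset.sum_congr rfl fun j _ => ?_
  choose f hf using fun i => exists_monomialMap_mul i j (q j i) (p i (j - 1 - 1))
  have h : (lamEquiv K n).symm (lamEquiv K n q * lamEquiv K n p) j (j - 1 - 1) =
      ∑ i, (f i, entryPairing (if i = j - 1 then 1 else X) (q j i) (p i (j - 1 - 1))) := by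
    refine monomialMap_injective (lowerExp j (j - 1 - 1)) (upperExp j (j - 1 - 1)) ?_
    rw [← lamEquiv_apply, LinearEquiv.apply_symm_apply, map_sum]
    refine (Matrix.mul_apply (M := (lamEquiv K n q).1)).trans ?_
    exact Finset.sum_congr rfl fun i _ => hf i
  rw [h, Prod.snd_sum]

theorem lamForm_single_mul (p : Fin n → Fin n → K[X] × K[X]) (i j : Fin n) (v : K[X] × K[X]) :
    lamForm K n (lamEquiv K n (Pi.single j (Pi.single i v)) * lamEquiv K n p) =
      entryPairing (if i = j - 1 then 1 else X) v (p i (j - 1 - 1)) := by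
  have h : ∀ (e : K[X]) q, entryPairing e 0 q = 0 := fun e q => by simp [entryPairing]
  rw [lamForm_mul, Finset.sum_eq_single j, Finset.sum_eq_single i, Pi.single_eq_same,
    Pi.single_eq_same]
  · intro b _ hb
    rw [Pi.single_eq_same, Pi.single_eq_of_ne hb, h]
  · exact fun h => absurd (Finset.mem_univ i) h
  · intro b _ hb
    refine Finset.sum_eq_zero fun c _ => ?_
    rw [Pi.single_eq_of_ne hb, Pi.zero_apply, h]
  · exact fun h => absurd (Finset.mem_univ j) h

/-- The dual of `Λ` is free of rank one as a left module, generated by `lamForm`: an element of `Λ`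
is determined by its pairings with the complementary entries, and these pairings can be prescribed.
-/
theorem bijective_smul_lamForm : Function.Bijective
    (LinearMap.toSpanSingleton (Lam K n) (RegularDual K[X] (Lam K n))
      (lamForm K n : Lam K n →ₗ[K[X]] K[X])) := by
  constructor
  · rw [injective_iff_map_eq_zero]
    intro a ha
    obtain ⟨p, rfl⟩ := (lamEquiv K n).surjective a
    have h : ∀ (i j : Fin n) v,
        entryPairing (if i = j - 1 then 1 else X) v (p i (j - 1 - 1)) = 0 := fun i j v => by
      rw [← lamForm_single_mul]
      exact congrArg (fun φ : Lam K n →ₗ[K[X]] K[X] =>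
        φ (lamEquiv K n (Pi.single j (Pi.single i v)))) ha
    -- The pairings with the two generators of the complementary entry give both coordinates.
    have hp : p = 0 := by
      ext1 i
      ext1 k
      have h1 := h i (k + 1 + 1) (1, 0)
      have h2 := h i (k + 1 + 1) (0, 1)
      simp only [entryPairing, add_sub_cancel_right, one_mul, zero_mul, add_zero, zero_add] at h1 h2
      rw [h1, zero_mul, add_zero] at h2
      exact Prod.ext h2 h1
    rw [hp, map_zero]
  · intro φ
    let ψ : (Fin n → Fin n → K[X] × K[X]) →ₗ[K[X]] K[X] :=
      (φ : Lam K n →ₗ[K[X]] K[X]) ∘ₗ (lamEquiv K n : _ →ₗ[K[X]] Lam K n)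
    -- The two coordinates of an entry are recovered from the values on the two generators of the
    -- complementary entry.
    refine ⟨lamEquiv K n fun i k =>
      (ψ (Pi.single (k + 1 + 1) (Pi.single i (0, 1))) -
        ψ (Pi.single (k + 1 + 1) (Pi.single i (1, 0))) * (if i = k + 1 then 1 else X),
      ψ (Pi.single (k + 1 + 1) (Pi.single i (1, 0)))), LinearMap.ext fun x => ?_⟩
    obtain ⟨q, rfl⟩ := (lamEquiv K n).surjective x
    refine (lamForm_mul _ q).trans ?_
    change _ = ψ q
    conv_rhs => rw [← Finset.univ_sum_single q, map_sum]
    refine Finset.sum_congr rfl fun j _ => ?_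
    have h1 : ψ (Pi.single j (q j)) = ∑ i, ψ (Pi.single j (Pi.single i (q j i))) := by
      conv_lhs => rw [← Finset.univ_sum_single (q j)]
      exact map_sum (ψ ∘ₗ LinearMap.single K[X] _ j) _ _
    rw [h1]
    refine Finset.sum_congr rfl fun i _ => ?_
    have h2 : q j i = (q j i).1 • (1, 0) + (q j i).2 • (0, 1) := by ext1 <;> simp
    have h3 : ψ (Pi.single j (Pi.single i (q j i))) =
        (q j i).1 * ψ (Pi.single j (Pi.single i (1, 0))) +
          (q j i).2 * ψ (Pi.single j (Pi.single i (0, 1))) := by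
      conv_lhs => rw [h2]
      rw [Pi.single_add, Pi.single_smul, Pi.single_smul, Pi.single_add, Pi.single_smul,
        Pi.single_smul, map_add, map_smul, map_smul, smul_eq_mul, smul_eq_mul]
    rw [h3]
    simp only [entryPairing, sub_add_cancel]
    ring

variable (K n) in
theorem isGorensteinOrder_lam : IsGorensteinOrder K[X] (Lam K n) := by
  refine ⟨⟨Module.Finite.equiv (lamEquiv K n), ?_⟩,
    Module.Projective.of_equiv (LinearEquiv.ofBijective _ bijective_smul_lamForm)⟩
  rw [sSup_eq_bot]
  intro N hN
  have : IsSimpleModule K[X] N := hN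
  have hf : Module.IsTorsionFree K[X] (Lam K n) :=
    (lamEquiv K n).symm.injective.moduleIsTorsionFree _ (lamEquiv K n).symm.map_smul
  rw [Submodule.eq_bot_iff]
  intro x hx
  by_contra hx0
  -- `X` acts injectively but not surjectively on the submodule generated by `x`.
  have h1 : (X : K[X]) • (⟨x, hx⟩ : N) ≠ 0 := fun h =>
    (smul_ne_zero X_ne_zero hx0) (congrArg Subtype.val h)
  obtain ⟨r, hr⟩ := IsSimpleModule.toSpanSingleton_surjective K[X] (M := N) h1 ⟨x, hx⟩
  have h2 : (r * X - 1 : K[X]) • x = 0 := by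
    rw [sub_smul, one_smul, mul_smul, sub_eq_zero]
    exact congrArg Subtype.val hr
  rcases smul_eq_zero.mp h2 with h3 | h3
  · exact not_isUnit_X (IsUnit.of_mul_eq_one_right r (sub_eq_zero.mp h3))
  · exact hx0 h3

end Gorenstein

end TaggedTriangulation

end PuncturedPolygon

end

theorem mainTheorem4 (K : Type*) [Field K] (n : ℕ) [NeZero n] (hn : 2 ≤ n)
    (σ : TaggedTriangulation n) :
    -- `Λ` is a Gorenstein `R`-order
    IsGorensteinOrder K[X] (Lam K n) ∧
    -- the structure of `R'`-algebra of `Γ_σ`, through an isomorphism of `R'` with its centre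
    ∃ φ : RPrime K ≃ₐ[K] Subalgebra.center K (σ.Gam K),
      (∀ k : Fin n, σ.e K (σ.sideVertex k) * (φ (RPrime.x K) : σ.Gam K) = σ.bigCycle K k) ∧
      (∀ (a : σ.Vertex) (w : List σ.Arrow), σ.IsPlanarCycleAt a w →
        (σ.HasPlain → σ.e K a * (φ (RPrime.y K) : σ.Gam K) = σ.path K w) ∧
        (¬ σ.HasPlain → σ.e K a * (φ (RPrime.y K) : σ.Gam K)
          = σ.e K a * (φ (RPrime.x K) : σ.Gam K) - σ.path K w)) ∧
      (∀ D : σ.Digon, σ.e K ⟨.spoke D.r .notched, D.mem_notched⟩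
        * (φ (RPrime.y K) : σ.Gam K) = 0) ∧
      letI : Algebra (RPrime K) (σ.FrozenPart K) :=
        σ.quiver.frozenPartAlgebra (σ.potential K)
          (φ : RPrime K →+* Subalgebra.center K (σ.Gam K))
      -- the two descriptions of the `R'`-algebra `e_F Γ_σ e_F`
      ∃ (Ψ : σ.FrozenPart K →ₐ[RPrime K] Matrix (Fin n) (Fin n) (BigR K n))
        (Θ : σ.FrozenPart K ≃ₐ[RPrime K] Lam K n),
        Function.Injective Ψ ∧
        Set.range Ψ = {m | ∀ i j, m i j ∈ frozenEntry K i j} ∧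
        (∀ k : Fin n, Ψ (σ.frozenE K k) = Matrix.single k k 1) ∧
        (∀ k : Fin n, (Θ (σ.frozenE K k) : Matrix (Fin n) (Fin n) (RPrimeLoc K))
          = Matrix.single k k 1) ∧
        -- the two descriptions of the modules `M_a = e_F Γ_σ e_a`
        ∀ a : σ.Vertex,
          (∃ f : σ.M K a →+ (Fin n → BigR K n), Function.Injective f ∧
            Set.range f = {c | ∀ i, c i ∈ sideEntry K (side i) a.1} ∧
            ∀ (x : σ.FrozenPart K) (m : σ.M K a), f (x • m) = (Ψ x).mulVec (f m)) ∧
          (∃ g : σ.M K a →+ (Fin n → RPrimeLoc K), Function.Injective g ∧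
            Set.range g = {c | ∀ i, c i ∈ Submodule.map
              (Algebra.linearMap (RPrime K) (RPrimeLoc K)) (columnIdeal K a.1 i)} ∧
            ∀ (x : σ.FrozenPart K) (m : σ.M K a),
              g (x • m) = (Θ x : Matrix (Fin n) (Fin n) (RPrimeLoc K)).mulVec (g m)) := by
  have : n.AtLeastTwo := ⟨hn⟩
  refine ⟨TaggedTriangulation.isGorensteinOrder_lam n K, TaggedTriangulation.centreEquiv σ K,
    TaggedTriangulation.e_mul_centreEquiv_x,
    fun a w hw => ⟨TaggedTriangulation.e_mul_centreEquiv_y_of_hasPlain hw,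
      TaggedTriangulation.e_mul_centreEquiv_y_of_not_hasPlain hw⟩,
    TaggedTriangulation.e_mul_centreEquiv_y_notched,
    TaggedTriangulation.frozenHom σ K, TaggedTriangulation.frozenEquivLam σ K,
    TaggedTriangulation.frozenHom_injective, TaggedTriangulation.range_frozenHom,
    TaggedTriangulation.frozenHom_frozenE, TaggedTriangulation.frozenEquivLam_frozenE,
    fun a => ⟨⟨TaggedTriangulation.columnMap σ K a, TaggedTriangulation.columnMap_injective a,
      TaggedTriangulation.range_columnMap a, TaggedTriangulation.columnMap_smul a⟩,
      TaggedTriangulation.lamColumnMap σ K a, TaggedTriangulation.lamColumnMap_injective a,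
      TaggedTriangulation.range_lamColumnMap a, TaggedTriangulation.lamColumnMap_smul a⟩⟩
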